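/- Let $n\ge 1$ and $\lambda>1$. Write $\hat f(\xi)=\int_{\mathbb R^n}e^{-ix\cdot\xi}f(x)\,dx$, extended to tempered distributions. For a function $m$ on $\mathbb R^n$, the Fourier multiplier operator with multiplier $m$ sends $f$ to the $g$ with $\hat g=m\hat f$. An $H^1$ atom of radius $r>0$ is a function $a$ on $\mathbb R^n$ that is supported in a ball of radius $r$ and satisfies $\|a\|_\infty\le r^{-n}$ and $\int a=0$. The Hardy space $H^1(\mathbb R^n)$ consists of the $f=\sum_j c_ja_j$ (convergence in $L^1$) with atoms $a_j$ and $\sum_j|c_j|<\infty$, and $\|f\|_{H^1}$ is the infimum of $\sum_j|c_j|$ over all such decompositions. For $s\in\mathbb R$, $W^{s,p}(\mathbb R^n)=(I-\Delta)^{-s/2}L^p(\mathbb R^n)$, with norm $\|(I-\Delta)^{s/2}f\|_{L^p}$. (1) Let $I\subset\mathbb R$ be a compact interval with $0\notin I$, let $\beta=n\lambda/2$, and for $\gamma,u\in\mathbb R$ let $T_u=T_u^{\gamma}$ be the Fourier multiplier operator with multiplier $$m_u(\xi)=e^{iu|\xi|^\lambda}(1+|\xi|^2)^{-(\beta+i\gamma)/2}.$$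 Then there are constants $C,N$ depending only on $n,\lambda,I$ such that for all $\gamma\in\mathbb R$ and all $f\in H^1(\mathbb R^n)$, $(u,x)\mapsto T_uf(x)$ has a jointly measurable version on $I\times\mathbb R^n$ and $$\Big\|\Big(\int_I|T_uf(x)|^2\,du\Big)^{1/2}\Big\|_{L^1_x(\mathbb R^n)}\le C(1+|\gamma|)^N\,\|f\|_{H^1(\mathbb R^n)}.$$ In particular, for each $\gamma\in\mathbb R$, $T$ maps $H^1(\mathbb R^n)$ boundedly into $L^1_x(\mathbb R^n;L^2_u(I))$. (2) Let $n\ge2$, $1<p\le2$, let $I\subset\mathbb R$ be any compact interval, and define $\beta$ by $\beta/\lambda=n\big(\tfrac1p-\tfrac12\big)$. Let $e^{it|D|^\lambda}$ be the Fourier multiplier operator with multiplier $e^{it|\xi|^\lambda}$. Then there is a constant $C$ depending only on $n,p,\lambda,I$ such that for all $f\in W^{\beta,p}(\mathbb R^n)$, $(t,x)\mapsto e^{it|D|^\lambda}f(x)$ has a jointly measurable version on $I\times\mathbb R^n$ and $$\Big\|\Big(\int_I|e^{it|D|^\lambda}f(x)|^2\,dt\Big)^{1/2}\Big\|_{L^p_x(\mathbb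 R^n)}\le C\,\|f\|_{W^{\beta,p}(\mathbb R^n)}.$$ -/

import Mathlib

open MeasureTheory FourierTransform TemperedDistribution
open scoped ENNReal SchwartzMap

namespace SquareFunction

/-- The tempered distribution `v` is the function `h`: every product `φ h` with a Schwartz function
`φ` is integrable, and `v φ = ∫ φ h`. -/
def IsFunction {n : ℕ} (v : 𝓢'(EuclideanSpace ℝ (Fin n), ℂ)) (h : EuclideanSpace ℝ (Fin n) → ℂ) :
    Prop :=
  ∀ φ : 𝓢(EuclideanSpace ℝ (Fin n), ℂ),
    Integrable (fun x => φ x * h x) ∧ v φ = ∫ x, φ x * h x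

/-- `g` is obtained from the tempered distribution `v` by applying the Fourier multiplier `m`,
`g(x) = (2π)⁻ⁿ ∫ e^{i x·ξ} m(ξ) v̂(ξ) dξ` with `v̂(ξ) = ∫ e^{-i x·ξ} v(x) dx`, where the Fourier
transforms are those of tempered distributions: `v̂` is a function, and `m v̂` is the Fourier
transform of `g`.
The Fourier transform `𝓕` has the kernel `e^{-2π i x·ξ}`, so `𝓕 v (ξ) = v̂ (2π ξ)`. -/
def IsMultiplierImage {n : ℕ} (m : EuclideanSpace ℝ (Fin n) → ℂ)
    (v : 𝓢'(EuclideanSpace ℝ (Fin n), ℂ)) (g : EuclideanSpace ℝ (Fin n) → ℂ) : Prop :=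
  ∃ (h : EuclideanSpace ℝ (Fin n) → ℂ) (w : 𝓢'(EuclideanSpace ℝ (Fin n), ℂ)),
    IsFunction (𝓕 v) h ∧ IsFunction w g ∧
      IsFunction (𝓕 w) (fun ξ => m ((2 * Real.pi) • ξ) * h ξ)

/-- `F u x` is a jointly measurable version, on `I × ℝⁿ`, of `T_u v (x)`, where `T_u` is the Fourier
multiplier operator with the multiplier `m u`. -/
def IsVersion {n : ℕ} (I : Set ℝ) (m : ℝ → EuclideanSpace ℝ (Fin n) → ℂ)
    (v : 𝓢'(EuclideanSpace ℝ (Fin n), ℂ)) (F : ℝ → EuclideanSpace ℝ (Fin n) → ℂ) : Prop :=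
  AEStronglyMeasurable (Function.uncurry F) ((volume.restrict I).prod volume) ∧
    ∀ᵐ u ∂(volume.restrict I), IsMultiplierImage (m u) v (F u)

/-- The mixed norm `‖ (∫_I |F u x|² du)^{1/2} ‖_{L^p_x}`, with values in `[0, ∞]`. -/
noncomputable def mixedNorm {n : ℕ} (p : ℝ≥0∞) (I : Set ℝ)
    (F : ℝ → EuclideanSpace ℝ (Fin n) → ℂ) : ℝ≥0∞ :=
  eLpNorm (fun x => (∫⁻ u in I, ‖F u x‖ₑ ^ 2) ^ (1 / 2 : ℝ)) p volume

/-- `e^{i u |ξ|^λ}`. -/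
noncomputable def phase (n : ℕ) (lam u : ℝ) (ξ : EuclideanSpace ℝ (Fin n)) : ℂ :=
  Complex.exp (Complex.I * (u : ℂ) * ((‖ξ‖ ^ lam : ℝ) : ℂ))

/-- `e^{i u |ξ|^λ} (1 + |ξ|²)^{-(β + iγ)/2}`. -/
noncomputable def symbol (n : ℕ) (lam β γ u : ℝ) (ξ : EuclideanSpace ℝ (Fin n)) : ℂ :=
  phase n lam u ξ *
    ((1 + ‖ξ‖ ^ 2 : ℝ) : ℂ) ^ (-((β : ℂ) + (γ : ℂ) * Complex.I) / 2)

/-- An `H¹` atom of radius `r`: a function supported in a ball of radius `r`, with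
`‖a‖_∞ ≤ r⁻ⁿ` and `∫ a = 0` (such functions are integrable, so nothing is lost by
taking them in `L¹`). -/
def IsAtom {n : ℕ} (a : Lp ℂ 1 (volume : Measure (EuclideanSpace ℝ (Fin n)))) : Prop :=
  ∃ (x₀ : EuclideanSpace ℝ (Fin n)) (r : ℝ), 0 < r ∧
    (∀ᵐ x, x ∉ Metric.closedBall x₀ r → a x = 0) ∧
    (∀ᵐ x, ‖a x‖ ≤ (r ^ n)⁻¹) ∧
    ∫ x, a x = 0

/-- `f = ∑ⱼ cⱼ aⱼ` with atoms `aⱼ` and `∑ⱼ |cⱼ| < ∞`. Since atoms are bounded in `L¹`, the series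
converges absolutely in `L¹`, which is where its sum is taken. -/
def IsAtomicDecomposition {n : ℕ} (c : ℕ → ℂ)
    (a : ℕ → Lp ℂ 1 (volume : Measure (EuclideanSpace ℝ (Fin n))))
    (f : Lp ℂ 1 (volume : Measure (EuclideanSpace ℝ (Fin n)))) : Prop :=
  (∀ j, IsAtom (a j)) ∧ Summable (fun j => ‖c j‖) ∧ HasSum (fun j => c j • a j) f

/-- Membership in the Hardy space `H¹(ℝⁿ)`. -/
def MemHardy {n : ℕ} (f : Lp ℂ 1 (volume : Measure (EuclideanSpace ℝ (Fin n)))) : Prop :=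
  ∃ c a, IsAtomicDecomposition c a f

/-- The atomic `H¹` norm: the infimum of `∑ⱼ |cⱼ|` over all atomic decompositions
(`∞` if there is none). -/
noncomputable def hardyNorm {n : ℕ}
    (f : Lp ℂ 1 (volume : Measure (EuclideanSpace ℝ (Fin n)))) : ℝ≥0∞ :=
  ⨅ (c : ℕ → ℂ) (a : ℕ → Lp ℂ 1 (volume : Measure (EuclideanSpace ℝ (Fin n))))
    (_ : IsAtomicDecomposition c a f), ∑' j, ‖c j‖ₑ

/-- The operator `(I - Δ)^{s/2}` on tempered distributions, that is, the Fourier multiplier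
`(1 + |ξ|²)^{s/2}`, rescaled to the normalization `e^{-2π i x·ξ}` of `𝓕`. -/
noncomputable def besselOp (n : ℕ) (s : ℝ) :
    𝓢'(EuclideanSpace ℝ (Fin n), ℂ) →L[ℂ] 𝓢'(EuclideanSpace ℝ (Fin n), ℂ) :=
  fourierMultiplierCLM ℂ
    (fun ξ => (((1 + ‖(2 * Real.pi) • ξ‖ ^ 2) ^ (s / 2) : ℝ) : ℂ))

/-- Membership in the Bessel potential space `W^{s,p} = (I - Δ)^{-s/2} L^p`. -/
def MemBessel {n : ℕ} (s : ℝ) (p : ℝ≥0∞) [Fact (1 ≤ p)]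
    (v : 𝓢'(EuclideanSpace ℝ (Fin n), ℂ)) : Prop :=
  ∃ g : Lp ℂ p (volume : Measure (EuclideanSpace ℝ (Fin n))),
    v = besselOp n (-s) (g : 𝓢'(EuclideanSpace ℝ (Fin n), ℂ))

/-- The norm of `W^{s,p}`: `‖g‖_{L^p}` for the unique `g ∈ L^p` with `v = (I - Δ)^{-s/2} g`
(`∞` if there is none). -/
noncomputable def besselNorm {n : ℕ} (s : ℝ) (p : ℝ≥0∞) [Fact (1 ≤ p)]
    (v : 𝓢'(EuclideanSpace ℝ (Fin n), ℂ)) : ℝ≥0∞ :=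
  ⨅ (g : Lp ℂ p (volume : Measure (EuclideanSpace ℝ (Fin n))))
    (_ : v = besselOp n (-s) (g : 𝓢'(EuclideanSpace ℝ (Fin n), ℂ))), ‖g‖ₑ

end SquareFunction

/-! Hardy space estimate. For `u` in a bounded set, each derivative of the multiplier at |ξ| ~ ρ
costs at most a constant times R(ρ) = max(ρ⁻¹, ρ^(λ-1)) (`radius`), so the part of the operator at
frequency ρ spreads mass over distance about R(ρ). Powers of `x` become derivatives on the Fourier
side, so Plancherel controls the pieces in L² with a polynomial weight at scale R
(`eLpNorm_iterate_coordMul_fourierInv_le`). Cauchy–Schwarz in `x` converts this into a bound in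
L¹(L²_u) at the price R^(n/2) (`exists_mixedNorm_one_le`). The symbol depends on γ through factors
polynomial in |γ|, whence the power of 1 + |γ|.

For an atom of radius r there are three frequency ranges. If ρr ≤ 1, the mean value zero makes the
Fourier transform O(ρr), and the band contributes O(ρr). If ρr ≥ 1 and r ≤ ρ^(λ-1), the L² norm
r^(-n/2) of the atom, the spreading cost ρ^((λ-1)n/2) and the decay ρ^(-nλ/2) multiply to
(ρr)^(-n/2). What remains, present only for r ≥ 1, is treated as a single band at spatial scale r,
where r^(n/2) and r^(-n/2) cancel. Both dyadic series are geometric, so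
`exists_mixedNorm_centeredAtom_le` bounds all frequency truncations uniformly.

L^p estimate. For 1 < p < 2, Stein interpolation is applied to the order ζ = (nλ/2)(1 - z): at Re z
= 0 there is the atomic estimate, at Re z = 1 there is Plancherel, and at z = 2 - 2/p the order is
nλ(1/p - 1/2). The Hardy endpoint is used by an explicit decomposition. A step function g is stopped
at the dyadic heights 2^j in the manner of Calderón and Zygmund; the difference of consecutive
stopped functions (`layer`) has size 2^j on a set Ω_j and is a finite combination of atoms with
coefficient sum of order 2^j |Ω_j| (`exists_atomic_decomposition`). Since the sum of 2^(jp) |Ω_j| is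
controlled by ∫|g|^p (`sum_measure_bigSet_le`), multiplying layer j by 2^(j(p - 1 - pz/2)) produces
an analytic family with the right size on both lines and with coefficients 1 at z = 2 - 2/p. Pairing
with an extremal test function, also made analytic in z, and the three lines theorem give the bound
(`stein_interpolation`). At p = 2 the order is 0 and Plancherel suffices.

Removal of truncations. Telescoping series absolutely convergent in the mixed norm give jointly
measurable functions having the correct Fourier transform for almost every `u`
(`exists_version_of_memLp_two`, `exists_hasSum_of_mixedNorm`); Fatou's lemma transfers the bounds,
and any two versions agree almost everywhere (`IsVersion.mixedNorm_eq`). A general g in L^p is split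
into an integrable and a square integrable part, so that its Fourier transform is a function. -/

namespace SquareFunction

open scoped ContDiff Nat

/-! ### Derivatives of complex powers, oscillating exponentials and products -/

section Calculus

variable {E : Type*} [NormedAddCommGroup E] [InnerProductSpace ℝ E]

lemma hasDerivAt_ofReal_cpow_pos {x : ℝ} (hx : 0 < x) (r : ℂ) :
    HasDerivAt (fun y : ℝ => (y : ℂ) ^ r) (r * (x : ℂ) ^ (r - 1)) x := by
  by_cases hr : r = 0
  · subst hr
    simpa using hasDerivAt_const x (1 : ℂ)
  · exact hasDerivAt_ofReal_cpow_const hx.ne' hr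

lemma iteratedDeriv_ofReal_cpow (w : ℂ) (i : ℕ) {s : ℝ} (hs : 0 < s) :
    iteratedDeriv i (fun y : ℝ => (y : ℂ) ^ w) s =
      (∏ l ∈ Finset.range i, (w - l)) * (s : ℂ) ^ (w - i) := by
  induction i generalizing s with
  | zero => simp
  | succ i ih =>
    rw [iteratedDeriv_succ]
    have : iteratedDeriv i (fun y : ℝ => (y : ℂ) ^ w) =ᶠ[nhds s]
        fun s => (∏ l ∈ Finset.range i, (w - l)) * (s : ℂ) ^ (w - i) := by
      filter_upwards [lt_mem_nhds hs] with t ht using ih ht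
    rw [this.deriv_eq, ((hasDerivAt_ofReal_cpow_pos hs (w - i)).const_mul _).deriv,
      Finset.prod_range_succ]
    push_cast
    rw [show w - (i + 1) = w - i - 1 by ring]
    ring

lemma norm_iteratedDeriv_ofReal_cpow_one_le (w : ℂ) (i : ℕ) :
    ‖iteratedDeriv i (fun y : ℝ => (y : ℂ) ^ w) 1‖ ≤ (‖w‖ + i) ^ i := by
  rw [iteratedDeriv_ofReal_cpow w i one_pos]
  simp only [Complex.ofReal_one, Complex.one_cpow, mul_one, norm_prod]
  calc ∏ l ∈ Finset.range i, ‖w - l‖ ≤ ∏ _l ∈ Finset.range i, (‖w‖ + i) := by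
        refine Finset.prod_le_prod (fun _ _ => norm_nonneg _) fun l hl => ?_
        refine (norm_sub_le _ _).trans ?_
        gcongr
        simpa using (Finset.mem_range.1 hl).le
    _ = _ := by simp

lemma contDiffOn_ofReal_cpow (w : ℂ) :
    ContDiffOn ℝ ∞ (fun y : ℝ => (y : ℂ) ^ w) (Set.Ioi 0) := by
  have : ContDiffOn ℝ ∞ (fun y : ℝ => Complex.exp (((Real.log y : ℝ) : ℂ) * w)) (Set.Ioi 0) := by
    refine ContDiffOn.cexp (ContDiffOn.mul ?_ contDiffOn_const)
    exact Complex.ofRealCLM.contDiff.comp_contDiffOn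
      (Real.contDiffOn_log.mono fun x hx => by simpa using (ne_of_gt hx))
  refine this.congr fun x hx => ?_
  rw [Complex.cpow_def_of_ne_zero (by exact_mod_cast (ne_of_gt hx)),
    Complex.ofReal_log (le_of_lt hx)]

/-- The square of the norm is quadratic: the first derivative is linear, the second constant, the
others vanish. The shape t² · D^i with D = 2/t is the input that the bound for derivatives of a
composition requires. -/
lemma norm_iteratedFDeriv_normSq_le (i : ℕ) (hi : 1 ≤ i) {t : ℝ} (x : E) (hx : ‖x‖ ≤ t)
    (ht : 0 < t) :
    ‖iteratedFDeriv ℝ i (fun y : E => ‖y‖ ^ 2) x‖ ≤ t ^ 2 * (2 / t) ^ i := by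
  obtain ⟨k, rfl⟩ : ∃ k, i = k + 1 := ⟨i - 1, by omega⟩
  rw [← norm_iteratedFDeriv_fderiv, fderiv_norm_sq]
  let L : E →L[ℝ] E →L[ℝ] ℝ := innerSL ℝ
  have hL : (2 • ⇑(innerSL ℝ (E := E))) = fun y => ((2 : ℝ) • L) y := by
    ext y z
    simp only [L, Pi.smul_apply, smul_apply, two_smul, add_apply]
  rw [hL]
  have hn : ‖((2 : ℝ) • L)‖ ≤ 2 := by
    have : ‖L‖ ≤ 1 := norm_innerSL_le ℝ (E := E)
    refine (ContinuousLinearMap.opNorm_smul_le _ _).trans ?_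
    norm_num
    linarith
  have hd : (fderiv ℝ fun y => ((2 : ℝ) • L) y) = fun _ => ((2 : ℝ) • L) := by
    ext1 y
    exact ContinuousLinearMap.fderiv _
  match k with
  | 0 =>
    simp only [norm_iteratedFDeriv_zero]
    calc ‖((2 : ℝ) • L) x‖ ≤ 2 * ‖x‖ := by
          refine (ContinuousLinearMap.le_opNorm _ _).trans ?_
          gcongr
      _ ≤ 2 * t := by gcongr
      _ = _ := by rw [zero_add, pow_one]; field_simp
  | 1 =>
    rw [← norm_iteratedFDeriv_fderiv, hd]
    simp only [norm_iteratedFDeriv_zero]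
    refine hn.trans ?_
    rw [show (1 + 1 : ℕ) = 2 from rfl, div_pow, mul_div_cancel₀ _ (by positivity)]
    norm_num
  | k + 2 =>
    rw [← norm_iteratedFDeriv_fderiv, hd, iteratedFDeriv_const_of_ne (by omega)]
    simp only [Pi.zero_apply, norm_zero]
    positivity

/-- Derivatives of `(c + |ξ|²)^w`. -/
lemma norm_iteratedFDeriv_cpow_le (w : ℂ) {c : ℝ} (hc : 0 ≤ c) (i : ℕ) {x : E} (hx : x ≠ 0)
    {t : ℝ} (ht : 0 < t) (htc : t ^ 2 = c + ‖x‖ ^ 2) :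
    ‖iteratedFDeriv ℝ i (fun y : E => ((c + ‖y‖ ^ 2 : ℝ) : ℂ) ^ w) x‖ ≤
      (i)! * ((t ^ 2) ^ w.re * (‖w‖ + i + 1) ^ i) * (2 / t) ^ i := by
  set s : Set E := {0}ᶜ with hs
  have hso : IsOpen s := isOpen_compl_singleton
  have hxs : x ∈ s := hx
  -- Dividing by t² makes the inner function equal to 1 at `x`, so the outer power is differentiated
  -- only at 1, and the homogeneity factor (t²)^w comes out as a constant.
  set q : E → ℝ := fun y => (c + ‖y‖ ^ 2) / t ^ 2 with hq
  have hqc : ContDiff ℝ ∞ q := (contDiff_const.add (contDiff_norm_sq ℝ)).div_const _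
  have hqx : q x = 1 := by rw [hq]; simp only; rw [← htc]; field_simp
  have hpos : ∀ y ∈ s, 0 < c + ‖y‖ ^ 2 := fun y hy => by
    have : 0 < ‖y‖ := norm_pos_iff.2 hy
    positivity
  have heq : Set.EqOn (fun y : E => ((c + ‖y‖ ^ 2 : ℝ) : ℂ) ^ w)
      ((fun z : ℝ => (((t ^ 2 : ℝ) : ℂ) ^ w) • (z : ℂ) ^ w) ∘ q) s := by
    intro y hy
    have h1 := hpos y hy
    simp only [Function.comp, smul_eq_mul]
    rw [← Complex.mul_cpow_ofReal_nonneg (by positivity) (by simp only [hq]; positivity),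
      ← Complex.ofReal_mul]
    congr 2
    simp only [hq]
    field_simp
  rw [← iteratedFDerivWithin_of_isOpen i hso hxs, iteratedFDerivWithin_congr heq hxs]
  refine norm_iteratedFDerivWithin_comp_le (t := Set.Ioi (0 : ℝ)) (N := ∞)
    ((contDiffOn_ofReal_cpow w).const_smul _) hqc.contDiffOn (by exact_mod_cast le_top)
    (isOpen_Ioi.uniqueDiffOn) hso.uniqueDiffOn ?_ hxs ?_ ?_
  · intro y hy
    have h1 := hpos y hy
    simp only [hq, Set.mem_Ioi]
    positivity
  · intro j hj
    rw [hqx, iteratedFDerivWithin_of_isOpen j isOpen_Ioi (by simp)]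
    rw [iteratedFDeriv_const_smul_apply'
      (((contDiffOn_ofReal_cpow w).contDiffAt (Ioi_mem_nhds one_pos)).of_le
        (by exact_mod_cast le_top)), norm_smul,
      Complex.norm_cpow_eq_rpow_re_of_pos (by positivity), norm_iteratedFDeriv_eq_norm_iteratedDeriv]
    gcongr
    calc _ ≤ (‖w‖ + j) ^ j := norm_iteratedDeriv_ofReal_cpow_one_le w j
      _ ≤ (‖w‖ + i + 1) ^ j := by
        have : (j : ℝ) ≤ i := by exact_mod_cast hj
        exact pow_le_pow_left₀ (by positivity) (by linarith) _
      _ ≤ _ := pow_le_pow_right₀ (by linarith [norm_nonneg w, (Nat.cast_nonneg i : (0 : ℝ) ≤ i)]) hj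
  · intro j h1 hj
    rw [iteratedFDerivWithin_of_isOpen j hso hxs]
    have hq' : q = fun y => (t ^ 2)⁻¹ • (c + ‖y‖ ^ 2) := by
      ext y; simp only [hq, smul_eq_mul]; field_simp
    rw [hq', iteratedFDeriv_const_smul_apply'
      ((contDiff_const.add (contDiff_norm_sq ℝ)).contDiffAt), norm_smul,
      fun_iteratedFDeriv_add_apply contDiff_const.contDiffAt (contDiff_norm_sq ℝ).contDiffAt,
      iteratedFDeriv_const_of_ne (by omega)]
    simp only [Pi.zero_apply, zero_add, norm_inv, norm_pow, Real.norm_eq_abs, abs_of_pos ht]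
    rw [inv_mul_le_iff₀ (by positivity)]
    refine norm_iteratedFDeriv_normSq_le j h1 x ?_ ht
    nlinarith [norm_nonneg x]

lemma contDiffOn_cpow (w : ℂ) {c : ℝ} (hc : 0 ≤ c) :
    ContDiffOn ℝ ∞ (fun y : E => ((c + ‖y‖ ^ 2 : ℝ) : ℂ) ^ w) {0}ᶜ := by
  refine (contDiffOn_ofReal_cpow w).comp
    (contDiff_const.add (contDiff_norm_sq ℝ)).contDiffOn fun y hy => ?_
  have : 0 < ‖y‖ := norm_pos_iff.2 hy
  simp only [Set.mem_Ioi]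
  positivity

lemma norm_iteratedFDeriv_ofReal_comp {f : E → ℝ} {i : ℕ} {x : E} (hf : ContDiffAt ℝ ∞ f x) :
    ‖iteratedFDeriv ℝ i f x‖ = ‖iteratedFDeriv ℝ i (fun y => (f y : ℂ)) x‖ :=
  (Complex.ofRealLI.norm_iteratedFDeriv_comp_left hf (by exact_mod_cast le_top)).symm

lemma iteratedDeriv_cexp_I_mul (i : ℕ) :
    iteratedDeriv i (fun t : ℝ => Complex.exp (Complex.I * t)) =
      fun t : ℝ => Complex.I ^ i * Complex.exp (Complex.I * t) := by
  induction i with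
  | zero => simp
  | succ i ih =>
    rw [iteratedDeriv_succ, ih]
    ext t
    have h : HasDerivAt (fun t : ℝ => Complex.exp (Complex.I * t))
        (Complex.exp (Complex.I * t) * (Complex.I * 1)) t :=
      ((Complex.ofRealCLM.hasDerivAt (x := t)).const_mul Complex.I).cexp
    rw [(h.const_mul _).deriv]
    ring

/-- If the derivatives of the real function `f` are controlled by powers of `D`, then so are those
of `e^{if}`. -/
lemma norm_iteratedFDeriv_cexp_I_le {f : E → ℝ} {s : Set E} (hs : IsOpen s)
    (hf : ContDiffOn ℝ ∞ f s) {x : E} (hx : x ∈ s) {D : ℝ} (i : ℕ)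
    (hD : ∀ j, 1 ≤ j → j ≤ i → ‖iteratedFDeriv ℝ j f x‖ ≤ D ^ j) :
    ‖iteratedFDeriv ℝ i (fun y => Complex.exp (Complex.I * f y)) x‖ ≤ (i)! * D ^ i := by
  rw [← iteratedFDerivWithin_of_isOpen i hs hx]
  have hg : ContDiff ℝ ∞ (fun t : ℝ => Complex.exp (Complex.I * t)) :=
    (contDiff_const.mul Complex.ofRealCLM.contDiff).cexp
  have := norm_iteratedFDerivWithin_comp_le (g := fun t : ℝ => Complex.exp (Complex.I * t))
    (t := Set.univ) (N := ∞) (n := i) (C := 1) (D := D) hg.contDiffOn hf (by exact_mod_cast le_top)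
    uniqueDiffOn_univ hs.uniqueDiffOn (Set.mapsTo_univ _ _) hx ?_ ?_
  · simpa [Function.comp_def] using this
  · intro j hj
    rw [iteratedFDerivWithin_univ, norm_iteratedFDeriv_eq_norm_iteratedDeriv,
      iteratedDeriv_cexp_I_mul]
    simp only [norm_mul, norm_pow, Complex.norm_I, one_pow, one_mul]
    rw [mul_comm, Complex.norm_exp_ofReal_mul_I]
  · intro j h1 hj
    rw [iteratedFDerivWithin_of_isOpen j hs hx]
    exact hD j h1 hj

/-- Products of functions whose derivatives are controlled by powers of the same `R`. -/
lemma norm_iteratedFDeriv_mul_le_of_le {f g : E → ℂ} {s : Set E} (hs : IsOpen s)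
    (hf : ContDiffOn ℝ ∞ f s) (hg : ContDiffOn ℝ ∞ g s) {x : E} (hx : x ∈ s) {A B R : ℝ}
    (hR : 0 ≤ R) (hA : 0 ≤ A) {M : ℕ} (hfA : ∀ i ≤ M, ‖iteratedFDeriv ℝ i f x‖ ≤ A * R ^ i)
    (hgB : ∀ i ≤ M, ‖iteratedFDeriv ℝ i g x‖ ≤ B * R ^ i) :
    ∀ i ≤ M, ‖iteratedFDeriv ℝ i (fun y => f y * g y) x‖ ≤ (2 ^ M * A * B) * R ^ i := by
  intro i hi
  have hB : 0 ≤ B := by simpa using (norm_nonneg _).trans (hgB 0 (Nat.zero_le _))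
  rw [← iteratedFDerivWithin_of_isOpen i hs hx]
  refine (norm_iteratedFDerivWithin_mul_le hf hg hs.uniqueDiffOn hx (N := ∞)
    (by exact_mod_cast le_top)).trans ?_
  calc _ ≤ ∑ j ∈ Finset.range (i + 1), (i.choose j : ℝ) * (A * B * R ^ i) := by
        refine Finset.sum_le_sum fun j hj => ?_
        have hj' : j ≤ i := by simpa [Nat.lt_succ_iff] using hj
        rw [iteratedFDerivWithin_of_isOpen j hs hx, iteratedFDerivWithin_of_isOpen (i - j) hs hx]
        calc _ ≤ (i.choose j : ℝ) * (A * R ^ j) * (B * R ^ (i - j)) := by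
              gcongr
              · exact hfA j (by omega)
              · exact hgB _ (by omega)
          _ = (i.choose j : ℝ) * (A * B * (R ^ j * R ^ (i - j))) := by ring
          _ = _ := by rw [← pow_add, Nat.add_sub_cancel' hj']
    _ = 2 ^ i * (A * B * R ^ i) := by
        rw [← Finset.sum_mul]
        congr 1
        exact_mod_cast Nat.sum_range_choose i
    _ ≤ 2 ^ M * (A * B * R ^ i) := by
        gcongr
        norm_num
    _ = _ := by ring

end Calculus
end SquareFunction

/-! ### Symbol estimates -/

namespace SquareFunction

open scoped ContDiff Nat

/-- The multiplier `e^{iu|ξ|^λ} (1 + |ξ|²)^{-ζ/2}` in the normalization of `𝓕`. -/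
noncomputable def sym (n : ℕ) (lam : ℝ) (ζ : ℂ) (u : ℝ) (ξ : EuclideanSpace ℝ (Fin n)) : ℂ :=
  phase n lam u ((2 * Real.pi) • ξ) *
    ((1 + ‖(2 * Real.pi) • ξ‖ ^ 2 : ℝ) : ℂ) ^ (-ζ / 2)

/-- The size of one derivative of the multiplier. -/
noncomputable def radius (lam r : ℝ) : ℝ := max r⁻¹ (r ^ (lam - 1))

variable {n : ℕ} {lam : ℝ}

local notation "𝔼" => EuclideanSpace ℝ (Fin n)

lemma norm_two_pi_smul (x : 𝔼) : ‖(2 * Real.pi) • x‖ = 2 * Real.pi * ‖x‖ := by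
  rw [norm_smul, Real.norm_of_nonneg (by positivity)]

lemma radius_pos {r : ℝ} (hr : 0 < r) : 0 < radius lam r :=
  lt_max_of_lt_left (by positivity)

lemma inv_le_radius (r : ℝ) : r⁻¹ ≤ radius lam r := le_max_left _ _

/-- One of the `j` factors absorbs r^λ and becomes r^(λ-1), the other j - 1 stay r⁻¹. At j = 0 this
would fail: the phase itself is unbounded and only its derivatives are controlled. -/
lemma rpow_sub_le_radius_pow {r : ℝ} (hr : 0 < r) {j : ℕ} (hj : 1 ≤ j) :
    r ^ lam * (r⁻¹) ^ j ≤ radius lam r ^ j := by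
  have h0 : r ^ lam * (r⁻¹) ^ j = r ^ (lam - 1) * (r⁻¹) ^ (j - 1) := by
    obtain ⟨k, rfl⟩ : ∃ k, j = k + 1 := ⟨j - 1, by omega⟩
    rw [Real.rpow_sub_one hr.ne', pow_succ]
    simp only [Nat.add_sub_cancel]
    field_simp
  have h1 : radius lam r ^ j = radius lam r * radius lam r ^ (j - 1) := by
    rw [← pow_succ']; congr 1; omega
  rw [h0, h1]
  gcongr
  · exact (radius_pos hr).le
  · exact le_max_right _ _
  · exact inv_le_radius r

lemma contDiffOn_norm_rpow_two_pi (u : ℝ) :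
    ContDiffOn ℝ ∞ (fun x : 𝔼 => u * ‖(2 * Real.pi) • x‖ ^ lam) {0}ᶜ := by
  refine contDiffOn_const.mul fun x hx => ContDiffAt.contDiffWithinAt ?_
  have hx' : ‖(2 * Real.pi) • x‖ ≠ 0 := by
    rw [norm_two_pi_smul]
    have : ‖x‖ ≠ 0 := norm_ne_zero_iff.2 hx
    positivity
  exact ((contDiffAt_norm ℝ (norm_ne_zero_iff.1 hx')).comp x
    (contDiff_const_smul _).contDiffAt).rpow_const_of_ne hx'

/-- In this form the phase is a multiple of a power of |x|², to which `norm_iteratedFDeriv_cpow_le`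
applies with c = 0. -/
lemma phaseArg_eq {x : 𝔼} (hx : x ≠ 0) (u : ℝ) :
    ((u * ‖(2 * Real.pi) • x‖ ^ lam : ℝ) : ℂ) =
      ((u * (2 * Real.pi) ^ lam : ℝ) : ℂ) • ((0 + ‖x‖ ^ 2 : ℝ) : ℂ) ^ ((lam / 2 : ℝ) : ℂ) := by
  have hx' : 0 < ‖x‖ := norm_pos_iff.2 hx
  rw [← Complex.ofReal_cpow (by positivity), smul_eq_mul, ← Complex.ofReal_mul, norm_two_pi_smul,
    Real.mul_rpow (by positivity) hx'.le, zero_add, ← Real.rpow_natCast, ← Real.rpow_mul hx'.le]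
  congr 1
  rw [show ((2 : ℕ) : ℝ) * (lam / 2) = lam by push_cast; ring]
  ring

lemma norm_iteratedFDeriv_phaseArg_le (hlam : 1 < lam) {x : 𝔼} (hx : x ≠ 0) {U u : ℝ}
    (hu : |u| ≤ U) {M j : ℕ} (hj : 1 ≤ j) (hjM : j ≤ M) :
    ‖iteratedFDeriv ℝ j (fun x : 𝔼 => u * ‖(2 * Real.pi) • x‖ ^ lam) x‖ ≤
      (((1 + U) * (2 * Real.pi) ^ lam * (M ! * (lam + M + 1) ^ M * 2 ^ M)) * radius lam ‖x‖) ^ j := by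
  have hU : 0 ≤ U := (abs_nonneg u).trans hu
  have hx' : 0 < ‖x‖ := norm_pos_iff.2 hx
  have hso : IsOpen ({0}ᶜ : Set 𝔼) := isOpen_compl_singleton
  rw [norm_iteratedFDeriv_ofReal_comp ((contDiffOn_norm_rpow_two_pi u).contDiffAt
    (hso.mem_nhds hx)), ← iteratedFDerivWithin_of_isOpen j hso hx,
    iteratedFDerivWithin_congr (f₁ := fun y : 𝔼 => ((u * ‖(2 * Real.pi) • y‖ ^ lam : ℝ) : ℂ))
      (s := {0}ᶜ) (fun y hy => phaseArg_eq (x := y) hy u) hx,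
    iteratedFDerivWithin_of_isOpen j hso hx, iteratedFDeriv_const_smul_apply'
      (((contDiffOn_cpow _ le_rfl).contDiffAt (hso.mem_nhds hx)).of_le (by exact_mod_cast le_top)),
    norm_smul]
  have h1 := norm_iteratedFDeriv_cpow_le ((lam / 2 : ℝ) : ℂ) le_rfl j hx hx' (by ring)
  have h2 : (‖x‖ ^ 2) ^ (lam / 2) = ‖x‖ ^ lam := by
    rw [← Real.rpow_natCast, ← Real.rpow_mul hx'.le]
    congr 1; push_cast; ring
  rw [Complex.ofReal_re, h2, Complex.norm_real, Real.norm_of_nonneg (by positivity)] at h1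
  -- Taking 1 + U in place of U ensures K ≥ 1, hence K ≤ K^j. The exponential of the phase needs
  -- bounds that are exact j-th powers.
  set K := (1 + U) * (2 * Real.pi) ^ lam * (M ! * (lam + M + 1) ^ M * 2 ^ M) with hK
  have hpi : 1 ≤ (2 * Real.pi) ^ lam :=
    Real.one_le_rpow (by linarith [Real.pi_gt_three]) (by linarith)
  have hfac : (1 : ℝ) ≤ M ! := by exact_mod_cast Nat.one_le_iff_ne_zero.2 (Nat.factorial_ne_zero M)
  have hb : (1 : ℝ) ≤ (lam + M + 1) ^ M :=
    one_le_pow₀ (by have : (0 : ℝ) ≤ M := Nat.cast_nonneg M; linarith)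
  have h2M : (1 : ℝ) ≤ 2 ^ M := one_le_pow₀ (by norm_num)
  have hK1 : 1 ≤ K := by
    rw [hK]
    exact one_le_mul_of_one_le_of_one_le (one_le_mul_of_one_le_of_one_le (by linarith) hpi)
      (one_le_mul_of_one_le_of_one_le (one_le_mul_of_one_le_of_one_le hfac hb) h2M)
  have hjM' : (j : ℝ) ≤ M := by exact_mod_cast hjM
  have hpj : (lam / 2 + j + 1) ^ j ≤ (lam + M + 1) ^ M := by
    calc (lam / 2 + j + 1) ^ j ≤ (lam + M + 1) ^ j :=
          pow_le_pow_left₀ (by positivity) (by linarith) _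
      _ ≤ _ := pow_le_pow_right₀ (by have : (0 : ℝ) ≤ M := Nat.cast_nonneg M; linarith) hjM
  have hfj : (j ! : ℝ) ≤ M ! := by exact_mod_cast Nat.factorial_le hjM
  have h2j : (2 : ℝ) ^ j ≤ 2 ^ M := pow_le_pow_right₀ (by norm_num) hjM
  calc _ ≤ ((1 + U) * (2 * Real.pi) ^ lam) *
        ((M !) * (‖x‖ ^ lam * (lam + M + 1) ^ M) * (2 ^ M * ‖x‖⁻¹ ^ j)) := by
        gcongr
        · rw [Complex.norm_real, norm_mul, Real.norm_eq_abs, Real.norm_of_nonneg (by positivity)]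
          gcongr
          linarith
        · refine h1.trans ?_
          have ht' : (2 / ‖x‖) ^ j ≤ 2 ^ M * ‖x‖⁻¹ ^ j := by
            rw [div_eq_mul_inv, mul_pow]
            gcongr
          gcongr
    _ = K * (‖x‖ ^ lam * ‖x‖⁻¹ ^ j) := by rw [hK]; ring
    _ ≤ K * radius lam ‖x‖ ^ j := by
        gcongr
        exact rpow_sub_le_radius_pow hx' hj
    _ ≤ K ^ j * radius lam ‖x‖ ^ j := by
        have := radius_pos (lam := lam) hx'
        gcongr
        exact le_self_pow₀ hK1 (by omega)
    _ = _ := (mul_pow _ _ _).symm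

lemma phase_two_pi_eq (u : ℝ) : (fun x : 𝔼 => phase n lam u ((2 * Real.pi) • x)) =
    fun x => Complex.exp (Complex.I * ((u * ‖(2 * Real.pi) • x‖ ^ lam : ℝ) : ℂ)) := by
  ext x
  rw [phase]
  push_cast
  ring_nf

lemma contDiffOn_phase (u : ℝ) :
    ContDiffOn ℝ ∞ (fun x : 𝔼 => phase n lam u ((2 * Real.pi) • x)) {0}ᶜ := by
  rw [phase_two_pi_eq]
  exact (contDiffOn_const.mul
    (Complex.ofRealCLM.contDiff.comp_contDiffOn (contDiffOn_norm_rpow_two_pi u))).cexp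

/-- Up to a constant factor the Bessel weight is a power of c + |x|² with c = (2π)⁻², the form
treated by `norm_iteratedFDeriv_cpow_le`. -/
lemma besselFactor_eq (ζ : ℂ) : (fun x : 𝔼 => ((1 + ‖(2 * Real.pi) • x‖ ^ 2 : ℝ) : ℂ) ^ (-ζ / 2)) =
    fun x => ((((2 * Real.pi) ^ 2 : ℝ) : ℂ) ^ (-ζ / 2)) •
      (((((2 * Real.pi) ^ 2)⁻¹ + ‖x‖ ^ 2 : ℝ) : ℂ) ^ (-ζ / 2)) := by
  ext x
  rw [smul_eq_mul, ← Complex.mul_cpow_ofReal_nonneg (by positivity) (by positivity),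
    ← Complex.ofReal_mul, norm_two_pi_smul]
  congr 2
  have : (2 * Real.pi) ^ 2 ≠ 0 := by positivity
  field_simp

lemma contDiffOn_besselFactor (ζ : ℂ) :
    ContDiffOn ℝ ∞ (fun x : 𝔼 => ((1 + ‖(2 * Real.pi) • x‖ ^ 2 : ℝ) : ℂ) ^ (-ζ / 2)) {0}ᶜ := by
  rw [besselFactor_eq]
  exact (contDiffOn_cpow _ (by positivity)).const_smul _

/-- A derivative costs 2/t with t² = c + |x|², and t ≥ |x|. The factor (‖ζ‖ + M + 1)^M is the only
place where the imaginary part of ζ enters; it is the origin of the polynomial growth in γ. -/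
lemma norm_iteratedFDeriv_besselFactor_le (ζ : ℂ) {x : 𝔼} (hx : x ≠ 0) {M j : ℕ} (hjM : j ≤ M) :
    ‖iteratedFDeriv ℝ j (fun x : 𝔼 => ((1 + ‖(2 * Real.pi) • x‖ ^ 2 : ℝ) : ℂ) ^ (-ζ / 2)) x‖ ≤
      (M ! * 2 ^ M * (‖ζ‖ + M + 1) ^ M * (1 + ‖(2 * Real.pi) • x‖ ^ 2) ^ (-ζ.re / 2)) *
        (‖x‖⁻¹) ^ j := by
  have hx' : 0 < ‖x‖ := norm_pos_iff.2 hx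
  have hso : IsOpen ({0}ᶜ : Set 𝔼) := isOpen_compl_singleton
  set c : ℝ := ((2 * Real.pi) ^ 2)⁻¹ with hc
  have hc0 : 0 < c := by positivity
  set t : ℝ := √(c + ‖x‖ ^ 2) with htdef
  have ht2 : t ^ 2 = c + ‖x‖ ^ 2 := Real.sq_sqrt (by positivity)
  have ht : 0 < t := Real.sqrt_pos.2 (by positivity)
  have hxt : ‖x‖ ≤ t := Real.le_sqrt_of_sq_le (by linarith)
  rw [besselFactor_eq, iteratedFDeriv_const_smul_apply'
      (((contDiffOn_cpow _ hc0.le).contDiffAt (hso.mem_nhds hx)).of_le (by exact_mod_cast le_top)),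
    norm_smul]
  have h1 := norm_iteratedFDeriv_cpow_le (-ζ / 2) hc0.le j hx ht ht2
  have hre : (-ζ / 2).re = -ζ.re / 2 := by simp
  have hre2 : ‖((((2 * Real.pi) ^ 2 : ℝ) : ℂ) ^ (-ζ / 2))‖ * (t ^ 2) ^ (-ζ.re / 2) =
      (1 + ‖(2 * Real.pi) • x‖ ^ 2) ^ (-ζ.re / 2) := by
    rw [Complex.norm_cpow_eq_rpow_re_of_pos (by positivity), hre,
      ← Real.mul_rpow (by positivity) (by positivity), ht2, norm_two_pi_smul, hc]
    field_simp
  have hjM' : (j : ℝ) ≤ M := by exact_mod_cast hjM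
  have hζ : ‖-ζ / 2‖ ≤ ‖ζ‖ := by
    rw [norm_div, norm_neg]
    norm_num
  have hpj : (‖-ζ / 2‖ + j + 1) ^ j ≤ (‖ζ‖ + M + 1) ^ M := by
    calc (‖-ζ / 2‖ + j + 1) ^ j ≤ (‖ζ‖ + M + 1) ^ j :=
          pow_le_pow_left₀ (by positivity) (by linarith) _
      _ ≤ _ := pow_le_pow_right₀ (by
          have : (0 : ℝ) ≤ M := Nat.cast_nonneg M
          linarith [norm_nonneg ζ]) hjM
  have hfj : (j ! : ℝ) ≤ M ! := by exact_mod_cast Nat.factorial_le hjM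
  have h2j : (2 : ℝ) ^ j ≤ 2 ^ M := pow_le_pow_right₀ (by norm_num) hjM
  calc _ ≤ ‖((((2 * Real.pi) ^ 2 : ℝ) : ℂ) ^ (-ζ / 2))‖ *
        (M ! * ((t ^ 2) ^ (-ζ.re / 2) * (‖ζ‖ + M + 1) ^ M) * (2 ^ M * ‖x‖⁻¹ ^ j)) := by
        gcongr
        refine h1.trans ?_
        have ht' : (2 / t) ^ j ≤ 2 ^ M * ‖x‖⁻¹ ^ j := by
          rw [div_eq_mul_inv, mul_pow]
          gcongr
        rw [hre]
        gcongr
    _ = (M ! * 2 ^ M * (‖ζ‖ + M + 1) ^ M *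
        (‖((((2 * Real.pi) ^ 2 : ℝ) : ℂ) ^ (-ζ / 2))‖ * (t ^ 2) ^ (-ζ.re / 2))) * ‖x‖⁻¹ ^ j := by
        ring
    _ = _ := by rw [hre2]

lemma contDiffOn_sym (ζ : ℂ) (u : ℝ) : ContDiffOn ℝ ∞ (sym n lam ζ u) {0}ᶜ :=
  (contDiffOn_phase u).mul (contDiffOn_besselFactor ζ)

/-- The derivatives of the multiplier. -/
lemma exists_norm_iteratedFDeriv_sym_le (n : ℕ) (hlam : 1 < lam) (U : ℝ) (M : ℕ) :
    ∃ C : ℝ, 0 ≤ C ∧ ∀ (ζ : ℂ) (u : ℝ), |u| ≤ U → ∀ x : EuclideanSpace ℝ (Fin n), x ≠ 0 →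
      ∀ i ≤ M, ‖iteratedFDeriv ℝ i (sym n lam ζ u) x‖ ≤
        (C * (‖ζ‖ + M + 1) ^ M * (1 + ‖(2 * Real.pi) • x‖ ^ 2) ^ (-ζ.re / 2)) *
          radius lam ‖x‖ ^ i := by
  set K := (1 + |U|) * (2 * Real.pi) ^ lam * (M ! * (lam + M + 1) ^ M * 2 ^ M) with hK
  have hK0 : 0 ≤ K := by positivity
  refine ⟨2 ^ M * (M ! * (1 + K) ^ M) * (M ! * 2 ^ M), by positivity, fun ζ u hu x hx i hi => ?_⟩
  have hx' : 0 < ‖x‖ := norm_pos_iff.2 hx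
  have hR := radius_pos (lam := lam) hx'
  have := norm_iteratedFDeriv_mul_le_of_le (isOpen_compl_singleton (x := (0 : EuclideanSpace ℝ (Fin n))))
    (contDiffOn_phase (lam := lam) u) (contDiffOn_besselFactor ζ) hx hR.le
    (A := M ! * (1 + K) ^ M)
    (B := M ! * 2 ^ M * (‖ζ‖ + M + 1) ^ M * (1 + ‖(2 * Real.pi) • x‖ ^ 2) ^ (-ζ.re / 2))
    (by positivity) (M := M) ?_ ?_ i hi
  · refine this.trans (le_of_eq ?_)
    ring
  · intro j hj
    rw [phase_two_pi_eq]
    refine (norm_iteratedFDeriv_cexp_I_le isOpen_compl_singleton (contDiffOn_norm_rpow_two_pi u) hx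
      (D := K * radius lam ‖x‖) j fun l hl hlj => ?_).trans ?_
    · exact norm_iteratedFDeriv_phaseArg_le hlam hx (hu.trans (le_abs_self U)) hl (hlj.trans hj)
    · have hfj : (j ! : ℝ) ≤ M ! := by exact_mod_cast Nat.factorial_le hj
      rw [mul_pow, ← mul_assoc]
      have : K ^ j ≤ (1 + K) ^ M :=
        (pow_le_pow_left₀ hK0 (by linarith) _).trans (pow_le_pow_right₀ (by linarith) hj)
      gcongr
  · intro j hj
    refine (norm_iteratedFDeriv_besselFactor_le ζ hx hj).trans ?_
    gcongr
    exact inv_le_radius _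

end SquareFunction

namespace SquareFunction

open scoped ContDiff

variable {n : ℕ}

local notation "𝔼" => EuclideanSpace ℝ (Fin n)

/-! ### Tempered distributions that are functions, and Plancherel's theorem -/

section Distributions

lemma IsFunction.locallyIntegrable {v : 𝓢'(𝔼, ℂ)} {h : 𝔼 → ℂ} (hv : IsFunction v h) :
    LocallyIntegrable h := by
  intro x
  let ψ : ContDiffBump x := ⟨1, 2, one_pos, one_lt_two⟩
  have hcs : HasCompactSupport fun y => (ψ y : ℂ) := ψ.hasCompactSupport.comp_left (g := Complex.ofReal) rfl
  let φ : 𝓢(𝔼, ℂ) := hcs.toSchwartzMap (Complex.ofRealCLM.contDiff.comp ψ.contDiff)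
  refine ⟨Metric.closedBall x 1, Metric.closedBall_mem_nhds x one_pos, ?_⟩
  refine ((hv φ).1.integrableOn (s := Metric.closedBall x 1)).congr_fun (fun y hy => ?_)
    measurableSet_closedBall
  change (ψ y : ℂ) * h y = h y
  rw [ψ.one_of_mem_closedBall hy]
  simp

lemma IsFunction.ae_eq {v : 𝓢'(𝔼, ℂ)} {h h' : 𝔼 → ℂ} (hv : IsFunction v h)
    (hv' : IsFunction v h') : h =ᵐ[volume] h' := by
  have := ae_eq_zero_of_integral_contDiff_smul_eq_zero (μ := volume)
    (hv.locallyIntegrable.sub hv'.locallyIntegrable) fun g hg hgc => ?_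
  · filter_upwards [this] with x hx
    simpa [sub_eq_zero] using hx
  · have hcs : HasCompactSupport fun y => (g y : ℂ) := hgc.comp_left (g := Complex.ofReal) rfl
    let φ : 𝓢(𝔼, ℂ) := hcs.toSchwartzMap (Complex.ofRealCLM.contDiff.comp hg)
    have h1 := hv φ
    have h2 := hv' φ
    have : ∀ x, g x • (h - h') x = φ x * h x - φ x * h' x := fun x => by
      change _ = (g x : ℂ) * h x - (g x : ℂ) * h' x
      simp [mul_sub]
    simp_rw [this]
    rw [integral_sub h1.1 h2.1, ← h1.2, ← h2.2, sub_self]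

lemma IsFunction.congr_ae {v : 𝓢'(𝔼, ℂ)} {h h' : 𝔼 → ℂ} (hv : IsFunction v h)
    (hh : h =ᵐ[volume] h') : IsFunction v h' := by
  intro φ
  have : (fun x => φ x * h x) =ᵐ[volume] fun x => φ x * h' x := by
    filter_upwards [hh] with x hx
    rw [hx]
  exact ⟨(hv φ).1.congr this, by rw [(hv φ).2, integral_congr_ae this]⟩

lemma IsFunction.add {v v' : 𝓢'(𝔼, ℂ)} {h h' : 𝔼 → ℂ} (hv : IsFunction v h)
    (hv' : IsFunction v' h') : IsFunction (v + v') (fun x => h x + h' x) := by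
  intro φ
  simp only [mul_add]
  refine ⟨(hv φ).1.add (hv' φ).1, ?_⟩
  rw [integral_add (hv φ).1 (hv' φ).1, ← (hv φ).2, ← (hv' φ).2]
  rfl

lemma integrable_schwartz_mul {p : ℝ≥0∞} (hp : 1 ≤ p) (φ : 𝓢(𝔼, ℂ)) {f : 𝔼 → ℂ}
    (hf : MemLp f p) : Integrable (fun x => φ x * f x) := by
  have : Fact (1 ≤ p) := ⟨hp⟩
  have : ENNReal.HolderConjugate p (ENNReal.conjExponent p) := .conjExponent hp
  have := hf.mul' (φ.memLp (ENNReal.conjExponent p)) (r := 1)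
  exact memLp_one_iff_integrable.1 this

lemma isFunction_toTemperedDistribution {p : ℝ≥0∞} [hp : Fact (1 ≤ p)]
    (f : Lp ℂ p (volume : Measure 𝔼)) : IsFunction (f : 𝓢'(𝔼, ℂ)) f := by
  intro φ
  refine ⟨integrable_schwartz_mul hp.out φ (Lp.memLp f), ?_⟩
  rw [Lp.toTemperedDistribution_apply]
  simp

lemma integral_fourier_mul_eq_of_integrable {f g : 𝔼 → ℂ} (hf : Integrable f) (hg : Integrable g) :
    ∫ x, 𝓕 f x * g x = ∫ x, f x * 𝓕 g x := by
  have := VectorFourier.integral_fourierIntegral_smul_eq_flip (𝕜 := ℝ) (e := Real.fourierChar)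
    (L := innerₗ 𝔼) (μ := volume) (ν := volume) Real.continuous_fourierChar
    (by simpa using continuous_inner) hf hg
  rw [flip_innerₗ] at this
  exact this

lemma continuous_fourier {f : 𝔼 → ℂ} (hf : Integrable f) : Continuous (𝓕 f) :=
  VectorFourier.fourierIntegral_continuous Real.continuous_fourierChar
    (by simpa using continuous_inner) hf

lemma norm_fourier_le (f : 𝔼 → ℂ) (ξ : 𝔼) : ‖𝓕 f ξ‖ ≤ ∫ x, ‖f x‖ :=
  VectorFourier.norm_fourierIntegral_le_integral_norm _ _ _ _ _

lemma integrable_schwartz_mul_bounded (φ : 𝓢(𝔼, ℂ)) {h : 𝔼 → ℂ} (hm : AEStronglyMeasurable h)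
    {C : ℝ} (hC : ∀ x, ‖h x‖ ≤ C) : Integrable (fun x => φ x * h x) :=
  φ.integrable.mul_bdd hm (Filter.Eventually.of_forall hC)

lemma isFunction_fourier_L1 (f : Lp ℂ 1 (volume : Measure 𝔼)) :
    IsFunction (𝓕 (f : 𝓢'(𝔼, ℂ))) (𝓕 (f : 𝔼 → ℂ)) := by
  have hf : Integrable f := L1.integrable_coeFn f
  intro φ
  refine ⟨integrable_schwartz_mul_bounded φ (continuous_fourier hf).aestronglyMeasurable
    (norm_fourier_le f), ?_⟩
  rw [TemperedDistribution.fourier_apply, (isFunction_toTemperedDistribution f (𝓕 φ)).2,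
    SchwartzMap.fourier_coe, integral_fourier_mul_eq_of_integrable φ.integrable hf]

/-- Plancherel's theorem on `L¹ ∩ L²`. -/
lemma fourier_ae_eq_L2 {f : 𝔼 → ℂ} (h1 : Integrable f) (h2 : MemLp f 2) :
    (𝓕 (h2.toLp f) : Lp ℂ 2 (volume : Measure 𝔼)) =ᵐ[volume] 𝓕 f := by
  have hA := isFunction_toTemperedDistribution (𝓕 (h2.toLp f))
  rw [← Lp.fourier_toTemperedDistribution_eq] at hA
  refine hA.ae_eq fun φ => ?_
  refine ⟨integrable_schwartz_mul_bounded φ (continuous_fourier h1).aestronglyMeasurable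
    (norm_fourier_le f), ?_⟩
  rw [TemperedDistribution.fourier_apply, (isFunction_toTemperedDistribution _ (𝓕 φ)).2,
    SchwartzMap.fourier_coe, ← integral_fourier_mul_eq_of_integrable φ.integrable h1]
  refine integral_congr_ae ?_
  filter_upwards [h2.coeFn_toLp] with x hx
  rw [hx]

lemma eLpNorm_fourier {f : 𝔼 → ℂ} (h1 : Integrable f) (h2 : MemLp f 2) :
    eLpNorm (𝓕 f) 2 = eLpNorm f 2 := by
  rw [← eLpNorm_congr_ae (fourier_ae_eq_L2 h1 h2), ← eLpNorm_congr_ae h2.coeFn_toLp]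
  have := Lp.norm_fourier_eq (h2.toLp f)
  rw [Lp.norm_def, Lp.norm_def] at this
  exact (ENNReal.toReal_eq_toReal_iff' (Lp.eLpNorm_ne_top _) (Lp.eLpNorm_ne_top _)).1 this

lemma memLp_fourier {f : 𝔼 → ℂ} (h1 : Integrable f) (h2 : MemLp f 2) : MemLp (𝓕 f) 2 :=
  ⟨(continuous_fourier h1).aestronglyMeasurable, by rw [eLpNorm_fourier h1 h2]; exact h2.2⟩

lemma fourierInv_eq_fourier_comp_neg' (f : 𝔼 → ℂ) : 𝓕⁻ f = fun x => 𝓕 f (-x) := by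
  ext x
  exact Real.fourierInv_eq_fourier_neg f x

lemma continuous_fourierInv {f : 𝔼 → ℂ} (hf : Integrable f) : Continuous (𝓕⁻ f) := by
  rw [fourierInv_eq_fourier_comp_neg']
  exact (continuous_fourier hf).comp continuous_neg

lemma eLpNorm_fourierInv {f : 𝔼 → ℂ} (h1 : Integrable f) (h2 : MemLp f 2) :
    eLpNorm (𝓕⁻ f) 2 = eLpNorm f 2 := by
  rw [fourierInv_eq_fourier_comp_neg', ← eLpNorm_fourier h1 h2]
  exact eLpNorm_comp_measurePreserving (continuous_fourier h1).aestronglyMeasurable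
    (Measure.measurePreserving_neg volume)

/-- The multiplication formula combined with the reflection x ↦ -x. It says that the inverse
transform of an integrable function has that function as its distributional Fourier transform. -/
lemma integral_fourierInv_mul_fourier {f : 𝔼 → ℂ} (hf : Integrable f) (φ : 𝓢(𝔼, ℂ)) :
    ∫ x, (𝓕 φ : 𝓢(𝔼, ℂ)) x * 𝓕⁻ f x = ∫ x, φ x * f x := by
  obtain ⟨ψ, rfl⟩ : ∃ ψ : 𝓢(𝔼, ℂ), φ = 𝓕⁻ ψ := ⟨𝓕 φ, by simp⟩
  have hi : Integrable (fun x => ψ (-x)) := ψ.integrable.comp_neg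
  rw [FourierTransform.fourier_fourierInv_eq]
  calc ∫ x, ψ x * 𝓕⁻ f x = ∫ x, ψ (-x) * 𝓕 f x := by
        rw [← integral_neg_eq_self (fun x : 𝔼 => ψ (-x) * 𝓕 f x), fourierInv_eq_fourier_comp_neg']
        simp_rw [neg_neg]
    _ = ∫ x, 𝓕 (fun x : 𝔼 => ψ (-x)) x * f x :=
        (integral_fourier_mul_eq_of_integrable hi hf).symm
    _ = ∫ x, (𝓕⁻ ψ : 𝓢(𝔼, ℂ)) x * f x := by
        rw [← Real.fourierInv_eq_fourier_comp_neg, ← SchwartzMap.fourierInv_coe]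

end Distributions
end SquareFunction

namespace SquareFunction

open scoped ContDiff

variable {n : ℕ}

local notation "𝔼" => EuclideanSpace ℝ (Fin n)

/-! ### Weighted L² bounds through derivatives on the Fourier side -/

section WeightedL2

/-- Multiplication by `-2πi x·v`, which is a derivative on the Fourier side. -/
noncomputable def coordMul (v : 𝔼) (f : 𝔼 → ℂ) (x : 𝔼) : ℂ :=
  (-(2 * Real.pi * Complex.I) * (inner ℝ x v : ℝ)) * f x

lemma fourierInv_fderiv_apply {B : 𝔼 → ℂ} (hB : ContDiff ℝ ∞ B) (hc : HasCompactSupport B)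
    (v : 𝔼) : 𝓕⁻ (fun ξ => fderiv ℝ B ξ v) = coordMul v (𝓕⁻ B) := by
  have hd : Continuous (fderiv ℝ B) := hB.continuous_fderiv (by simp)
  have hi : Integrable (fderiv ℝ B) := hd.integrable_of_hasCompactSupport (hc.fderiv ℝ)
  have h1 := Real.fourier_fderiv (hB.continuous.integrable_of_hasCompactSupport hc)
    (hB.differentiable (by simp)) hi
  ext x
  rw [Real.fourierInv_eq_fourier_neg, ← Real.fourier_continuousLinearMap_apply hi, h1]
  simp only [coordMul, VectorFourier.fourierSMulRight_apply, Real.fourierInv_eq_fourier_neg]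
  simp [innerSL_apply_apply ℝ]
  ring

lemma integrable_norm_pow_mul {f : 𝔼 → ℂ} (hf : Integrable f) {r : ℝ}
    (hr : ∀ x, r < ‖x‖ → f x = 0) (k : ℕ) : Integrable (fun x => ‖x‖ ^ k * ‖f x‖) := by
  refine (hf.norm.const_mul (|r| ^ k)).mono' ?_ (Filter.Eventually.of_forall fun x => ?_)
  · exact (continuous_norm.pow k).aestronglyMeasurable.mul hf.1.norm
  · rw [Real.norm_of_nonneg (by positivity)]
    rcases le_or_gt ‖x‖ r with h | h
    · gcongr
      exact h.trans (le_abs_self r)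
    · simp [hr x h]

lemma integrable_coordMul {f : 𝔼 → ℂ} (hf : Integrable f) {r : ℝ}
    (hr : ∀ x, r < ‖x‖ → f x = 0) (v : 𝔼) : Integrable (coordMul v f) := by
  refine ((integrable_norm_pow_mul hf hr 1).const_mul (2 * Real.pi * ‖v‖)).mono' ?_
    (Filter.Eventually.of_forall fun x => ?_)
  · refine AEStronglyMeasurable.mul ?_ hf.1
    exact (continuous_const.mul (Complex.continuous_ofReal.comp
      (continuous_id.inner continuous_const))).aestronglyMeasurable
  · simp only [coordMul, norm_mul, norm_neg, Complex.norm_real, Complex.norm_I, mul_one,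
      Complex.norm_ofNat, Real.norm_of_nonneg Real.pi_pos.le, pow_one]
    have := norm_inner_le_norm (𝕜 := ℝ) x v
    calc _ ≤ 2 * Real.pi * (‖x‖ * ‖v‖) * ‖f x‖ := by gcongr
      _ = _ := by ring

lemma coordMul_eq_zero {f : 𝔼 → ℂ} {r : ℝ} (hr : ∀ x, r < ‖x‖ → f x = 0) (v : 𝔼) :
    ∀ x, r < ‖x‖ → coordMul v f x = 0 := fun x hx => by simp [coordMul, hr x hx]

lemma contDiff_fourier_of_bounded_support {f : 𝔼 → ℂ} (hf : Integrable f) {r : ℝ}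
    (hr : ∀ x, r < ‖x‖ → f x = 0) : ContDiff ℝ ∞ (𝓕 f) :=
  Real.contDiff_fourier (N := ⊤) fun k _ => integrable_norm_pow_mul hf hr k

lemma fderiv_fourier_apply {f : 𝔼 → ℂ} (hf : Integrable f) {r : ℝ}
    (hr : ∀ x, r < ‖x‖ → f x = 0) (v ξ : 𝔼) :
    fderiv ℝ (𝓕 f) ξ v = 𝓕 (coordMul v f) ξ := by
  have h1 : Integrable (fun x => ‖x‖ * ‖f x‖) := by simpa using integrable_norm_pow_mul hf hr 1
  rw [Real.fderiv_fourier hf h1]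
  have hi : Integrable (VectorFourier.fourierSMulRight (innerSL ℝ) f) := by
    refine (h1.const_mul (2 * Real.pi * ‖innerSL ℝ (E := 𝔼)‖)).mono'
      (AEStronglyMeasurable.fourierSMulRight hf.1) (Filter.Eventually.of_forall fun x => ?_)
    refine (VectorFourier.norm_fourierSMulRight_le _ _ _).trans (le_of_eq ?_)
    ring
  rw [Real.fourier_continuousLinearMap_apply hi]
  have h2 : (fun x => VectorFourier.fourierSMulRight (innerSL ℝ) f x v) = coordMul v f := by
    ext x
    simp only [coordMul, VectorFourier.fourierSMulRight_apply]
    simp [innerSL_apply_apply ℝ]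
    ring
  rw [h2]

lemma contDiff_fderiv_apply {b : 𝔼 → ℂ} (hb : ContDiff ℝ ∞ b) (v : 𝔼) :
    ContDiff ℝ ∞ (fun ξ => fderiv ℝ b ξ v) :=
  (hb.fderiv_right (m := ∞) (by simp)).clm_apply contDiff_const

lemma norm_iteratedFDeriv_fderiv_apply_le {b : 𝔼 → ℂ} (hb : ContDiff ℝ ∞ b) {v : 𝔼}
    (hv : ‖v‖ ≤ 1) (i : ℕ) (ξ : 𝔼) :
    ‖iteratedFDeriv ℝ i (fun ξ => fderiv ℝ b ξ v) ξ‖ ≤ ‖iteratedFDeriv ℝ (i + 1) b ξ‖ := by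
  refine (norm_iteratedFDeriv_clm_apply_const (N := ∞)
    (hb.fderiv_right (m := ∞) (by simp)).contDiffAt (by exact_mod_cast le_top)).trans ?_
  rw [norm_iteratedFDeriv_fderiv]
  exact mul_le_of_le_one_left (norm_nonneg _) hv

lemma integrable_mul_fourier {b f : 𝔼 → ℂ} (hb : Continuous b) (hbc : HasCompactSupport b)
    (hf : Integrable f) : Integrable (fun ξ => b ξ * 𝓕 f ξ) :=
  (hb.mul (continuous_fourier hf)).integrable_of_hasCompactSupport hbc.mul_right

lemma memLp_mul_fourier {b f : 𝔼 → ℂ} (hb : Continuous b) (hbc : HasCompactSupport b)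
    (hf : Integrable f) (p : ℝ≥0∞) : MemLp (fun ξ => b ξ * 𝓕 f ξ) p :=
  (hb.mul (continuous_fourier hf)).memLp_of_hasCompactSupport hbc.mul_right

/-- Multiplication by a coordinate is differentiation on the Fourier side. By the Leibniz rule the
derivative hits the multiplier or the transform of `f`, and the latter gives a coordinate factor
back to `f`. -/
lemma coordMul_fourierInv {b f : 𝔼 → ℂ} (hb : ContDiff ℝ ∞ b) (hbc : HasCompactSupport b)
    (hf : Integrable f) {r : ℝ} (hr : ∀ x, r < ‖x‖ → f x = 0) (v : 𝔼) :
    coordMul v (𝓕⁻ (fun ξ => b ξ * 𝓕 f ξ)) =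
      𝓕⁻ (fun ξ => fderiv ℝ b ξ v * 𝓕 f ξ) + 𝓕⁻ (fun ξ => b ξ * 𝓕 (coordMul v f) ξ) := by
  have hF := contDiff_fourier_of_bounded_support hf hr
  rw [← fourierInv_fderiv_apply (hb.mul hF) hbc.mul_right]
  have h1 : Integrable (fun ξ => fderiv ℝ b ξ v * 𝓕 f ξ) :=
    integrable_mul_fourier (contDiff_fderiv_apply hb v).continuous (hbc.fderiv_apply ℝ v) hf
  have h2 := integrable_mul_fourier hb.continuous hbc (integrable_coordMul hf hr v)
  have h3 : (fun ξ => fderiv ℝ (fun ξ => b ξ * 𝓕 f ξ) ξ v) =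
      fun ξ => fderiv ℝ b ξ v * 𝓕 f ξ + b ξ * 𝓕 (coordMul v f) ξ := by
    ext ξ
    rw [fderiv_fun_mul (hb.differentiable (by simp) ξ) (hF.differentiable (by simp) ξ)]
    simp only [add_apply, smul_apply, smul_eq_mul,
      fderiv_fourier_apply hf hr]
    ring
  rw [h3]
  ext x
  simp only [Pi.add_apply, Real.fourierInv_eq]
  rw [← integral_add]
  · simp [smul_add]
  · simpa using (Real.fourierIntegral_convergent_iff (-x)).2 h1
  · simpa using (Real.fourierIntegral_convergent_iff (-x)).2 h2

lemma iterate_coordMul_add (v : 𝔼) (f g : 𝔼 → ℂ) (M : ℕ) :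
    (coordMul v)^[M] (f + g) = (coordMul v)^[M] f + (coordMul v)^[M] g := by
  induction M generalizing f g with
  | zero => rfl
  | succ M ih =>
    rw [Function.iterate_succ_apply, Function.iterate_succ_apply, Function.iterate_succ_apply, ← ih]
    congr 1
    ext x
    simp [coordMul, mul_add]

lemma continuous_iterate_coordMul (v : 𝔼) {f : 𝔼 → ℂ} (hf : Continuous f) (M : ℕ) :
    Continuous ((coordMul v)^[M] f) := by
  induction M generalizing f with
  | zero => exact hf
  | succ M ih =>
    rw [Function.iterate_succ_apply]
    refine ih ?_
    exact (continuous_const.mul (Complex.continuous_ofReal.comp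
      (continuous_id.inner continuous_const))).mul hf

/-- Weighted `L²` estimate for a multiplier: powers of `x` fall on the multiplier and on the
function as derivatives and as powers of `x`, respectively. -/
lemma eLpNorm_iterate_coordMul_fourierInv_le {S : Set 𝔼} {v : 𝔼}
    (hv : ‖v‖ ≤ 1) {r R : ℝ} (hR : 0 ≤ R) (M : ℕ) :
    ∀ {b f : 𝔼 → ℂ} {D : ℝ} {A : ℝ≥0∞}, ContDiff ℝ ∞ b → HasCompactSupport b → tsupport b ⊆ S →
      Integrable f → (∀ x, r < ‖x‖ → f x = 0) → 0 ≤ D →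
      (∀ i ≤ M, ∀ ξ, ‖iteratedFDeriv ℝ i b ξ‖ ≤ D * R ^ i) →
      (∀ i ≤ M, eLpNorm (S.indicator (𝓕 ((coordMul v)^[i] f))) 2 ≤ A * ENNReal.ofReal R ^ i) →
      eLpNorm ((coordMul v)^[M] (𝓕⁻ (fun ξ => b ξ * 𝓕 f ξ))) 2 ≤
        2 ^ M * ENNReal.ofReal D * A * ENNReal.ofReal R ^ M := by
  induction M with
  | zero =>
    intro b f D A hb hbc hbS hf hr hD hbD hfA
    have h0 := hfA 0 le_rfl
    simp only [Function.iterate_zero, id_eq, pow_zero, mul_one, one_mul] at h0 ⊢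
    rw [eLpNorm_fourierInv (integrable_mul_fourier hb.continuous hbc hf)
      (memLp_mul_fourier hb.continuous hbc hf 2)]
    calc _ ≤ ENNReal.ofReal D * eLpNorm (S.indicator (𝓕 f)) 2 := by
          refine eLpNorm_le_mul_eLpNorm_of_ae_le_mul (Filter.Eventually.of_forall fun ξ => ?_) 2
          by_cases hξ : ξ ∈ S
          · rw [Set.indicator_of_mem hξ, norm_mul]
            gcongr
            simpa using hbD 0 le_rfl ξ
          · rw [image_eq_zero_of_notMem_tsupport (fun h => hξ (hbS h)), zero_mul, norm_zero]
            positivity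
      _ ≤ _ := by gcongr
  | succ M ih =>
    intro b f D A hb hbc hbS hf hr hD hbD hfA
    rw [Function.iterate_succ_apply, coordMul_fourierInv hb hbc hf hr, iterate_coordMul_add]
    have hdb : ContDiff ℝ ∞ fun ξ => fderiv ℝ b ξ v := contDiff_fderiv_apply hb v
    have hdbc : HasCompactSupport fun ξ => fderiv ℝ b ξ v := hbc.fderiv_apply ℝ v
    have hts : tsupport (fun ξ => fderiv ℝ b ξ v) ⊆ tsupport b := by
      refine closure_minimal (fun ξ hξ => ?_) (isClosed_tsupport b)
      refine support_fderiv_subset ℝ (fun h => hξ ?_)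
      simp only
      rw [h]
      rfl
    -- A derivative on the multiplier is charged to D, a moment of the function to A. Either costs
    -- one factor R, and the two branches account for the factor 2 per step.
    have e1 := ih (D := D * R) (A := A) hdb hdbc (hts.trans hbS) hf hr (by positivity)
      (fun i hi ξ => (norm_iteratedFDeriv_fderiv_apply_le hb hv i ξ).trans
        ((hbD (i + 1) (by omega) ξ).trans (le_of_eq (by ring))))
      (fun i hi => hfA i (by omega))
    have e2 := ih (D := D) (A := A * ENNReal.ofReal R) hb hbc hbS (integrable_coordMul hf hr v)
      (coordMul_eq_zero hr v) hD (fun i hi => hbD i (by omega))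
      (fun i hi => by
        rw [← Function.iterate_succ_apply]
        exact (hfA (i + 1) (by omega)).trans (le_of_eq (by ring)))
    have hc1 : Continuous (𝓕⁻ (fun ξ => fderiv ℝ b ξ v * 𝓕 f ξ)) :=
      continuous_fourierInv (integrable_mul_fourier hdb.continuous hdbc hf)
    have hc2 : Continuous (𝓕⁻ (fun ξ => b ξ * 𝓕 (coordMul v f) ξ)) :=
      continuous_fourierInv (integrable_mul_fourier hb.continuous hbc (integrable_coordMul hf hr v))
    calc _ ≤ _ := eLpNorm_add_le (continuous_iterate_coordMul v hc1 M).aestronglyMeasurable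
          (continuous_iterate_coordMul v hc2 M).aestronglyMeasurable one_le_two
      _ ≤ _ := add_le_add e1 e2
      _ = _ := by
        rw [ENNReal.ofReal_mul hD]
        ring

lemma norm_iterate_coordMul (v : 𝔼) (f : 𝔼 → ℂ) (M : ℕ) (x : 𝔼) :
    ‖(coordMul v)^[M] f x‖ = (2 * Real.pi * |inner ℝ x v|) ^ M * ‖f x‖ := by
  induction M generalizing f with
  | zero => simp
  | succ M ih =>
    rw [Function.iterate_succ_apply, ih]
    simp only [coordMul, norm_mul, norm_neg, Complex.norm_real, Complex.norm_I, mul_one,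
      Complex.norm_ofNat, Real.norm_eq_abs, abs_of_pos Real.pi_pos, Complex.norm_real]
    ring

end WeightedL2
end SquareFunction

namespace SquareFunction

open scoped ContDiff

variable {n : ℕ}

local notation "𝔼" => EuclideanSpace ℝ (Fin n)

/-! ### From weighted L² to the mixed L¹ norm -/

section MixedNorm

lemma mixedNorm_one (I : Set ℝ) (F : ℝ → 𝔼 → ℂ) :
    mixedNorm 1 I F = ∫⁻ x, (∫⁻ u in I, ‖F u x‖ₑ ^ 2) ^ (1 / 2 : ℝ) := by
  rw [mixedNorm, eLpNorm_one_eq_lintegral_enorm]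
  rfl

/-- The weight `1 + ∑ᵢ |2π xᵢ / R|^{2n}`. -/
noncomputable def polyWeight (R : ℝ) (x : 𝔼) : ℝ :=
  1 + ∑ i : Fin n, ((2 * Real.pi * |x i|) ^ n / R ^ n) ^ 2

lemma polyWeight_pos (R : ℝ) (x : 𝔼) : 0 < polyWeight R x := by
  unfold polyWeight
  positivity

lemma continuous_polyWeight (R : ℝ) : Continuous (polyWeight (n := n) R) := by
  unfold polyWeight
  fun_prop

/-- Some coordinate satisfies y_i² ≥ |y|²/n, so pure powers of the coordinates control |y|^(2n).
This is why derivatives along the coordinate directions are enough. -/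
lemma one_add_normSq_pow_le_polyWeight {R : ℝ} (hR : 0 < R) (x : 𝔼) :
    (1 + ‖R⁻¹ • x‖ ^ 2) ^ n ≤ (2 ^ n * (1 + (n : ℝ) ^ n)) * polyWeight R x := by
  rcases Nat.eq_zero_or_pos n with rfl | hn
  · simp [polyWeight]
  set y := R⁻¹ • x with hy
  have hsum : ‖y‖ ^ 2 = ∑ i, (y i) ^ 2 := by
    rw [EuclideanSpace.norm_sq_eq]
    simp
  obtain ⟨i, -, hi⟩ : ∃ i ∈ (Finset.univ : Finset (Fin n)), ‖y‖ ^ 2 / n ≤ (y i) ^ 2 := by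
    refine Finset.exists_le_of_sum_le ⟨⟨0, hn⟩, Finset.mem_univ _⟩ ?_
    rw [← hsum]
    simp only [Finset.sum_const, Finset.card_univ, Fintype.card_fin, nsmul_eq_mul]
    have : (n : ℝ) ≠ 0 := by positivity
    exact le_of_eq (by field_simp)
  have hn' : (0 : ℝ) < n := by exact_mod_cast hn
  have h1 : (‖y‖ ^ 2) ^ n ≤ (n : ℝ) ^ n * ((y i) ^ 2) ^ n := by
    rw [← mul_pow]
    rw [div_le_iff₀ hn'] at hi
    exact pow_le_pow_left₀ (by positivity) (by linarith) _
  have h2 : ((y i) ^ 2) ^ n ≤ polyWeight R x := by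
    have h3 : ((y i) ^ 2) ^ n ≤ ((2 * Real.pi * |x i|) ^ n / R ^ n) ^ 2 := by
      rw [← div_pow, ← pow_mul, ← pow_mul, mul_comm n 2, pow_mul, pow_mul (_ / R)]
      refine pow_le_pow_left₀ (by positivity) ?_ _
      rw [hy]
      simp only [PiLp.smul_apply, smul_eq_mul]
      rw [div_pow, mul_pow, mul_pow, sq_abs, inv_pow, inv_mul_eq_div]
      gcongr
      have : 1 ≤ (2 * Real.pi) ^ 2 := one_le_pow₀ (by linarith [Real.pi_gt_three])
      nlinarith [sq_nonneg (x i)]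
    calc _ ≤ _ := h3
      _ ≤ ∑ i : Fin n, ((2 * Real.pi * |x i|) ^ n / R ^ n) ^ 2 :=
        Finset.single_le_sum (f := fun i => ((2 * Real.pi * |x i|) ^ n / R ^ n) ^ 2)
          (fun i _ => by positivity) (Finset.mem_univ i)
      _ ≤ _ := by unfold polyWeight; linarith
  have h4 : 1 ≤ polyWeight R x := by
    unfold polyWeight
    have : 0 ≤ ∑ i : Fin n, ((2 * Real.pi * |x i|) ^ n / R ^ n) ^ 2 := by positivity
    linarith
  calc (1 + ‖y‖ ^ 2) ^ n ≤ 2 ^ (n - 1) * (1 ^ n + (‖y‖ ^ 2) ^ n) :=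
        add_pow_le (by norm_num) (by positivity) n
    _ ≤ 2 ^ n * (polyWeight R x + (n : ℝ) ^ n * polyWeight R x) := by
        rw [one_pow]
        gcongr
        · norm_num
        · omega
        · exact h1.trans (by gcongr)
    _ = _ := by ring

/-- The weight grows like |x/R|^(2n), and 2n exceeds the dimension. The substitution x = Ry gives
the factor R^n. -/
lemma exists_lintegral_inv_polyWeight_le (hn : 1 ≤ n) : ∃ C : ℝ, 0 ≤ C ∧ ∀ R : ℝ, 0 < R →
    ∫⁻ x : 𝔼, ENNReal.ofReal (polyWeight R x)⁻¹ ≤ ENNReal.ofReal (C * R ^ n) := by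
  set g : 𝔼 → ℝ := fun y => (1 + ‖y‖ ^ 2) ^ (-(2 * n : ℝ) / 2) with hg
  have hgi : Integrable g := by
    refine integrable_rpow_neg_one_add_norm_sq ?_
    simp only [finrank_euclideanSpace, Fintype.card_fin]
    have : (1 : ℝ) ≤ n := by exact_mod_cast hn
    linarith
  have hg0 : ∀ y, 0 ≤ g y := fun y => by simp only [hg]; positivity
  set K : ℝ := 2 ^ n * (1 + (n : ℝ) ^ n) with hK
  have hK0 : 0 < K := by positivity
  refine ⟨K * ∫ y, g y, mul_nonneg hK0.le (integral_nonneg hg0), fun R hR => ?_⟩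
  have hle : ∀ x : 𝔼, (polyWeight R x)⁻¹ ≤ K * g (R⁻¹ • x) := fun x => by
    have h1 := one_add_normSq_pow_le_polyWeight hR x
    have h2 : g (R⁻¹ • x) = ((1 + ‖R⁻¹ • x‖ ^ 2) ^ n)⁻¹ := by
      simp only [hg]
      rw [show -(2 * n : ℝ) / 2 = -(n : ℝ) by ring, Real.rpow_neg (by positivity),
        Real.rpow_natCast]
    rw [h2, inv_le_iff_one_le_mul₀ (polyWeight_pos R x), mul_comm K, mul_assoc,
      inv_mul_eq_div, one_le_div (by positivity)]
    exact h1
  calc _ ≤ ∫⁻ x : 𝔼, ENNReal.ofReal (K * g (R⁻¹ • x)) :=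
        lintegral_mono fun x => ENNReal.ofReal_le_ofReal (hle x)
    _ = ENNReal.ofReal (∫ x : 𝔼, K * g (R⁻¹ • x)) := by
        rw [ofReal_integral_eq_lintegral_ofReal]
        · exact ((integrable_comp_smul_iff volume g (by positivity)).2 hgi).const_mul K
        · exact Filter.Eventually.of_forall fun x => mul_nonneg hK0.le (hg0 _)
    _ = _ := by
        rw [integral_const_mul, Measure.integral_comp_inv_smul]
        simp only [finrank_euclideanSpace, Fintype.card_fin, smul_eq_mul]
        rw [abs_of_pos (by positivity)]
        congr 1
        ring

lemma eLpNorm_two_sq (f : 𝔼 → ℂ) : eLpNorm f 2 ^ 2 = ∫⁻ x, ‖f x‖ₑ ^ 2 := by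
  rw [eLpNorm_eq_lintegral_rpow_enorm_toReal (by norm_num) (by norm_num), ← ENNReal.rpow_natCast,
    ← ENNReal.rpow_mul]
  norm_num

lemma lintegral_polyWeight_mul_le {G : 𝔼 → ℂ} (hG : Continuous G) {R : ℝ} (hR : 0 < R) {B : ℝ≥0∞}
    (h0 : eLpNorm G 2 ≤ B)
    (h1 : ∀ i : Fin n, eLpNorm ((coordMul (EuclideanSpace.single i 1))^[n] G) 2 ≤
      B * ENNReal.ofReal R ^ n) :
    ∫⁻ x, ENNReal.ofReal (polyWeight R x) * ‖G x‖ₑ ^ 2 ≤ (1 + n) * B ^ 2 := by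
  have hpt : ∀ x, ENNReal.ofReal (polyWeight R x) * ‖G x‖ₑ ^ 2 = ‖G x‖ₑ ^ 2 +
      ∑ i : Fin n, (ENNReal.ofReal (R ^ n)⁻¹) ^ 2 *
        ‖(coordMul (EuclideanSpace.single i 1))^[n] G x‖ₑ ^ 2 := by
    intro x
    rw [polyWeight, ENNReal.ofReal_add (by norm_num) (by positivity), ENNReal.ofReal_one, add_mul,
      one_mul, ENNReal.ofReal_sum_of_nonneg (fun i _ => by positivity), Finset.sum_mul]
    congr 1
    refine Finset.sum_congr rfl fun i _ => ?_
    rw [← ofReal_norm, ← ofReal_norm, norm_iterate_coordMul,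
      ENNReal.ofReal_pow (by positivity), ← mul_pow, ← mul_pow, ← ENNReal.ofReal_mul (by positivity),
      ← ENNReal.ofReal_mul (by positivity)]
    congr 2
    rw [EuclideanSpace.inner_single_right]
    simp only [one_mul, conj_trivial]
    ring
  simp_rw [hpt]
  rw [lintegral_add_left' (hG.aestronglyMeasurable.enorm.pow_const 2), lintegral_finsetSum']
  · rw [← eLpNorm_two_sq, add_mul, one_mul]
    gcongr
    calc _ ≤ ∑ _i : Fin n, B ^ 2 := by
          refine Finset.sum_le_sum fun i _ => ?_
          rw [lintegral_const_mul' _ _ (by simp), ← eLpNorm_two_sq, ← mul_pow]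
          gcongr
          calc _ ≤ ENNReal.ofReal (R ^ n)⁻¹ * (B * ENNReal.ofReal R ^ n) := by gcongr; exact h1 i
            _ = B * (ENNReal.ofReal (R ^ n)⁻¹ * ENNReal.ofReal (R ^ n)) := by
                rw [ENNReal.ofReal_pow hR.le]; ring
            _ = B := by
                rw [← ENNReal.ofReal_mul (by positivity), inv_mul_cancel₀ (by positivity)]
                simp
      _ = _ := by simp
  · intro i _
    exact ((continuous_iterate_coordMul _ hG n).aestronglyMeasurable.enorm.pow_const 2).const_mul _

/-- Cauchy–Schwarz: weighted `L²` bounds at scale `R` give a bound for the `L¹` mixed norm. -/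
lemma exists_mixedNorm_one_le (hn : 1 ≤ n) (I : Set ℝ) (hI : volume I ≠ ⊤) :
    ∃ C : ℝ, 0 ≤ C ∧ ∀ (G : ℝ → 𝔼 → ℂ), Measurable (Function.uncurry G) → (∀ u, Continuous (G u)) →
      ∀ (R : ℝ), 0 < R → ∀ B : ℝ≥0∞, (∀ᵐ u ∂(volume.restrict I), eLpNorm (G u) 2 ≤ B) →
      (∀ᵐ u ∂(volume.restrict I), ∀ i : Fin n, 
        eLpNorm ((coordMul (EuclideanSpace.single i 1))^[n] (G u)) 2 ≤ B * ENNReal.ofReal R ^ n) →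
      mixedNorm 1 I G ≤ ENNReal.ofReal (C * R ^ ((n : ℝ) / 2)) * B := by
  obtain ⟨C₀, hC₀, hW⟩ := exists_lintegral_inv_polyWeight_le hn
  refine ⟨√(C₀ * ((volume I).toReal * (1 + n))), Real.sqrt_nonneg _,
    fun G hGm hGc R hR B h0 h1 => ?_⟩
  rw [mixedNorm_one]
  set H : 𝔼 → ℝ≥0∞ := fun x => ∫⁻ u in I, ‖G u x‖ₑ ^ 2 with hH
  have hGm2 : Measurable fun p : 𝔼 × ℝ => ‖G p.2 p.1‖ₑ ^ 2 :=
    ((hGm.comp measurable_swap).enorm).pow_const 2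
  have hHm : Measurable H := hGm2.lintegral_prod_right'
  set w : 𝔼 → ℝ≥0∞ := fun x => ENNReal.ofReal (polyWeight R x) with hw
  have hwm : Measurable w := (continuous_polyWeight R).measurable.ennreal_ofReal
  have hw0 : ∀ x, w x ≠ 0 := fun x => by simpa [hw] using polyWeight_pos R x
  have hwt : ∀ x, w x ≠ ⊤ := fun x => ENNReal.ofReal_ne_top
  have hwi : ∀ x, ENNReal.ofReal (polyWeight R x)⁻¹ = (w x)⁻¹ := fun x =>
    ENNReal.ofReal_inv_of_pos (polyWeight_pos R x)
  have hsplit : ∀ x, H x ^ (1 / 2 : ℝ) = ((w x)⁻¹) ^ (1 / 2 : ℝ) * (w x * H x) ^ (1 / 2 : ℝ) := by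
    intro x
    rw [← ENNReal.mul_rpow_of_nonneg _ _ (by norm_num), ← mul_assoc,
      ENNReal.inv_mul_cancel (hw0 x) (hwt x), one_mul]
  have hWH : ∫⁻ x, w x * H x ≤ volume I * ((1 + n) * B ^ 2) := by
    calc ∫⁻ x, w x * H x = ∫⁻ x, ∫⁻ u in I, w x * ‖G u x‖ₑ ^ 2 := by
          refine lintegral_congr fun x => ?_
          rw [lintegral_const_mul' _ _ (hwt x)]
      _ = ∫⁻ u in I, ∫⁻ x, w x * ‖G u x‖ₑ ^ 2 := by
          refine lintegral_lintegral_swap (Measurable.aemeasurable ?_)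
          exact (hwm.comp measurable_fst).mul hGm2
      _ ≤ ∫⁻ _u in I, ((1 + n) * B ^ 2) := by
          refine lintegral_mono_ae ?_
          filter_upwards [h0, h1] with u hu0 hu1
          exact lintegral_polyWeight_mul_le (hGc u) hR hu0 hu1
      _ = _ := by
          rw [setLIntegral_const, mul_comm]
  have hhalf : ∀ a : ℝ≥0∞, (a ^ (1 / 2 : ℝ)) ^ (2 : ℝ) = a := fun a => by
    rw [← ENNReal.rpow_mul]
    norm_num
  calc ∫⁻ x, H x ^ (1 / 2 : ℝ)
      = ∫⁻ x, ((w x)⁻¹) ^ (1 / 2 : ℝ) * (w x * H x) ^ (1 / 2 : ℝ) :=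
        lintegral_congr hsplit
    _ ≤ (∫⁻ x, (((w x)⁻¹) ^ (1 / 2 : ℝ)) ^ (2 : ℝ)) ^ (1 / 2 : ℝ) *
          (∫⁻ x, ((w x * H x) ^ (1 / 2 : ℝ)) ^ (2 : ℝ)) ^ (1 / 2 : ℝ) :=
        ENNReal.lintegral_mul_le_Lp_mul_Lq volume Real.HolderConjugate.two_two
          (hwm.inv.pow_const _).aemeasurable ((hwm.mul hHm).pow_const _).aemeasurable
    _ = (∫⁻ x, (w x)⁻¹) ^ (1 / 2 : ℝ) * (∫⁻ x, w x * H x) ^ (1 / 2 : ℝ) := by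
        simp_rw [hhalf]
    _ ≤ (ENNReal.ofReal (C₀ * R ^ n)) ^ (1 / 2 : ℝ) *
          (volume I * ((1 + n) * B ^ 2)) ^ (1 / 2 : ℝ) := by
        gcongr
        simp_rw [← hwi]
        exact hW R hR
    _ = _ := by
        have hB : (B ^ 2) ^ (1 / 2 : ℝ) = B := by
          rw [← ENNReal.rpow_natCast, ← ENNReal.rpow_mul]
          norm_num
        have hVI : volume I = ENNReal.ofReal (volume I).toReal := (ENNReal.ofReal_toReal hI).symm
        rw [← mul_assoc, ENNReal.mul_rpow_of_nonneg _ (B ^ 2) (by norm_num), hB, ← mul_assoc, hVI]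
        congr 1
        rw [show (1 + n : ℝ≥0∞) = ENNReal.ofReal (1 + n) by
            rw [ENNReal.ofReal_add (by norm_num) (by positivity)]; simp,
          ← ENNReal.ofReal_mul (by positivity),
          ENNReal.ofReal_rpow_of_nonneg (by positivity) (by norm_num),
          ENNReal.ofReal_rpow_of_nonneg (by positivity) (by norm_num),
          ← ENNReal.ofReal_mul (by positivity)]
        congr 1
        rw [ENNReal.toReal_ofReal (by positivity), ← Real.sqrt_eq_rpow, ← Real.sqrt_eq_rpow,
          Real.sqrt_mul hC₀, Real.sqrt_mul hC₀]
        have : √(R ^ n) = R ^ ((n : ℝ) / 2) := by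
          rw [Real.sqrt_eq_rpow, ← Real.rpow_natCast, ← Real.rpow_mul hR.le]
          congr 1
          ring
        rw [this]
        ring

end MixedNorm
end SquareFunction

namespace SquareFunction

open scoped ContDiff

variable {n : ℕ}

local notation "𝔼" => EuclideanSpace ℝ (Fin n)

/-! ### Smooth cutoffs to frequency bands -/

section Cutoffs

/-- A smooth bump function, equal to `1` on the unit ball and to `0` outside the ball of radius
`2`. -/
noncomputable def unitBump (n : ℕ) : ContDiffBump (0 : EuclideanSpace ℝ (Fin n)) :=
  ⟨1, 2, one_pos, one_lt_two⟩

/-- The smooth cutoff to `s ≤ |ξ| ≤ 2t`. -/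
noncomputable def cut (s t : ℝ) (ξ : 𝔼) : ℂ :=
  ((unitBump n (t⁻¹ • ξ) : ℝ) : ℂ) - ((unitBump n (s⁻¹ • ξ) : ℝ) : ℂ)

lemma unitBump_eq_one {t : ℝ} (ht : 0 < t) {ξ : 𝔼} (h : ‖ξ‖ ≤ t) : unitBump n (t⁻¹ • ξ) = 1 := by
  refine (unitBump n).one_of_mem_closedBall ?_
  simp only [unitBump, mem_closedBall_zero_iff, norm_smul, norm_inv, Real.norm_eq_abs,
    abs_of_pos ht]
  rwa [inv_mul_le_one₀ ht]

lemma unitBump_eq_zero {t : ℝ} (ht : 0 < t) {ξ : 𝔼} (h : 2 * t ≤ ‖ξ‖) :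
    unitBump n (t⁻¹ • ξ) = 0 := by
  refine (unitBump n).zero_of_le_dist ?_
  simp only [unitBump, dist_zero_right, norm_smul, norm_inv, Real.norm_eq_abs, abs_of_pos ht]
  rw [inv_mul_eq_div, le_div_iff₀ ht]
  exact h

lemma contDiff_cut (s t : ℝ) : ContDiff ℝ ∞ (cut s t : 𝔼 → ℂ) := by
  refine ContDiff.sub ?_ ?_
  · exact Complex.ofRealCLM.contDiff.comp ((unitBump n).contDiff.comp (contDiff_const_smul _))
  · exact Complex.ofRealCLM.contDiff.comp ((unitBump n).contDiff.comp (contDiff_const_smul _))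

lemma cut_eq_zero_of_le {s t : ℝ} (hs : 0 < s) (hst : s ≤ t) {ξ : 𝔼} (h : ‖ξ‖ ≤ s) :
    cut s t ξ = 0 := by
  rw [cut, unitBump_eq_one hs h, unitBump_eq_one (hs.trans_le hst) (h.trans hst)]
  simp

lemma cut_eq_zero_of_ge {s t : ℝ} (hs : 0 < s) (hst : s ≤ t) {ξ : 𝔼} (h : 2 * t ≤ ‖ξ‖) :
    cut s t ξ = 0 := by
  rw [cut, unitBump_eq_zero hs (by linarith), unitBump_eq_zero (hs.trans_le hst) h]
  simp

lemma cut_eq_one {s t : ℝ} (hs : 0 < s) (ht : 0 < t) {ξ : 𝔼} (h : 2 * s ≤ ‖ξ‖) (h' : ‖ξ‖ ≤ t) :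
    cut s t ξ = 1 := by
  rw [cut, unitBump_eq_zero hs h, unitBump_eq_one ht h']
  simp

/-- Because a cutoff is a difference of two dilated bumps, adjacent bands add up exactly. The
decomposition into dyadic bands rests on this telescoping. -/
lemma cut_add_cut (s t w : ℝ) (ξ : 𝔼) : cut s t ξ + cut t w ξ = cut s w ξ := by
  simp [cut]

lemma norm_cut_le_one (s t : ℝ) (ξ : 𝔼) : ‖cut s t ξ‖ ≤ 1 := by
  rw [cut, ← Complex.ofReal_sub, Complex.norm_real, Real.norm_eq_abs, abs_le]
  constructor <;> linarith [(unitBump n).nonneg (x := t⁻¹ • ξ), (unitBump n).nonneg (x := s⁻¹ • ξ),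
    (unitBump n).le_one (x := t⁻¹ • ξ), (unitBump n).le_one (x := s⁻¹ • ξ)]

lemma tsupport_cut_subset {s t : ℝ} (hs : 0 < s) (hst : s ≤ t) :
    tsupport (cut s t : 𝔼 → ℂ) ⊆ {ξ | s ≤ ‖ξ‖ ∧ ‖ξ‖ ≤ 2 * t} := by
  refine closure_minimal (fun ξ hξ => ⟨?_, ?_⟩) ?_
  · by_contra h
    exact hξ (cut_eq_zero_of_le hs hst (not_le.1 h).le)
  · by_contra h
    exact hξ (cut_eq_zero_of_ge hs hst (not_le.1 h).le)
  · exact (isClosed_le continuous_const continuous_norm).inter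
      (isClosed_le continuous_norm continuous_const)

lemma hasCompactSupport_cut {s t : ℝ} (hs : 0 < s) (hst : s ≤ t) :
    HasCompactSupport (cut s t : 𝔼 → ℂ) :=
  HasCompactSupport.of_support_subset_isCompact (isCompact_closedBall (0 : 𝔼) (2 * t))
    fun ξ hξ => by simpa using (tsupport_cut_subset hs hst (subset_tsupport _ hξ)).2

/-- The quantity |y|^i |∂^i| of the bump is bounded; evaluating at y = ξ/t and undoing the dilation
gives |ξ|^(-i), uniformly in t. -/
lemma exists_norm_iteratedFDeriv_unitBump_le (n M : ℕ) : ∃ C : ℝ, 0 ≤ C ∧ ∀ i ≤ M, ∀ t : ℝ, 0 < t →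
    ∀ ξ : EuclideanSpace ℝ (Fin n), ξ ≠ 0 →
      ‖iteratedFDeriv ℝ i (fun ξ => ((unitBump n (t⁻¹ • ξ) : ℝ) : ℂ)) ξ‖ ≤ C * (‖ξ‖⁻¹) ^ i := by
  have hcs : HasCompactSupport fun y => (unitBump n y : ℂ) :=
    (unitBump n).hasCompactSupport.comp_left (g := Complex.ofReal) rfl
  have hcd : ContDiff ℝ ∞ fun y => (unitBump n y : ℂ) :=
    Complex.ofRealCLM.contDiff.comp (unitBump n).contDiff
  have hdec := fun i => (hcs.toSchwartzMap hcd).decay i i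
  choose c hc0 hc using hdec
  refine ⟨∑ i ∈ Finset.range (M + 1), c i, Finset.sum_nonneg fun i _ => (hc0 i).le,
    fun i hi t ht ξ hξ => ?_⟩
  have hξ' : 0 < ‖ξ‖ := norm_pos_iff.2 hξ
  rw [iteratedFDeriv_comp_const_smul (f := fun y => (unitBump n y : ℂ)) t⁻¹
    (hcd.of_le (by exact_mod_cast le_top))]
  have h1 := hc i (t⁻¹ • ξ)
  rw [norm_smul, norm_inv, Real.norm_of_nonneg ht.le] at h1
  rw [norm_smul, norm_pow, norm_inv, Real.norm_of_nonneg ht.le]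
  calc _ = ((t⁻¹ * ‖ξ‖) ^ i * ‖iteratedFDeriv ℝ i (fun y => (unitBump n y : ℂ)) (t⁻¹ • ξ)‖) *
        (‖ξ‖⁻¹) ^ i := by
        rw [mul_pow, inv_pow ‖ξ‖]
        field_simp
    _ ≤ c i * (‖ξ‖⁻¹) ^ i := by
        gcongr
        exact h1
    _ ≤ _ := by
        gcongr
        exact Finset.single_le_sum (f := c) (fun i _ => (hc0 i).le) (by simp; omega)

lemma exists_norm_iteratedFDeriv_cut_le (n M : ℕ) : ∃ C : ℝ, 0 ≤ C ∧ ∀ i ≤ M, ∀ s t : ℝ, 0 < s →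
    0 < t → ∀ ξ : EuclideanSpace ℝ (Fin n), ξ ≠ 0 →
      ‖iteratedFDeriv ℝ i (cut s t) ξ‖ ≤ C * (‖ξ‖⁻¹) ^ i := by
  obtain ⟨C, hC, h⟩ := exists_norm_iteratedFDeriv_unitBump_le n M
  refine ⟨2 * C, by positivity, fun i hi s t hs ht ξ hξ => ?_⟩
  have hcd : ∀ t : ℝ, ContDiff ℝ i fun ξ => ((unitBump n (t⁻¹ • ξ) : ℝ) : ℂ) := fun t =>
    (Complex.ofRealCLM.contDiff (n := ∞).comp
      ((unitBump n).contDiff.comp (contDiff_const_smul _))).of_le (by exact_mod_cast le_top)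
  have := fun_iteratedFDeriv_sub_apply (hcd t).contDiffAt (hcd s).contDiffAt (x := ξ)
  unfold cut
  rw [this]
  calc _ ≤ _ := norm_sub_le _ _
    _ ≤ C * (‖ξ‖⁻¹) ^ i + C * (‖ξ‖⁻¹) ^ i := add_le_add (h i hi t ht ξ hξ) (h i hi s hs ξ hξ)
    _ = _ := by ring

end Cutoffs

/-! ### The estimate for one frequency band -/

section Pieces

/-- The operator with the Fourier multiplier `b u`. -/
noncomputable def mulOp (b : ℝ → 𝔼 → ℂ) (f : 𝔼 → ℂ) (u : ℝ) (x : 𝔼) : ℂ :=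
  𝓕⁻ (fun ξ => b u ξ * 𝓕 f ξ) x

lemma measurable_mulOp {b : ℝ → 𝔼 → ℂ} (hb : Measurable (Function.uncurry b)) {f : 𝔼 → ℂ}
    (hf : Integrable f) : Measurable (Function.uncurry (mulOp b f)) := by
  have h : Function.uncurry (mulOp b f) = fun p : ℝ × 𝔼 =>
      ∫ ξ, Complex.exp (((2 * Real.pi * inner ℝ ξ p.2 : ℝ) : ℂ) * Complex.I) • (b p.1 ξ * 𝓕 f ξ) := by
    ext ⟨u, x⟩
    simp only [Function.uncurry, mulOp, Real.fourierInv_eq']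
  rw [h]
  refine StronglyMeasurable.measurable (StronglyMeasurable.integral_prod_right
    (f := fun (p : ℝ × 𝔼) (ξ : 𝔼) => _) (Measurable.stronglyMeasurable ?_))
  have h1 : Measurable fun q : (ℝ × 𝔼) × 𝔼 => b q.1.1 q.2 :=
    hb.comp ((measurable_fst.comp measurable_fst).prodMk measurable_snd)
  have h2 : Measurable fun q : (ℝ × 𝔼) × 𝔼 => 𝓕 f q.2 :=
    (continuous_fourier hf).measurable.comp measurable_snd
  refine Measurable.smul (Measurable.cexp ?_) (h1.mul h2)
  refine Measurable.mul_const (Complex.measurable_ofReal.comp ?_) _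
  exact ((continuous_snd.inner (continuous_snd.comp continuous_fst)).measurable).const_mul _

variable {lam : ℝ}

lemma measurable_sym (ζ : ℂ) : Measurable (Function.uncurry (sym n lam ζ)) := by
  unfold sym phase Function.uncurry
  fun_prop

/-- The multiplier cut off to a dyadic range of frequencies. -/
noncomputable def symCut (n : ℕ) (lam : ℝ) (ζ : ℂ) (κ : EuclideanSpace ℝ (Fin n) → ℂ) (u : ℝ)
    (ξ : EuclideanSpace ℝ (Fin n)) : ℂ := sym n lam ζ u ξ * κ ξ

lemma measurable_symCut (ζ : ℂ) {κ : 𝔼 → ℂ} (hκ : Measurable κ) :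
    Measurable (Function.uncurry (symCut n lam ζ κ)) :=
  (measurable_sym ζ).mul (hκ.comp measurable_snd)

lemma contDiff_symCut (ζ : ℂ) (u : ℝ) {κ : 𝔼 → ℂ} (hκ : ContDiff ℝ ∞ κ) {s : ℝ} (hs : 0 < s)
    (h0 : ∀ ξ, ‖ξ‖ ≤ s → κ ξ = 0) : ContDiff ℝ ∞ (symCut n lam ζ κ u) := by
  rw [contDiff_iff_contDiffAt]
  intro ξ
  by_cases hξ : ξ = 0
  · subst hξ
    refine (contDiffAt_const (c := (0 : ℂ))).congr_of_eventuallyEq ?_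
    filter_upwards [Metric.closedBall_mem_nhds (0 : 𝔼) hs] with ξ hξ
    rw [symCut, h0 ξ (by simpa using hξ), mul_zero]
  · exact (((contDiffOn_sym ζ u).mul hκ.contDiffOn).contDiffAt (isOpen_compl_singleton.mem_nhds hξ))

/-- The cutoff with s, t is the truncation of the operator, the one with ρ₀, ρ₁ selects the band;
both are differentiated at the cost of the symbol. Here R is a spatial scale that must dominate the
cost of a derivative of the multiplier on the band and the cost of a moment of `f`, while D bounds
the decay factor and A the Fourier transform of `f` on the band. -/
lemma exists_mixedNorm_piece_le (hn : 1 ≤ n) (hlam : 1 < lam) (I : Set ℝ) (hI : Bornology.IsBounded I)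
    (hIm : MeasurableSet I) :
    ∃ C : ℝ, 0 ≤ C ∧ ∀ (ζ : ℂ) (s t ρ₀ ρ₁ D R r : ℝ) (A : ℝ≥0∞) (f : 𝔼 → ℂ), 0 < s → s ≤ t →
      0 < ρ₀ → ρ₀ ≤ ρ₁ → 0 < R → 0 ≤ D →
      (∀ x : 𝔼, ρ₀ ≤ ‖x‖ → ‖x‖ ≤ 2 * ρ₁ → (1 + ‖(2 * Real.pi) • x‖ ^ 2) ^ (-ζ.re / 2) ≤ D) →
      (∀ x : 𝔼, ρ₀ ≤ ‖x‖ → ‖x‖ ≤ 2 * ρ₁ → radius lam ‖x‖ ≤ R) →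
      Integrable f → (∀ x, r < ‖x‖ → f x = 0) →
      (∀ v : 𝔼, ‖v‖ ≤ 1 → ∀ i ≤ n, eLpNorm ({ξ : 𝔼 | ρ₀ ≤ ‖ξ‖ ∧ ‖ξ‖ ≤ 2 * ρ₁}.indicator
        (𝓕 ((coordMul v)^[i] f))) 2 ≤ A * ENNReal.ofReal R ^ i) →
      mixedNorm 1 I (mulOp (symCut n lam ζ (fun ξ => cut s t ξ * cut ρ₀ ρ₁ ξ)) f) ≤
        ENNReal.ofReal (C * (‖ζ‖ + n + 1) ^ n * D * R ^ ((n : ℝ) / 2)) * A := by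
  obtain ⟨U, hU⟩ := hI.exists_norm_le
  obtain ⟨C₁, hC₁, h₁⟩ := exists_norm_iteratedFDeriv_sym_le (lam := lam) n hlam U n
  obtain ⟨C₂, hC₂, h₂⟩ := exists_norm_iteratedFDeriv_cut_le n n
  obtain ⟨C₃, hC₃, h₃⟩ := exists_mixedNorm_one_le hn I hI.measure_lt_top.ne
  refine ⟨C₃ * (2 ^ n * (2 ^ n * C₁ * (2 ^ n * C₂ * C₂))), by positivity, ?_⟩
  intro ζ s t ρ₀ ρ₁ D R r A f hs hst hρ₀ hρ hR hD hW hrad hf hfr hA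
  have ht := hs.trans_le hst
  have hρ₁ := hρ₀.trans_le hρ
  set κ : 𝔼 → ℂ := fun ξ => cut s t ξ * cut ρ₀ ρ₁ ξ with hκ
  set S : Set 𝔼 := {ξ : 𝔼 | ρ₀ ≤ ‖ξ‖ ∧ ‖ξ‖ ≤ 2 * ρ₁} with hS
  set Dtot : ℝ := (2 ^ n * C₁ * (2 ^ n * C₂ * C₂)) * (‖ζ‖ + n + 1) ^ n * D with hDtot
  have hDtot0 : 0 ≤ Dtot := by positivity
  have hκc : ContDiff ℝ ∞ κ := (contDiff_cut s t).mul (contDiff_cut ρ₀ ρ₁)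
  have hb : ∀ u, ContDiff ℝ ∞ (symCut n lam ζ κ u) := fun u =>
    contDiff_symCut ζ u hκc hs fun ξ hξ => by
      simp only [hκ]
      rw [cut_eq_zero_of_le hs hst hξ, zero_mul]
  have hts : ∀ u, tsupport (symCut n lam ζ κ u) ⊆ tsupport (cut ρ₀ ρ₁ : 𝔼 → ℂ) := fun u =>
    (tsupport_mul_subset_right).trans tsupport_mul_subset_right
  have hbc : ∀ u, HasCompactSupport (symCut n lam ζ κ u) := fun u =>
    (hasCompactSupport_cut hρ₀ hρ).of_isClosed_subset (isClosed_tsupport _) (hts u)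
  have hbS : ∀ u, tsupport (symCut n lam ζ κ u) ⊆ S := fun u =>
    (hts u).trans (tsupport_cut_subset hρ₀ hρ)
  have hder : ∀ u ∈ I, ∀ i ≤ n, ∀ ξ, ‖iteratedFDeriv ℝ i (symCut n lam ζ κ u) ξ‖ ≤ Dtot * R ^ i := by
    intro u hu i hi ξ
    by_cases hξ : ξ ∈ S
    · have hξ0 : ξ ≠ 0 := fun h => by
        have := hξ.1
        rw [h, norm_zero] at this
        linarith
      have hξn : 0 < ‖ξ‖ := norm_pos_iff.2 hξ0
      have hrp := radius_pos (lam := lam) hξn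
      have ho : IsOpen ({0}ᶜ : Set 𝔼) := isOpen_compl_singleton
      have hcut : ∀ a b : ℝ, 0 < a → 0 < b → ∀ i ≤ n, ‖iteratedFDeriv ℝ i (cut a b) ξ‖ ≤
          C₂ * radius lam ‖ξ‖ ^ i := fun a b ha hb i hi => by
        refine (h₂ i hi a b ha hb ξ hξ0).trans ?_
        gcongr
        exact inv_le_radius _
      have hκd := norm_iteratedFDeriv_mul_le_of_le ho (contDiff_cut s t).contDiffOn
        (contDiff_cut ρ₀ ρ₁).contDiffOn hξ0 hrp.le hC₂ (hcut s t hs ht) (hcut ρ₀ ρ₁ hρ₀ hρ₁)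
      have hfin := norm_iteratedFDeriv_mul_le_of_le ho (contDiffOn_sym ζ u) hκc.contDiffOn hξ0
        hrp.le (by positivity) (h₁ ζ u (hU u hu) ξ hξ0) hκd i hi
      refine hfin.trans ?_
      calc _ = ((2 ^ n * C₁ * (2 ^ n * C₂ * C₂)) * (‖ζ‖ + n + 1) ^ n *
            (1 + ‖(2 * Real.pi) • ξ‖ ^ 2) ^ (-ζ.re / 2)) * radius lam ‖ξ‖ ^ i := by ring
        _ ≤ _ := by
          rw [hDtot]
          gcongr
          · exact hW ξ hξ.1 hξ.2
          · exact hrad ξ hξ.1 hξ.2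
    · have : ξ ∉ tsupport (symCut n lam ζ κ u) := fun h => hξ (hbS u h)
      have h0 : iteratedFDeriv ℝ i (symCut n lam ζ κ u) ξ = 0 := by
        by_contra hne
        exact this (support_iteratedFDeriv_subset i hne)
      rw [h0, norm_zero]
      positivity
  have hmeas := measurable_mulOp (measurable_symCut (lam := lam) ζ hκc.continuous.measurable) hf
  have hcont : ∀ u, Continuous (mulOp (symCut n lam ζ κ) f u) := fun u =>
    continuous_fourierInv (integrable_mul_fourier (hb u).continuous (hbc u) hf)
  refine (h₃ _ hmeas hcont R hR (2 ^ n * ENNReal.ofReal Dtot * A) ?_ ?_).trans (le_of_eq ?_)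
  · filter_upwards [ae_restrict_mem hIm] with u hu
    -- The unweighted bound is the case of no coordinate factors; the direction is then irrelevant.
    have := eLpNorm_iterate_coordMul_fourierInv_le (v := (0 : 𝔼)) (by simp) hR.le 0 (hb u) (hbc u)
      (hbS u) hf hfr hDtot0 (fun i hi => hder u hu i (by omega))
      (fun i hi => hA 0 (by simp) i (by omega))
    simp only [Function.iterate_zero, id_eq, pow_zero, one_mul, mul_one] at this
    refine this.trans ?_
    gcongr
    exact le_mul_of_one_le_left (zero_le) (one_le_pow₀ (by norm_num))
  · filter_upwards [ae_restrict_mem hIm] with u hu i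
    exact eLpNorm_iterate_coordMul_fourierInv_le (v := EuclideanSpace.single i 1) (by simp)
      hR.le n (hb u) (hbc u) (hbS u) hf hfr hDtot0 (hder u hu) (hA _ (by simp))
  · rw [← mul_assoc, ← mul_assoc, show (2 : ℝ≥0∞) ^ n = ENNReal.ofReal (2 ^ n) by
      rw [ENNReal.ofReal_pow (by norm_num)]; simp, ← ENNReal.ofReal_mul (by positivity),
      ← ENNReal.ofReal_mul (by positivity)]
    congr 2
    rw [hDtot]
    ring

end Pieces
end SquareFunction

namespace SquareFunction

open scoped ContDiff

variable {n : ℕ}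

local notation "𝔼" => EuclideanSpace ℝ (Fin n)

/-! ### Fourier transforms of atoms and of their moments -/

section AtomFourier

/-- The volume of the unit ball. -/
noncomputable def ballVol (n : ℕ) : ℝ :=
  (volume (Metric.ball (0 : EuclideanSpace ℝ (Fin n)) 1)).toReal

lemma ballVol_nonneg (n : ℕ) : 0 ≤ ballVol n := ENNReal.toReal_nonneg

lemma volume_closedBall_eq (x : 𝔼) {r : ℝ} (hr : 0 ≤ r) :
    volume (Metric.closedBall x r) = ENNReal.ofReal (ballVol n * r ^ n) := by
  rw [Measure.addHaar_closedBall _ _ hr, ballVol, mul_comm, ENNReal.ofReal_mul ENNReal.toReal_nonneg,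
    ENNReal.ofReal_toReal (measure_ball_lt_top).ne]
  simp

/-- A pointwise defined `H¹` atom centered at the origin. -/
structure IsCenteredAtom (r : ℝ) (f : 𝔼 → ℂ) : Prop where
  pos : 0 < r
  meas : AEStronglyMeasurable f
  supp : ∀ x, r < ‖x‖ → f x = 0
  bound : ∀ x, ‖f x‖ ≤ (r ^ n)⁻¹
  mean : ∫ x, f x = 0

variable {r : ℝ} {f : EuclideanSpace ℝ (Fin n) → ℂ}

lemma norm_iterate_coordMul_le (hr : 0 < r) (hsupp : ∀ x, r < ‖x‖ → f x = 0)
    (hb : ∀ x, ‖f x‖ ≤ (r ^ n)⁻¹) {v : 𝔼} (hv : ‖v‖ ≤ 1) (i : ℕ) (x : 𝔼) :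
    ‖(coordMul v)^[i] f x‖ ≤ (Metric.closedBall (0 : 𝔼) r).indicator
      (fun _ => (2 * Real.pi * r) ^ i * (r ^ n)⁻¹) x := by
  rw [norm_iterate_coordMul]
  by_cases hx : ‖x‖ ≤ r
  · rw [Set.indicator_of_mem (by simpa using hx)]
    have h1 : |inner ℝ x v| ≤ r := by
      calc _ ≤ ‖x‖ * ‖v‖ := abs_real_inner_le_norm x v
        _ ≤ r * 1 := by gcongr
        _ = r := mul_one r
    gcongr
    exact hb x
  · rw [hsupp x (not_le.1 hx), norm_zero, mul_zero, Set.indicator_of_notMem (by simpa using hx)]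

lemma aestronglyMeasurable_iterate_coordMul (hf : AEStronglyMeasurable f) (v : 𝔼) (i : ℕ) :
    AEStronglyMeasurable ((coordMul v)^[i] f) := by
  induction i generalizing f with
  | zero => exact hf
  | succ i ih =>
    rw [Function.iterate_succ_apply]
    refine ih (AEStronglyMeasurable.mul ?_ hf)
    exact (continuous_const.mul (Complex.continuous_ofReal.comp
      (continuous_id.inner continuous_const))).aestronglyMeasurable

lemma memLp_indicator_closedBall (r c : ℝ) (p : ℝ≥0∞) :
    MemLp ((Metric.closedBall (0 : 𝔼) r).indicator fun _ => c) p :=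
  memLp_indicator_const p measurableSet_closedBall c (Or.inr measure_closedBall_lt_top.ne)

lemma IsCenteredAtom.memLp_iterate (hf : IsCenteredAtom r f) {v : 𝔼} (hv : ‖v‖ ≤ 1) (i : ℕ)
    (p : ℝ≥0∞) : MemLp ((coordMul v)^[i] f) p :=
  (memLp_indicator_closedBall r _ p).mono' (aestronglyMeasurable_iterate_coordMul hf.meas v i)
    (Filter.Eventually.of_forall (norm_iterate_coordMul_le hf.pos hf.supp hf.bound hv i))

lemma IsCenteredAtom.integrable (hf : IsCenteredAtom r f) : Integrable f := by
  simpa using memLp_one_iff_integrable.1 (hf.memLp_iterate (v := 0) (by simp) 0 1)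

lemma eLpNorm_indicator_le (S : Set 𝔼) (g : 𝔼 → ℂ) (p : ℝ≥0∞) :
    eLpNorm (S.indicator g) p ≤ eLpNorm g p :=
  eLpNorm_mono fun x => by
    by_cases hx : x ∈ S
    · simp [hx]
    · simp [hx]

lemma ofReal_rpow_half {a : ℝ} (ha : 0 ≤ a) :
    (ENNReal.ofReal a) ^ (1 / (2 : ℝ≥0∞).toReal) = ENNReal.ofReal (√a) := by
  rw [ENNReal.ofReal_rpow_of_nonneg ha (by simp), Real.sqrt_eq_rpow]
  norm_num

lemma eLpNorm_indicator_closedBall {r c : ℝ} (hr : 0 ≤ r) (hc : 0 ≤ c) :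
    eLpNorm ((Metric.closedBall (0 : 𝔼) r).indicator (fun _ => c)) 2 =
      ENNReal.ofReal (c * (√(ballVol n) * r ^ ((n : ℝ) / 2))) := by
  rw [eLpNorm_indicator_const measurableSet_closedBall (by norm_num) (by norm_num),
    volume_closedBall_eq _ hr, ofReal_rpow_half (mul_nonneg (ballVol_nonneg n) (by positivity)),
    Real.enorm_of_nonneg hc, ← ENNReal.ofReal_mul hc, Real.sqrt_mul (ballVol_nonneg n)]
  have h1 : √(r ^ n) = r ^ ((n : ℝ) / 2) := by
    rw [Real.sqrt_eq_rpow, ← Real.rpow_natCast, ← Real.rpow_mul hr]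
    ring_nf
  rw [h1]

/-- The `L²` bound for the moments of an atom. -/
lemma IsCenteredAtom.eLpNorm_fourier_iterate_le (hf : IsCenteredAtom r f) (S : Set 𝔼) {v : 𝔼}
    (hv : ‖v‖ ≤ 1) {R : ℝ} (hR : 2 * Real.pi * r ≤ R) (i : ℕ) :
    eLpNorm (S.indicator (𝓕 ((coordMul v)^[i] f))) 2 ≤
      ENNReal.ofReal (√(ballVol n) * r ^ (-(n : ℝ) / 2)) * ENNReal.ofReal R ^ i := by
  have hr := hf.pos
  have hR0 : 0 ≤ R := le_trans (by positivity) hR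
  refine (eLpNorm_indicator_le _ _ _).trans ?_
  rw [eLpNorm_fourier (memLp_one_iff_integrable.1 (hf.memLp_iterate hv i 1))
    (hf.memLp_iterate hv i 2)]
  have e1 : eLpNorm ((coordMul v)^[i] f) 2 ≤ eLpNorm ((Metric.closedBall (0 : 𝔼) r).indicator
      (fun _ => (2 * Real.pi * r) ^ i * (r ^ n)⁻¹)) 2 :=
    eLpNorm_mono_real (norm_iterate_coordMul_le hr hf.supp hf.bound hv i)
  have e2 := eLpNorm_indicator_closedBall (n := n) hr.le
    (c := (2 * Real.pi * r) ^ i * (r ^ n)⁻¹) (by positivity)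
  refine e1.trans (e2.le.trans ?_)
  rw [← ENNReal.ofReal_pow hR0, ← ENNReal.ofReal_mul (by positivity)]
  refine ENNReal.ofReal_le_ofReal ?_
  have h2 : (r ^ n)⁻¹ * r ^ ((n : ℝ) / 2) = r ^ (-(n : ℝ) / 2) := by
    rw [← Real.rpow_natCast, ← Real.rpow_neg hr.le, ← Real.rpow_add hr]
    ring_nf
  rw [show (2 * Real.pi * r) ^ i * (r ^ n)⁻¹ * (√(ballVol n) * r ^ ((n : ℝ) / 2)) =
    √(ballVol n) * ((r ^ n)⁻¹ * r ^ ((n : ℝ) / 2)) * (2 * Real.pi * r) ^ i by ring, h2]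
  gcongr

lemma norm_fourierChar_sub_one_le (x ξ : 𝔼) :
    ‖Complex.exp (((-2 * Real.pi * inner ℝ x ξ : ℝ) : ℂ) * Complex.I) - 1‖ ≤
      2 * Real.pi * ‖x‖ * ‖ξ‖ := by
  have h := Real.norm_exp_I_mul_ofReal_sub_one_le (x := -2 * Real.pi * inner ℝ x ξ)
  rw [mul_comm]
  refine h.trans ?_
  rw [Real.norm_eq_abs, abs_mul, abs_mul, abs_of_pos Real.pi_pos]
  have := abs_real_inner_le_norm x ξ
  norm_num
  calc _ ≤ 2 * Real.pi * (‖x‖ * ‖ξ‖) := by gcongr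
    _ = _ := by ring

/-- Since the mean is zero, 1 may be subtracted from the character, and the difference is at most
2π|x||ξ| with |x| ≤ r. The mass of the atom is at most the volume of the unit ball. -/
lemma IsCenteredAtom.norm_fourier_le (hf : IsCenteredAtom r f) (ξ : 𝔼) :
    ‖𝓕 f ξ‖ ≤ 2 * Real.pi * r * ‖ξ‖ * ballVol n := by
  have hr := hf.pos
  have hi : Integrable fun x => Complex.exp (((-2 * Real.pi * inner ℝ x ξ : ℝ) : ℂ) * Complex.I) • f x := by
    have := (Real.fourierIntegral_convergent_iff (μ := volume) (f := f) ξ).2 hf.integrable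
    refine this.congr (Filter.Eventually.of_forall fun x => ?_)
    simp only [Circle.smul_def, Real.fourierChar_apply, smul_eq_mul]
    congr 3
    push_cast
    ring
  have h1 : 𝓕 f ξ = ∫ x, (Complex.exp (((-2 * Real.pi * inner ℝ x ξ : ℝ) : ℂ) * Complex.I) - 1) * f x := by
    rw [Real.fourier_eq']
    simp_rw [sub_mul, one_mul]
    rw [integral_sub (by simpa using hi) hf.integrable, hf.mean, sub_zero]
    simp
  rw [h1]
  calc _ ≤ ∫ x, (Metric.closedBall (0 : 𝔼) r).indicator
        (fun _ => 2 * Real.pi * r * ‖ξ‖ * (r ^ n)⁻¹) x := by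
        refine norm_integral_le_of_norm_le
          ((memLp_one_iff_integrable).1 (memLp_indicator_closedBall r _ 1))
          (Filter.Eventually.of_forall fun x => ?_)
        by_cases hx : ‖x‖ ≤ r
        · rw [Set.indicator_of_mem (by simpa using hx), norm_mul]
          have := norm_fourierChar_sub_one_le x ξ
          gcongr
          · exact this.trans (by gcongr)
          · exact hf.bound x
        · rw [hf.supp x (not_le.1 hx), mul_zero, norm_zero,
            Set.indicator_of_notMem (by simpa using hx)]
    _ = _ := by
        rw [integral_indicator_const _ measurableSet_closedBall, measureReal_def,
          volume_closedBall_eq _ hr.le,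
          ENNReal.toReal_ofReal (mul_nonneg (ballVol_nonneg n) (by positivity)), smul_eq_mul]
        field_simp

/-- The cancellation of an atom at low frequencies. -/
lemma IsCenteredAtom.eLpNorm_fourier_iterate_le_of_subset (hf : IsCenteredAtom r f) {S : Set 𝔼}
    {ρ : ℝ} (hρ : 0 < ρ) (hS : ∀ ξ ∈ S, ‖ξ‖ ≤ ρ) {v : 𝔼}
    (hv : ‖v‖ ≤ 1) {R : ℝ} (hR : 2 * Real.pi * r ≤ R) (hρR : 1 ≤ ρ * R) (i : ℕ) :
    eLpNorm (S.indicator (𝓕 ((coordMul v)^[i] f))) 2 ≤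
      ENNReal.ofReal (2 * Real.pi * r * ρ * ballVol n * (√(ballVol n) * ρ ^ ((n : ℝ) / 2))) *
        ENNReal.ofReal R ^ i := by
  have hr := hf.pos
  have hV := ballVol_nonneg n
  have hR0 : 0 ≤ R := le_trans (by positivity) hR
  have hpt : ∀ ξ, ‖S.indicator (𝓕 ((coordMul v)^[i] f)) ξ‖ ≤ (Metric.closedBall (0 : 𝔼) ρ).indicator
      (fun _ => 2 * Real.pi * r * ρ * ballVol n * R ^ i) ξ := by
    intro ξ
    by_cases hξ : ξ ∈ S
    · rw [Set.indicator_of_mem hξ, Set.indicator_of_mem (by simpa using hS ξ hξ)]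
      cases i with
      | zero =>
        simp only [Function.iterate_zero, id_eq, pow_zero, mul_one]
        refine (hf.norm_fourier_le ξ).trans ?_
        gcongr
        exact hS ξ hξ
      | succ i =>
        -- A moment of positive order has no cancellation. One of its factors 2πr is enlarged to 2πr
        -- · ρR, using 1 ≤ ρR, which supplies the same gain rρ; the other factors 2πr are at most R.
        refine (SquareFunction.norm_fourier_le _ _).trans ?_
        calc _ ≤ ∫ x, (Metric.closedBall (0 : 𝔼) r).indicator
              (fun _ => (2 * Real.pi * r) ^ (i + 1) * (r ^ n)⁻¹) x := by
              refine integral_mono_of_nonneg (Filter.Eventually.of_forall fun x => norm_nonneg _)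
                ((memLp_one_iff_integrable).1 (memLp_indicator_closedBall r _ 1))
                (Filter.Eventually.of_forall
                  (norm_iterate_coordMul_le hr hf.supp hf.bound hv (i + 1)))
          _ = (2 * Real.pi * r) ^ (i + 1) * ballVol n := by
              rw [integral_indicator_const _ measurableSet_closedBall, measureReal_def,
                volume_closedBall_eq _ hr.le,
                ENNReal.toReal_ofReal (mul_nonneg hV (by positivity)), smul_eq_mul]
              field_simp
          _ = (2 * Real.pi * r * 1) * (2 * Real.pi * r) ^ i * ballVol n := by ring
          _ ≤ (2 * Real.pi * r * (ρ * R)) * R ^ i * ballVol n := by gcongr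
          _ = _ := by ring
    · rw [Set.indicator_of_notMem hξ, norm_zero]
      exact Set.indicator_nonneg (fun _ _ => by positivity) _
  have e1 : eLpNorm (S.indicator (𝓕 ((coordMul v)^[i] f))) 2 ≤
      eLpNorm ((Metric.closedBall (0 : 𝔼) ρ).indicator
      (fun _ => 2 * Real.pi * r * ρ * ballVol n * R ^ i)) 2 := eLpNorm_mono_real hpt
  have e2 := eLpNorm_indicator_closedBall (n := n) hρ.le
    (c := 2 * Real.pi * r * ρ * ballVol n * R ^ i) (by positivity)
  refine e1.trans (e2.le.trans ?_)
  rw [← ENNReal.ofReal_pow hR0, ← ENNReal.ofReal_mul (by positivity)]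
  refine ENNReal.ofReal_le_ofReal (le_of_eq ?_)
  ring

end AtomFourier
end SquareFunction

namespace SquareFunction

open scoped ContDiff

variable {n : ℕ} {lam : ℝ}

local notation "𝔼" => EuclideanSpace ℝ (Fin n)

/-! ### The truncated operator on a centered atom: low, middle and high frequencies -/

section AtomEstimate

lemma lintegral_L2_add_le {α : Type*} [MeasurableSpace α] (μ : Measure α) {F G : α → ℂ}
    (hF : AEStronglyMeasurable F μ) (hG : AEStronglyMeasurable G μ) :
    (∫⁻ u, ‖F u + G u‖ₑ ^ 2 ∂μ) ^ (1 / 2 : ℝ) ≤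
      (∫⁻ u, ‖F u‖ₑ ^ 2 ∂μ) ^ (1 / 2 : ℝ) + (∫⁻ u, ‖G u‖ₑ ^ 2 ∂μ) ^ (1 / 2 : ℝ) := by
  have h := eLpNorm_add_le hF hG (p := 2) one_le_two
  simp only [eLpNorm_eq_lintegral_rpow_enorm_toReal two_ne_zero ENNReal.ofNat_ne_top,
    ENNReal.toReal_ofNat, ENNReal.rpow_ofNat, Pi.add_apply] at h
  exact h

lemma mixedNorm_one_add_le (I : Set ℝ) {F G : ℝ → 𝔼 → ℂ} (hF : Measurable (Function.uncurry F))
    (hG : Measurable (Function.uncurry G)) :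
    mixedNorm 1 I (fun u x => F u x + G u x) ≤ mixedNorm 1 I F + mixedNorm 1 I G := by
  simp only [mixedNorm_one]
  have hm : Measurable fun x : 𝔼 => (∫⁻ u in I, ‖F u x‖ₑ ^ 2) ^ (1 / 2 : ℝ) :=
    (((hF.comp measurable_swap).enorm.pow_const 2).lintegral_prod_right').pow_const _
  rw [← lintegral_add_left hm]
  refine lintegral_mono fun x => lintegral_L2_add_le _ ?_ ?_
  · exact (hF.comp (measurable_id.prodMk measurable_const)).aestronglyMeasurable
  · exact (hG.comp (measurable_id.prodMk measurable_const)).aestronglyMeasurable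

/-- The part of the operator with frequencies between `a` and `b`. -/
noncomputable def bandNorm (n : ℕ) (lam : ℝ) (I : Set ℝ) (ζ : ℂ) (s t : ℝ)
    (f : EuclideanSpace ℝ (Fin n) → ℂ) (a b : ℝ) : ℝ≥0∞ :=
  mixedNorm 1 I (mulOp (symCut n lam ζ (fun ξ => cut s t ξ * cut a b ξ)) f)

lemma continuous_symCut_cut (ζ : ℂ) (u : ℝ) {s t : ℝ} (hs : 0 < s) (hst : s ≤ t) {η : 𝔼 → ℂ}
    (hη : ContDiff ℝ ∞ η) : Continuous (symCut n lam ζ (fun ξ => cut s t ξ * η ξ) u) :=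
  (contDiff_symCut ζ u ((contDiff_cut s t).mul hη) hs fun ξ h => by
    rw [cut_eq_zero_of_le hs hst h, zero_mul]).continuous

lemma hasCompactSupport_symCut_cut (ζ : ℂ) (u : ℝ) {s t : ℝ} (hs : 0 < s) (hst : s ≤ t)
    (η : 𝔼 → ℂ) : HasCompactSupport (symCut n lam ζ (fun ξ => cut s t ξ * η ξ) u) :=
  ((hasCompactSupport_cut hs hst).mul_right).mul_left

lemma fourierInv_add' {f g : 𝔼 → ℂ} (hf : Integrable f) (hg : Integrable g) (x : 𝔼) :
    𝓕⁻ (fun ξ => f ξ + g ξ) x = 𝓕⁻ f x + 𝓕⁻ g x := by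
  simp only [Real.fourierInv_eq]
  rw [← integral_add]
  · simp [smul_add]
  · simpa using (Real.fourierIntegral_convergent_iff (-x)).2 hf
  · simpa using (Real.fourierIntegral_convergent_iff (-x)).2 hg

lemma bandNorm_le_add {I : Set ℝ} (ζ : ℂ) {s t : ℝ} (hs : 0 < s) (hst : s ≤ t) {f : 𝔼 → ℂ}
    (hf : Integrable f) (a b c : ℝ) :
    bandNorm n lam I ζ s t f a c ≤ bandNorm n lam I ζ s t f a b + bandNorm n lam I ζ s t f b c := by
  have hm : ∀ a b : ℝ, Measurable (Function.uncurry
      (mulOp (symCut n lam ζ (fun ξ => cut s t ξ * cut a b ξ)) f)) := fun a b =>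
    measurable_mulOp (measurable_symCut ζ
      ((contDiff_cut s t).mul (contDiff_cut a b)).continuous.measurable) hf
  have heq : mulOp (symCut n lam ζ (fun ξ => cut s t ξ * cut a c ξ)) f = fun u x =>
      mulOp (symCut n lam ζ (fun ξ => cut s t ξ * cut a b ξ)) f u x +
        mulOp (symCut n lam ζ (fun ξ => cut s t ξ * cut b c ξ)) f u x := by
    ext u x
    have hfun : (fun ξ => symCut n lam ζ (fun ξ => cut s t ξ * cut a c ξ) u ξ * 𝓕 f ξ) = fun ξ =>
        symCut n lam ζ (fun ξ => cut s t ξ * cut a b ξ) u ξ * 𝓕 f ξ +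
          symCut n lam ζ (fun ξ => cut s t ξ * cut b c ξ) u ξ * 𝓕 f ξ := by
      ext ξ
      simp only [symCut]
      rw [← cut_add_cut a b c]
      ring
    simp only [mulOp]
    rw [hfun, fourierInv_add']
    · exact integrable_mul_fourier (continuous_symCut_cut ζ u hs hst (contDiff_cut _ _))
        (hasCompactSupport_symCut_cut ζ u hs hst _) hf
    · exact integrable_mul_fourier (continuous_symCut_cut ζ u hs hst (contDiff_cut _ _))
        (hasCompactSupport_symCut_cut ζ u hs hst _) hf
  rw [bandNorm, heq]
  exact mixedNorm_one_add_le I (hm a b) (hm b c)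

lemma bandNorm_self (I : Set ℝ) (ζ : ℂ) (s t : ℝ) (f : 𝔼 → ℂ) (a : ℝ) :
    bandNorm n lam I ζ s t f a a = 0 := by
  have : mulOp (symCut n lam ζ (fun ξ => cut s t ξ * cut a a ξ)) f = fun _ _ => 0 := by
    ext u x
    simp [mulOp, symCut, cut, Real.fourierInv_eq]
  rw [bandNorm, this, mixedNorm_one]
  simp

/-- A wide enough band contains the support of the truncation, on which the second cutoff is 1. -/
lemma bandNorm_eq_of_le (I : Set ℝ) (ζ : ℂ) {s t : ℝ} (hs : 0 < s) (hst : s ≤ t) (f : 𝔼 → ℂ)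
    {a b : ℝ} (ha : 0 < a) (has : 2 * a ≤ s) (hb : 2 * t ≤ b) :
    bandNorm n lam I ζ s t f a b = mixedNorm 1 I (mulOp (symCut n lam ζ (cut s t)) f) := by
  have ht := hs.trans_le hst
  have : (fun ξ : 𝔼 => cut s t ξ * cut a b ξ) = cut s t := by
    ext ξ
    by_cases h1 : ‖ξ‖ ≤ s
    · rw [cut_eq_zero_of_le hs hst h1, zero_mul]
    · by_cases h2 : 2 * t ≤ ‖ξ‖
      · rw [cut_eq_zero_of_ge hs hst h2, zero_mul]
      · rw [cut_eq_one ha (by linarith) (by linarith) (by linarith), mul_one]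
  rw [bandNorm, this]

lemma radius_le_of_mem {ρ y : ℝ} (hlam : 1 < lam) (hρ : 0 < ρ) (h1 : ρ ≤ y) (h2 : y ≤ 4 * ρ) :
    radius lam y ≤ 4 ^ lam * radius lam ρ := by
  have hy := hρ.trans_le h1
  have h4 : (1 : ℝ) ≤ 4 ^ lam := Real.one_le_rpow (by norm_num) (by linarith)
  have h4' : (4 : ℝ) ^ (lam - 1) ≤ 4 ^ lam :=
    Real.rpow_le_rpow_of_exponent_le (by norm_num) (by linarith)
  refine max_le ?_ ?_
  · calc y⁻¹ ≤ ρ⁻¹ := by gcongr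
      _ ≤ 1 * radius lam ρ := by rw [one_mul]; exact inv_le_radius ρ
      _ ≤ _ := by have := radius_pos (lam := lam) hρ; gcongr
  · calc y ^ (lam - 1) ≤ (4 * ρ) ^ (lam - 1) :=
          Real.rpow_le_rpow hy.le h2 (by linarith)
      _ = 4 ^ (lam - 1) * ρ ^ (lam - 1) := Real.mul_rpow (by norm_num) hρ.le
      _ ≤ _ := by
          have := radius_pos (lam := lam) hρ
          gcongr
          exact le_max_right _ _

lemma weight_le {ρ β : ℝ} (hβ : 0 ≤ β) (hρ : 0 ≤ ρ) {x : 𝔼} (h1 : ρ ≤ ‖x‖) :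
    (1 + ‖(2 * Real.pi) • x‖ ^ 2) ^ (-β / 2) ≤ (1 + ρ ^ 2) ^ (-β / 2) := by
  refine Real.rpow_le_rpow_of_nonpos (by positivity) ?_ (by linarith)
  have h2 : ‖x‖ ≤ ‖(2 * Real.pi) • x‖ := by
    rw [norm_two_pi_smul]
    nlinarith [Real.pi_gt_three, norm_nonneg x]
  gcongr
  exact h1.trans h2

/-- The balance of sizes at the critical order `nλ/2`. -/
lemma low_balance (hlam : 1 < lam) {ρ : ℝ} (hρ : 0 < ρ) :
    (1 + ρ ^ 2) ^ (-(n * lam / 2) / 2) * (radius lam ρ ^ ((n : ℝ) / 2) * ρ ^ ((n : ℝ) / 2)) ≤ 1 := by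
  have hR := radius_pos (lam := lam) hρ
  have hn : (0 : ℝ) ≤ n := Nat.cast_nonneg n
  rw [← Real.mul_rpow hR.le hρ.le]
  -- For ρ ≤ 1 the radius is ρ⁻¹ and the product with ρ is 1. For ρ > 1 it is ρ^(λ-1), the product
  -- is ρ^λ, and the decay of order nλ/2 cancels its power n/2 exactly.
  rcases le_or_gt ρ 1 with h | h
  · have h1 : radius lam ρ * ρ = 1 := by
      have : radius lam ρ = ρ⁻¹ := max_eq_left
        ((Real.rpow_le_one hρ.le h (by linarith)).trans ((one_le_inv₀ hρ).2 h))
      rw [this, inv_mul_cancel₀ hρ.ne']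
    rw [h1, Real.one_rpow, mul_one]
    refine Real.rpow_le_one_of_one_le_of_nonpos (by nlinarith) ?_
    have : 0 ≤ n * lam := by positivity
    linarith
  · have h1 : radius lam ρ * ρ = ρ ^ lam := by
      have : radius lam ρ = ρ ^ (lam - 1) := max_eq_right
        ((inv_le_one_of_one_le₀ h.le).trans (Real.one_le_rpow h.le (by linarith)))
      rw [this, Real.rpow_sub_one hρ.ne', div_mul_cancel₀ _ hρ.ne']
    have h2 : (1 + ρ ^ 2) ^ (-(n * lam / 2) / 2) ≤ (ρ ^ 2) ^ (-(n * lam / 2) / 2) := by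
      refine Real.rpow_le_rpow_of_nonpos (by positivity) (by linarith) ?_
      have : 0 ≤ n * lam := by positivity
      linarith
    rw [h1]
    calc _ ≤ (ρ ^ 2) ^ (-(n * lam / 2) / 2) * (ρ ^ lam) ^ ((n : ℝ) / 2) := by gcongr
      _ = 1 := by
        rw [← Real.rpow_natCast ρ 2, ← Real.rpow_mul hρ.le, ← Real.rpow_mul hρ.le,
          ← Real.rpow_add hρ]
        rw [show ((2 : ℕ) : ℝ) * (-(n * lam / 2) / 2) + lam * (n / 2) = 0 by push_cast; ring,
          Real.rpow_zero]

/-- The critical order of the multiplier on the line `re = nλ/2`. -/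
noncomputable def critExp (n : ℕ) (lam γ : ℝ) : ℂ := ((n * lam / 2 : ℝ) : ℂ) + (γ : ℂ) * Complex.I

lemma critExp_re (n : ℕ) (lam γ : ℝ) : (critExp n lam γ).re = n * lam / 2 := by
  simp [critExp]

variable (n) in
-- By cancellation the transform of the atom is O(ρr) on the band, so its L² norm there is O(ρr ·
-- ρ^(n/2)). The spreading cost and the decay of the symbol compensate ρ^(n/2) by `low_balance`.
-- What is left sums geometrically as ρ decreases from 1/r.
lemma exists_bandNorm_low_le (hn : 1 ≤ n) (hlam : 1 < lam) (I : Set ℝ)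
    (hI : Bornology.IsBounded I) (hIm : MeasurableSet I) :
    ∃ C : ℝ, 0 ≤ C ∧ ∀ (γ s t r ρ : ℝ) (f : EuclideanSpace ℝ (Fin n) → ℂ), 0 < s → s ≤ t → 0 < ρ →
      ρ * r ≤ 1 → IsCenteredAtom r f →
      bandNorm n lam I (critExp n lam γ) s t f ρ (2 * ρ) ≤
        ENNReal.ofReal (C * (‖critExp n lam γ‖ + n + 1) ^ n * (ρ * r)) := by
  obtain ⟨C, hC, h⟩ := exists_mixedNorm_piece_le hn hlam I hI hIm
  -- The first summand compares the radius on ρ ≤ |ξ| ≤ 4ρ with that at ρ; the second makes the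
  -- scale dominate 2πr, because r ≤ ρ⁻¹ ≤ `radius lam ρ`.
  set K : ℝ := 4 ^ lam + 2 * Real.pi with hK
  have hKpos : 0 < K := by positivity
  set c : ℝ := 2 * Real.pi * 4 * ballVol n * (√(ballVol n) * 4 ^ ((n : ℝ) / 2)) with hc
  have hV := ballVol_nonneg n
  refine ⟨C * K ^ ((n : ℝ) / 2) * c, by positivity, fun γ s t r ρ f hs hst hρ hρr hf => ?_⟩
  set Z : ℝ := (‖critExp n lam γ‖ + n + 1) ^ n with hZ
  have hZ0 : 0 ≤ Z := by positivity
  have hr := hf.pos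
  have hrad := radius_pos (lam := lam) hρ
  have hrρ : r ≤ ρ⁻¹ := by rw [← one_div, le_div_iff₀ hρ]; linarith
  have h1 := h (critExp n lam γ) s t ρ (2 * ρ) ((1 + ρ ^ 2) ^ (-(n * lam / 2) / 2))
    (K * radius lam ρ) r
    (ENNReal.ofReal (2 * Real.pi * r * (4 * ρ) * ballVol n *
      (√(ballVol n) * (4 * ρ) ^ ((n : ℝ) / 2)))) f hs hst hρ (by linarith) (by positivity)
    (by positivity) (fun x hx _ => by rw [critExp_re]; exact weight_le (by positivity) hρ.le hx)
    (fun x hx hx' => by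
      refine (radius_le_of_mem hlam hρ hx (by linarith)).trans ?_
      gcongr
      rw [hK]; linarith [Real.pi_pos]) hf.integrable hf.supp
    (fun v hv i _ => hf.eLpNorm_fourier_iterate_le_of_subset (by positivity)
      (fun ξ hξ => by have := hξ.2; linarith) hv
      (by
        have h3 : r ≤ radius lam ρ := hrρ.trans (inv_le_radius ρ)
        have h4 : (0 : ℝ) ≤ 4 ^ lam := by positivity
        rw [hK]
        nlinarith [Real.pi_pos])
      (by
        have h3 : 1 ≤ ρ * radius lam ρ := by
          calc 1 = ρ * ρ⁻¹ := (mul_inv_cancel₀ hρ.ne').symm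
            _ ≤ _ := by gcongr; exact inv_le_radius ρ
        have h4 : 1 ≤ K := by
          have : (0 : ℝ) ≤ 4 ^ lam := by positivity
          rw [hK]; linarith [Real.pi_gt_three]
        calc (1 : ℝ) ≤ 1 * 1 := by norm_num
          _ ≤ (4 * K) * (ρ * radius lam ρ) := by
            gcongr
            linarith
          _ = _ := by ring) i)
  refine h1.trans ?_
  rw [← ENNReal.ofReal_mul (by positivity)]
  refine ENNReal.ofReal_le_ofReal ?_
  rw [Real.mul_rpow hKpos.le hrad.le, Real.mul_rpow (by norm_num) hρ.le]
  have hbal := low_balance (n := n) hlam hρ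
  calc _ = (C * K ^ ((n : ℝ) / 2) * c * Z * (ρ * r)) *
      ((1 + ρ ^ 2) ^ (-(n * lam / 2) / 2) * (radius lam ρ ^ ((n : ℝ) / 2) * ρ ^ ((n : ℝ) / 2))) := by
        rw [hc]; ring
    _ ≤ (C * K ^ ((n : ℝ) / 2) * c * Z * (ρ * r)) * 1 := by
        gcongr
    _ = _ := mul_one _

variable (n) in
-- No cancellation is needed. The condition r ≤ ρ^(λ-1) says that the spreading scale dominates the
-- size of the atom; then ρ^(-nλ/2) · ρ^((λ-1)n/2) · r^(-n/2) = (ρr)^(-n/2).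
lemma exists_bandNorm_high_le (hn : 1 ≤ n) (hlam : 1 < lam) (I : Set ℝ)
    (hI : Bornology.IsBounded I) (hIm : MeasurableSet I) :
    ∃ C : ℝ, 0 ≤ C ∧ ∀ (γ s t r ρ : ℝ) (f : EuclideanSpace ℝ (Fin n) → ℂ), 0 < s → s ≤ t → 1 ≤ ρ →
      r ≤ ρ ^ (lam - 1) → IsCenteredAtom r f →
      bandNorm n lam I (critExp n lam γ) s t f ρ (2 * ρ) ≤
        ENNReal.ofReal (C * (‖critExp n lam γ‖ + n + 1) ^ n * (ρ * r) ^ (-(n : ℝ) / 2)) := by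
  obtain ⟨C, hC, h⟩ := exists_mixedNorm_piece_le hn hlam I hI hIm
  set K : ℝ := 4 ^ lam + 2 * Real.pi with hK
  have hKpos : 0 < K := by positivity
  have hV := ballVol_nonneg n
  refine ⟨C * K ^ ((n : ℝ) / 2) * √(ballVol n), by positivity, fun γ s t r ρ f hs hst hρ1 hρr hf => ?_⟩
  have hρ : 0 < ρ := one_pos.trans_le hρ1
  set Z : ℝ := (‖critExp n lam γ‖ + n + 1) ^ n with hZ
  have hZ0 : 0 ≤ Z := by positivity
  have hr := hf.pos
  have hradeq : radius lam ρ = ρ ^ (lam - 1) := max_eq_right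
    ((inv_le_one_of_one_le₀ hρ1).trans (Real.one_le_rpow hρ1 (by linarith)))
  have hrpow : 0 < ρ ^ (lam - 1) := Real.rpow_pos_of_pos hρ _
  have h1 := h (critExp n lam γ) s t ρ (2 * ρ) (ρ ^ (-(n * lam / 2)))
    (K * ρ ^ (lam - 1)) r
    (ENNReal.ofReal (√(ballVol n) * r ^ (-(n : ℝ) / 2))) f hs hst hρ (by linarith) (by positivity)
    (by positivity) (fun x hx _ => by
      rw [critExp_re]
      refine (weight_le (by positivity) hρ.le hx).trans ?_
      have hnl : 0 ≤ n * lam := by positivity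
      calc _ ≤ (ρ ^ 2) ^ (-(n * lam / 2) / 2) :=
            Real.rpow_le_rpow_of_nonpos (by positivity) (by linarith) (by linarith)
        _ = _ := by
            rw [← Real.rpow_natCast ρ 2, ← Real.rpow_mul hρ.le]
            congr 1
            push_cast
            ring)
    (fun x hx hx' => by
      refine (radius_le_of_mem hlam hρ hx (by linarith)).trans ?_
      rw [hradeq]
      gcongr
      rw [hK]; linarith [Real.pi_pos]) hf.integrable hf.supp
    (fun v hv i _ => hf.eLpNorm_fourier_iterate_le _ hv
      (by
        have h4 : (0 : ℝ) ≤ 4 ^ lam := by positivity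
        rw [hK]
        nlinarith [Real.pi_pos]) i)
  refine h1.trans ?_
  rw [← ENNReal.ofReal_mul (by positivity)]
  refine ENNReal.ofReal_le_ofReal (le_of_eq ?_)
  rw [Real.mul_rpow hKpos.le hrpow.le, Real.mul_rpow hρ.le hr.le, ← Real.rpow_mul hρ.le]
  have : ρ ^ (-(n * lam / 2)) * ρ ^ ((lam - 1) * (n / 2)) = ρ ^ (-(n : ℝ) / 2) := by
    rw [← Real.rpow_add hρ]
    congr 1
    ring
  rw [← this]
  ring

variable (n) in
-- Between r⁻¹ and r^(1/(λ-1)) the radius is at most a multiple of r, so the output remains at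
-- distance O(r) from the atom. The whole range is one band with scale Kr and the decay factor
-- bounded by 1; a dyadic sum here would only lose.
lemma exists_bandNorm_mid_le (hn : 1 ≤ n) (hlam : 1 < lam) (I : Set ℝ)
    (hI : Bornology.IsBounded I) (hIm : MeasurableSet I) :
    ∃ C : ℝ, 0 ≤ C ∧ ∀ (γ s t r : ℝ) (f : EuclideanSpace ℝ (Fin n) → ℂ), 0 < s → s ≤ t → 1 ≤ r →
      IsCenteredAtom r f →
      bandNorm n lam I (critExp n lam γ) s t f r⁻¹ (r ^ (lam - 1)⁻¹) ≤
        ENNReal.ofReal (C * (‖critExp n lam γ‖ + n + 1) ^ n) := by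
  obtain ⟨C, hC, h⟩ := exists_mixedNorm_piece_le hn hlam I hI hIm
  set K : ℝ := 2 ^ lam + 2 * Real.pi with hK
  have hKpos : 0 < K := by positivity
  have hV := ballVol_nonneg n
  refine ⟨C * K ^ ((n : ℝ) / 2) * √(ballVol n), by positivity, fun γ s t r f hs hst hr1 hf => ?_⟩
  set Z : ℝ := (‖critExp n lam γ‖ + n + 1) ^ n with hZ
  have hZ0 : 0 ≤ Z := by positivity
  have hr := hf.pos
  have hl0 : 0 < lam - 1 := by linarith
  have h1 := h (critExp n lam γ) s t r⁻¹ (r ^ (lam - 1)⁻¹) 1 (K * r) r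
    (ENNReal.ofReal (√(ballVol n) * r ^ (-(n : ℝ) / 2))) f hs hst (by positivity)
    ((inv_le_one_of_one_le₀ hr1).trans (Real.one_le_rpow hr1 (by positivity))) (by positivity)
    (by norm_num) (fun x hx _ => by
      rw [critExp_re]
      refine Real.rpow_le_one_of_one_le_of_nonpos (by nlinarith [sq_nonneg ‖(2 * Real.pi) • x‖]) ?_
      have hnl : 0 ≤ n * lam := by positivity
      linarith)
    (fun x hx hx' => by
      have hxp : 0 < ‖x‖ := lt_of_lt_of_le (by positivity) hx
      have h2 : (0 : ℝ) ≤ 2 ^ lam := by positivity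
      refine max_le ?_ ?_
      · calc ‖x‖⁻¹ ≤ (r⁻¹)⁻¹ := by gcongr
          _ = 1 * r := by simp
          _ ≤ K * r := by gcongr; rw [hK]; linarith [Real.pi_gt_three]
      · calc ‖x‖ ^ (lam - 1) ≤ (2 * r ^ (lam - 1)⁻¹) ^ (lam - 1) :=
              Real.rpow_le_rpow hxp.le hx' hl0.le
          _ = 2 ^ (lam - 1) * r := by
              rw [Real.mul_rpow (by norm_num) (by positivity), ← Real.rpow_mul hr.le,
                inv_mul_cancel₀ hl0.ne', Real.rpow_one]
          _ ≤ K * r := by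
              gcongr
              have : (2 : ℝ) ^ (lam - 1) ≤ 2 ^ lam :=
                Real.rpow_le_rpow_of_exponent_le (by norm_num) (by linarith)
              rw [hK]; linarith [Real.pi_pos]) hf.integrable hf.supp
    (fun v hv i _ => hf.eLpNorm_fourier_iterate_le _ hv
      (by
        have h4 : (0 : ℝ) ≤ 2 ^ lam := by positivity
        rw [hK]
        nlinarith [Real.pi_pos]) i)
  refine h1.trans ?_
  rw [← ENNReal.ofReal_mul (by positivity)]
  refine ENNReal.ofReal_le_ofReal (le_of_eq ?_)
  rw [Real.mul_rpow hKpos.le hr.le]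
  have : r ^ ((n : ℝ) / 2) * r ^ (-(n : ℝ) / 2) = 1 := by
    rw [← Real.rpow_add hr, show (n : ℝ) / 2 + -(n : ℝ) / 2 = 0 by ring, Real.rpow_zero]
  calc _ = (C * K ^ ((n : ℝ) / 2) * √(ballVol n) * Z) *
        (r ^ ((n : ℝ) / 2) * r ^ (-(n : ℝ) / 2)) := by ring
    _ = _ := by rw [this, mul_one]

lemma sum_pow_le_of_lt_one {q : ℝ} (h0 : 0 ≤ q) (h1 : q < 1) (K : ℕ) :
    ∑ k ∈ Finset.range K, q ^ k ≤ (1 - q)⁻¹ := by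
  rw [← tsum_geometric_of_lt_one h0 h1]
  exact (summable_geometric_of_lt_one h0 h1).sum_le_tsum _ fun _ _ => by positivity

lemma bandNorm_le_sum {I : Set ℝ} (ζ : ℂ) {s t : ℝ} (hs : 0 < s) (hst : s ≤ t) {f : 𝔼 → ℂ}
    (hf : Integrable f) (a : ℕ → ℝ) (K : ℕ) :
    bandNorm n lam I ζ s t f (a 0) (a K) ≤
      ∑ k ∈ Finset.range K, bandNorm n lam I ζ s t f (a k) (a (k + 1)) := by
  induction K with
  | zero => simp [bandNorm_self]
  | succ K ih =>
    rw [Finset.sum_range_succ]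
    exact (bandNorm_le_add ζ hs hst hf _ (a K) _).trans (by gcongr)

lemma bandNorm_le_sum' {I : Set ℝ} (ζ : ℂ) {s t : ℝ} (hs : 0 < s) (hst : s ≤ t) {f : 𝔼 → ℂ}
    (hf : Integrable f) (a : ℕ → ℝ) (K : ℕ) :
    bandNorm n lam I ζ s t f (a K) (a 0) ≤
      ∑ k ∈ Finset.range K, bandNorm n lam I ζ s t f (a (k + 1)) (a k) := by
  induction K with
  | zero => simp [bandNorm_self]
  | succ K ih =>
    rw [Finset.sum_range_succ]
    exact ((bandNorm_le_add ζ hs hst hf _ (a K) _).trans (add_le_add le_rfl ih)).trans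
      (add_comm _ _).le

variable (n) in
/-- The main estimate: the truncated operator maps atoms to `L¹(L²)`, uniformly. -/
lemma exists_mixedNorm_centeredAtom_le (hn : 1 ≤ n) (hlam : 1 < lam) (I : Set ℝ)
    (hI : Bornology.IsBounded I) (hIm : MeasurableSet I) :
    ∃ C : ℝ, 0 ≤ C ∧ ∀ (γ s t r : ℝ) (f : EuclideanSpace ℝ (Fin n) → ℂ), 0 < s → s ≤ t →
      IsCenteredAtom r f →
      mixedNorm 1 I (mulOp (symCut n lam (critExp n lam γ) (cut s t)) f) ≤
        ENNReal.ofReal (C * (‖critExp n lam γ‖ + n + 1) ^ n) := by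
  obtain ⟨C₁, hC₁, h₁⟩ := exists_bandNorm_low_le n hn hlam I hI hIm
  obtain ⟨C₂, hC₂, h₂⟩ := exists_bandNorm_mid_le n hn hlam I hI hIm
  obtain ⟨C₃, hC₃, h₃⟩ := exists_bandNorm_high_le n hn hlam I hI hIm
  -- The ratio of the high frequency series in the worst case n = 1, where (2^k)^(-n/2) = q^k.
  set q : ℝ := (2 : ℝ) ^ (-(1 / 2) : ℝ) with hq
  have hq0 : 0 < q := by positivity
  have hq1 : q < 1 := Real.rpow_lt_one_of_one_lt_of_neg (by norm_num) (by norm_num)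
  have hqi : 0 < (1 - q)⁻¹ := inv_pos.2 (by linarith)
  refine ⟨C₁ * (1 - 2⁻¹)⁻¹ + C₂ + C₃ * (1 - q)⁻¹, by positivity, fun γ s t r f hs hst hf => ?_⟩
  have hr := hf.pos
  have hl0 : 0 < lam - 1 := by linarith
  set ζ := critExp n lam γ with hζ
  set Z : ℝ := (‖ζ‖ + n + 1) ^ n with hZ
  have hZ0 : 0 ≤ Z := by positivity
  -- Above ρ₁ both ρr ≥ 1 and r ≤ ρ^(λ-1) hold. For r < 1 it equals r⁻¹ and the middle range is
  -- empty.
  set ρ₁ : ℝ := max r⁻¹ (r ^ (lam - 1)⁻¹) with hρ₁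
  have hρ₁r : 1 ≤ ρ₁ * r := by
    calc 1 = r⁻¹ * r := (inv_mul_cancel₀ hr.ne').symm
      _ ≤ _ := by gcongr; exact le_max_left _ _
  have hρ₁1 : 1 ≤ ρ₁ := by
    rcases le_or_gt 1 r with h | h
    · exact (Real.one_le_rpow h (by positivity)).trans (le_max_right _ _)
    · exact ((one_le_inv₀ hr).2 h.le).trans (le_max_left _ _)
  have hρ₁0 : 0 < ρ₁ := by linarith
  -- K doublings away from r⁻¹ and from ρ₁ cover the support of the truncation. The geometric series
  -- make the final bound independent of K, hence of s and t.
  obtain ⟨K, hK⟩ : ∃ K : ℕ, 2 * r⁻¹ * s⁻¹ + 2 * t ≤ 2 ^ K := by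
    obtain ⟨K, hK⟩ := pow_unbounded_of_one_lt (2 * r⁻¹ * s⁻¹ + 2 * t) (one_lt_two)
    exact ⟨K, hK.le⟩
  have ht := hs.trans_le hst
  have hrs : 0 < r⁻¹ * s⁻¹ := by positivity
  set a : ℕ → ℝ := fun k => (2 ^ k : ℝ)⁻¹ * r⁻¹ with ha
  set b : ℕ → ℝ := fun k => (2 ^ k : ℝ) * ρ₁ with hb
  have hlow : bandNorm n lam I ζ s t f (a K) (a 0) ≤ ENNReal.ofReal (C₁ * (1 - 2⁻¹)⁻¹ * Z) := by
    refine (bandNorm_le_sum' ζ hs hst hf.integrable a K).trans ?_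
    calc _ ≤ ∑ k ∈ Finset.range K, ENNReal.ofReal (C₁ * Z * 2⁻¹ ^ k) := by
          refine Finset.sum_le_sum fun k _ => ?_
          have e1 : a k = 2 * a (k + 1) := by simp only [ha, pow_succ]; field_simp
          have e2 : a (k + 1) * r = 2⁻¹ * 2⁻¹ ^ k := by
            simp only [ha, pow_succ, inv_pow]; field_simp
          have e3 : (2⁻¹ : ℝ) ^ k ≤ 1 := pow_le_one₀ (by norm_num) (by norm_num)
          have e4 : (0 : ℝ) < 2⁻¹ ^ k := by positivity
          rw [e1]
          refine (h₁ γ s t r (a (k + 1)) f hs hst (by simp only [ha]; positivity)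
            (by rw [e2]; linarith) hf).trans (ENNReal.ofReal_le_ofReal ?_)
          rw [e2]
          gcongr
          linarith
      _ = ENNReal.ofReal (C₁ * Z * ∑ k ∈ Finset.range K, 2⁻¹ ^ k) := by
          rw [← ENNReal.ofReal_sum_of_nonneg (fun k _ => by positivity), Finset.mul_sum]
      _ ≤ _ := by
          refine ENNReal.ofReal_le_ofReal ?_
          calc _ ≤ C₁ * Z * (1 - 2⁻¹)⁻¹ := by
                gcongr
                exact sum_pow_le_of_lt_one (by norm_num) (by norm_num) K
            _ = _ := by ring
  have hmid : bandNorm n lam I ζ s t f (a 0) (b 0) ≤ ENNReal.ofReal (C₂ * Z) := by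
    have e1 : a 0 = r⁻¹ := by simp [ha]
    have e2 : b 0 = ρ₁ := by simp [hb]
    rw [e1, e2]
    rcases le_or_gt 1 r with h | h
    · have : ρ₁ = r ^ (lam - 1)⁻¹ := max_eq_right
        ((inv_le_one_of_one_le₀ h).trans (Real.one_le_rpow h (by positivity)))
      rw [this]
      exact h₂ γ s t r f hs hst h hf
    · have : ρ₁ = r⁻¹ := max_eq_left
        ((Real.rpow_le_one hr.le h.le (by positivity)).trans ((one_le_inv₀ hr).2 h.le))
      rw [this, bandNorm_self]
      exact zero_le
  have hhigh : bandNorm n lam I ζ s t f (b 0) (b K) ≤ ENNReal.ofReal (C₃ * (1 - q)⁻¹ * Z) := by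
    refine (bandNorm_le_sum ζ hs hst hf.integrable b K).trans ?_
    calc _ ≤ ∑ k ∈ Finset.range K, ENNReal.ofReal (C₃ * Z * q ^ k) := by
          refine Finset.sum_le_sum fun k _ => ?_
          have e1 : b (k + 1) = 2 * b k := by simp only [hb, pow_succ]; ring
          have e5 : (1 : ℝ) ≤ 2 ^ k := one_le_pow₀ (by norm_num)
          have e2 : ρ₁ ≤ b k := le_mul_of_one_le_left hρ₁0.le e5
          have e6 : r ≤ b k ^ (lam - 1) := by
            calc r = (r ^ (lam - 1)⁻¹) ^ (lam - 1) := by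
                  rw [← Real.rpow_mul hr.le, inv_mul_cancel₀ hl0.ne', Real.rpow_one]
              _ ≤ _ := Real.rpow_le_rpow (by positivity) ((le_max_right _ _).trans e2) hl0.le
          have e7 : (2 : ℝ) ^ k ≤ b k * r := by
            simp only [hb]
            rw [mul_assoc]
            exact le_mul_of_one_le_right (by positivity) hρ₁r
          rw [e1]
          refine (h₃ γ s t r (b k) f hs hst (hρ₁1.trans e2) e6 hf).trans
            (ENNReal.ofReal_le_ofReal ?_)
          gcongr
          have hn' : (1 : ℝ) ≤ n := by exact_mod_cast hn
          calc (b k * r) ^ (-(n : ℝ) / 2) ≤ (2 ^ k : ℝ) ^ (-(n : ℝ) / 2) :=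
                Real.rpow_le_rpow_of_nonpos (by positivity) e7 (by linarith)
            _ ≤ (2 ^ k : ℝ) ^ (-(1 / 2) : ℝ) :=
                Real.rpow_le_rpow_of_exponent_le e5 (by linarith)
            _ = q ^ k := by
                rw [hq, ← Real.rpow_natCast, ← Real.rpow_natCast, ← Real.rpow_mul (by norm_num),
                  ← Real.rpow_mul (by norm_num), mul_comm]
      _ = ENNReal.ofReal (C₃ * Z * ∑ k ∈ Finset.range K, q ^ k) := by
          rw [← ENNReal.ofReal_sum_of_nonneg (fun k _ => by positivity), Finset.mul_sum]
      _ ≤ _ := by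
          refine ENNReal.ofReal_le_ofReal ?_
          calc _ ≤ C₃ * Z * (1 - q)⁻¹ := by
                gcongr
                exact sum_pow_le_of_lt_one hq0.le hq1 K
            _ = _ := by ring
  have haK : 2 * a K ≤ s := by
    simp only [ha]
    rw [← mul_assoc, mul_comm 2, mul_assoc, inv_mul_le_iff₀ (by positivity)]
    calc 2 * r⁻¹ = (2 * r⁻¹ * s⁻¹) * s := by field_simp
      _ ≤ 2 ^ K * s := by gcongr; linarith
  have hbK : 2 * t ≤ b K := by
    simp only [hb]
    calc 2 * t ≤ 2 ^ K * 1 := by linarith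
      _ ≤ _ := by gcongr
  rw [← bandNorm_eq_of_le I ζ hs hst f (by simp only [ha]; positivity) haK hbK]
  calc _ ≤ bandNorm n lam I ζ s t f (a K) (a 0) + (bandNorm n lam I ζ s t f (a 0) (b 0) +
        bandNorm n lam I ζ s t f (b 0) (b K)) :=
        (bandNorm_le_add ζ hs hst hf.integrable _ (a 0) _).trans
          (add_le_add le_rfl (bandNorm_le_add ζ hs hst hf.integrable _ _ _))
    _ ≤ _ := add_le_add hlow (add_le_add hmid hhigh)
    _ = _ := by
        rw [← ENNReal.ofReal_add (by positivity) (by positivity),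
          ← ENNReal.ofReal_add (by positivity) (by positivity)]
        congr 1
        ring

end AtomEstimate
end SquareFunction

namespace SquareFunction

open scoped ContDiff

variable {n : ℕ} {lam : ℝ}

local notation "𝔼" => EuclideanSpace ℝ (Fin n)

/-! ### Minkowski, Fatou and Tonelli for the mixed norm -/

section MixedNormTools

open Filter Topology

lemma lintegral_sq_eq_eLpNorm {α : Type*} [MeasurableSpace α] (μ : Measure α) (F : α → ℂ) :
    (∫⁻ u, ‖F u‖ₑ ^ 2 ∂μ) ^ (1 / 2 : ℝ) = eLpNorm F 2 μ := by
  simp only [eLpNorm_eq_lintegral_rpow_enorm_toReal two_ne_zero ENNReal.ofNat_ne_top,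
    ENNReal.toReal_ofNat, ENNReal.rpow_ofNat]

lemma mixedNorm_eq (p : ℝ≥0∞) (I : Set ℝ) (F : ℝ → 𝔼 → ℂ) : mixedNorm p I F =
    eLpNorm (fun x => eLpNorm (fun u => F u x) 2 (volume.restrict I)) p volume := by
  simp only [mixedNorm, lintegral_sq_eq_eLpNorm]

lemma measurable_slice {F : ℝ → 𝔼 → ℂ} (hF : Measurable (Function.uncurry F)) (x : 𝔼) :
    Measurable fun u => F u x := hF.comp (measurable_id.prodMk measurable_const)

lemma measurable_slice_norm (I : Set ℝ) {F : ℝ → 𝔼 → ℂ} (hF : Measurable (Function.uncurry F)) :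
    Measurable fun x : 𝔼 => eLpNorm (fun u => F u x) 2 (volume.restrict I) := by
  simp only [← lintegral_sq_eq_eLpNorm]
  exact (((hF.comp measurable_swap).enorm.pow_const 2).lintegral_prod_right').pow_const _

lemma mixedNorm_congr_ae (p : ℝ≥0∞) (I : Set ℝ) {F G : ℝ → 𝔼 → ℂ}
    (h : ∀ᵐ x, ∀ᵐ u ∂(volume.restrict I), F u x = G u x) : mixedNorm p I F = mixedNorm p I G := by
  simp only [mixedNorm_eq]
  refine eLpNorm_congr_ae ?_
  filter_upwards [h] with x hx
  exact eLpNorm_congr_ae hx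

lemma mixedNorm_zero (p : ℝ≥0∞) (I : Set ℝ) : mixedNorm p I (fun _ (_ : 𝔼) => 0) = 0 := by
  simp [mixedNorm_eq]

lemma mixedNorm_add_le {p : ℝ≥0∞} (hp : 1 ≤ p) (I : Set ℝ) {F G : ℝ → 𝔼 → ℂ}
    (hF : Measurable (Function.uncurry F)) (hG : Measurable (Function.uncurry G)) :
    mixedNorm p I (fun u x => F u x + G u x) ≤ mixedNorm p I F + mixedNorm p I G := by
  simp only [mixedNorm_eq]
  refine le_trans ?_ (eLpNorm_add_le (measurable_slice_norm I hF).aestronglyMeasurable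
    (measurable_slice_norm I hG).aestronglyMeasurable hp)
  refine eLpNorm_mono_enorm fun x => ?_
  exact eLpNorm_add_le (measurable_slice hF x).aestronglyMeasurable
    (measurable_slice hG x).aestronglyMeasurable one_le_two

lemma mixedNorm_const_mul_le (p : ℝ≥0∞) (I : Set ℝ) (c : ℂ) (F : ℝ → 𝔼 → ℂ) :
    mixedNorm p I (fun u x => c * F u x) ≤ ‖c‖ₑ * mixedNorm p I F := by
  simp only [mixedNorm_eq]
  refine eLpNorm_le_nnreal_smul_eLpNorm_of_ae_le_mul' (c := ‖c‖₊)
    (Filter.Eventually.of_forall fun x => ?_) p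
  simp only [enorm_eq_self]
  exact eLpNorm_le_nnreal_smul_eLpNorm_of_ae_le_mul' (c := ‖c‖₊)
    (Filter.Eventually.of_forall fun u => (enorm_mul _ _).le) 2

lemma measurable_sum_uncurry {ι : Type*} (s : Finset ι) {F : ι → ℝ → 𝔼 → ℂ}
    (hF : ∀ i, Measurable (Function.uncurry (F i))) :
    Measurable (Function.uncurry fun u x => ∑ i ∈ s, F i u x) := by
  simp only [Function.uncurry_def] at hF ⊢
  exact Finset.measurable_fun_sum s fun i _ => hF i

lemma mixedNorm_sum_le {p : ℝ≥0∞} (hp : 1 ≤ p) (I : Set ℝ) {ι : Type*} (s : Finset ι)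
    {F : ι → ℝ → 𝔼 → ℂ} (hF : ∀ i, Measurable (Function.uncurry (F i))) :
    mixedNorm p I (fun u x => ∑ i ∈ s, F i u x) ≤ ∑ i ∈ s, mixedNorm p I (F i) := by
  classical
  induction s using Finset.induction_on with
  | empty => simp [mixedNorm_zero]
  | insert a s ha ih =>
    simp only [Finset.sum_insert ha]
    exact (mixedNorm_add_le hp I (hF a) (measurable_sum_uncurry s hF)).trans (by gcongr)

/-- Fatou's lemma; the continuous increasing maps a ↦ a^p and a ↦ a^(1/p) commute with the lower
limit. -/
lemma eLpNorm_le_liminf {α : Type*} [MeasurableSpace α] {μ : Measure α} {p : ℝ≥0∞} (hp0 : p ≠ 0)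
    (hp : p ≠ ⊤) {G : α → ℝ≥0∞} {H : ℕ → α → ℝ≥0∞} (hH : ∀ k, Measurable (H k))
    (h : ∀ᵐ x ∂μ, G x ≤ liminf (fun k => H k x) atTop) :
    eLpNorm G p μ ≤ liminf (fun k => eLpNorm (H k) p μ) atTop := by
  have hpp : 0 < p.toReal := ENNReal.toReal_pos hp0 hp
  simp only [eLpNorm_eq_lintegral_rpow_enorm_toReal hp0 hp, enorm_eq_self]
  have hm : ∀ {q : ℝ}, 0 < q → ∀ v : ℕ → ℝ≥0∞,
      (liminf v atTop) ^ q = liminf (fun k => v k ^ q) atTop := fun {q} hq v =>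
    Monotone.map_liminf_of_continuousAt (fun a b hab => ENNReal.rpow_le_rpow hab hq.le) v
      ENNReal.continuous_rpow_const.continuousAt
  rw [← hm (by positivity)]
  refine ENNReal.rpow_le_rpow ?_ (by positivity)
  refine le_trans (lintegral_mono_ae ?_) (lintegral_liminf_le fun k => (hH k).pow_const _)
  filter_upwards [h] with x hx
  rw [← hm hpp]
  exact ENNReal.rpow_le_rpow hx hpp.le

lemma mixedNorm_le_liminf {p : ℝ≥0∞} (hp0 : p ≠ 0) (hp : p ≠ ⊤) (I : Set ℝ) {F : ℝ → 𝔼 → ℂ}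
    {G : ℕ → ℝ → 𝔼 → ℂ} (hG : ∀ k, Measurable (Function.uncurry (G k)))
    (h : ∀ᵐ x, ∀ᵐ u ∂(volume.restrict I), Tendsto (fun k => G k u x) atTop (𝓝 (F u x))) :
    mixedNorm p I F ≤ liminf (fun k => mixedNorm p I (G k)) atTop := by
  simp only [mixedNorm_eq]
  refine eLpNorm_le_liminf hp0 hp (fun k => measurable_slice_norm I (hG k)) ?_
  filter_upwards [h] with x hx
  exact Lp.eLpNorm_lim_le_liminf_eLpNorm (fun k => (measurable_slice (hG k) x).aestronglyMeasurable)
    _ hx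

/-- Fatou in `u` and then in `x`. Bounds for truncated operators and for partial sums pass to their
almost everywhere limits in this way. -/
lemma mixedNorm_le_of_tendsto {p : ℝ≥0∞} (hp0 : p ≠ 0) (hp : p ≠ ⊤) (I : Set ℝ) {F : ℝ → 𝔼 → ℂ}
    {G : ℕ → ℝ → 𝔼 → ℂ} (hG : ∀ k, Measurable (Function.uncurry (G k)))
    (h : ∀ᵐ x, ∀ᵐ u ∂(volume.restrict I), Tendsto (fun k => G k u x) atTop (𝓝 (F u x)))
    {B : ℝ≥0∞} (hB : ∀ᶠ k in atTop, mixedNorm p I (G k) ≤ B) : mixedNorm p I F ≤ B :=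
  (mixedNorm_le_liminf hp0 hp I hG h).trans
    (liminf_le_of_frequently_le' hB.frequently)

lemma ae_swap {I : Set ℝ} {P : ℝ → 𝔼 → Prop}
    (h : ∀ᵐ q ∂((volume.restrict I).prod (volume : Measure 𝔼)), P q.1 q.2) :
    ∀ᵐ x, ∀ᵐ u ∂(volume.restrict I), P u x := by
  have : ∀ᵐ q ∂((volume : Measure 𝔼).prod (volume.restrict I)), P q.2 q.1 := by
    rw [← Measure.prod_swap] at h
    exact ae_of_ae_map measurable_swap.aemeasurable h
  exact Measure.ae_ae_of_ae_prod this

lemma mixedNorm_two (I : Set ℝ) {F : ℝ → 𝔼 → ℂ} (hF : Measurable (Function.uncurry F)) :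
    mixedNorm 2 I F ^ 2 = ∫⁻ u in I, eLpNorm (F u) 2 ^ 2 := by
  rw [mixedNorm, eLpNorm_eq_lintegral_rpow_enorm_toReal two_ne_zero ENNReal.ofNat_ne_top,
    ← ENNReal.rpow_natCast, ← ENNReal.rpow_mul]
  simp only [enorm_eq_self, ENNReal.toReal_ofNat, ← ENNReal.rpow_mul]
  norm_num
  simp only [eLpNorm_two_sq]
  exact lintegral_lintegral_swap ((hF.comp measurable_swap).enorm.pow_const 2).aemeasurable

end MixedNormTools

/-! ### Linearity, translation invariance and the L² bound of multiplier operators -/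

section MulOp

/-- Multipliers that are jointly measurable, and continuous with compact support for every `u`. -/
structure IsNice (b : ℝ → 𝔼 → ℂ) : Prop where
  meas : Measurable (Function.uncurry b)
  cont : ∀ u, Continuous (b u)
  supp : ∀ u, HasCompactSupport (b u)

lemma isNice_symCut (ζ : ℂ) {s t : ℝ} (hs : 0 < s) (hst : s ≤ t) :
    IsNice (symCut n lam ζ (cut s t)) :=
  ⟨measurable_symCut ζ (contDiff_cut s t).continuous.measurable, fun u =>
    (contDiff_symCut ζ u (contDiff_cut s t) hs fun _ h => cut_eq_zero_of_le hs hst h).continuous,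
    fun _ => (hasCompactSupport_cut hs hst).mul_left⟩

variable {b : ℝ → EuclideanSpace ℝ (Fin n) → ℂ}

lemma fourier_congr_ae {f g : 𝔼 → ℂ} (h : f =ᵐ[volume] g) : 𝓕 f = 𝓕 g := by
  ext ξ
  rw [Real.fourier_eq, Real.fourier_eq]
  refine integral_congr_ae ?_
  filter_upwards [h] with x hx
  rw [hx]

lemma fourier_sum_mul {ι : Type*} (s : Finset ι) (c : ι → ℂ) {f : ι → 𝔼 → ℂ}
    (hf : ∀ i ∈ s, Integrable (f i)) (ξ : 𝔼) :
    𝓕 (fun x => ∑ i ∈ s, c i * f i x) ξ = ∑ i ∈ s, c i * 𝓕 (f i) ξ := by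
  simp only [Real.fourier_eq]
  have hi : ∀ i ∈ s, Integrable fun v : 𝔼 => Real.fourierChar (-inner ℝ v ξ) • f i v := fun i hi => by
    simpa using (Real.fourierIntegral_convergent_iff ξ).2 (hf i hi)
  have : ∀ v : 𝔼, Real.fourierChar (-inner ℝ v ξ) • ∑ i ∈ s, c i * f i v =
      ∑ i ∈ s, c i * Real.fourierChar (-inner ℝ v ξ) • f i v := fun v => by
    rw [Finset.smul_sum]
    exact Finset.sum_congr rfl fun i _ => by rw [mul_smul_comm]
  simp only [this]
  rw [integral_finsetSum _ fun i hi' => (hi i hi').const_mul _]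
  exact Finset.sum_congr rfl fun i _ => integral_const_mul _ _

lemma fourierInv_sum_mul {ι : Type*} (s : Finset ι) (c : ι → ℂ) {f : ι → 𝔼 → ℂ}
    (hf : ∀ i ∈ s, Integrable (f i)) (x : 𝔼) :
    𝓕⁻ (fun x => ∑ i ∈ s, c i * f i x) x = ∑ i ∈ s, c i * 𝓕⁻ (f i) x := by
  simp only [fourierInv_eq_fourier_comp_neg']
  exact fourier_sum_mul s c hf (-x)

lemma mulOp_sum_mul (hb : IsNice b) {ι : Type*} (s : Finset ι) (c : ι → ℂ) {f : ι → 𝔼 → ℂ}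
    (hf : ∀ i ∈ s, Integrable (f i)) (u : ℝ) (x : 𝔼) :
    mulOp b (fun x => ∑ i ∈ s, c i * f i x) u x = ∑ i ∈ s, c i * mulOp b (f i) u x := by
  unfold mulOp
  rw [← fourierInv_sum_mul s c fun i hi => integrable_mul_fourier (hb.cont u) (hb.supp u) (hf i hi)]
  have : (fun ξ => b u ξ * 𝓕 (fun x => ∑ i ∈ s, c i * f i x) ξ) =
      fun ξ => ∑ i ∈ s, c i * (b u ξ * 𝓕 (f i) ξ) := by
    ext ξ
    rw [fourier_sum_mul s c hf, Finset.mul_sum]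
    exact Finset.sum_congr rfl fun i _ => by ring
  rw [this]

lemma mulOp_sub (hb : IsNice b) {f g : 𝔼 → ℂ} (hf : Integrable f) (hg : Integrable g) (u : ℝ)
    (x : 𝔼) : mulOp b (fun x => f x - g x) u x = mulOp b f u x - mulOp b g u x := by
  have := mulOp_sum_mul hb Finset.univ ![1, -1] (f := ![f, g]) (by simp [Fin.forall_fin_two, hf, hg])
    u x
  simpa [Fin.sum_univ_two, ← sub_eq_add_neg] using this

lemma mixedNorm_mulOp_sum_le (hb : IsNice b) {p : ℝ≥0∞} (hp : 1 ≤ p) (I : Set ℝ) {ι : Type*}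
    (s : Finset ι) (c : ι → ℂ) {f : ι → 𝔼 → ℂ} (hf : ∀ i, Integrable (f i)) :
    mixedNorm p I (mulOp b (fun x => ∑ i ∈ s, c i * f i x)) ≤
      ∑ i ∈ s, ‖c i‖ₑ * mixedNorm p I (mulOp b (f i)) := by
  have : mulOp b (fun x => ∑ i ∈ s, c i * f i x) = fun u x => ∑ i ∈ s, c i * mulOp b (f i) u x := by
    ext u x
    exact mulOp_sum_mul hb s c (fun i _ => hf i) u x
  rw [this]
  refine (mixedNorm_sum_le hp I s (F := fun i u x => c i * mulOp b (f i) u x) fun i => ?_).trans ?_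
  · exact (measurable_mulOp hb.meas (hf i)).const_mul _
  · exact Finset.sum_le_sum fun i _ => mixedNorm_const_mul_le p I _ _

lemma mulOp_translate (f : 𝔼 → ℂ) (x₀ : 𝔼) (u : ℝ) (x : 𝔼) :
    mulOp b (fun y => f (y + x₀)) u x = mulOp b f u (x + x₀) := by
  have h : 𝓕 (fun y => f (y + x₀)) = fun ξ => Real.fourierChar (inner ℝ x₀ ξ) • 𝓕 f ξ :=
    VectorFourier.fourierIntegral_comp_add_right Real.fourierChar volume (innerₗ 𝔼) f x₀
  simp only [mulOp, h, Real.fourierInv_eq]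
  congr 1
  ext ξ
  rw [mul_smul_comm, ← mul_smul, ← AddChar.map_add_eq_mul, inner_add_right, real_inner_comm x₀]

lemma mixedNorm_translate (p : ℝ≥0∞) (I : Set ℝ) {F : ℝ → 𝔼 → ℂ}
    (hF : Measurable (Function.uncurry F)) (x₀ : 𝔼) :
    mixedNorm p I (fun u x => F u (x + x₀)) = mixedNorm p I F := by
  simp only [mixedNorm_eq]
  exact eLpNorm_comp_measurePreserving (measurable_slice_norm I hF).aestronglyMeasurable
    (measurePreserving_add_right volume x₀)

lemma mixedNorm_mulOp_translate (hb : IsNice b) (p : ℝ≥0∞) (I : Set ℝ) {f : 𝔼 → ℂ}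
    (hf : Integrable f) (x₀ : 𝔼) :
    mixedNorm p I (mulOp b fun y => f (y + x₀)) = mixedNorm p I (mulOp b f) := by
  rw [← mixedNorm_translate p I (measurable_mulOp hb.meas hf) x₀]
  congr 1
  ext u x
  exact mulOp_translate f x₀ u x

lemma enorm_mulOp_le (u : ℝ) (x : 𝔼) (f : 𝔼 → ℂ) :
    ‖mulOp b f u x‖ₑ ≤ ∫⁻ ξ, ‖b u ξ‖ₑ * ‖𝓕 f ξ‖ₑ := by
  rw [mulOp, Real.fourierInv_eq]
  refine (enorm_integral_le_lintegral_enorm _).trans_eq ?_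
  refine lintegral_congr fun ξ => ?_
  rw [← enorm_mul, ← ofReal_norm, Circle.norm_smul, ofReal_norm]

/-- Plancherel for a multiplier bounded by 1. Integrated over the interval, it is the L² endpoint of
the interpolation. -/
lemma eLpNorm_mulOp_le (hb : IsNice b) (h1 : ∀ u ξ, ‖b u ξ‖ ≤ 1) {f : 𝔼 → ℂ} (hf : Integrable f)
    (hf2 : MemLp f 2) (u : ℝ) : eLpNorm (mulOp b f u) 2 ≤ eLpNorm f 2 := by
  have : mulOp b f u = 𝓕⁻ (fun ξ => b u ξ * 𝓕 f ξ) := rfl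
  rw [this, eLpNorm_fourierInv (integrable_mul_fourier (hb.cont u) (hb.supp u) hf)
    (memLp_mul_fourier (hb.cont u) (hb.supp u) hf 2), ← eLpNorm_fourier hf hf2]
  refine eLpNorm_mono fun ξ => ?_
  rw [norm_mul]
  exact mul_le_of_le_one_left (norm_nonneg _) (h1 u ξ)

/-- The truncated operator on an `H¹` atom centered at `x₀`, uniformly in the truncation. -/
lemma exists_mixedNorm_atom_le (hn : 1 ≤ n) (hlam : 1 < lam) (I : Set ℝ)
    (hI : Bornology.IsBounded I) (hIm : MeasurableSet I) :
    ∃ C : ℝ, 0 ≤ C ∧ ∀ (γ s t r : ℝ) (x₀ : 𝔼) (f : 𝔼 → ℂ), 0 < s → s ≤ t →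
      IsCenteredAtom r (fun x => f (x + x₀)) →
      mixedNorm 1 I (mulOp (symCut n lam (critExp n lam γ) (cut s t)) f) ≤
        ENNReal.ofReal (C * (1 + |γ|) ^ n) := by
  obtain ⟨C, hC, h⟩ := exists_mixedNorm_centeredAtom_le (lam := lam) n hn hlam I hI hIm
  -- Since ‖critExp‖ ≤ nλ/2 + |γ|, the quantity ‖critExp‖ + n + 1 is at most (nλ/2 + n + 1)(1 +
  -- |γ|).
  refine ⟨C * (n * lam / 2 + n + 1) ^ n, by positivity, fun γ s t r x₀ f hs hst hf => ?_⟩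
  have hfi : Integrable f := by
    simpa using hf.integrable.comp_sub_right x₀
  rw [← mixedNorm_mulOp_translate (isNice_symCut _ hs hst) 1 I hfi x₀]
  refine (h γ s t r _ hs hst hf).trans (ENNReal.ofReal_le_ofReal ?_)
  rw [mul_assoc, ← mul_pow]
  gcongr
  have : ‖critExp n lam γ‖ ≤ n * lam / 2 + |γ| := by
    unfold critExp
    refine (norm_add_le _ _).trans (le_of_eq ?_)
    rw [Complex.norm_real, norm_mul, Complex.norm_I, mul_one, Complex.norm_real, Real.norm_eq_abs,
      Real.norm_eq_abs, abs_of_nonneg (by positivity)]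
  have h0 : 0 ≤ n * lam / 2 := by positivity
  have h1 : (0 : ℝ) ≤ n := by positivity
  nlinarith [abs_nonneg γ]

end MulOp
end SquareFunction

namespace SquareFunction

open scoped ContDiff

variable {n : ℕ} {lam : ℝ}

local notation "𝔼" => EuclideanSpace ℝ (Fin n)

/-! ### Absolutely convergent series in the mixed norm -/

section Series

open Filter Topology

lemma eLpNorm_tsum_le {α : Type*} [MeasurableSpace α] {μ : Measure α} {p : ℝ≥0∞} (hp : 1 ≤ p)
    (hp' : p ≠ ⊤) {f : ℕ → α → ℝ≥0∞} (hf : ∀ k, Measurable (f k)) :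
    eLpNorm (fun x => ∑' k, f k x) p μ ≤ ∑' k, eLpNorm (f k) p μ := by
  have hm : ∀ K, Measurable fun x => ∑ k ∈ Finset.range K, f k x := fun K =>
    Finset.measurable_fun_sum _ fun i _ => hf i
  refine (eLpNorm_le_liminf (zero_lt_one.trans_le hp).ne' hp'
    (H := fun K x => ∑ k ∈ Finset.range K, f k x) hm (Eventually.of_forall fun x => ?_)).trans ?_
  · exact (ENNReal.tendsto_nat_tsum fun k => f k x).liminf_eq.ge
  · refine liminf_le_of_frequently_le' (Eventually.of_forall fun K => ?_).frequently
    have := eLpNorm_sum_le (s := Finset.range K) (μ := μ) (f := f)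
      (fun i _ => (hf i).aestronglyMeasurable) hp
    have h2 : (∑ k ∈ Finset.range K, f k) = fun x => ∑ k ∈ Finset.range K, f k x := by
      ext x
      simp
    rw [h2] at this
    exact this.trans (ENNReal.sum_le_tsum _)

/-- An absolutely convergent series in the mixed norm space converges almost everywhere, and its
sum is, for almost every `u`, the sum in `L^p`. -/
lemma exists_hasSum_of_mixedNorm {p : ℝ≥0∞} (hp : 1 ≤ p) (hp2 : p ≤ 2) {I : Set ℝ}
    (hI : volume I ≠ ⊤) {G : ℕ → ℝ → 𝔼 → ℂ} (hG : ∀ k, Measurable (Function.uncurry (G k)))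
    (hsum : ∑' k, mixedNorm p I (G k) ≠ ⊤) :
    ∃ F : ℝ → 𝔼 → ℂ, Measurable (Function.uncurry F) ∧
      (∀ᵐ x, ∀ᵐ u ∂(volume.restrict I), HasSum (fun k => G k u x) (F u x)) ∧
      ∀ᵐ u ∂(volume.restrict I), MemLp (F u) p ∧
        ∀ φ : 𝓢(𝔼, ℂ), HasSum (fun k => ∫ x, φ x * G k u x) (∫ x, φ x * F u x) := by
  have hp' : p ≠ ⊤ := (hp2.trans_lt (by simp)).ne
  have hp0 : p ≠ 0 := (zero_lt_one.trans_le hp).ne'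
  have hpp : 0 < p.toReal := ENNReal.toReal_pos hp0 hp'
  have : IsFiniteMeasure (volume.restrict I) := ⟨by simpa using hI.lt_top⟩
  set S : ℝ → 𝔼 → ℝ≥0∞ := fun u x => ∑' k, ‖G k u x‖ₑ with hS
  have hSm : Measurable (Function.uncurry S) := Measurable.tsum fun k => (hG k).enorm
  have hSx : ∀ x, Measurable fun u => S u x := fun x =>
    hSm.comp (measurable_id.prodMk measurable_const)
  have hN : eLpNorm (fun x : 𝔼 => eLpNorm (fun u => S u x) 2 (volume.restrict I)) p volume ≠ ⊤ := by
    refine ne_top_of_le_ne_top hsum ?_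
    simp only [mixedNorm_eq]
    refine le_trans ?_ (eLpNorm_tsum_le hp hp' fun k => measurable_slice_norm I (hG k))
    refine eLpNorm_mono_enorm fun x => ?_
    simp only [enorm_eq_self]
    refine (eLpNorm_tsum_le one_le_two (by simp) fun k => (measurable_slice (hG k) x).enorm).trans ?_
    exact ENNReal.tsum_le_tsum fun k => (eLpNorm_enorm _).le
  -- As p ≤ 2 and the interval has finite measure, the L² norm in `u` dominates the L^p norm up to a
  -- constant. Hence the majorant S belongs to L^p of the product, and Tonelli puts almost every
  -- slice S u in L^p(ℝⁿ), where it can be tested against Schwartz functions.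
  have hN' : ∫⁻ x : 𝔼, ∫⁻ u in I, S u x ^ p.toReal < ⊤ := by
    set c : ℝ≥0∞ := (volume.restrict I) Set.univ ^ (1 / p.toReal - 1 / (2 : ℝ≥0∞).toReal) with hc
    have hct : c ≠ ⊤ := by
      refine ENNReal.rpow_ne_top_of_nonneg ?_ (by simpa using hI)
      rw [sub_nonneg]
      refine one_div_le_one_div_of_le hpp ?_
      exact ENNReal.toReal_mono (by simp) hp2
    have h1 : eLpNorm (fun x : 𝔼 => eLpNorm (fun u => S u x) p (volume.restrict I)) p volume < ⊤ := by
      refine lt_of_le_of_lt (eLpNorm_le_nnreal_smul_eLpNorm_of_ae_le_mul' (c := c.toNNReal)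
        (g := fun x : 𝔼 => eLpNorm (fun u => S u x) 2 (volume.restrict I))
        (Eventually.of_forall fun x => ?_) p) ?_
      · rw [ENNReal.coe_toNNReal hct, mul_comm]
        simp only [enorm_eq_self]
        exact eLpNorm_le_eLpNorm_mul_rpow_measure_univ hp2 (hSx x).aestronglyMeasurable
      · exact ENNReal.mul_lt_top ENNReal.coe_lt_top hN.lt_top
    have h2 := (eLpNorm_lt_top_iff_lintegral_rpow_enorm_lt_top hp0 hp').1 h1
    refine lt_of_le_of_lt (le_of_eq (lintegral_congr fun x => ?_)) h2
    rw [eLpNorm_eq_lintegral_rpow_enorm_toReal hp0 hp', enorm_eq_self, ← ENNReal.rpow_mul,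
      one_div_mul_cancel hpp.ne', ENNReal.rpow_one]
    simp
  have hswap : ∫⁻ u in I, ∫⁻ x : 𝔼, S u x ^ p.toReal < ⊤ := by
    rw [lintegral_lintegral_swap (hSm.pow_const _).aemeasurable]
    exact hN'
  have hu : ∀ᵐ u ∂(volume.restrict I), ∫⁻ x : 𝔼, S u x ^ p.toReal < ⊤ :=
    ae_lt_top (hSm.pow_const _).lintegral_prod_right' hswap.ne
  have hae : ∀ᵐ u ∂(volume.restrict I), ∀ᵐ x : 𝔼, S u x < ⊤ := by
    filter_upwards [hu] with u hu
    have hm : Measurable fun x => S u x ^ p.toReal :=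
      (hSm.comp (measurable_const.prodMk measurable_id)).pow_const _
    filter_upwards [ae_lt_top hm hu.ne] with x hx
    exact (ENNReal.rpow_lt_top_iff_of_pos hpp).1 hx
  have hae' : ∀ᵐ x : 𝔼, ∀ᵐ u ∂(volume.restrict I), S u x < ⊤ := by
    have hm : Measurable fun x : 𝔼 => ∫⁻ u in I, S u x ^ p.toReal :=
      ((hSm.comp measurable_swap).pow_const _).lintegral_prod_right'
    filter_upwards [ae_lt_top hm hN'.ne] with x hx
    filter_upwards [ae_lt_top ((hSx x).pow_const _) hx.ne] with u hu
    exact (ENNReal.rpow_lt_top_iff_of_pos hpp).1 hu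
  set F : ℝ → 𝔼 → ℂ := fun u x => if S u x < ⊤ then ∑' k, G k u x else 0 with hF
  have hsm : ∀ {u x}, S u x < ⊤ → Summable fun k => ‖G k u x‖ := fun {u x} h => by
    have := ENNReal.summable_toReal h.ne
    simpa using this
  have hFs : ∀ {u x}, S u x < ⊤ → HasSum (fun k => G k u x) (F u x) := fun {u x} h => by
    simp only [hF, h, if_true]
    exact (hsm h).of_norm.hasSum
  have hFm : Measurable (Function.uncurry F) := by
    have : Function.uncurry F = {q : ℝ × 𝔼 | Function.uncurry S q < ⊤}.indicator
        (fun q => ∑' k, G k q.1 q.2) := by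
      ext q
      simp only [Set.indicator_apply, Set.mem_ofPred_eq]
      rfl
    rw [this]
    exact (Measurable.tsum fun k => hG k).indicator (measurableSet_lt hSm measurable_const)
  refine ⟨F, hFm, ?_, ?_⟩
  · filter_upwards [hae'] with x hx
    filter_upwards [hx] with u hu
    exact hFs hu
  · filter_upwards [hu, hae] with u hu hau
    have hFum : Measurable (F u) := hFm.comp (measurable_const.prodMk measurable_id)
    have hSu : Measurable (S u) := hSm.comp (measurable_const.prodMk measurable_id)
    have hT : MemLp (fun x => ((S u x).toReal : ℂ)) p := by
      refine ⟨(Complex.measurable_ofReal.comp hSu.ennreal_toReal).aestronglyMeasurable, ?_⟩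
      rw [eLpNorm_lt_top_iff_lintegral_rpow_enorm_lt_top hp0 hp']
      refine lt_of_le_of_lt (lintegral_mono fun x => ?_) hu
      gcongr
      rw [← ofReal_norm, Complex.norm_real, Real.norm_of_nonneg ENNReal.toReal_nonneg]
      exact ENNReal.ofReal_toReal_le
    have htsum : ∀ x, ∑' k, ‖G k u x‖ = (S u x).toReal := fun x => by
      simp only [hS]
      rw [ENNReal.tsum_toReal_eq (by simp)]
      simp
    have hFle : ∀ x, ‖F u x‖ ≤ (S u x).toReal := fun x => by
      by_cases h : S u x < ⊤
      · rw [← htsum]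
        simp only [hF, h, if_true]
        exact norm_tsum_le_tsum_norm (hsm h)
      · simp [hF, h]
    refine ⟨hT.mono hFum.aestronglyMeasurable (Eventually.of_forall fun x => ?_), fun φ => ?_⟩
    · rw [Complex.norm_real, Real.norm_of_nonneg ENNReal.toReal_nonneg]
      exact hFle x
    · refine hasSum_integral_of_dominated_convergence (fun k x => ‖φ x‖ * ‖G k u x‖) (fun k => ?_)
        (fun k => Eventually.of_forall fun x => (norm_mul _ _).le) ?_ ?_ ?_
      · exact φ.continuous.aestronglyMeasurable.mul
          ((hG k).comp (measurable_const.prodMk measurable_id)).aestronglyMeasurable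
      · filter_upwards [hau] with x hx
        exact (hsm hx).mul_left _
      · simp only [tsum_mul_left, htsum]
        refine (integrable_schwartz_mul hp φ hT).norm.congr (Eventually.of_forall fun x => ?_)
        simp only [norm_mul, Complex.norm_real, Real.norm_of_nonneg ENNReal.toReal_nonneg]
      · filter_upwards [hau] with x hx
        exact (hFs hx).mul_left _

end Series

/-! ### Distributional Fourier transforms of limits, and exhausting cutoffs -/

section Versions

open Filter Topology

/-- The function `g` defines a tempered distribution whose Fourier transform is the function
`H`. -/
def HasFourier (g H : 𝔼 → ℂ) : Prop :=
  ∃ w : 𝓢'(𝔼, ℂ), IsFunction w g ∧ IsFunction (𝓕 w) H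

lemma hasFourier_of_memLp {p : ℝ≥0∞} (hp : 1 ≤ p) {g H : 𝔼 → ℂ} (hg : MemLp g p)
    (h : ∀ φ : 𝓢(𝔼, ℂ), Integrable (fun x => φ x * H x) ∧
      ∫ x, (𝓕 φ : 𝓢(𝔼, ℂ)) x * g x = ∫ x, φ x * H x) : HasFourier g H := by
  have : Fact (1 ≤ p) := ⟨hp⟩
  have hw := (isFunction_toTemperedDistribution (hg.toLp g)).congr_ae hg.coeFn_toLp
  refine ⟨_, hw, fun φ => ⟨(h φ).1, ?_⟩⟩
  rw [TemperedDistribution.fourier_apply, (hw (𝓕 φ)).2, (h φ).2]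

lemma HasFourier.integral_eq {g H : 𝔼 → ℂ} (h : HasFourier g H) (φ : 𝓢(𝔼, ℂ)) :
    Integrable (fun x => φ x * H x) ∧
      ∫ x, (𝓕 φ : 𝓢(𝔼, ℂ)) x * g x = ∫ x, φ x * H x := by
  obtain ⟨w, hg, hH⟩ := h
  refine ⟨(hH φ).1, ?_⟩
  rw [← (hH φ).2, TemperedDistribution.fourier_apply, (hg (𝓕 φ)).2]

/-- Both sides, tested against a Schwartz function, are limits of the same partial sums. Only
convergence of these pairings is needed for the transforms. -/
lemma hasFourier_of_series {p : ℝ≥0∞} (hp : 1 ≤ p) {F : 𝔼 → ℂ} {G : ℕ → 𝔼 → ℂ} (hF : MemLp F p)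
    (hs : ∀ φ : 𝓢(𝔼, ℂ), HasSum (fun k => ∫ x, φ x * G k x) (∫ x, φ x * F x))
    {H : ℕ → 𝔼 → ℂ} {h : 𝔼 → ℂ}
    (hG : ∀ k (φ : 𝓢(𝔼, ℂ)), ∫ x, (𝓕 φ : 𝓢(𝔼, ℂ)) x * G k x = ∫ x, φ x * H k x)
    (hh : ∀ φ : 𝓢(𝔼, ℂ), Integrable (fun x => φ x * h x) ∧
      Tendsto (fun K => ∑ k ∈ Finset.range K, ∫ x, φ x * H k x) atTop (𝓝 (∫ x, φ x * h x))) :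
    HasFourier F h := by
  refine hasFourier_of_memLp hp hF fun φ => ⟨(hh φ).1, ?_⟩
  have h1 := (hs (𝓕 φ)).tendsto_sum_nat
  simp only [hG] at h1
  exact tendsto_nhds_unique h1 (hh φ).2

lemma norm_sym (ζ : ℂ) (u : ℝ) (ξ : 𝔼) :
    ‖sym n lam ζ u ξ‖ = (1 + ‖(2 * Real.pi) • ξ‖ ^ 2) ^ (-ζ.re / 2) := by
  rw [sym, norm_mul, phase, Complex.norm_exp, Complex.norm_cpow_eq_rpow_re_of_pos (by positivity)]
  simp

lemma norm_sym_le_one {ζ : ℂ} (hζ : 0 ≤ ζ.re) (u : ℝ) (ξ : 𝔼) : ‖sym n lam ζ u ξ‖ ≤ 1 := by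
  rw [norm_sym]
  exact Real.rpow_le_one_of_one_le_of_nonpos (by nlinarith [sq_nonneg ‖(2 * Real.pi) • ξ‖])
    (by linarith)

lemma norm_symCut_le_one {ζ : ℂ} (hζ : 0 ≤ ζ.re) (s t u : ℝ) (ξ : 𝔼) :
    ‖symCut n lam ζ (cut s t) u ξ‖ ≤ 1 := by
  rw [symCut, norm_mul]
  exact mul_le_one₀ (norm_sym_le_one hζ u ξ) (norm_nonneg _) (norm_cut_le_one s t ξ)

/-- A sequence of cutoffs exhausting the frequency space. -/
noncomputable def cutSeq (n k : ℕ) : EuclideanSpace ℝ (Fin n) → ℂ :=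
  cut (1 / (k + 1 : ℝ)) (k + 1)

lemma cutSeq_pos (k : ℕ) : (0 : ℝ) < 1 / (k + 1 : ℝ) := by positivity

lemma cutSeq_le (k : ℕ) : (1 / (k + 1 : ℝ) : ℝ) ≤ k + 1 := by
  rw [div_le_iff₀ (by positivity)]
  nlinarith [(Nat.cast_nonneg k : (0 : ℝ) ≤ k)]

lemma eventually_cutSeq_eq_one {ξ : 𝔼} (hξ : ξ ≠ 0) : ∀ᶠ k in atTop, cutSeq n k ξ = 1 := by
  have hξ' : 0 < ‖ξ‖ := norm_pos_iff.2 hξ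
  obtain ⟨k₀, hk₀⟩ := exists_nat_ge (max ‖ξ‖ (2 / ‖ξ‖))
  filter_upwards [eventually_ge_atTop k₀] with k hk
  have hk' : (k₀ : ℝ) ≤ k := by exact_mod_cast hk
  refine cut_eq_one (by positivity) (by positivity) ?_ ?_
  · rw [mul_one_div, div_le_iff₀ (by positivity), ← div_le_iff₀' hξ']
    linarith [(le_max_right ‖ξ‖ (2 / ‖ξ‖))]
  · linarith [(le_max_left ‖ξ‖ (2 / ‖ξ‖))]

/-- Dominated convergence with majorant 2|h|. The cutoffs all vanish at the origin, which is a null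
set because n ≥ 1. -/
lemma tendsto_eLpNorm_cutSeq (hn : 1 ≤ n) {h : 𝔼 → ℂ} (hh : MemLp h 2) :
    Tendsto (fun k => eLpNorm (fun ξ => (cutSeq n k ξ - 1) * h ξ) 2) atTop (𝓝 0) := by
  have : Nonempty (Fin n) := ⟨⟨0, hn⟩⟩
  have hcont : ∀ k, Continuous (cutSeq n k) := fun k => (contDiff_cut _ _).continuous
  have key : Tendsto (fun k => ∫⁻ ξ, ‖(cutSeq n k ξ - 1) * h ξ‖ₑ ^ 2) atTop
      (𝓝 (∫⁻ _ : 𝔼, 0)) := by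
    refine tendsto_lintegral_of_dominated_convergence' (fun ξ => (2 * ‖h ξ‖ₑ) ^ 2) (fun k => ?_)
      (fun k => Eventually.of_forall fun ξ => ?_) ?_ ?_
    · exact ((((hcont k).sub continuous_const).aestronglyMeasurable.mul hh.1).enorm.pow_const 2)
    · simp only [enorm_mul]
      gcongr
      refine enorm_sub_le.trans ?_
      have : ‖cutSeq n k ξ‖ₑ ≤ 1 := by
        rw [← ofReal_norm]
        exact ENNReal.ofReal_le_one.2 (norm_cut_le_one _ _ _)
      calc _ ≤ (1 : ℝ≥0∞) + 1 := by gcongr; simp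
        _ = 2 := one_add_one_eq_two
    · simp only [mul_pow]
      rw [lintegral_const_mul' _ _ (by simp), ← eLpNorm_two_sq]
      exact ENNReal.mul_ne_top (by simp) (ENNReal.pow_ne_top hh.2.ne)
    · have h0 : ∀ᵐ ξ : 𝔼, ξ ≠ 0 := by
        have : (volume : Measure 𝔼) {0} = 0 := measure_singleton _
        exact measure_eq_zero_iff_ae_notMem.1 this
      filter_upwards [h0] with ξ hξ
      refine tendsto_const_nhds.congr' ?_
      filter_upwards [eventually_cutSeq_eq_one hξ] with k hk
      simp [hk]
  simp only [lintegral_zero] at key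
  have := (ENNReal.continuous_rpow_const (y := (1 / 2 : ℝ))).continuousAt.tendsto.comp key
  rw [ENNReal.zero_rpow_of_pos (by norm_num)] at this
  refine this.congr fun k => ?_
  exact lintegral_sq_eq_eLpNorm _ _

end Versions
end SquareFunction

namespace SquareFunction

open scoped ContDiff

variable {n : ℕ} {lam : ℝ}

local notation "𝔼" => EuclideanSpace ℝ (Fin n)

/-! ### Construction and uniqueness of versions -/

section Versions

open Filter Topology

/-- The terms of the series whose partial sums are the given sequence. -/
def diffSeq {M : Type*} [AddCommGroup M] (f : ℕ → M) : ℕ → M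
  | 0 => f 0
  | k + 1 => f (k + 1) - f k

lemma sum_diffSeq {M : Type*} [AddCommGroup M] (f : ℕ → M) (K : ℕ) :
    ∑ k ∈ Finset.range (K + 1), diffSeq f k = f K := by
  induction K with
  | zero => simp [diffSeq]
  | succ K ih => rw [Finset.sum_range_succ, ih, diffSeq, add_sub_cancel]

lemma fourierInv_sub' {f g : 𝔼 → ℂ} (hf : Integrable f) (hg : Integrable g) (x : 𝔼) :
    𝓕⁻ (f - g) x = 𝓕⁻ f x - 𝓕⁻ g x := by
  have := fourierInv_sum_mul Finset.univ ![1, -1] (f := ![f, g])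
    (by simp [Fin.forall_fin_two, hf, hg]) x
  simp only [Fin.sum_univ_two, Matrix.cons_val_zero, Matrix.cons_val_one, one_mul, neg_mul,
    ← sub_eq_add_neg] at this
  exact this

lemma mixedNorm_two_le (I : Set ℝ) {F : ℝ → 𝔼 → ℂ} (hF : Measurable (Function.uncurry F)) {B : ℝ≥0∞}
    (h : ∀ u, eLpNorm (F u) 2 ≤ B) : mixedNorm 2 I F ≤ (volume I) ^ (1 / 2 : ℝ) * B := by
  have h1 : mixedNorm 2 I F ^ 2 ≤ ((volume I) ^ (1 / 2 : ℝ) * B) ^ 2 := by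
    rw [mixedNorm_two I hF, mul_pow]
    have : ((volume I) ^ (1 / 2 : ℝ)) ^ 2 = volume I := by
      rw [← ENNReal.rpow_natCast, ← ENNReal.rpow_mul]
      norm_num
    rw [this]
    calc _ ≤ ∫⁻ _u in I, B ^ 2 := lintegral_mono fun u => by gcongr; exact h u
      _ = _ := by rw [setLIntegral_const, mul_comm]
  exact (ENNReal.pow_le_pow_left_iff two_ne_zero).1 h1

lemma eLpNorm_symCut_sub_le {ζ : ℂ} (hζ : 0 ≤ ζ.re) (j k : ℕ) (u : ℝ) {h : 𝔼 → ℂ}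
    (hh : MemLp h 2) :
    eLpNorm (fun ξ => symCut n lam ζ (cutSeq n j) u ξ * h ξ -
        symCut n lam ζ (cutSeq n k) u ξ * h ξ) 2 ≤
      eLpNorm (fun ξ => (cutSeq n j ξ - 1) * h ξ) 2 +
        eLpNorm (fun ξ => (cutSeq n k ξ - 1) * h ξ) 2 := by
  have hc : ∀ k, AEStronglyMeasurable (fun ξ => (cutSeq n k ξ - 1) * h ξ) := fun k =>
    ((contDiff_cut _ _).continuous.sub continuous_const).aestronglyMeasurable.mul hh.1
  refine le_trans (eLpNorm_mono fun ξ => ?_) (eLpNorm_sub_le (hc j) (hc k) one_le_two)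
  have : symCut n lam ζ (cutSeq n j) u ξ * h ξ - symCut n lam ζ (cutSeq n k) u ξ * h ξ =
      sym n lam ζ u ξ * ((cutSeq n j ξ - 1) * h ξ - (cutSeq n k ξ - 1) * h ξ) := by
    simp only [symCut]
    ring
  rw [this, norm_mul]
  exact mul_le_of_le_one_left (norm_nonneg _) (norm_sym_le_one hζ u ξ)

lemma add_half_pow_le {a b : ℝ≥0∞} {j : ℕ} (ha : a ≤ (1 / 2) ^ (j + 1)) (hb : b ≤ (1 / 2) ^ j) :
    a + b ≤ 2 * (1 / 2) ^ j := by
  have h2 : (1 / 2 : ℝ≥0∞) ^ (j + 1) ≤ (1 / 2) ^ j := by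
    rw [pow_succ]
    exact mul_le_of_le_one_right' (by simp)
  rw [two_mul]
  exact add_le_add (ha.trans h2) hb

/-- The truncations converge in L², uniformly in `u`, because the symbol is bounded by 1. Along a
subsequence the increments are geometrically small, so the telescoping series converges in the mixed
L² norm to a jointly measurable function with the right transform for almost every `u`. This
function is also an almost everywhere limit of truncations, so Fatou gives it every mixed norm bound
that the truncations satisfy uniformly, for exponents other than 2 too. -/
lemma exists_version_of_memLp_two (hn : 1 ≤ n) {ζ : ℂ} (hζ : 0 ≤ ζ.re) {I : Set ℝ}
    (hI : volume I ≠ ⊤) {f : 𝔼 → ℂ} (hf : Integrable f) (hf2 : MemLp f 2) :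
    ∃ F : ℝ → 𝔼 → ℂ, Measurable (Function.uncurry F) ∧
      (∀ᵐ u ∂(volume.restrict I), HasFourier (F u) (fun ξ => sym n lam ζ u ξ * 𝓕 f ξ)) ∧
      ∀ p : ℝ≥0∞, p ≠ 0 → p ≠ ⊤ → ∀ B : ℝ≥0∞,
        (∀ s t : ℝ, 0 < s → s ≤ t →
          mixedNorm p I (mulOp (symCut n lam ζ (cut s t)) f) ≤ B) → mixedNorm p I F ≤ B := by
  have : Nonempty (Fin n) := ⟨⟨0, hn⟩⟩
  have hF2 := memLp_fourier hf hf2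
  set e : ℕ → ℝ≥0∞ := fun k => eLpNorm (fun ξ => (cutSeq n k ξ - 1) * 𝓕 f ξ) 2 with he
  have he0 := tendsto_eLpNorm_cutSeq hn hF2
  -- The error 2^(-j) makes the increments summable; j ≤ k forces the chosen indices to infinity, so
  -- that the cutoffs still tend to 1 pointwise.
  have hex : ∀ j : ℕ, ∃ k, e k ≤ (1 / 2 : ℝ≥0∞) ^ j ∧ j ≤ k := fun j =>
    (((he0.eventually_le_const (ENNReal.pow_pos (by simp) j)).and
      (eventually_ge_atTop j)).exists)
  choose κ hκe hκ using hex
  set b : ℕ → ℝ → 𝔼 → ℂ := fun j => symCut n lam ζ (cutSeq n (κ j)) with hb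
  have hnice : ∀ j, IsNice (b j) := fun j => isNice_symCut ζ (cutSeq_pos _) (cutSeq_le _)
  have hb1 : ∀ j u ξ, ‖b j u ξ‖ ≤ 1 := fun j u ξ => norm_symCut_le_one hζ _ _ u ξ
  have hint : ∀ j u, Integrable fun ξ => b j u ξ * 𝓕 f ξ := fun j u =>
    integrable_mul_fourier ((hnice j).cont u) ((hnice j).supp u) hf
  have hmem : ∀ j u, MemLp (fun ξ => b j u ξ * 𝓕 f ξ) 2 := fun j u =>
    memLp_mul_fourier ((hnice j).cont u) ((hnice j).supp u) hf 2
  set H : ℕ → ℝ → 𝔼 → ℂ := diffSeq fun j u ξ => b j u ξ * 𝓕 f ξ with hH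
  set G : ℕ → ℝ → 𝔼 → ℂ := diffSeq fun j => mulOp (b j) f with hG
  have hHi : ∀ j u, Integrable (H j u) := fun j u => by
    cases j with
    | zero => exact hint 0 u
    | succ j => exact (hint (j + 1) u).sub (hint j u)
  have hH2 : ∀ j u, MemLp (H j u) 2 := fun j u => by
    cases j with
    | zero => exact hmem 0 u
    | succ j => exact (hmem (j + 1) u).sub (hmem j u)
  have hGm : ∀ j, Measurable (Function.uncurry (G j)) := fun j => by
    cases j with
    | zero => exact measurable_mulOp (hnice 0).meas hf
    | succ j =>
      exact (measurable_mulOp (hnice (j + 1)).meas hf).sub (measurable_mulOp (hnice j).meas hf)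
  have hGH : ∀ j u, G j u = 𝓕⁻ (H j u) := fun j u => by
    cases j with
    | zero => rfl
    | succ j =>
      ext x
      exact (fourierInv_sub' (hint (j + 1) u) (hint j u) x).symm
  have hGn : ∀ j u, eLpNorm (G (j + 1) u) 2 ≤ 2 * (1 / 2 : ℝ≥0∞) ^ j := fun j u => by
    rw [hGH, eLpNorm_fourierInv (hHi _ u) (hH2 _ u)]
    have hHs : H (j + 1) u = fun ξ => symCut n lam ζ (cutSeq n (κ (j + 1))) u ξ * 𝓕 f ξ -
        symCut n lam ζ (cutSeq n (κ j)) u ξ * 𝓕 f ξ := rfl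
    have h1 := eLpNorm_symCut_sub_le (lam := lam) hζ (κ (j + 1)) (κ j) u hF2
    rw [← hHs] at h1
    exact h1.trans (add_half_pow_le (hκe (j + 1)) (hκe j))
  have hV : (volume I) ^ (1 / 2 : ℝ) ≠ ⊤ := ENNReal.rpow_ne_top_of_nonneg (by norm_num) hI
  have hsum : ∑' k, mixedNorm 2 I (G k) ≠ ⊤ := by
    rw [tsum_eq_zero_add' ENNReal.summable]
    refine ENNReal.add_ne_top.2 ⟨?_, ?_⟩
    · have hG0 : G 0 = mulOp (b 0) f := rfl
      have h0 := mixedNorm_two_le I (hG0 ▸ hGm 0) fun u =>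
        eLpNorm_mulOp_le (hnice 0) (hb1 0) hf hf2 u
      rw [hG0]
      exact ne_top_of_le_ne_top (ENNReal.mul_ne_top hV hf2.2.ne) h0
    · refine ne_top_of_le_ne_top ?_ (ENNReal.tsum_le_tsum fun j =>
        mixedNorm_two_le I (hGm (j + 1)) (hGn j))
      rw [ENNReal.tsum_mul_left, ENNReal.tsum_mul_left, ENNReal.tsum_geometric]
      refine ENNReal.mul_ne_top hV (ENNReal.mul_ne_top (by simp) ?_)
      simp
  obtain ⟨F, hFm, hFs, hF⟩ := exists_hasSum_of_mixedNorm one_le_two le_rfl hI hGm hsum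
  refine ⟨F, hFm, ?_, fun p hp0 hp B hB => ?_⟩
  · filter_upwards [hF] with u hu
    refine hasFourier_of_series one_le_two hu.1 hu.2 (H := fun k => H k u) (fun k φ => ?_)
      fun φ => ⟨?_, ?_⟩
    · rw [hGH, integral_fourierInv_mul_fourier (hHi k u)]
    · have hm : MemLp (fun ξ => sym n lam ζ u ξ * 𝓕 f ξ) 2 := by
        refine hF2.mono ?_ (Eventually.of_forall fun ξ => ?_)
        · exact ((measurable_sym ζ).comp
            (measurable_const.prodMk measurable_id)).aestronglyMeasurable.mul hF2.1
        · rw [norm_mul]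
          exact mul_le_of_le_one_left (norm_nonneg _) (norm_sym_le_one hζ u ξ)
      exact integrable_schwartz_mul one_le_two φ hm
    · rw [← tendsto_add_atTop_iff_nat 1]
      have hs : ∀ K, ∑ k ∈ Finset.range (K + 1), ∫ x, φ x * H k u x =
          ∫ x, φ x * (b K u x * 𝓕 f x) := fun K => by
        rw [← integral_finsetSum _ fun k _ => integrable_schwartz_mul one_le_two φ (hH2 k u)]
        refine integral_congr_ae (Eventually.of_forall fun x => ?_)
        simp only [← Finset.mul_sum]
        congr 1
        have := congrFun (congrFun (sum_diffSeq (fun j u ξ => b j u ξ * 𝓕 f ξ) K) u) x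
        simpa [Finset.sum_apply] using this
      simp only [hs]
      refine tendsto_integral_of_dominated_convergence (fun x => ‖φ x * 𝓕 f x‖)
        (fun K => (integrable_schwartz_mul one_le_two φ (hmem K u)).1)
        (integrable_schwartz_mul one_le_two φ hF2).norm (fun K => Eventually.of_forall fun x => ?_) ?_
      · rw [norm_mul, norm_mul, norm_mul]
        gcongr
        exact mul_le_of_le_one_left (norm_nonneg _) (hb1 K u x)
      · have h0 : ∀ᵐ ξ : 𝔼, ξ ≠ 0 := by
          have : (volume : Measure 𝔼) {0} = 0 := measure_singleton _
          exact measure_eq_zero_iff_ae_notMem.1 this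
        filter_upwards [h0] with ξ hξ
        refine tendsto_const_nhds.congr' ?_
        have hκt : Tendsto κ atTop atTop := tendsto_atTop_mono hκ tendsto_id
        filter_upwards [hκt.eventually (eventually_cutSeq_eq_one hξ)] with j hj
        simp [hb, symCut, hj]
  · refine mixedNorm_le_of_tendsto hp0 hp I (G := fun k => mulOp (b k) f)
      (fun k => measurable_mulOp (hnice k).meas hf) ?_
      (Eventually.of_forall fun k => hB _ _ (cutSeq_pos _) (cutSeq_le _))
    filter_upwards [hFs] with x hx
    filter_upwards [hx] with u hu
    have := (tendsto_add_atTop_iff_nat 1).2 hu.tendsto_sum_nat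
    refine this.congr fun K => ?_
    have := congrFun (congrFun (sum_diffSeq (fun j => mulOp (b j) f) K) u) x
    simpa [Finset.sum_apply] using this

/-- Every Schwartz function is a Fourier transform, so a tempered distribution is determined by its
transform. -/
lemma HasFourier.ae_eq {g g' H : 𝔼 → ℂ} (h : HasFourier g H) (h' : HasFourier g' H) :
    g =ᵐ[volume] g' := by
  obtain ⟨w, hg, hw⟩ := h
  obtain ⟨w', hg', hw'⟩ := h'
  have : w = w' := by
    ext φ
    obtain ⟨ψ, rfl⟩ : ∃ ψ : 𝓢(𝔼, ℂ), φ = 𝓕 ψ := ⟨𝓕⁻ φ, by simp⟩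
    rw [← TemperedDistribution.fourier_apply, ← TemperedDistribution.fourier_apply, (hw ψ).2,
      (hw' ψ).2]
  subst this
  exact hg.ae_eq hg'

lemma IsMultiplierImage.hasFourier {m : 𝔼 → ℂ} {v : 𝓢'(𝔼, ℂ)} {g h : 𝔼 → ℂ}
    (hg : IsMultiplierImage m v g) (hh : IsFunction (𝓕 v) h) :
    HasFourier g (fun ξ => m ((2 * Real.pi) • ξ) * h ξ) := by
  obtain ⟨h', w, hh', hw, hm⟩ := hg
  refine ⟨w, hw, hm.congr_ae ?_⟩
  filter_upwards [hh'.ae_eq hh] with x hx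
  rw [hx]

lemma HasFourier.isMultiplierImage {m : 𝔼 → ℂ} {v : 𝓢'(𝔼, ℂ)} {g h : 𝔼 → ℂ}
    (hg : HasFourier g (fun ξ => m ((2 * Real.pi) • ξ) * h ξ)) (hh : IsFunction (𝓕 v) h) :
    IsMultiplierImage m v g := by
  obtain ⟨w, hw, hm⟩ := hg
  exact ⟨h, w, hh, hw, hm⟩

/-- A version is determined almost everywhere on the product, so an estimate for one constructed
version holds for all. -/
lemma IsVersion.mixedNorm_eq {p : ℝ≥0∞} {I : Set ℝ} {m : ℝ → 𝔼 → ℂ} {v : 𝓢'(𝔼, ℂ)} {h : 𝔼 → ℂ}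
    {F F' : ℝ → 𝔼 → ℂ} (hF : IsVersion I m v F) (hh : IsFunction (𝓕 v) h)
    (hm : Measurable (Function.uncurry F'))
    (hF' : ∀ᵐ u ∂(volume.restrict I), HasFourier (F' u) (fun ξ => m u ((2 * Real.pi) • ξ) * h ξ)) :
    mixedNorm p I F = mixedNorm p I F' := by
  refine mixedNorm_congr_ae p I (ae_swap (P := fun u x => F u x = F' u x) ?_)
  have h1 : ∀ᵐ u ∂(volume.restrict I), ∀ᵐ x, F u x = F' u x := by
    filter_upwards [hF.2, hF'] with u hu hu'
    exact (hu.hasFourier hh).ae_eq hu'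
  have h2 := hF.1.ae_eq_mk
  have h3 : ∀ᵐ u ∂(volume.restrict I), ∀ᵐ x, hF.1.mk _ (u, x) = Function.uncurry F' (u, x) := by
    filter_upwards [h1, Measure.ae_ae_of_ae_prod h2] with u hu hu'
    filter_upwards [hu, hu'] with x hx hx'
    rw [← hx']
    exact hx
  -- Passing from "for almost every u, for almost every x" to the product measure needs a measurable
  -- set, hence the measurable representative of F.
  have h4 := (Measure.ae_prod_iff_ae_ae (measurableSet_eq_fun
    hF.1.stronglyMeasurable_mk.measurable hm)).2 h3
  filter_upwards [h2, h4] with q hq hq'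
  exact hq.trans hq'

end Versions
end SquareFunction

namespace SquareFunction

open scoped ContDiff

variable {n : ℕ} {lam : ℝ}

local notation "𝔼" => EuclideanSpace ℝ (Fin n)

/-! ### Atomic sums and the Hardy space estimate -/

section HardySpace

open Filter Topology

lemma fourier_sub' {f g : 𝔼 → ℂ} (hf : Integrable f) (hg : Integrable g) (x : 𝔼) :
    𝓕 (fun x => f x - g x) x = 𝓕 f x - 𝓕 g x := by
  have := fourier_sum_mul Finset.univ ![1, -1] (f := ![f, g])
    (by simp [Fin.forall_fin_two, hf, hg]) x
  simp only [Fin.sum_univ_two, Matrix.cons_val_zero, Matrix.cons_val_one, one_mul, neg_mul,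
    ← sub_eq_add_neg] at this
  exact this

/-- Convergence in L¹ gives uniform convergence of the Fourier transforms. -/
lemma tendsto_integral_mul_fourier {f : 𝔼 → ℂ} {g : ℕ → 𝔼 → ℂ} (hf : Integrable f)
    (hg : ∀ k, Integrable (g k)) (h : Tendsto (fun k => eLpNorm (g k - f) 1) atTop (𝓝 0))
    {ψ : 𝔼 → ℂ} (hψ : Integrable ψ) :
    Tendsto (fun k => ∫ x, ψ x * 𝓕 (g k) x) atTop (𝓝 (∫ x, ψ x * 𝓕 f x)) := by
  have hi : ∀ {g : 𝔼 → ℂ}, Integrable g → Integrable fun x => ψ x * 𝓕 g x := fun {g} hg =>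
    hψ.mul_bdd (continuous_fourier hg).aestronglyMeasurable (Eventually.of_forall (norm_fourier_le g))
  rw [tendsto_iff_norm_sub_tendsto_zero]
  have h1 : Tendsto (fun k => (∫ x, ‖ψ x‖) * (eLpNorm (g k - f) 1).toReal) atTop (𝓝 0) := by
    have := (ENNReal.tendsto_toReal ENNReal.zero_ne_top).comp h
    simpa using this.const_mul (∫ x, ‖ψ x‖)
  refine squeeze_zero (fun _ => norm_nonneg _) (fun k => ?_) h1
  rw [← integral_sub (hi (hg k)) (hi hf), ← integral_mul_const]
  refine norm_integral_le_of_norm_le (hψ.norm.mul_const _) (Eventually.of_forall fun x => ?_)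
  rw [← mul_sub, norm_mul]
  gcongr
  rw [← fourier_sub' (hg k) hf]
  refine (norm_fourier_le _ x).trans (le_of_eq ?_)
  rw [eLpNorm_one_eq_lintegral_enorm]
  exact integral_norm_eq_lintegral_enorm ((hg k).sub hf).1

lemma integrable_schwartz_mul_sym (φ : 𝓢(𝔼, ℂ)) {ζ : ℂ} (hζ : 0 ≤ ζ.re) (u : ℝ) :
    Integrable fun x => φ x * sym n lam ζ u x :=
  integrable_schwartz_mul_bounded φ
    ((measurable_sym ζ).comp (measurable_const.prodMk measurable_id)).aestronglyMeasurable
    (norm_sym_le_one hζ u)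

/-- Setting the atom to zero where the support or size condition fails changes it on a null set only
and makes the conditions pointwise. -/
lemma IsAtom.exists_isCenteredAtom {a : Lp ℂ 1 (volume : Measure 𝔼)} (ha : IsAtom a) :
    ∃ (x₀ : 𝔼) (r : ℝ) (f : 𝔼 → ℂ), a =ᵐ[volume] f ∧ IsCenteredAtom r (fun x => f (x + x₀)) := by
  obtain ⟨x₀, r, hr, hs, hb, hm⟩ := ha
  classical
  set f : 𝔼 → ℂ := fun x => if x ∈ Metric.closedBall x₀ r ∧ ‖a x‖ ≤ (r ^ n)⁻¹ then a x else 0 with hf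
  have hfa : a =ᵐ[volume] f := by
    filter_upwards [hs, hb] with x hx hx'
    by_cases h : x ∈ Metric.closedBall x₀ r
    · simp [hf, hx', Metric.mem_closedBall.1 h]
    · simp [hf, hx h]
  refine ⟨x₀, r, f, hfa, hr, ?_, fun x hx => ?_, fun x => ?_, ?_⟩
  · exact ((Lp.aestronglyMeasurable a).congr hfa).comp_quasiMeasurePreserving
      (measurePreserving_add_right volume x₀).quasiMeasurePreserving
  · have : x + x₀ ∉ Metric.closedBall x₀ r := by
      simpa [Metric.mem_closedBall, dist_eq_norm] using hx
    simp only [hf, this, false_and, if_false]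
  · simp only [hf]
    split_ifs with h
    · exact h.2
    · rw [norm_zero]
      positivity
  · rw [integral_add_right_eq_self, ← integral_congr_ae hfa, hm]

lemma IsCenteredAtom.memLp_of_translate {r : ℝ} {x₀ : 𝔼} {f : 𝔼 → ℂ}
    (hf : IsCenteredAtom r (fun x => f (x + x₀))) (p : ℝ≥0∞) : MemLp f p := by
  have h := (hf.memLp_iterate (v := 0) (by simp) 0 p).comp_measurePreserving
    (measurePreserving_add_right volume (-x₀))
  refine h.ae_eq (Eventually.of_forall fun x => ?_)
  simp

lemma fourier_lp_sum (c : ℕ → ℂ) (a : ℕ → Lp ℂ 1 (volume : Measure 𝔼)) (K : ℕ) (ξ : 𝔼) :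
    𝓕 (⇑(∑ k ∈ Finset.range K, c k • a k) : 𝔼 → ℂ) ξ =
      ∑ k ∈ Finset.range K, c k * 𝓕 (a k : 𝔼 → ℂ) ξ := by
  rw [← fourier_sum_mul _ _ fun k _ => L1.integrable_coeFn (a k)]
  have : (⇑(∑ k ∈ Finset.range K, c k • a k) : 𝔼 → ℂ) =ᵐ[volume]
      fun x => ∑ k ∈ Finset.range K, c k * a k x := by
    refine (Lp.coeFn_fun_finsetSum _ _).trans ?_
    filter_upwards [ae_all_iff.2 fun k => Lp.coeFn_smul (c k) (a k)] with x hx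
    exact Finset.sum_congr rfl fun k _ => hx k
  rw [fourier_congr_ae this]

lemma HasFourier.const_mul_integral {g H : 𝔼 → ℂ} (h : HasFourier g H) (c : ℂ) (φ : 𝓢(𝔼, ℂ)) :
    ∫ x, (𝓕 φ : 𝓢(𝔼, ℂ)) x * (c * g x) = ∫ x, φ x * (c * H x) := by
  simp only [mul_left_comm _ c]
  rw [integral_const_mul, integral_const_mul, (h.integral_eq φ).2]

/-- The operator on a sum of atoms. -/
lemma exists_version_of_decomposition (hn : 1 ≤ n) {I : Set ℝ} (hI : volume I ≠ ⊤) {ζ : ℂ}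
    (hζ : 0 ≤ ζ.re) {B : ℝ≥0∞} (hBt : B ≠ ⊤)
    (hB : ∀ (s t r : ℝ) (x₀ : 𝔼) (f : 𝔼 → ℂ), 0 < s → s ≤ t →
      IsCenteredAtom r (fun x => f (x + x₀)) →
      mixedNorm 1 I (mulOp (symCut n lam ζ (cut s t)) f) ≤ B)
    {c : ℕ → ℂ} {a : ℕ → Lp ℂ 1 (volume : Measure 𝔼)} {f : Lp ℂ 1 (volume : Measure 𝔼)}
    (hf : IsAtomicDecomposition c a f) :
    ∃ F : ℝ → 𝔼 → ℂ, Measurable (Function.uncurry F) ∧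
      (∀ᵐ u ∂(volume.restrict I), HasFourier (F u) (fun ξ => sym n lam ζ u ξ * 𝓕 (f : 𝔼 → ℂ) ξ)) ∧
      mixedNorm 1 I F ≤ B * ∑' j, ‖c j‖ₑ := by
  obtain ⟨ha, hc, hs⟩ := hf
  choose x₀ r g hag hg using fun j => (ha j).exists_isCenteredAtom
  -- Atoms are in L¹ and L², so each has a version from the L² construction, and the atomic bound on
  -- truncations passes to it. The series with coefficients c_j then converges absolutely in L¹(L²).
  have hFj := fun j => exists_version_of_memLp_two (lam := lam) hn hζ hI
    (memLp_one_iff_integrable.1 ((hg j).memLp_of_translate 1)) ((hg j).memLp_of_translate 2)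
  choose F hFm hF hFB using hFj
  have hFB' : ∀ j, mixedNorm 1 I (F j) ≤ B := fun j => hFB j 1 (by simp) (by simp) B
    fun s t hs hst => hB s t (r j) (x₀ j) (g j) hs hst (hg j)
  set G : ℕ → ℝ → 𝔼 → ℂ := fun j u x => c j * F j u x with hG
  have hGm : ∀ j, Measurable (Function.uncurry (G j)) := fun j => (hFm j).const_mul _
  have hGB : ∀ j, mixedNorm 1 I (G j) ≤ B * ‖c j‖ₑ := fun j =>
    (mixedNorm_const_mul_le 1 I _ _).trans (by rw [mul_comm B]; gcongr; exact hFB' j)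
  have hsumB : ∑' j, mixedNorm 1 I (G j) ≤ B * ∑' j, ‖c j‖ₑ := by
    rw [← ENNReal.tsum_mul_left]
    exact ENNReal.tsum_le_tsum hGB
  have hct : ∑' j, ‖c j‖ₑ ≠ ⊤ := by
    simp only [← ofReal_norm]
    exact hc.tsum_ofReal_ne_top
  obtain ⟨Φ, hΦm, hΦs, hΦ⟩ := exists_hasSum_of_mixedNorm le_rfl one_le_two hI hGm
    (ne_top_of_le_ne_top (ENNReal.mul_ne_top hBt hct) hsumB)
  refine ⟨Φ, hΦm, ?_, ?_⟩
  · filter_upwards [hΦ, ae_all_iff.2 hF] with u hu hFu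
    refine hasFourier_of_series le_rfl hu.1 hu.2
      (H := fun k ξ => c k * (sym n lam ζ u ξ * 𝓕 (g k) ξ))
      (fun k φ => (hFu k).const_mul_integral (c k) φ) fun φ => ?_
    have hψ := integrable_schwartz_mul_sym (lam := lam) φ hζ u
    have hmul : ∀ {g : 𝔼 → ℂ}, Integrable g →
        Integrable fun x => (φ x * sym n lam ζ u x) * 𝓕 g x := fun {g} hg =>
      hψ.mul_bdd (continuous_fourier hg).aestronglyMeasurable
        (Eventually.of_forall (norm_fourier_le g))
    have hgi : ∀ k, Integrable (g k) := fun k =>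
      memLp_one_iff_integrable.1 ((hg k).memLp_of_translate 1)
    refine ⟨?_, ?_⟩
    · simpa only [mul_assoc] using hmul (L1.integrable_coeFn f)
    -- The partial sums converge to `f` in L¹ and the multiplier is bounded, so the transform of the
    -- limit is identified by testing; no prior boundedness of the operator on its domain is used.
    · have ht := tendsto_integral_mul_fourier (L1.integrable_coeFn f)
        (g := fun K => ⇑(∑ k ∈ Finset.range K, c k • a k)) (fun K => L1.integrable_coeFn _) ?_ hψ
      · simp only [mul_assoc] at ht
        refine ht.congr fun K => ?_
        rw [← integral_finsetSum]
        · refine integral_congr_ae (Eventually.of_forall fun x => ?_)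
          simp only [fourier_lp_sum, Finset.mul_sum]
          refine Finset.sum_congr rfl fun k _ => ?_
          rw [fourier_congr_ae (hag k)]
          ring
        · intro k _
          refine ((hmul (hgi k)).const_mul (c k)).congr (Eventually.of_forall fun x => ?_)
          simp only
          ring
      · have h1 := tendsto_iff_norm_sub_tendsto_zero.1 hs.tendsto_sum_nat
        have h2 := ENNReal.tendsto_ofReal h1
        rw [ENNReal.ofReal_zero] at h2
        refine h2.congr fun K => ?_
        rw [Lp.norm_def, ENNReal.ofReal_toReal (Lp.eLpNorm_ne_top _)]
        exact eLpNorm_congr_ae (Lp.coeFn_sub _ _)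
  · refine mixedNorm_le_of_tendsto one_ne_zero ENNReal.one_ne_top I
      (G := fun K u x => ∑ k ∈ Finset.range K, G k u x) (fun K => measurable_sum_uncurry _ hGm) ?_
      (Eventually.of_forall fun K => ?_)
    · filter_upwards [hΦs] with x hx
      filter_upwards [hx] with u hu
      exact hu.tendsto_sum_nat
    · exact (mixedNorm_sum_le le_rfl I _ hGm).trans ((ENNReal.sum_le_tsum _).trans hsumB)

variable (n) in
-- Each atomic decomposition yields its own version with the bound by its coefficient sum. All
-- versions have the same mixed norm, so the infimum over decompositions may be taken.
theorem hardy_bound (hn : 1 ≤ n) (hlam : 1 < lam) (a b : ℝ) :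
    ∃ (C : ℝ) (N : ℕ), ∀ (γ : ℝ)
      (f : Lp ℂ 1 (volume : Measure (EuclideanSpace ℝ (Fin n)))), MemHardy f →
      (∃ F, IsVersion (Set.Icc a b) (symbol n lam (n * lam / 2) γ)
        (f : 𝓢'(EuclideanSpace ℝ (Fin n), ℂ)) F) ∧
      ∀ F, IsVersion (Set.Icc a b) (symbol n lam (n * lam / 2) γ)
          (f : 𝓢'(EuclideanSpace ℝ (Fin n), ℂ)) F →
        mixedNorm 1 (Set.Icc a b) F ≤ ENNReal.ofReal (C * (1 + |γ|) ^ N) * hardyNorm f := by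
  obtain ⟨C, hC, h⟩ := exists_mixedNorm_atom_le (n := n) hn hlam (Set.Icc a b)
    (Metric.isBounded_Icc a b) measurableSet_Icc
  -- The constant must be nonzero for the multiplication to pass through the infimum in [0, ∞].
  refine ⟨C + 1, n, fun γ f hf => ?_⟩
  set B := ENNReal.ofReal ((C + 1) * (1 + |γ|) ^ n) with hB
  have hB0 : B ≠ 0 := by
    rw [hB, ENNReal.ofReal_ne_zero_iff]
    positivity
  have hζ : 0 ≤ (critExp n lam γ).re := by
    simp only [critExp, Complex.add_re, Complex.ofReal_re, Complex.mul_re, Complex.I_re,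
      Complex.ofReal_im, Complex.I_im]
    have : 0 ≤ n * lam / 2 := by positivity
    linarith
  have hI : volume (Set.Icc a b) ≠ ⊤ := by simp
  have key := fun {c : ℕ → ℂ} {α : ℕ → Lp ℂ 1 (volume : Measure (EuclideanSpace ℝ (Fin n)))}
      (hd : IsAtomicDecomposition c α f) =>
    exists_version_of_decomposition hn hI hζ (ENNReal.ofReal_ne_top (r := (C + 1) * (1 + |γ|) ^ n))
      (fun s t r x₀ f hs hst hf => (h γ s t r x₀ f hs hst hf).trans
        (ENNReal.ofReal_le_ofReal (by gcongr; linarith))) hd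
  have hfun := isFunction_fourier_L1 f
  constructor
  · obtain ⟨c, α, hd⟩ := hf
    obtain ⟨F, hFm, hF, -⟩ := key hd
    refine ⟨F, hFm.aestronglyMeasurable, ?_⟩
    filter_upwards [hF] with u hu
    exact HasFourier.isMultiplierImage hu hfun
  · intro F hF
    rw [hardyNorm]
    simp only [ENNReal.mul_iInf_of_ne hB0 ENNReal.ofReal_ne_top]
    refine le_iInf fun c => le_iInf fun α => le_iInf fun hd => ?_
    obtain ⟨F', hFm, hF', hle⟩ := key hd
    rw [hF.mixedNorm_eq hfun hFm hF']
    exact hle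

end HardySpace
end SquareFunction

namespace SquareFunction

variable {n : ℕ}

local notation "𝔼" => EuclideanSpace ℝ (Fin n)

/-! ### Integration over sets that are unions of fibers of a countable partition -/

section Partition

lemma iUnion_inter_fiber {X ι : Type*} (π : X → ι) (S : Set X) : ⋃ i, S ∩ π ⁻¹' {i} = S := by
  ext x
  simp

lemma pairwise_disjoint_inter_fiber {X ι : Type*} (π : X → ι) (S : Set X) :
    Pairwise (Function.onFun Disjoint fun i => S ∩ π ⁻¹' {i}) := fun _ _ hij =>
  Set.disjoint_left.2 fun _ hx hx' => hij (hx.2.symm.trans hx'.2)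

lemma inter_fiber_eq {X ι : Type*} {π : X → ι} {S : Set X} (hS : ∀ x ∈ S, ∀ y, π y = π x → y ∈ S) {x : X} (hx : x ∈ S) :
    S ∩ π ⁻¹' {π x} = π ⁻¹' {π x} :=
  Set.inter_eq_right.2 fun y hy => hS x hx y hy

variable {X ι : Type*} [MeasurableSpace X] {μ : Measure X} [Countable ι] [MeasurableSpace ι]
  [MeasurableSingletonClass ι] {π : X → ι}

/-- The set S is saturated: it is the countable disjoint union of the fibers that meet it. For the
Calderón–Zygmund argument, fibers are stopping cubes. -/
lemma setIntegral_eq_of_fibers (hπ : Measurable π) {S : Set X} (hSm : MeasurableSet S)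
    (hS : ∀ x ∈ S, ∀ y, π y = π x → y ∈ S) {f g : X → ℂ} (hf : Integrable f μ) (hg : Integrable g μ)
    (h : ∀ x ∈ S, ∫ y in π ⁻¹' {π x}, f y ∂μ = ∫ y in π ⁻¹' {π x}, g y ∂μ) :
    ∫ y in S, f y ∂μ = ∫ y in S, g y ∂μ := by
  have hm : ∀ i, MeasurableSet (S ∩ π ⁻¹' {i}) := fun i => hSm.inter (hπ (measurableSet_singleton i))
  have key : ∀ {f : X → ℂ}, Integrable f μ →
      HasSum (fun i => ∫ y in S ∩ π ⁻¹' {i}, f y ∂μ) (∫ y in S, f y ∂μ) := fun {f} hf => by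
    have := hasSum_integral_iUnion hm (pairwise_disjoint_inter_fiber π S) hf.integrableOn
    rwa [iUnion_inter_fiber] at this
  refine (key hf).unique ((key hg).congr_fun ?_)
  intro i
  by_cases hne : (S ∩ π ⁻¹' {i}).Nonempty
  · obtain ⟨x, hx, rfl⟩ := hne
    rw [inter_fiber_eq hS hx]
    exact (h x hx)
  · rw [Set.not_nonempty_iff_eq_empty.1 hne]
    simp

lemma setLIntegral_le_of_fibers (hπ : Measurable π) {S : Set X} (hSm : MeasurableSet S)
    (hS : ∀ x ∈ S, ∀ y, π y = π x → y ∈ S) {f g : X → ℝ≥0∞}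
    (h : ∀ x ∈ S, ∫⁻ y in π ⁻¹' {π x}, f y ∂μ ≤ ∫⁻ y in π ⁻¹' {π x}, g y ∂μ) :
    ∫⁻ y in S, f y ∂μ ≤ ∫⁻ y in S, g y ∂μ := by
  have hm : ∀ i, MeasurableSet (S ∩ π ⁻¹' {i}) := fun i => hSm.inter (hπ (measurableSet_singleton i))
  have key : ∀ f : X → ℝ≥0∞, ∫⁻ y in S, f y ∂μ = ∑' i, ∫⁻ y in S ∩ π ⁻¹' {i}, f y ∂μ := fun f => by
    rw [← lintegral_iUnion hm (pairwise_disjoint_inter_fiber π S), iUnion_inter_fiber]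
  rw [key f, key g]
  refine ENNReal.tsum_le_tsum fun i => ?_
  by_cases hne : (S ∩ π ⁻¹' {i}).Nonempty
  · obtain ⟨x, hx, rfl⟩ := hne
    rw [inter_fiber_eq hS hx]
    exact h x hx
  · rw [Set.not_nonempty_iff_eq_empty.1 hne]
    simp

/-- If the fibers in a set of finite measure have measure bounded below, there are finitely many of
them. -/
lemma finite_image_of_fibers (hπ : Measurable π) {S : Set X} (hSm : MeasurableSet S)
    (hS : ∀ x ∈ S, ∀ y, π y = π x → y ∈ S) (hμ : μ S ≠ ⊤) {ε : ℝ≥0∞} (hε : ε ≠ 0)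
    (h : ∀ x ∈ S, ε ≤ μ (π ⁻¹' {π x})) : (π '' S).Finite ∧ ∀ s : Finset ι, (s : Set ι) ⊆ π '' S →
      ∑ i ∈ s, μ (π ⁻¹' {i}) ≤ μ S := by
  have hm : ∀ i, MeasurableSet (S ∩ π ⁻¹' {i}) := fun i => hSm.inter (hπ (measurableSet_singleton i))
  have key : μ S = ∑' i, μ (S ∩ π ⁻¹' {i}) := by
    rw [← measure_iUnion (pairwise_disjoint_inter_fiber π S) hm, iUnion_inter_fiber]
  constructor
  · refine (ENNReal.finite_const_le_of_tsum_ne_top (key ▸ hμ) hε).subset ?_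
    rintro _ ⟨x, hx, rfl⟩
    simp only [Set.mem_ofPred_eq, inter_fiber_eq hS hx]
    exact h x hx
  · intro s hs
    rw [key]
    refine le_trans (Finset.sum_le_sum fun i hi => ?_) (ENNReal.sum_le_tsum s)
    obtain ⟨x, hx, rfl⟩ := hs hi
    rw [inter_fiber_eq hS hx]

end Partition

/-! ### Dyadic cubes -/

section DyadicCubes

/-- The index of the dyadic cube of side `2^{-k}` containing `x`. -/
noncomputable def grid (n : ℕ) (k : ℤ) (x : EuclideanSpace ℝ (Fin n)) : Fin n → ℤ :=
  fun i => ⌊(2 : ℝ) ^ k * x i⌋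

/-- The dyadic cube of side `2^{-k}` containing `x`. -/
def cube (k : ℤ) (x : 𝔼) : Set 𝔼 := {y | grid n k y = grid n k x}

/-- The volume of a dyadic cube. -/
noncomputable def cubeVol (n : ℕ) (k : ℤ) : ℝ := ((2 : ℝ) ^ (-k)) ^ n

lemma cubeVol_pos (k : ℤ) : 0 < cubeVol n k := by
  unfold cubeVol
  positivity

lemma measurable_grid (k : ℤ) : Measurable (grid n k) := by
  unfold grid
  refine measurable_pi_lambda _ fun i => Int.measurable_floor.comp ?_
  fun_prop

lemma measurableSet_cube (k : ℤ) (x : 𝔼) : MeasurableSet (cube k x) :=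
  measurable_grid k (measurableSet_singleton _)

lemma cube_congr {k : ℤ} {x y : 𝔼} (h : grid n k y = grid n k x) : cube k y = cube k x := by
  unfold cube
  rw [h]

/-- Nesting of dyadic cubes: the coarse index is the integer quotient of the fine one by a power of
2. -/
lemma grid_eq_of_le {k l : ℤ} (hkl : k ≤ l) {x y : 𝔼} (h : grid n l y = grid n l x) :
    grid n k y = grid n k x := by
  obtain ⟨m, rfl⟩ := Int.le.dest hkl
  have key : ∀ z : 𝔼, ∀ i, grid n k z i = grid n (k + m) z i / ((2 ^ m : ℕ) : ℤ) := fun z i => by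
    simp only [grid]
    rw [← Int.floor_div_natCast]
    congr 1
    push_cast
    rw [zpow_add₀ two_ne_zero, zpow_natCast]
    field_simp
  ext i
  rw [key, key, h]

lemma cube_subset {k l : ℤ} (hkl : k ≤ l) (x : 𝔼) : cube l x ⊆ cube k x :=
  fun _ h => grid_eq_of_le hkl h

lemma volume_cube (k : ℤ) (x : 𝔼) : volume (cube k x) = ENNReal.ofReal (cubeVol n k) := by
  have h2 : (0 : ℝ) < 2 ^ k := by positivity
  have : cube k x = WithLp.ofLp ⁻¹' (Set.univ.pi fun i => Set.Ico ((grid n k x i : ℝ) * 2 ^ (-k))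
      (((grid n k x i : ℝ) + 1) * 2 ^ (-k))) := by
    ext y
    simp only [cube, Set.mem_ofPred_eq, Set.mem_preimage, Set.mem_univ_pi, Set.mem_Ico, funext_iff]
    refine forall_congr' fun i => ?_
    rw [show grid n k y i = ⌊(2 : ℝ) ^ k * y i⌋ from rfl, Int.floor_eq_iff, zpow_neg,
      ← div_eq_mul_inv, ← div_eq_mul_inv, div_le_iff₀' h2, lt_div_iff₀' h2]
  rw [this, (PiLp.volume_preserving_ofLp (Fin n)).measure_preimage
    (MeasurableSet.univ_pi fun i => measurableSet_Ico).nullMeasurableSet, Real.volume_pi_Ico]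
  rw [cubeVol, ENNReal.ofReal_pow (by positivity)]
  simp [add_mul]

lemma norm_sub_le_of_mem_cube {k : ℤ} {x y : 𝔼} (h : y ∈ cube k x) :
    ‖y - x‖ ≤ √n * 2 ^ (-k) := by
  have h2 : (0 : ℝ) < 2 ^ k := by positivity
  have hi : ∀ i, ((y - x) i) ^ 2 ≤ ((2 : ℝ) ^ (-k)) ^ 2 := fun i => by
    have h1 : ⌊(2 : ℝ) ^ k * y i⌋ = ⌊(2 : ℝ) ^ k * x i⌋ := congrFun h i
    have h3 := Int.abs_sub_lt_one_of_floor_eq_floor h1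
    rw [← mul_sub, abs_mul, abs_of_pos h2] at h3
    rw [sq_le_sq, abs_of_pos (by positivity : (0 : ℝ) < 2 ^ (-k)), zpow_neg, ← one_div,
      le_div_iff₀' h2]
    exact h3.le
  rw [EuclideanSpace.norm_eq, ← Real.sqrt_sq (by positivity : (0 : ℝ) ≤ 2 ^ (-k)),
    ← Real.sqrt_mul (by positivity)]
  refine Real.sqrt_le_sqrt ?_
  calc _ ≤ ∑ _i : Fin n, ((2 : ℝ) ^ (-k)) ^ 2 := by
        refine Finset.sum_le_sum fun i _ => ?_
        rw [Real.norm_eq_abs, sq_abs]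
        exact hi i
    _ = _ := by simp

/-- The function is constant on the dyadic cubes of side `2^{-K}`. -/
def IsStep {β : Type*} (K : ℤ) (f : 𝔼 → β) : Prop := ∀ x y, grid n K y = grid n K x → f y = f x

lemma IsStep.measurable {β : Type*} [MeasurableSpace β] [Nonempty β] {K : ℤ} {f : 𝔼 → β}
    (hf : IsStep K f) : Measurable f := by
  have : f = Function.extend (grid n K) f (fun _ => Classical.arbitrary β) ∘ grid n K := by
    ext x
    exact (Function.FactorsThrough.extend_apply (fun a b h => hf b a h) _ x).symm
  rw [this]
  exact (measurable_of_countable _).comp (measurable_grid K)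

end DyadicCubes

/-! ### Stopping cubes and stopped averages -/

section Stopping

/-- The average of `|g|` over a dyadic cube. -/
noncomputable def cubeAvg (g : 𝔼 → ℂ) (k : ℤ) (x : 𝔼) : ℝ := (cubeVol n k)⁻¹ * ∫ y in cube k x, ‖g y‖

lemma cubeAvg_congr (g : 𝔼 → ℂ) {k : ℤ} {x y : 𝔼} (h : grid n k y = grid n k x) :
    cubeAvg g k y = cubeAvg g k x := by
  unfold cubeAvg
  rw [cube_congr h]

/-- The first scale at which the average of `|g|` exceeds `α`, stopped at the scale `K`. -/
noncomputable def stopScale (K : ℤ) (g : 𝔼 → ℂ) (α : ℝ) (x : 𝔼) : ℤ :=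
  sInf {k | k ≤ K ∧ (k = K ∨ α < cubeAvg g k x)}

/-- The union of the cubes of scale at most `K` on which the average of `|g|` exceeds `α`. -/
def bigSet (K : ℤ) (g : 𝔼 → ℂ) (α : ℝ) : Set 𝔼 := {x | ∃ k ≤ K, α < cubeAvg g k x}

/-- The average of `g` over the stopping cube. -/
noncomputable def stopAvg (K : ℤ) (g : 𝔼 → ℂ) (α : ℝ) (x : 𝔼) : ℂ :=
  ((cubeVol n (stopScale K g α x))⁻¹ : ℝ) * ∫ y in cube (stopScale K g α x) x, g y

/-- The partition into stopping cubes. -/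
noncomputable def stopCell (K : ℤ) (g : 𝔼 → ℂ) (α : ℝ) (x : 𝔼) : ℤ × (Fin n → ℤ) :=
  (stopScale K g α x, grid n (stopScale K g α x) x)

variable {K : ℤ} {g : EuclideanSpace ℝ (Fin n) → ℂ} {α : ℝ}

lemma cubeAvg_le (hg : Integrable g) (k : ℤ) (x : 𝔼) :
    cubeAvg g k x ≤ (cubeVol n k)⁻¹ * ∫ y, ‖g y‖ := by
  unfold cubeAvg
  have := (cubeVol_pos (n := n) k).le
  gcongr
  · exact Filter.Eventually.of_forall fun _ => norm_nonneg _
  · exact hg.norm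
  · exact Measure.restrict_le_self

/-- The average over a cube is at most ‖g‖₁ divided by its volume, which tends to 0 for large cubes
since n ≥ 1. So only finitely many scales up to `K` can have average above α, and a first one
exists. -/
lemma bddBelow_stop (hn : 1 ≤ n) (hg : Integrable g) (hα : 0 < α) (x : 𝔼) :
    BddBelow {k | k ≤ K ∧ (k = K ∨ α < cubeAvg g k x)} := by
  set N := ∫ y, ‖g y‖ with hN
  have hN0 : 0 ≤ N := integral_nonneg fun _ => norm_nonneg _
  obtain ⟨m, hm⟩ := pow_unbounded_of_one_lt (N / α) (one_lt_two : (1 : ℝ) < 2)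
  refine ⟨min K (-m), fun k hk => ?_⟩
  rcases hk with ⟨hkK, rfl | hk⟩
  · exact min_le_left _ _
  refine (min_le_right _ _).trans ?_
  by_contra hlt
  push Not at hlt
  obtain ⟨j, hj⟩ : ∃ j : ℕ, k = -(j : ℤ) := ⟨(-k).toNat, by omega⟩
  subst hj
  have hmj : m ≤ j := by omega
  have h1 : cubeVol n (-(j : ℤ)) = (2 ^ j) ^ n := by simp [cubeVol]
  have h2 := hk.trans_le (cubeAvg_le hg _ x)
  rw [h1, ← hN, inv_mul_eq_div, lt_div_iff₀ (by positivity)] at h2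
  rw [div_lt_iff₀ hα] at hm
  have h3 : (2 : ℝ) ^ m ≤ (2 ^ j) ^ n :=
    (pow_le_pow_right₀ one_le_two hmj).trans (le_self_pow₀ (one_le_pow₀ one_le_two) (by omega))
  nlinarith

lemma stopScale_mem (hn : 1 ≤ n) (hg : Integrable g) (hα : 0 < α) (x : 𝔼) :
    stopScale K g α x ∈ {k | k ≤ K ∧ (k = K ∨ α < cubeAvg g k x)} :=
  Int.csInf_mem ⟨K, le_rfl, Or.inl rfl⟩ (bddBelow_stop hn hg hα x)

lemma stopScale_le (hn : 1 ≤ n) (hg : Integrable g) (hα : 0 < α) {x : 𝔼} {k : ℤ} (hk : k ≤ K)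
    (h : k = K ∨ α < cubeAvg g k x) : stopScale K g α x ≤ k :=
  csInf_le (bddBelow_stop hn hg hα x) ⟨hk, h⟩

lemma cubeAvg_le_of_lt (hn : 1 ≤ n) (hg : Integrable g) (hα : 0 < α) {x : 𝔼} {k : ℤ}
    (hk : k < stopScale K g α x) : cubeAvg g k x ≤ α := by
  by_contra h
  exact absurd (stopScale_le hn hg hα (hk.le.trans (stopScale_mem hn hg hα x).1)
    (Or.inr (not_le.1 h))) (not_le.2 hk)

lemma lt_cubeAvg_of_mem (hn : 1 ≤ n) (hg : Integrable g) (hα : 0 < α) {x : 𝔼}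
    (hx : x ∈ bigSet K g α) : α < cubeAvg g (stopScale K g α x) x := by
  obtain ⟨k, hk, hlt⟩ := hx
  have h1 := stopScale_le hn hg hα hk (Or.inr hlt)
  rcases (stopScale_mem (K := K) hn hg hα x).2 with h | h
  · have : k = stopScale K g α x := le_antisymm (hk.trans_eq h.symm) h1
    rwa [← this]
  · exact h

/-- Points of the same stopping cube lie in the same cube at every coarser scale, so they see the
same averages up to the stop. This makes the stopping cubes a partition. -/
lemma stopScale_congr (hn : 1 ≤ n) (hg : Integrable g) (hα : 0 < α) {x y : 𝔼}
    (h : grid n (stopScale K g α x) y = grid n (stopScale K g α x) x) :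
    stopScale K g α y = stopScale K g α x := by
  have hA : ∀ k ≤ stopScale K g α x, cubeAvg g k y = cubeAvg g k x := fun k hk =>
    cubeAvg_congr g (grid_eq_of_le hk h)
  have hx := stopScale_mem (K := K) hn hg hα x
  have hy := stopScale_mem (K := K) hn hg hα y
  have h1 : stopScale K g α y ≤ stopScale K g α x :=
    stopScale_le hn hg hα hx.1 (by rw [hA _ le_rfl]; exact hx.2)
  refine le_antisymm h1 (stopScale_le hn hg hα hy.1 ?_)
  rw [← hA _ h1]
  exact hy.2

/-- A greater height stops later, that is, at a finer cube. Hence the stopping partitions for two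
heights are nested, which is the source of the mean value zero of their difference. -/
lemma stopScale_mono (hn : 1 ≤ n) (hg : Integrable g) (hα : 0 < α) {α' : ℝ} (h : α ≤ α') (x : 𝔼) :
    stopScale K g α x ≤ stopScale K g α' x := by
  have hx := stopScale_mem (K := K) hn hg (hα.trans_le h) x
  exact stopScale_le hn hg hα hx.1 (hx.2.imp_right fun h' => h.trans_lt h')

lemma isStep_stopScale (hn : 1 ≤ n) (hg : Integrable g) (hα : 0 < α) :
    IsStep K (stopScale K g α) := fun x _ h =>
  stopScale_congr hn hg hα (grid_eq_of_le (stopScale_mem hn hg hα x).1 h)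

lemma stopCell_eq_iff (hn : 1 ≤ n) (hg : Integrable g) (hα : 0 < α) {x y : 𝔼} :
    stopCell K g α y = stopCell K g α x ↔ y ∈ cube (stopScale K g α x) x := by
  simp only [stopCell, Prod.mk.injEq, cube, Set.mem_ofPred_eq]
  refine ⟨fun ⟨h1, h2⟩ => h1 ▸ h2, fun h => ?_⟩
  have := stopScale_congr hn hg hα h
  exact ⟨this, by rw [this, h]⟩

lemma stopCell_fiber (hn : 1 ≤ n) (hg : Integrable g) (hα : 0 < α) (x : 𝔼) :
    stopCell K g α ⁻¹' {stopCell K g α x} = cube (stopScale K g α x) x := by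
  ext y
  exact stopCell_eq_iff hn hg hα

lemma measurable_stopCell (hn : 1 ≤ n) (hg : Integrable g) (hα : 0 < α) :
    Measurable (stopCell K g α) :=
  IsStep.measurable (K := K) fun x _ h => (stopCell_eq_iff hn hg hα).2
    (grid_eq_of_le (stopScale_mem hn hg hα x).1 h)

lemma isStep_stopAvg (hn : 1 ≤ n) (hg : Integrable g) (hα : 0 < α) :
    IsStep K (stopAvg K g α) := fun x y h => by
  have h1 := isStep_stopScale hn hg hα x y h
  have h2 := grid_eq_of_le (stopScale_mem (K := K) hn hg hα x).1 h
  simp only [stopAvg, h1, cube_congr h2]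

lemma setIntegral_stopAvg (hn : 1 ≤ n) (hg : Integrable g) (hα : 0 < α) (x : 𝔼) :
    ∫ y in cube (stopScale K g α x) x, stopAvg K g α y = ∫ y in cube (stopScale K g α x) x, g y := by
  have h1 : ∀ y ∈ cube (stopScale K g α x) x, stopAvg K g α y = stopAvg K g α x := fun y hy => by
    have h2 := stopScale_congr hn hg hα hy
    simp only [stopAvg, h2, cube_congr hy]
  rw [setIntegral_congr_fun (measurableSet_cube _ _) h1, setIntegral_const, measureReal_def,
    volume_cube, ENNReal.toReal_ofReal (cubeVol_pos _).le, stopAvg, Complex.real_smul, ← mul_assoc,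
    ← Complex.ofReal_mul, mul_inv_cancel₀ (cubeVol_pos _).ne', Complex.ofReal_one, one_mul]

lemma norm_stopAvg_le_cubeAvg (x : 𝔼) :
    ‖stopAvg K g α x‖ ≤ cubeAvg g (stopScale K g α x) x := by
  rw [stopAvg, cubeAvg, norm_mul, Complex.norm_real, Real.norm_of_nonneg
    (inv_nonneg.2 (cubeVol_pos _).le)]
  have := (cubeVol_pos (n := n) (stopScale K g α x)).le
  gcongr
  exact norm_integral_le_integral_norm _

lemma cubeAvg_le_two_pow (hg : Integrable g) (k : ℤ) (x : 𝔼) :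
    cubeAvg g k x ≤ 2 ^ n * cubeAvg g (k - 1) x := by
  unfold cubeAvg
  have h1 : (cubeVol n k)⁻¹ = 2 ^ n * (cubeVol n (k - 1))⁻¹ := by
    simp only [cubeVol]
    rw [← inv_pow, ← inv_pow, ← mul_pow, ← zpow_neg, ← zpow_neg, neg_neg, neg_neg,
      zpow_sub_one₀ two_ne_zero]
    field_simp
  rw [h1, mul_assoc]
  have := (cubeVol_pos (n := n) (k - 1)).le
  gcongr
  · exact Filter.Eventually.of_forall fun _ => norm_nonneg _
  · exact hg.norm.integrableOn
  · exact cube_subset (by omega) x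

/-- The parent of a stopping cube has average at most α, and its volume is only 2^n times larger. -/
lemma norm_stopAvg_le (hn : 1 ≤ n) (hg : Integrable g) (hα : 0 < α) (x : 𝔼) :
    ‖stopAvg K g α x‖ ≤ 2 ^ n * α := by
  refine (norm_stopAvg_le_cubeAvg x).trans ((cubeAvg_le_two_pow hg _ x).trans ?_)
  gcongr
  exact cubeAvg_le_of_lt hn hg hα (sub_one_lt (stopScale K g α x))

lemma IsStep.integral_cube {f : 𝔼 → ℂ} (hf : IsStep K f) (x : 𝔼) :
    ∫ y in cube K x, f y = cubeVol n K * f x := by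
  rw [setIntegral_congr_fun (measurableSet_cube _ _) (fun y hy => hf x y hy), setIntegral_const,
    measureReal_def, volume_cube, ENNReal.toReal_ofReal (cubeVol_pos _).le, Complex.real_smul]

lemma IsStep.cubeAvg_eq (hs : IsStep K g) (x : 𝔼) : cubeAvg g K x = ‖g x‖ := by
  have h1 : ∀ y ∈ cube K x, ‖g y‖ = ‖g x‖ := fun y hy => by rw [hs x y hy]
  rw [cubeAvg, setIntegral_congr_fun (measurableSet_cube _ _) h1, setIntegral_const,
    measureReal_def, volume_cube, ENNReal.toReal_ofReal (cubeVol_pos _).le, smul_eq_mul,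
    inv_mul_cancel_left₀ (cubeVol_pos _).ne']

lemma stopScale_eq_of_notMem (hn : 1 ≤ n) (hg : Integrable g) (hα : 0 < α) {x : 𝔼}
    (hx : x ∉ bigSet K g α) : stopScale K g α x = K := by
  rcases (stopScale_mem (K := K) hn hg hα x) with ⟨h1, h | h⟩
  · exact h
  · exact absurd ⟨_, h1, h⟩ hx

/-- Off the exceptional set the stop occurs at the finest scale, on whose cubes g is constant. This
is where step functions simplify matters: no differentiation theorem is needed. -/
lemma stopAvg_eq_of_notMem (hn : 1 ≤ n) (hg : Integrable g) (hs : IsStep K g) (hα : 0 < α) {x : 𝔼}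
    (hx : x ∉ bigSet K g α) : stopAvg K g α x = g x := by
  rw [stopAvg, stopScale_eq_of_notMem hn hg hα hx, hs.integral_cube, ← mul_assoc,
    ← Complex.ofReal_mul, inv_mul_cancel₀ (cubeVol_pos _).ne', Complex.ofReal_one, one_mul]

lemma norm_le_of_notMem (hs : IsStep K g) {x : 𝔼} (hx : x ∉ bigSet K g α) : ‖g x‖ ≤ α := by
  rw [← hs.cubeAvg_eq]
  by_contra h
  exact hx ⟨K, le_rfl, not_le.1 h⟩

lemma isStep_mem_bigSet : IsStep K (fun x => x ∈ bigSet K g α) := fun x y h => by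
  simp only [bigSet, Set.mem_ofPred_eq, eq_iff_iff]
  refine exists_congr fun k => and_congr_right fun hk => ?_
  rw [cubeAvg_congr g (grid_eq_of_le hk h)]

lemma measurableSet_bigSet : MeasurableSet (bigSet K g α) :=
  measurableSet_setOfPred.2 (isStep_mem_bigSet (g := g)).measurable

lemma mem_bigSet_of_stopCell_eq (hn : 1 ≤ n) (hg : Integrable g) (hα : 0 < α) (x : 𝔼)
    (hx : x ∈ bigSet K g α) (y : 𝔼) (h : stopCell K g α y = stopCell K g α x) :
    y ∈ bigSet K g α := by
  have h1 := (stopCell_eq_iff hn hg hα).1 h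
  refine ⟨_, (stopScale_mem hn hg hα x).1, ?_⟩
  rw [cubeAvg_congr g h1]
  exact lt_cubeAvg_of_mem hn hg hα hx

lemma bigSet_eq_empty (hg : Integrable g) (h : ∀ x, ‖g x‖ ≤ α) : bigSet K g α = ∅ := by
  refine Set.eq_empty_of_forall_notMem fun x ⟨k, _, hk⟩ => not_le.2 hk ?_
  rw [cubeAvg, inv_mul_le_iff₀ (cubeVol_pos _)]
  calc _ ≤ ∫ _y in cube k x, α := by
        refine setIntegral_mono hg.norm.integrableOn ?_ fun y => h y
        exact integrableOn_const (by rw [volume_cube]; exact ENNReal.ofReal_ne_top)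
    _ = _ := by
      rw [setIntegral_const, measureReal_def, volume_cube, ENNReal.toReal_ofReal (cubeVol_pos _).le,
        smul_eq_mul]

end Stopping
end SquareFunction

namespace SquareFunction

variable {n : ℕ}

local notation "𝔼" => EuclideanSpace ℝ (Fin n)

/-! ### Geometric sums over integer exponents -/

section GeometricSums

lemma sum_two_rpow_le {a : ℝ} (ha : 0 < a) {S : Finset ℤ} {m : ℤ} (hS : ∀ j ∈ S, j ≤ m) :
    ∑ j ∈ S, (2 : ℝ) ^ ((j : ℝ) * a) ≤ (1 - (2 : ℝ) ^ (-a))⁻¹ * 2 ^ ((m : ℝ) * a) := by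
  have hq0 : (0 : ℝ) < 2 ^ (-a) := by positivity
  have hq1 : (2 : ℝ) ^ (-a) < 1 := Real.rpow_lt_one_of_one_lt_of_neg one_lt_two (by linarith)
  have h1 : ∀ j ∈ S, (2 : ℝ) ^ ((j : ℝ) * a) =
      ((2 : ℝ) ^ (-a)) ^ ((m - j).toNat) * 2 ^ ((m : ℝ) * a) := fun j hj => by
    have h2 : (((m - j).toNat : ℕ) : ℝ) = (m : ℝ) - j := by
      have : (((m - j).toNat : ℕ) : ℤ) = m - j := Int.toNat_of_nonneg (by linarith [hS j hj])
      exact_mod_cast this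
    rw [← Real.rpow_natCast, ← Real.rpow_mul (by norm_num), ← Real.rpow_add (by norm_num), h2]
    congr 1
    ring
  rw [Finset.sum_congr rfl h1, ← Finset.sum_mul]
  gcongr
  have hinj : Set.InjOn (fun j : ℤ => (m - j).toNat) S := fun i hi j hj h => by
    have := hS i hi
    have := hS j hj
    simp only at h
    omega
  rw [← Finset.sum_image (f := fun k => ((2 : ℝ) ^ (-a)) ^ k) hinj,
    ← tsum_geometric_of_lt_one hq0.le hq1]
  exact (summable_geometric_of_lt_one hq0.le hq1).sum_le_tsum _ fun _ _ => by positivity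

/-- A geometric sum is comparable with its largest term, so the square of the sum is controlled by
the sum of the squares. -/
lemma sq_sum_two_rpow_le {a : ℝ} (ha : 0 < a) (S : Finset ℤ) :
    (∑ j ∈ S, (2 : ℝ) ^ ((j : ℝ) * a)) ^ 2 ≤
      ((1 - (2 : ℝ) ^ (-a))⁻¹) ^ 2 * ∑ j ∈ S, (2 : ℝ) ^ ((j : ℝ) * (2 * a)) := by
  rcases S.eq_empty_or_nonempty with rfl | hne
  · simp
  have hm := Finset.max'_mem S hne
  set m := S.max' hne
  have h1 := sum_two_rpow_le ha (S := S) (m := m) fun j hj => S.le_max' j hj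
  calc _ ≤ ((1 - (2 : ℝ) ^ (-a))⁻¹ * 2 ^ ((m : ℝ) * a)) ^ 2 :=
        pow_le_pow_left₀ (by positivity) h1 2
    _ = ((1 - (2 : ℝ) ^ (-a))⁻¹) ^ 2 * 2 ^ ((m : ℝ) * (2 * a)) := by
        rw [mul_pow, ← Real.rpow_natCast (2 ^ ((m : ℝ) * a)), ← Real.rpow_mul (by norm_num)]
        congr 2
        push_cast
        ring
    _ ≤ _ := by
        gcongr
        exact Finset.single_le_sum (f := fun j : ℤ => (2 : ℝ) ^ ((j : ℝ) * (2 * a)))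
          (fun _ _ => by positivity) hm

lemma sum_two_rpow_filter_le {a : ℝ} (ha : 0 < a) (S : Finset ℤ) {y : ℝ} (hy : 0 ≤ y) :
    ∑ j ∈ S.filter fun j : ℤ => (2 : ℝ) ^ (j : ℝ) / 2 < y, (2 : ℝ) ^ ((j : ℝ) * a) ≤
      (1 - (2 : ℝ) ^ (-a))⁻¹ * (2 * y) ^ a := by
  have hq1 : (2 : ℝ) ^ (-a) < 1 := Real.rpow_lt_one_of_one_lt_of_neg one_lt_two (by linarith)
  have hpos : 0 < (1 - (2 : ℝ) ^ (-a))⁻¹ := inv_pos.2 (by linarith)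
  set T := S.filter fun j : ℤ => (2 : ℝ) ^ (j : ℝ) / 2 < y with hT
  rcases T.eq_empty_or_nonempty with h | hne
  · rw [h]
    simp only [Finset.sum_empty]
    positivity
  have hm := Finset.max'_mem T hne
  refine (sum_two_rpow_le ha (S := T) (m := T.max' hne) fun j hj => T.le_max' j hj).trans ?_
  have h2 := (Finset.mem_filter.1 hm).2
  rw [Real.rpow_mul (by norm_num)]
  gcongr
  linarith

end GeometricSums

/-! ### Measure of the exceptional sets and decomposition into atoms -/

section CalderonZygmund

variable {K : ℤ} {g : EuclideanSpace ℝ (Fin n) → ℂ} {α : ℝ}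

/-- On a stopping cube Q the integral of |g| exceeds α|Q|, while the points with |g| ≤ α/2
contribute at most α|Q|/2. So the points with |g| > α/2 contribute at least α|Q|/2, and the cubes
are disjoint. Keeping the restriction to large values of g is what allows summation over all
heights. -/
lemma measure_bigSet_mul_le (hn : 1 ≤ n) (hg : Integrable g) (hα : 0 < α) :
    ENNReal.ofReal (α / 2) * volume (bigSet K g α) ≤
      ∫⁻ x, {x | α / 2 < ‖g x‖}.indicator (fun x => ‖g x‖ₑ) x := by
  have h := setLIntegral_le_of_fibers (μ := volume) (measurable_stopCell (K := K) hn hg hα)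
    measurableSet_bigSet (mem_bigSet_of_stopCell_eq hn hg hα) (f := fun _ => ENNReal.ofReal (α / 2))
    (g := {x | α / 2 < ‖g x‖}.indicator (fun x => ‖g x‖ₑ)) fun x hx => ?_
  · rw [setLIntegral_const] at h
    exact h.trans (setLIntegral_le_lintegral _ _)
  rw [stopCell_fiber hn hg hα, setLIntegral_const]
  set Q := cube (stopScale K g α x) x
  have hQ : volume Q = ENNReal.ofReal (cubeVol n (stopScale K g α x)) := volume_cube _ _
  have hv := cubeVol_pos (n := n) (stopScale K g α x)
  have h1 : ENNReal.ofReal (α / 2) * volume Q + ENNReal.ofReal (α / 2) * volume Q ≤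
      ∫⁻ y in Q, ‖g y‖ₑ := by
    have h2 := lt_cubeAvg_of_mem hn hg hα hx
    rw [cubeAvg, inv_mul_eq_div, lt_div_iff₀ hv] at h2
    rw [← add_mul, ← ENNReal.ofReal_add (by positivity) (by positivity), add_halves, hQ,
      ← ENNReal.ofReal_mul hα.le]
    refine (ENNReal.ofReal_le_ofReal h2.le).trans (le_of_eq ?_)
    rw [ofReal_integral_norm_eq_lintegral_enorm hg.integrableOn]
  have h3 : ∫⁻ y in Q, ‖g y‖ₑ ≤ (∫⁻ y in Q, {x | α / 2 < ‖g x‖}.indicator (fun x => ‖g x‖ₑ) y) +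
      ENNReal.ofReal (α / 2) * volume Q := by
    rw [← setLIntegral_const, ← lintegral_add_right _ measurable_const]
    refine lintegral_mono fun y => ?_
    by_cases hy : α / 2 < ‖g y‖
    · rw [Set.indicator_of_mem (by exact hy)]
      exact le_self_add
    · rw [Set.indicator_of_notMem (by exact hy), zero_add, ← ofReal_norm]
      exact ENNReal.ofReal_le_ofReal (not_lt.1 hy)
  refine (ENNReal.add_le_add_iff_right ?_).1 (h1.trans h3)
  rw [hQ]
  exact ENNReal.mul_ne_top ENNReal.ofReal_ne_top ENNReal.ofReal_ne_top

lemma measure_bigSet_mul_le' (hn : 1 ≤ n) (hg : Integrable g) (hα : 0 < α) :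
    ENNReal.ofReal (α / 2) * volume (bigSet K g α) ≤ ∫⁻ x, ‖g x‖ₑ :=
  (measure_bigSet_mul_le hn hg hα).trans (lintegral_mono fun x => Set.indicator_le_self _ _ x)

lemma measure_bigSet_ne_top (hn : 1 ≤ n) (hg : Integrable g) (hα : 0 < α) :
    volume (bigSet K g α) ≠ ⊤ := fun h => by
  have := measure_bigSet_mul_le' (K := K) hn hg hα
  rw [h, ENNReal.mul_top (by simpa using hα)] at this
  exact (hg.2.ne (top_le_iff.1 this))

lemma norm_stopAvg_le_indicator (hn : 1 ≤ n) (hg : Integrable g) (hs : IsStep K g) (hα : 0 < α)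
    (x : 𝔼) : ‖stopAvg K g α x‖ ≤ (bigSet K g α).indicator (fun _ => 2 ^ n * α) x + ‖g x‖ := by
  by_cases hx : x ∈ bigSet K g α
  · rw [Set.indicator_of_mem hx]
    linarith [norm_stopAvg_le (K := K) hn hg hα x, norm_nonneg (g x)]
  · rw [Set.indicator_of_notMem hx, stopAvg_eq_of_notMem hn hg hs hα hx, zero_add]

lemma integrable_stopAvg (hn : 1 ≤ n) (hg : Integrable g) (hs : IsStep K g) (hα : 0 < α) :
    Integrable (stopAvg K g α) := by
  refine Integrable.mono' (((integrable_indicator_iff measurableSet_bigSet).2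
    (integrableOn_const (measure_bigSet_ne_top hn hg hα))).add hg.norm)
    (isStep_stopAvg hn hg hα).measurable.aestronglyMeasurable
    (Filter.Eventually.of_forall (norm_stopAvg_le_indicator hn hg hs hα))

/-- On the exceptional set, of measure at most 2‖g‖₁/α, the stopped average is at most 2^n α;
elsewhere it is g with |g|² ≤ α|g|. The factor α makes the L² norm vanish as the height tends to 0.
-/
lemma lintegral_stopAvg_sq_le (hn : 1 ≤ n) (hg : Integrable g) (hs : IsStep K g) (hα : 0 < α) :
    ∫⁻ x, ‖stopAvg K g α x‖ₑ ^ 2 ≤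
      ENNReal.ofReal ((2 * (2 ^ n) ^ 2 + 1) * α) * ∫⁻ x, ‖g x‖ₑ := by
  have h1 : ∀ x, ‖stopAvg K g α x‖ₑ ^ 2 ≤
      (bigSet K g α).indicator (fun _ => ENNReal.ofReal (2 ^ n * α) ^ 2) x +
        ENNReal.ofReal α * ‖g x‖ₑ := fun x => by
    by_cases hx : x ∈ bigSet K g α
    · rw [Set.indicator_of_mem hx]
      refine le_add_right ?_
      gcongr
      rw [← ofReal_norm]
      exact ENNReal.ofReal_le_ofReal (norm_stopAvg_le hn hg hα x)
    · rw [Set.indicator_of_notMem hx, stopAvg_eq_of_notMem hn hg hs hα hx, zero_add, sq]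
      gcongr
      rw [← ofReal_norm]
      exact ENNReal.ofReal_le_ofReal (norm_le_of_notMem hs hx)
  refine (lintegral_mono h1).trans ?_
  rw [lintegral_add_left (measurable_const.indicator measurableSet_bigSet),
    lintegral_indicator measurableSet_bigSet, setLIntegral_const,
    lintegral_const_mul' _ _ ENNReal.ofReal_ne_top, add_mul, one_mul,
    ENNReal.ofReal_add (by positivity) hα.le, add_mul]
  gcongr ?_ + _
  have h2 : ENNReal.ofReal (2 ^ n * α) ^ 2 =
      ENNReal.ofReal (2 * (2 ^ n) ^ 2 * α) * ENNReal.ofReal (α / 2) := by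
    rw [← ENNReal.ofReal_pow (by positivity), ← ENNReal.ofReal_mul (by positivity)]
    congr 1
    ring
  rw [h2, mul_assoc]
  gcongr
  exact measure_bigSet_mul_le' hn hg hα

/-- The maximal theorem by the layer cake argument: 2^(jp)|Ω_j| is at most 2 · 2^(j(p-1)) times the
integral of |g| over |g| > 2^j/2. After exchanging sum and integral, the heights below 2|g(x)| form
a geometric sum of size |g(x)|^(p-1), since p > 1. -/
lemma sum_measure_bigSet_le (hn : 1 ≤ n) (hg : Integrable g) {p : ℝ} (hp : 1 < p) (S : Finset ℤ) :
    ∑ j ∈ S, ENNReal.ofReal ((2 : ℝ) ^ ((j : ℝ) * p)) * volume (bigSet K g (2 ^ (j : ℝ))) ≤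
      ENNReal.ofReal (2 * (1 - (2 : ℝ) ^ (-(p - 1)))⁻¹ * 2 ^ (p - 1)) * ∫⁻ x, ‖g x‖ₑ ^ p := by
  have hp1 : 0 < p - 1 := by linarith
  have hq1 : (2 : ℝ) ^ (-(p - 1)) < 1 := Real.rpow_lt_one_of_one_lt_of_neg one_lt_two (by linarith)
  have hpos : 0 < (1 - (2 : ℝ) ^ (-(p - 1)))⁻¹ := inv_pos.2 (by linarith)
  have h1 : ∀ j ∈ S, ENNReal.ofReal ((2 : ℝ) ^ ((j : ℝ) * p)) * volume (bigSet K g (2 ^ (j : ℝ))) ≤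
      ∫⁻ x, ENNReal.ofReal (2 * (2 : ℝ) ^ ((j : ℝ) * (p - 1))) *
        {x | (2 : ℝ) ^ (j : ℝ) / 2 < ‖g x‖}.indicator (fun x => ‖g x‖ₑ) x := fun j _ => by
    rw [lintegral_const_mul' _ _ ENNReal.ofReal_ne_top]
    have h2 : (2 : ℝ) ^ ((j : ℝ) * p) = 2 * (2 : ℝ) ^ ((j : ℝ) * (p - 1)) * (2 ^ (j : ℝ) / 2) := by
      have : (j : ℝ) * p = (j : ℝ) * (p - 1) + j := by ring
      rw [this, Real.rpow_add (by norm_num)]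
      ring
    rw [h2, ENNReal.ofReal_mul (by positivity), mul_assoc]
    gcongr
    exact measure_bigSet_mul_le hn hg (by positivity)
  refine (Finset.sum_le_sum h1).trans ?_
  have hset : ∀ j : ℤ, NullMeasurableSet {x | (2 : ℝ) ^ (j : ℝ) / 2 < ‖g x‖} := fun j =>
    nullMeasurableSet_lt aemeasurable_const hg.1.norm.aemeasurable
  rw [← lintegral_finsetSum' _ fun j _ => ((hg.1.enorm.indicator₀ (hset j)).const_mul _),
    ← lintegral_const_mul' _ _ ENNReal.ofReal_ne_top]
  refine lintegral_mono fun x => ?_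
  have h3 : ∀ j ∈ S, ENNReal.ofReal (2 * (2 : ℝ) ^ ((j : ℝ) * (p - 1))) *
        {x | (2 : ℝ) ^ (j : ℝ) / 2 < ‖g x‖}.indicator (fun x => ‖g x‖ₑ) x =
      if (2 : ℝ) ^ (j : ℝ) / 2 < ‖g x‖ then
        ENNReal.ofReal (2 * (2 : ℝ) ^ ((j : ℝ) * (p - 1)) * ‖g x‖) else 0 := fun j _ => by
    simp only [Set.indicator_apply, Set.mem_ofPred_eq]
    split_ifs
    · rw [← ofReal_norm, ← ENNReal.ofReal_mul (by positivity)]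
    · rw [mul_zero]
  rw [Finset.sum_congr rfl h3, ← Finset.sum_filter, ← ENNReal.ofReal_sum_of_nonneg
    (fun j _ => by positivity), ← Finset.sum_mul, ← Finset.mul_sum, ← ofReal_norm (g x),
    ENNReal.ofReal_rpow_of_nonneg (norm_nonneg _) (by linarith), ← ENNReal.ofReal_mul (by positivity)]
  refine ENNReal.ofReal_le_ofReal ?_
  have h4 := sum_two_rpow_filter_le hp1 S (norm_nonneg (g x))
  rw [Real.mul_rpow (by norm_num) (norm_nonneg _)] at h4
  have h5 : ‖g x‖ ^ p = ‖g x‖ ^ (p - 1) * ‖g x‖ := by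
    rcases (norm_nonneg (g x)).eq_or_lt with h | h
    · rw [← h, mul_zero, Real.zero_rpow (by linarith)]
    · rw [Real.rpow_sub_one h.ne', div_mul_cancel₀ _ h.ne']
  rw [h5]
  calc _ ≤ 2 * ((1 - (2 : ℝ) ^ (-(p - 1)))⁻¹ * (2 ^ (p - 1) * ‖g x‖ ^ (p - 1))) * ‖g x‖ := by gcongr
    _ = _ := by ring

/-- The jump between two stopped averages is a finite combination of atoms. -/
lemma exists_atomic_decomposition (hn : 1 ≤ n) (hg : Integrable g) (hs : IsStep K g) (hα : 0 < α)
    {α' : ℝ} (h : α ≤ α') :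
    ∃ (s : Finset (ℤ × (Fin n → ℤ))) (c : ℤ × (Fin n → ℤ) → ℝ) (a : ℤ × (Fin n → ℤ) → 𝔼 → ℂ),
      (∀ i ∈ s, 0 ≤ c i ∧ ∃ r x₀, IsCenteredAtom r (fun x => a i (x + x₀))) ∧
      (∀ i, Integrable (a i)) ∧
      (∀ x, stopAvg K g α' x - stopAvg K g α x = ∑ i ∈ s, (c i : ℂ) * a i x) ∧
      ∑ i ∈ s, ENNReal.ofReal (c i) ≤
        ENNReal.ofReal (2 ^ n * (α + α') * √n ^ n) * volume (bigSet K g α) := by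
  classical
  have hα' := hα.trans_le h
  set b : 𝔼 → ℂ := fun x => stopAvg K g α' x - stopAvg K g α x with hb
  have hbi : Integrable b := (integrable_stopAvg hn hg hs hα').sub (integrable_stopAvg hn hg hs hα)
  have hbM : ∀ x, ‖b x‖ ≤ 2 ^ n * (α + α') := fun x => by
    refine (norm_sub_le _ _).trans ?_
    linarith [norm_stopAvg_le (K := K) hn hg hα x, norm_stopAvg_le (K := K) hn hg hα' x]
  have hb0 : ∀ x ∉ bigSet K g α, b x = 0 := fun x hx => by
    have hx' : x ∉ bigSet K g α' := fun ⟨k, hk, hlt⟩ => hx ⟨k, hk, h.trans_lt hlt⟩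
    simp only [hb]
    rw [stopAvg_eq_of_notMem hn hg hs hα hx, stopAvg_eq_of_notMem hn hg hs hα' hx', sub_self]
  set π := stopCell K g α with hπ
  have hπm : Measurable π := measurable_stopCell hn hg hα
  have hfib : ∀ x, π ⁻¹' {π x} = cube (stopScale K g α x) x := stopCell_fiber hn hg hα
  -- Over a stopping cube for α, the average stopped at α integrates to the integral of g. So does
  -- the one stopped at α', because the cube is a union of stopping cubes for α'.
  have hmean : ∀ x, ∫ y in π ⁻¹' {π x}, b y = 0 := fun x => by
    rw [hfib, integral_sub (integrable_stopAvg hn hg hs hα').integrableOn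
      (integrable_stopAvg hn hg hs hα).integrableOn, setIntegral_stopAvg hn hg hα, sub_eq_zero]
    refine setIntegral_eq_of_fibers (measurable_stopCell (K := K) hn hg hα') (measurableSet_cube _ _)
      (fun y hy z hz => ?_) (integrable_stopAvg hn hg hs hα') hg fun y _ => ?_
    · have h1 := (stopCell_eq_iff hn hg hα').1 hz
      have h2 : stopScale K g α y = stopScale K g α x := stopScale_congr hn hg hα hy
      have h3 : stopScale K g α x ≤ stopScale K g α' y := h2 ▸ stopScale_mono hn hg hα h y
      exact (grid_eq_of_le h3 h1).trans hy
    · rw [stopCell_fiber hn hg hα', setIntegral_stopAvg hn hg hα']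
  have hvol : ∀ x, volume (π ⁻¹' {π x}) = ENNReal.ofReal (cubeVol n (π x).1) := fun x => by
    rw [hfib, volume_cube]
    rfl
  -- The exceptional set has finite measure and no stopping cube is finer than scale K, so only
  -- finitely many cubes occur.
  obtain ⟨hfin, hsum⟩ := finite_image_of_fibers (μ := volume) hπm measurableSet_bigSet
    (mem_bigSet_of_stopCell_eq hn hg hα) (measure_bigSet_ne_top hn hg hα)
    (ε := ENNReal.ofReal (cubeVol n K)) (by simpa using cubeVol_pos K) fun x _ => by
      rw [hvol]
      refine ENNReal.ofReal_le_ofReal ?_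
      unfold cubeVol
      gcongr
      · exact one_le_two
      · exact (stopScale_mem hn hg hα x).1
  have hn0 : (0 : ℝ) < n := by exact_mod_cast hn
  have hM : 0 < 2 ^ n * (α + α') := by positivity
  -- The coefficient is the bound 2^n(α + α') for the difference times r^n, where r = √n · 2^(-k)
  -- bounds the diameter of the cube; a ball of radius r about any point of the cube contains it.
  set c : ℤ × (Fin n → ℤ) → ℝ := fun i => 2 ^ n * (α + α') * √n ^ n * cubeVol n i.1 with hc
  have hcpos : ∀ i, 0 < c i := fun i => by
    have := cubeVol_pos (n := n) i.1
    positivity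
  refine ⟨hfin.toFinset, c, fun i x => ((c i)⁻¹ : ℝ) * (π ⁻¹' {i}).indicator b x, ?_, ?_, ?_, ?_⟩
  · intro i hi
    obtain ⟨x₀, -, rfl⟩ := hfin.mem_toFinset.1 hi
    have hr : 0 < √n * (2 : ℝ) ^ (-(π x₀).1) := by positivity
    have hcr : c (π x₀) = 2 ^ n * (α + α') * (√n * (2 : ℝ) ^ (-(π x₀).1)) ^ n := by
      simp only [hc, cubeVol, mul_pow]
      ring
    have hms : MeasurableSet (π ⁻¹' {π x₀}) := hπm (measurableSet_singleton _)
    have hai : Integrable fun x => ((c (π x₀))⁻¹ : ℝ) * (π ⁻¹' {π x₀}).indicator b x :=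
      ((integrable_indicator_iff hms).2 hbi.integrableOn).const_mul _
    beta_reduce
    refine ⟨(hcpos _).le, √n * (2 : ℝ) ^ (-(π x₀).1), x₀, hr, ?_, fun x hx => ?_, fun x => ?_, ?_⟩
    · exact (hai.comp_add_right x₀).1
    · rw [Set.indicator_of_notMem, mul_zero]
      intro hmem
      rw [hfib] at hmem
      have := norm_sub_le_of_mem_cube hmem
      rw [add_sub_cancel_right] at this
      exact absurd hx (not_lt.2 this)
    · rw [norm_mul, Complex.norm_real, Real.norm_of_nonneg (inv_nonneg.2 (hcpos _).le),
        inv_mul_le_iff₀ (hcpos _), hcr, mul_assoc, mul_inv_cancel₀ (by positivity), mul_one]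
      refine (norm_indicator_le_norm_self _ _).trans (hbM _)
    · rw [integral_add_right_eq_self (fun x => ((c (π x₀))⁻¹ : ℝ) * (π ⁻¹' {π x₀}).indicator b x),
        integral_const_mul, integral_indicator hms, hmean, mul_zero]
  · intro i
    exact ((integrable_indicator_iff (hπm (measurableSet_singleton _))).2 hbi.integrableOn).const_mul _
  · intro x
    have h1 : ∀ i ∈ hfin.toFinset, (c i : ℂ) * (((c i)⁻¹ : ℝ) * (π ⁻¹' {i}).indicator b x) =
        if i = π x then b x else 0 := fun i _ => by
      rw [← mul_assoc, ← Complex.ofReal_mul, mul_inv_cancel₀ (hcpos i).ne', Complex.ofReal_one,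
        one_mul, Set.indicator_apply]
      simp only [Set.mem_preimage, Set.mem_singleton_iff, eq_comm]
    rw [Finset.sum_congr rfl h1, Finset.sum_ite_eq']
    split_ifs with hx
    · rfl
    · refine hb0 x fun hx' => hx ?_
      exact hfin.mem_toFinset.2 ⟨x, hx', rfl⟩
  · have h1 : ∀ i ∈ hfin.toFinset, ENNReal.ofReal (c i) =
        ENNReal.ofReal (2 ^ n * (α + α') * √n ^ n) * volume (π ⁻¹' {i}) := fun i hi => by
      obtain ⟨x₀, -, rfl⟩ := hfin.mem_toFinset.1 hi
      rw [hvol, ← ENNReal.ofReal_mul (by positivity)]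
    rw [Finset.sum_congr rfl h1, ← Finset.mul_sum]
    gcongr
    exact hsum _ (by simp)

end CalderonZygmund
end SquareFunction

namespace SquareFunction

variable {n : ℕ} {lam : ℝ}

local notation "𝔼" => EuclideanSpace ℝ (Fin n)

/-! ### Holomorphy of the truncated pairing -/

section AnalyticFamily

lemma norm_cexp_mul_ofReal_le {M k : ℝ} (hk : |k| ≤ M) (z : ℂ) :
    ‖Complex.exp (z * k)‖ ≤ Real.exp (|z.re| * M) := by
  rw [Complex.norm_exp, Real.exp_le_exp]
  simp only [Complex.mul_re, Complex.ofReal_re, Complex.ofReal_im, mul_zero, sub_zero]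
  calc _ ≤ |z.re * k| := le_abs_self _
    _ = |z.re| * |k| := abs_mul _ _
    _ ≤ _ := by gcongr

lemma norm_integral_cexp_mul_le {X : Type*} [MeasurableSpace X] {μ : Measure X} {d : X → ℂ}
    {κ : X → ℝ} (hd : Integrable d μ) {M : ℝ} (hM : ∀ᵐ x ∂μ, d x ≠ 0 → |κ x| ≤ M) (z : ℂ) :
    ‖∫ x, Complex.exp (z * κ x) * d x ∂μ‖ ≤ Real.exp (|z.re| * M) * ∫ x, ‖d x‖ ∂μ := by
  rw [← integral_const_mul]
  refine norm_integral_le_of_norm_le (hd.norm.const_mul _) ?_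
  filter_upwards [hM] with x hx
  rw [norm_mul]
  by_cases h : d x = 0
  · simp [h]
  · gcongr
    exact norm_cexp_mul_ofReal_le (hx h) z

lemma integrable_cexp_mul {X : Type*} [MeasurableSpace X] {μ : Measure X} {d : X → ℂ}
    {κ : X → ℝ} (hd : Integrable d μ) (hκ : AEStronglyMeasurable κ μ) {M : ℝ}
    (hM : ∀ᵐ x ∂μ, d x ≠ 0 → |κ x| ≤ M) (z : ℂ) :
    Integrable (fun x => Complex.exp (z * κ x) * d x) μ := by
  refine (hd.norm.const_mul (Real.exp (|z.re| * M))).mono' ?_ ?_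
  · refine AEStronglyMeasurable.mul ?_ hd.1
    exact Complex.continuous_exp.comp_aestronglyMeasurable
      ((Complex.continuous_ofReal.comp_aestronglyMeasurable hκ).const_mul z)
  · filter_upwards [hM] with x hx
    rw [norm_mul]
    by_cases h : d x = 0
    · simp [h]
    · gcongr
      exact norm_cexp_mul_ofReal_le (hx h) z

lemma differentiable_integral_cexp_mul {X : Type*} [MeasurableSpace X] {μ : Measure X} {d : X → ℂ}
    {κ : X → ℝ} (hd : Integrable d μ) (hκ : AEStronglyMeasurable κ μ) {M : ℝ} (hM0 : 0 ≤ M)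
    (hM : ∀ᵐ x ∂μ, d x ≠ 0 → |κ x| ≤ M) :
    Differentiable ℂ fun z : ℂ => ∫ x, Complex.exp (z * κ x) * d x ∂μ := by
  intro z₀
  have hmeas : ∀ z : ℂ, AEStronglyMeasurable (fun x => Complex.exp (z * κ x) * d x) μ := fun z =>
    (integrable_cexp_mul hd hκ hM z).1
  refine (hasDerivAt_integral_of_dominated_loc_of_deriv_le (μ := μ)
    (F := fun z x => Complex.exp (z * κ x) * d x)
    (F' := fun z x => κ x * (Complex.exp (z * κ x) * d x)) (x₀ := z₀) (s := Metric.ball z₀ 1)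
    (bound := fun x => M * (Real.exp ((|z₀.re| + 1) * M) * ‖d x‖)) (Metric.ball_mem_nhds z₀ one_pos)
    (Filter.Eventually.of_forall hmeas) (integrable_cexp_mul hd hκ hM z₀) ?_ ?_
    ((hd.norm.const_mul _).const_mul _) ?_).2.differentiableAt
  · exact (Complex.continuous_ofReal.comp_aestronglyMeasurable hκ).mul (hmeas z₀)
  · filter_upwards [hM] with x hx z hz
    by_cases h : d x = 0
    · simp [h]
    · rw [norm_mul, norm_mul, Complex.norm_real, Real.norm_eq_abs]
      gcongr
      · exact hx h
      · refine (norm_cexp_mul_ofReal_le (hx h) z).trans ?_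
        gcongr
        have h1 : |(z - z₀).re| ≤ 1 :=
          (Complex.abs_re_le_norm _).trans (by simpa [dist_eq_norm] using (Metric.mem_ball.1 hz).le)
        rw [Complex.sub_re] at h1
        have := abs_sub_abs_le_abs_sub z.re z₀.re
        linarith
  · filter_upwards with x z _
    have h1 : HasDerivAt (fun z : ℂ => Complex.exp (z * κ x)) (Complex.exp (z * κ x) * κ x) z := by
      simpa using ((hasDerivAt_id z).mul_const (κ x : ℂ)).cexp
    exact (h1.mul_const (d x)).congr_deriv (by ring)

/-- The parameter z occurs only through e^(zκ) with κ real. The pairing thus becomes the integral of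
e^(zκ) against a fixed integrable function, and holomorphy is differentiation under the integral. -/
lemma sym_eq_cexp_mul (β : ℝ) (z : ℂ) (u : ℝ) (ξ : 𝔼) : sym n lam (β * (1 - z)) u ξ =
    Complex.exp (z * ((β / 2 * Real.log (1 + ‖(2 * Real.pi) • ξ‖ ^ 2) : ℝ) : ℂ)) *
      sym n lam β u ξ := by
  have h : ((1 + ‖(2 * Real.pi) • ξ‖ ^ 2 : ℝ) : ℂ) ≠ 0 := by
    rw [Complex.ofReal_ne_zero]
    positivity
  simp only [sym]
  rw [Complex.cpow_def_of_ne_zero h, Complex.cpow_def_of_ne_zero h, mul_left_comm, ← Complex.exp_add,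
    ← Complex.ofReal_log (by positivity)]
  congr 2
  push_cast
  ring

/-- The integrand of the analytic family tested against `ω`. -/
noncomputable def testKernel (lam s t β : ℝ) (ω : ℝ → 𝔼 → ℂ) (f : 𝔼 → ℂ) (q : 𝔼 × ℝ × 𝔼) : ℂ :=
  (Real.fourierChar (inner ℝ q.2.2 q.1) • (symCut n lam β (cut s t) q.2.1 q.2.2 * 𝓕 f q.2.2)) *
    ω q.2.1 q.1

/-- The exponent of the analytic family. -/
noncomputable def testExponent (β : ℝ) (a : 𝔼 → ℝ) (q : 𝔼 × ℝ × 𝔼) : ℝ :=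
  β / 2 * Real.log (1 + ‖(2 * Real.pi) • q.2.2‖ ^ 2) + a q.1

/-- The measure over which the analytic family is integrated. -/
noncomputable def testMeasure (K : Set 𝔼) (I : Set ℝ) : Measure (𝔼 × ℝ × 𝔼) :=
  (volume.restrict K).prod ((volume.restrict I).prod volume)

/-- The value of the operator, tested against `ω exp (z a)`. -/
noncomputable def testIntegral (lam s t β : ℝ) (K : Set 𝔼) (I : Set ℝ) (ω : ℝ → 𝔼 → ℂ) (a : 𝔼 → ℝ)
    (f : 𝔼 → ℂ) (z : ℂ) : ℂ :=
  ∫ q, Complex.exp (z * testExponent β a q) * testKernel lam s t β ω f q ∂(testMeasure K I)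

variable {s t β : ℝ} {K : Set (EuclideanSpace ℝ (Fin n))} {I : Set ℝ}
  {ω : ℝ → EuclideanSpace ℝ (Fin n) → ℂ} {a : EuclideanSpace ℝ (Fin n) → ℝ}
  {f : EuclideanSpace ℝ (Fin n) → ℂ}

lemma integrable_testKernel (hs : 0 < s) (hst : s ≤ t) (hβ : 0 ≤ β) (hK : volume K ≠ ⊤)
    (hI : volume I ≠ ⊤) (hω : Measurable (Function.uncurry ω)) {W : ℝ} (hW : ∀ u, ∀ x ∈ K, ‖ω u x‖ ≤ W)
    (hKm : MeasurableSet K) (hf : Integrable f) :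
    Integrable (testKernel lam s t β ω f) (testMeasure K I) := by
  have : IsFiniteMeasure (volume.restrict K) := ⟨by simpa using hK.lt_top⟩
  have : IsFiniteMeasure (volume.restrict I) := ⟨by simpa using hI.lt_top⟩
  set B := ∫ x, ‖f x‖
  have hb : Integrable (fun q : 𝔼 × ℝ × 𝔼 => W * (1 * (1 * (‖cut s t q.2.2‖ * B))))
      (testMeasure K I) := by
    refine Integrable.const_mul ?_ _
    refine Integrable.mul_prod (f := fun _ : 𝔼 => (1 : ℝ))
      (g := fun r : ℝ × 𝔼 => 1 * (‖cut s t r.2‖ * B)) (integrable_const _) ?_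
    refine Integrable.mul_prod (f := fun _ : ℝ => (1 : ℝ))
      (g := fun ξ : 𝔼 => ‖cut s t ξ‖ * B) (integrable_const _) ?_
    exact (((contDiff_cut s t).continuous.integrable_of_hasCompactSupport
      (hasCompactSupport_cut hs hst)).norm).mul_const _
  refine hb.mono' ?_ ?_
  · refine AEStronglyMeasurable.mul ?_ ?_
    · have h1 : Continuous fun q : 𝔼 × ℝ × 𝔼 => Real.fourierChar (inner ℝ q.2.2 q.1) :=
        Real.continuous_fourierChar.comp (by fun_prop)
      refine (h1.aestronglyMeasurable).smul (AEStronglyMeasurable.mul ?_ ?_)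
      · exact ((measurable_symCut β (contDiff_cut s t).continuous.measurable).comp
          measurable_snd).aestronglyMeasurable
      · exact ((continuous_fourier hf).comp (continuous_snd.comp continuous_snd)).aestronglyMeasurable
    · exact (hω.comp ((measurable_fst.comp measurable_snd).prodMk
        measurable_fst)).aestronglyMeasurable
  · have hKae : ∀ᵐ q ∂(testMeasure K I), q.1 ∈ K := by
      have := Measure.quasiMeasurePreserving_fst (μ := volume.restrict K)
        (ν := (volume.restrict I).prod (volume : Measure 𝔼))
      exact this.ae (ae_restrict_mem hKm)
    filter_upwards [hKae] with q hq
    rw [testKernel, norm_mul, Circle.norm_smul, norm_mul, mul_comm, one_mul, one_mul]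
    have hB0 : 0 ≤ B := integral_nonneg fun _ => norm_nonneg _
    have h1 : ‖symCut n lam β (cut s t) q.2.1 q.2.2‖ ≤ ‖cut s t q.2.2‖ := by
      rw [symCut, norm_mul]
      exact mul_le_of_le_one_left (norm_nonneg _) (norm_sym_le_one (by simpa using hβ) _ _)
    have hW0 : 0 ≤ W := (norm_nonneg _).trans (hW 0 _ hq)
    gcongr
    · exact hW _ _ hq
    · exact norm_fourier_le f _

lemma aestronglyMeasurable_testExponent (ha : Measurable a) (μ : Measure (𝔼 × ℝ × 𝔼)) :
    AEStronglyMeasurable (testExponent β a) μ := by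
  refine Measurable.aestronglyMeasurable ?_
  unfold testExponent
  refine Measurable.add ?_ (ha.comp measurable_fst)
  fun_prop

/-- The frequency truncation bounds the logarithm of the symbol, and the bound on `a` over `K` takes
care of the rest. A bounded exponent makes the pairing entire and bounded on the strip. -/
lemma exists_testExponent_le (hs : 0 < s) (hst : s ≤ t) (hKm : MeasurableSet K)
    {A : ℝ} (hA : ∀ x ∈ K, |a x| ≤ A) : ∃ M : ℝ, 0 ≤ M ∧ ∀ f : 𝔼 → ℂ, ∀ᵐ q ∂(testMeasure K I),
      testKernel lam s t β ω f q ≠ 0 → |testExponent β a q| ≤ M := by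
  refine ⟨|β / 2| * Real.log (1 + (2 * Real.pi * (2 * t)) ^ 2) + |A|, ?_, fun f => ?_⟩
  · have : 0 ≤ Real.log (1 + (2 * Real.pi * (2 * t)) ^ 2) :=
      Real.log_nonneg (by nlinarith [sq_nonneg (2 * Real.pi * (2 * t))])
    positivity
  · have hKae : ∀ᵐ q ∂(testMeasure K I), q.1 ∈ K := by
      have := Measure.quasiMeasurePreserving_fst (μ := volume.restrict K)
        (ν := (volume.restrict I).prod (volume : Measure 𝔼))
      exact this.ae (ae_restrict_mem hKm)
    filter_upwards [hKae] with q hq hne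
    have h1 : ‖q.2.2‖ ≤ 2 * t := by
      by_contra h
      refine hne ?_
      rw [testKernel, symCut, cut_eq_zero_of_ge hs hst (not_le.1 h).le]
      simp
    rw [testExponent]
    refine (abs_add_le _ _).trans (add_le_add ?_ ((hA _ hq).trans (le_abs_self _)))
    rw [abs_mul, abs_of_nonneg (Real.log_nonneg (by nlinarith [sq_nonneg ‖(2 * Real.pi) • q.2.2‖])),
      norm_two_pi_smul]
    gcongr

/-- Fubini. The triple integral is convenient for holomorphy, the iterated one for estimates. -/
lemma testIntegral_eq (hs : 0 < s) (hst : s ≤ t) (hβ : 0 ≤ β) (hK : volume K ≠ ⊤)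
    (hI : volume I ≠ ⊤) (hω : Measurable (Function.uncurry ω)) {W : ℝ} (hW : ∀ u, ∀ x ∈ K, ‖ω u x‖ ≤ W)
    (hKm : MeasurableSet K) (ha : Measurable a) {A : ℝ} (hA : ∀ x ∈ K, |a x| ≤ A) (hf : Integrable f)
    (z : ℂ) :
    testIntegral lam s t β K I ω a f z = ∫ x in K, (∫ u in I,
      mulOp (symCut n lam (β * (1 - z)) (cut s t)) f u x * ω u x) * Complex.exp (z * a x) := by
  obtain ⟨M, -, hM⟩ := exists_testExponent_le (lam := lam) (β := β) (ω := ω) (I := I) hs hst hKm hA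
  have hint := integrable_cexp_mul (integrable_testKernel (lam := lam) (I := I) hs hst hβ hK hI hω hW
    hKm hf) (aestronglyMeasurable_testExponent (β := β) ha _) (hM f) z
  rw [testIntegral, testMeasure, integral_prod _ hint]
  have hae : ∀ᵐ x ∂(volume.restrict K), Integrable (fun r : ℝ × 𝔼 =>
      Complex.exp (z * testExponent β a (x, r)) * testKernel lam s t β ω f (x, r))
      ((volume.restrict I).prod volume) := hint.prod_right_ae
  refine integral_congr_ae ?_
  filter_upwards [hae] with x hx
  rw [integral_prod _ hx, ← integral_mul_const]
  refine integral_congr_ae (Filter.Eventually.of_forall fun u => ?_)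
  simp only
  rw [mulOp, Real.fourierInv_eq, ← integral_mul_const, ← integral_mul_const]
  refine integral_congr_ae (Filter.Eventually.of_forall fun ξ => ?_)
  simp only [testKernel, testExponent, symCut, sym_eq_cexp_mul β z, Complex.ofReal_add, mul_add,
    Complex.exp_add, Circle.smul_def, smul_eq_mul]
  ring

lemma testIntegral_sum (hs : 0 < s) (hst : s ≤ t) (hβ : 0 ≤ β) (hK : volume K ≠ ⊤)
    (hI : volume I ≠ ⊤) (hω : Measurable (Function.uncurry ω)) {W : ℝ} (hW : ∀ u, ∀ x ∈ K, ‖ω u x‖ ≤ W)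
    (hKm : MeasurableSet K) (ha : Measurable a) {A : ℝ} (hA : ∀ x ∈ K, |a x| ≤ A) {ι : Type*}
    (S : Finset ι) (c : ι → ℂ) {b : ι → 𝔼 → ℂ} (hb : ∀ i, Integrable (b i)) (z : ℂ) :
    testIntegral lam s t β K I ω a (fun x => ∑ i ∈ S, c i * b i x) z =
      ∑ i ∈ S, c i * testIntegral lam s t β K I ω a (b i) z := by
  obtain ⟨M, -, hM⟩ := exists_testExponent_le (lam := lam) (β := β) (ω := ω) (I := I) hs hst hKm hA
  have hint := fun i => integrable_cexp_mul (integrable_testKernel (lam := lam) (I := I) hs hst hβ hK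
    hI hω hW hKm (hb i)) (aestronglyMeasurable_testExponent (β := β) ha _) (hM (b i)) z
  simp only [testIntegral]
  simp only [← integral_const_mul]
  rw [← integral_finsetSum _ fun i _ => (hint i).const_mul (c i)]
  refine integral_congr_ae (Filter.Eventually.of_forall fun q => ?_)
  simp only [testKernel, fourier_sum_mul S c fun i _ => hb i, Finset.mul_sum, Finset.sum_mul,
    Finset.smul_sum]
  refine Finset.sum_congr rfl fun i _ => ?_
  simp only [Circle.smul_def, smul_eq_mul]
  ring

lemma differentiable_testIntegral (hs : 0 < s) (hst : s ≤ t) (hβ : 0 ≤ β) (hK : volume K ≠ ⊤)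
    (hI : volume I ≠ ⊤) (hω : Measurable (Function.uncurry ω)) {W : ℝ} (hW : ∀ u, ∀ x ∈ K, ‖ω u x‖ ≤ W)
    (hKm : MeasurableSet K) (ha : Measurable a) {A : ℝ} (hA : ∀ x ∈ K, |a x| ≤ A) (hf : Integrable f) :
    Differentiable ℂ (testIntegral lam s t β K I ω a f) ∧
      ∃ B : ℝ, ∀ z : ℂ, 0 ≤ z.re → z.re ≤ 1 → ‖testIntegral lam s t β K I ω a f z‖ ≤ B := by
  obtain ⟨M, hM0, hM⟩ := exists_testExponent_le (lam := lam) (β := β) (ω := ω) (I := I) hs hst hKm hA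
  have hi := integrable_testKernel (lam := lam) (I := I) hs hst hβ hK hI hω hW hKm hf
  refine ⟨differentiable_integral_cexp_mul hi (aestronglyMeasurable_testExponent ha _) hM0 (hM f),
    Real.exp (1 * M) * ∫ q, ‖testKernel lam s t β ω f q‖ ∂(testMeasure K I), fun z h0 h1 => ?_⟩
  refine (norm_integral_cexp_mul_le hi (hM f) z).trans ?_
  gcongr
  rwa [abs_of_nonneg h0]

end AnalyticFamily
end SquareFunction

namespace SquareFunction

variable {n : ℕ} {lam : ℝ}

local notation "𝔼" => EuclideanSpace ℝ (Fin n)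

/-! ### Three lines theorem and the extremal test function -/

section Stein

lemma norm_cexp_sq (z : ℂ) : ‖Complex.exp (z ^ 2)‖ = Real.exp (z.re ^ 2 - z.im ^ 2) := by
  rw [Complex.norm_exp]
  simp [sq]

/-- The three lines theorem with polynomial growth on the left boundary. -/
lemma norm_le_of_three_lines {H : ℂ → ℂ} (hd : Differentiable ℂ H)
    (hB : ∃ B : ℝ, ∀ z : ℂ, 0 ≤ z.re → z.re ≤ 1 → ‖H z‖ ≤ B) {M₀ M₁ : ℝ} (hM₀ : 0 ≤ M₀)
    (m : ℕ) (h₀ : ∀ z : ℂ, z.re = 0 → ‖H z‖ ≤ M₀ * (1 + |z.im|) ^ m)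
    (h₁ : ∀ z : ℂ, z.re = 1 → ‖H z‖ ≤ M₁) {θ : ℝ} (hθ0 : 0 ≤ θ) (hθ1 : θ ≤ 1) :
    ‖H θ‖ ≤ (m.factorial * Real.exp 2 * M₀) ^ (1 - θ) * (m.factorial * Real.exp 2 * M₁) ^ θ := by
  obtain ⟨B, hB⟩ := hB
  have hf1 : (1 : ℝ) ≤ m.factorial := by exact_mod_cast Nat.one_le_iff_ne_zero.2 m.factorial_ne_zero
  -- The factor e^(z²) has modulus e^(x² - y²): it is at least 1 at real points, at most e on the
  -- strip, and absorbs the growth (1 + |y|)^m ≤ m! e^(1 + |y|) on the left line.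
  have key := Complex.HadamardThreeLines.norm_le_interp_of_mem_verticalClosedStrip₀₁'
    (fun z => Complex.exp (z ^ 2) * H z) (z := (θ : ℂ)) (a := m.factorial * Real.exp 2 * M₀)
    (b := m.factorial * Real.exp 2 * M₁) ?_ ?_ ?_ ?_ ?_
  · rw [Complex.ofReal_re] at key
    refine le_trans ?_ key
    rw [norm_mul, norm_cexp_sq]
    refine le_mul_of_one_le_left (norm_nonneg _) (Real.one_le_exp ?_)
    simp only [Complex.ofReal_re, Complex.ofReal_im]
    nlinarith
  · simp only [Complex.HadamardThreeLines.verticalClosedStrip, Set.mem_preimage, Complex.ofReal_re,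
      Set.mem_Icc]
    exact ⟨hθ0, hθ1⟩
  · exact ((Complex.differentiable_exp.comp (differentiable_id.pow 2)).mul hd).diffContOnCl
  · refine ⟨Real.exp 1 * B, ?_⟩
    rintro _ ⟨z, hz, rfl⟩
    simp only [Complex.HadamardThreeLines.verticalClosedStrip, Set.mem_preimage, Set.mem_Icc] at hz
    simp only [Function.comp, norm_mul, norm_cexp_sq]
    gcongr
    · nlinarith [sq_nonneg z.im]
    · exact hB z hz.1 hz.2
  · intro z hz
    have hz : z.re = 0 := hz
    rw [norm_mul, norm_cexp_sq, hz]
    have h2 := Real.pow_div_factorial_le_exp (1 + |z.im|) (by positivity) m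
    rw [div_le_iff₀ (by positivity)] at h2
    calc _ ≤ Real.exp (0 ^ 2 - z.im ^ 2) * (M₀ * (Real.exp (1 + |z.im|) * m.factorial)) := by
          gcongr
          exact (h₀ z hz).trans (by gcongr)
      _ = m.factorial * (Real.exp (0 ^ 2 - z.im ^ 2) * Real.exp (1 + |z.im|)) * M₀ := by ring
      _ ≤ _ := by
          rw [← Real.exp_add]
          gcongr
          rw [← sq_abs z.im]
          nlinarith [sq_nonneg (|z.im| - 1)]
  · intro z hz
    have hz : z.re = 1 := hz
    rw [norm_mul, norm_cexp_sq, hz]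
    have h3 : Real.exp (1 ^ 2 - z.im ^ 2) ≤ m.factorial * Real.exp 2 :=
      (Real.exp_le_exp.2 (by nlinarith [sq_nonneg z.im])).trans
        (le_mul_of_one_le_left (Real.exp_nonneg _) hf1)
    exact mul_le_mul h3 (h₁ z hz) (norm_nonneg _) (by positivity)

lemma lintegral_mul_le_eLpNorm_two {X : Type*} [MeasurableSpace X] {μ : Measure X} {f g : X → ℝ≥0∞}
    (hf : AEMeasurable f μ) (hg : AEMeasurable g μ) :
    ∫⁻ x, f x * g x ∂μ ≤ eLpNorm f 2 μ * eLpNorm g 2 μ := by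
  have := ENNReal.lintegral_mul_le_Lp_mul_Lq μ Real.HolderConjugate.two_two hf hg
  simp only [eLpNorm_eq_lintegral_rpow_enorm_toReal two_ne_zero ENNReal.ofNat_ne_top,
    ENNReal.toReal_ofNat, enorm_eq_self]
  exact this

lemma enorm_integral_mul_le {X : Type*} [MeasurableSpace X] {μ : Measure X} {f g : X → ℂ}
    (hf : AEStronglyMeasurable f μ) (hg : AEStronglyMeasurable g μ) :
    ‖∫ x, f x * g x ∂μ‖ₑ ≤ eLpNorm f 2 μ * eLpNorm g 2 μ := by
  refine (enorm_integral_le_lintegral_enorm _).trans ?_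
  simp only [enorm_mul]
  refine (lintegral_mul_le_eLpNorm_two hf.enorm hg.enorm).trans_eq ?_
  rw [eLpNorm_enorm, eLpNorm_enorm]

variable {s t β p : ℝ} {K : Set (EuclideanSpace ℝ (Fin n))} {I : Set ℝ}
  {F : ℝ → EuclideanSpace ℝ (Fin n) → ℂ} {A : EuclideanSpace ℝ (Fin n) → ℝ}

/-- The extremal test function for the norm of `F`. -/
noncomputable def dualFun (F : ℝ → 𝔼 → ℂ) (A : 𝔼 → ℝ) (u : ℝ) (x : 𝔼) : ℂ :=
  ((A x)⁻¹ : ℝ) * (starRingEnd ℂ) (F u x)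

lemma measurable_dualFun (hF : Measurable (Function.uncurry F)) (hA : Measurable A) :
    Measurable (Function.uncurry (dualFun F A)) := by
  refine Measurable.mul ?_ ?_
  · exact Complex.measurable_ofReal.comp (hA.inv.comp measurable_snd)
  · exact Complex.continuous_conj.measurable.comp hF

lemma eLpNorm_dualFun_le {x : 𝔼} (hx : 0 < A x)
    (hA : ENNReal.ofReal (A x) = eLpNorm (fun u => F u x) 2 (volume.restrict I)) :
    eLpNorm (fun u => dualFun F A u x) 2 (volume.restrict I) ≤ 1 := by
  refine (eLpNorm_le_mul_eLpNorm_of_ae_le_mul (c := (A x)⁻¹) (g := fun u => F u x)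
    (Filter.Eventually.of_forall fun u => ?_) 2).trans ?_
  · rw [dualFun, norm_mul, Complex.norm_real, Real.norm_of_nonneg (by positivity), RCLike.norm_conj]
  · rw [← hA, ← ENNReal.ofReal_mul (by positivity), inv_mul_cancel₀ hx.ne', ENNReal.ofReal_one]

lemma integral_mul_dualFun {x : 𝔼} (hx : 0 < A x)
    (hF : AEStronglyMeasurable (fun u => F u x) (volume.restrict I))
    (hA : ENNReal.ofReal (A x) = eLpNorm (fun u => F u x) 2 (volume.restrict I)) :
    ∫ u in I, F u x * dualFun F A u x = A x := by
  have h1 : ∀ u, F u x * dualFun F A u x = (((A x)⁻¹ * ‖F u x‖ ^ 2 : ℝ) : ℂ) := fun u => by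
    rw [dualFun, mul_left_comm, Complex.mul_conj, Complex.normSq_eq_norm_sq, ← Complex.ofReal_mul]
  simp only [h1]
  rw [integral_complex_ofReal, integral_const_mul]
  have h2 : ∫ u in I, ‖F u x‖ ^ 2 = A x ^ 2 := by
    have hm : AEStronglyMeasurable (fun u => ‖F u x‖ ^ 2) (volume.restrict I) := hF.norm.pow 2
    rw [integral_eq_lintegral_of_nonneg_ae (Filter.Eventually.of_forall fun u => sq_nonneg _) hm]
    have h3 : ∀ u, ENNReal.ofReal (‖F u x‖ ^ 2) = ‖F u x‖ₑ ^ 2 := fun u => by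
      rw [ENNReal.ofReal_pow (norm_nonneg _), ofReal_norm]
    simp only [h3]
    have h4 : ∫⁻ u in I, ‖F u x‖ₑ ^ 2 = ENNReal.ofReal (A x) ^ 2 := by
      rw [hA, ← lintegral_sq_eq_eLpNorm, ← ENNReal.rpow_natCast, ← ENNReal.rpow_mul]
      norm_num
    rw [h4, ENNReal.toReal_pow, ENNReal.toReal_ofReal hx.le]
  rw [h2]
  congr 1
  field_simp

/-- The weight exponent for which the analytic family is bounded by three lines. -/
noncomputable def logWeight (p : ℝ) (A : 𝔼 → ℝ) (x : 𝔼) : ℝ := p / 2 * Real.log (A x)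

lemma exp_mul_logWeight {x : 𝔼} (hx : 0 < A x) (r : ℝ) :
    Real.exp (r * logWeight p A x) = A x ^ (p / 2 * r) := by
  rw [logWeight, Real.rpow_def_of_pos hx]
  congr 1
  ring

lemma enorm_pairing_le {G : ℝ → 𝔼 → ℂ} (hG : Measurable (Function.uncurry G))
    (hF : Measurable (Function.uncurry F)) (hAm : Measurable A)
    (hA : ∀ x, ENNReal.ofReal (A x) = eLpNorm (fun u => F u x) 2 (volume.restrict I))
    (hKm : MeasurableSet K) (hK : ∀ x ∈ K, 0 < A x) (z : ℂ) :
    ‖∫ x in K, (∫ u in I, G u x * dualFun F A u x) * Complex.exp (z * logWeight p A x)‖ₑ ≤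
      ∫⁻ x in K, eLpNorm (fun u => G u x) 2 (volume.restrict I) *
        ENNReal.ofReal (A x ^ (p / 2 * z.re)) := by
  refine (enorm_integral_le_lintegral_enorm _).trans ?_
  refine lintegral_mono_ae ?_
  filter_upwards [ae_restrict_mem hKm] with x hx
  rw [enorm_mul]
  gcongr
  · refine (enorm_integral_mul_le (measurable_slice hG x).aestronglyMeasurable
      (measurable_slice (measurable_dualFun hF hAm) x).aestronglyMeasurable).trans ?_
    exact mul_le_of_le_one_right' (eLpNorm_dualFun_le (hK x hx) (hA x))
  · rw [← ofReal_norm, Complex.norm_exp, ← exp_mul_logWeight (hK x hx)]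
    simp

/-- The coefficients of the analytic family of functions. -/
noncomputable def steinCoeff (p : ℝ) (j : ℤ) (z : ℂ) : ℂ :=
  Complex.exp (((Real.log 2 * j : ℝ) : ℂ) * (((p - 1 : ℝ) : ℂ) - ((p / 2 : ℝ) : ℂ) * z))

lemma norm_steinCoeff (j : ℤ) (z : ℂ) :
    ‖steinCoeff p j z‖ = 2 ^ ((j : ℝ) * (p - 1 - p / 2 * z.re)) := by
  rw [steinCoeff, Complex.norm_exp, Real.rpow_def_of_pos two_pos]
  congr 1
  simp only [Complex.re_ofReal_mul, Complex.sub_re, Complex.ofReal_re]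
  ring

lemma differentiable_steinCoeff (j : ℤ) : Differentiable ℂ (steinCoeff p j) := by
  unfold steinCoeff
  fun_prop

/-- With θ = 2 - 2/p, the unknown X appears on the right with exponent θ/2. Division leaves X^(1 -
θ/2) = X^(1/p), which is the norm sought. -/
lemma rpow_le_of_three_lines {M₀ M₁ X E : ℝ} (hp1 : 1 < p) (hp2 : p < 2) (hM₀ : 0 ≤ M₀)
    (hM₁ : 0 ≤ M₁) (hX0 : 0 ≤ X) (hE0 : 0 < E)
    (h : X ≤ (E * M₀) ^ (1 - (2 - 2 / p)) * (E * (M₁ * X ^ (1 / 2 : ℝ))) ^ (2 - 2 / p)) :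
    X ^ (1 / p) ≤ E * (M₀ ^ (2 / p - 1) * M₁ ^ (2 - 2 / p)) := by
  have hp0 : 0 < p := by linarith
  have hp1' : 1 < 2 / p := by rw [lt_div_iff₀ hp0]; linarith
  have h7 : 2 / p - 1 = 1 - (2 - 2 / p) := by ring
  rw [h7]
  have hθ : 1 - 1 / 2 * (2 - 2 / p) = 1 / p := by ring
  generalize 2 - 2 / p = θ at h hθ ⊢
  rw [Real.mul_rpow hE0.le hM₀, Real.mul_rpow hE0.le (by positivity),
    Real.mul_rpow hM₁ (by positivity), ← Real.rpow_mul hX0] at h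
  rcases hX0.eq_or_lt with h0 | hXpos
  · rw [← h0, Real.zero_rpow (by positivity)]
    positivity
  have h5 : X ≤ E * (M₀ ^ (1 - θ) * M₁ ^ θ) * X ^ (1 / 2 * θ) := by
    refine h.trans (le_of_eq ?_)
    have : E ^ (1 - θ) * E ^ θ = E := by
      rw [← Real.rpow_add hE0, sub_add_cancel, Real.rpow_one]
    calc _ = (E ^ (1 - θ) * E ^ θ) * (M₀ ^ (1 - θ) * M₁ ^ θ) * X ^ (1 / 2 * θ) := by ring
      _ = _ := by rw [this]
  have h6 : X ^ (1 / p) = X / X ^ (1 / 2 * θ) := by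
    rw [← hθ, Real.rpow_sub hXpos, Real.rpow_one]
  rw [h6, div_le_iff₀ (by positivity)]
  exact h5

/-- The pairing of the analytic family with the extremal test function. -/
lemma exists_dualPairing (lam : ℝ) (hp0 : 0 < p) (hI : volume I ≠ ⊤) (hs : 0 < s)
    (hst : s ≤ t) (hβ : 0 ≤ β) (hFm : Measurable (Function.uncurry F)) (hAm : Measurable A)
    (hKm : MeasurableSet K) (hK : volume K ≠ ⊤) {D δ Δ : ℝ} (hD : ∀ u x, ‖F u x‖ ≤ D) (hδ : 0 < δ)
    (hKδ : ∀ x ∈ K, δ ≤ A x) (hKΔ : ∀ x ∈ K, A x ≤ Δ) :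
    ∃ T : (𝔼 → ℂ) → ℂ → ℂ,
      (∀ f, Integrable f → Differentiable ℂ (T f)) ∧
      (∀ f, Integrable f → ∃ B : ℝ, ∀ z : ℂ, 0 ≤ z.re → z.re ≤ 1 → ‖T f z‖ ≤ B) ∧
      (∀ f, Integrable f → ∀ z : ℂ, T f z = ∫ x in K, (∫ u in I,
        mulOp (symCut n lam (β * (1 - z)) (cut s t)) f u x * dualFun F A u x) *
          Complex.exp (z * logWeight p A x)) ∧
      ∀ (S : Finset ℤ) (c : ℤ → ℂ) (b : ℤ → 𝔼 → ℂ), (∀ j, Integrable (b j)) → ∀ z : ℂ,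
        T (fun x => ∑ j ∈ S, c j * b j x) z = ∑ j ∈ S, c j * T (b j) z := by
  have hK0 : ∀ x ∈ K, 0 < A x := fun x hx => hδ.trans_le (hKδ x hx)
  have hω := measurable_dualFun hFm hAm
  have hW : ∀ u, ∀ x ∈ K, ‖dualFun F A u x‖ ≤ δ⁻¹ * D := fun u x hx => by
    rw [dualFun, norm_mul, Complex.norm_real, RCLike.norm_conj,
      Real.norm_of_nonneg (inv_nonneg.2 (hK0 x hx).le)]
    have := hKδ x hx
    gcongr
    exact hD u x
  have ham : Measurable (logWeight p A) := (Real.measurable_log.comp hAm).const_mul _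
  have hab : ∀ x ∈ K, |logWeight p A x| ≤ p / 2 * (|Real.log δ| + |Real.log Δ|) := fun x hx => by
    rw [logWeight, abs_mul, abs_of_pos (by positivity)]
    gcongr
    have h1 := Real.log_le_log hδ (hKδ x hx)
    have h2 := Real.log_le_log (hK0 x hx) (hKΔ x hx)
    rw [abs_le]
    constructor
    · linarith [neg_abs_le (Real.log δ), abs_nonneg (Real.log Δ)]
    · linarith [le_abs_self (Real.log Δ), abs_nonneg (Real.log δ)]
  exact ⟨testIntegral lam s t β K I (dualFun F A) (logWeight p A),
    fun f hf => (differentiable_testIntegral hs hst hβ hK hI hω hW hKm ham hab hf).1,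
    fun f hf => (differentiable_testIntegral hs hst hβ hK hI hω hW hKm ham hab hf).2,
    fun f hf z => testIntegral_eq hs hst hβ hK hI hω hW hKm ham hab hf z,
    fun S c b hb z => testIntegral_sum hs hst hβ hK hI hω hW hKm ham hab S c hb z⟩

lemma integrable_rpow_of_le (hp0 : 0 < p) (hAm : Measurable A) (hKm : MeasurableSet K)
    (hK : volume K ≠ ⊤) {Δ : ℝ} (hK0 : ∀ x ∈ K, 0 < A x) (hKΔ : ∀ x ∈ K, A x ≤ Δ) :
    Integrable (fun x => A x ^ p) (volume.restrict K) := by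
  have : IsFiniteMeasure (volume.restrict K) := ⟨by simpa using hK.lt_top⟩
  refine (integrable_const (Δ ^ p)).mono' (hAm.pow_const p).aestronglyMeasurable ?_
  filter_upwards [ae_restrict_mem hKm] with x hx
  rw [Real.norm_of_nonneg (Real.rpow_nonneg (hK0 x hx).le _)]
  exact Real.rpow_le_rpow (hK0 x hx).le (hKΔ x hx) hp0.le

lemma steinCoeff_eq_one (hp0 : 0 < p) (j : ℤ) : steinCoeff p j ((2 - 2 / p : ℝ) : ℂ) = 1 := by
  have : p - 1 - p / 2 * (2 - 2 / p) = 0 := by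
    field_simp
    ring
  rw [steinCoeff, ← Complex.ofReal_mul, ← Complex.ofReal_sub, this]
  simp

/-- The pairing with the extremal test function recovers the norm. -/
lemma integral_dualFun_mul_exp (hp0 : 0 < p) (hFm : Measurable (Function.uncurry F))
    (hA : ∀ x, ENNReal.ofReal (A x) = eLpNorm (fun u => F u x) 2 (volume.restrict I))
    (hKm : MeasurableSet K) (hK0 : ∀ x ∈ K, 0 < A x) :
    ∫ x in K, (∫ u in I, F u x * dualFun F A u x) *
      Complex.exp (((2 - 2 / p : ℝ) : ℂ) * logWeight p A x) = ((∫ x in K, A x ^ p : ℝ) : ℂ) := by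
  rw [← integral_complex_ofReal]
  refine setIntegral_congr_fun hKm fun x hx => ?_
  have h4 : A x * A x ^ (p / 2 * (2 - 2 / p)) = A x ^ p := by
    have h5 : p = 1 + p / 2 * (2 - 2 / p) := by
      field_simp
      ring
    conv_rhs => rw [h5, Real.rpow_add (hK0 x hx), Real.rpow_one]
  rw [integral_mul_dualFun (hK0 x hx) (measurable_slice hFm x).aestronglyMeasurable (hA x),
    ← Complex.ofReal_mul, ← Complex.ofReal_exp, exp_mul_logWeight (hK0 x hx),
    ← Complex.ofReal_mul, h4]

lemma enorm_pairing_le_mixedNorm_one {G : ℝ → 𝔼 → ℂ} (hG : Measurable (Function.uncurry G))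
    (hF : Measurable (Function.uncurry F)) (hAm : Measurable A)
    (hA : ∀ x, ENNReal.ofReal (A x) = eLpNorm (fun u => F u x) 2 (volume.restrict I))
    (hKm : MeasurableSet K) (hK : ∀ x ∈ K, 0 < A x) {z : ℂ} (hz : z.re = 0) :
    ‖∫ x in K, (∫ u in I, G u x * dualFun F A u x) * Complex.exp (z * logWeight p A x)‖ₑ ≤
      mixedNorm 1 I G := by
  refine (enorm_pairing_le hG hF hAm hA hKm hK z).trans ?_
  rw [hz, mixedNorm_eq, eLpNorm_one_eq_lintegral_enorm]
  simp only [mul_zero, Real.rpow_zero, ENNReal.ofReal_one, mul_one, enorm_eq_self]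
  exact setLIntegral_le_lintegral _ _

/-- On this line the scalar weight has modulus A^(p/2), whose L² norm over K is the square root of
∫A^p. On the line Re z = 0 the modulus is 1 instead. -/
lemma enorm_pairing_le_mixedNorm_two {G : ℝ → 𝔼 → ℂ} (hG : Measurable (Function.uncurry G))
    (hF : Measurable (Function.uncurry F)) (hAm : Measurable A)
    (hA : ∀ x, ENNReal.ofReal (A x) = eLpNorm (fun u => F u x) 2 (volume.restrict I))
    (hKm : MeasurableSet K) (hK0 : ∀ x ∈ K, 0 < A x)
    (hXi : Integrable (fun x => A x ^ p) (volume.restrict K)) {z : ℂ} (hz : z.re = 1) :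
    ‖∫ x in K, (∫ u in I, G u x * dualFun F A u x) * Complex.exp (z * logWeight p A x)‖ₑ ≤
      mixedNorm 2 I G * ENNReal.ofReal ((∫ x in K, A x ^ p) ^ (1 / 2 : ℝ)) := by
  have hX0 : 0 ≤ ∫ x in K, A x ^ p :=
    setIntegral_nonneg hKm fun x hx => Real.rpow_nonneg (hK0 x hx).le _
  refine (enorm_pairing_le hG hF hAm hA hKm hK0 z).trans ?_
  rw [hz, mul_one]
  have hm := measurable_slice_norm I hG
  refine (lintegral_mul_le_eLpNorm_two hm.aemeasurable
    (hAm.pow_const _).ennreal_ofReal.aemeasurable).trans ?_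
  gcongr
  · refine (eLpNorm_mono_measure _ Measure.restrict_le_self).trans ?_
    rw [← mixedNorm_eq]
  · rw [eLpNorm_eq_lintegral_rpow_enorm_toReal two_ne_zero ENNReal.ofNat_ne_top,
      ENNReal.toReal_ofNat, ← ENNReal.ofReal_rpow_of_nonneg hX0 (by norm_num)]
    refine ENNReal.rpow_le_rpow (le_of_eq ?_) (by norm_num)
    rw [ofReal_integral_eq_lintegral_ofReal hXi]
    · refine setLIntegral_congr_fun hKm fun x hx => ?_
      simp only [enorm_eq_self]
      rw [ENNReal.ofReal_rpow_of_nonneg (Real.rpow_nonneg (hK0 x hx).le _) (by norm_num),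
        ← Real.rpow_mul (hK0 x hx).le]
      congr 2
      ring
    · filter_upwards [ae_restrict_mem hKm] with x hx
      exact Real.rpow_nonneg (hK0 x hx).le _

/-- Stein interpolation for the truncated operators, on a set where the size of the function is
bounded from above and below. -/
lemma stein_interpolation_on (hp1 : 1 < p) (hp2 : p < 2) (hI : volume I ≠ ⊤) (hs : 0 < s)
    (hst : s ≤ t) (hβ : 0 ≤ β) (S : Finset ℤ) {b : ℤ → 𝔼 → ℂ} (hb : ∀ j, Integrable (b j))
    {M₀ M₁ : ℝ} (hM₀ : 0 ≤ M₀) (hM₁ : 0 ≤ M₁)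
    (h₀ : ∀ z : ℂ, z.re = 0 → ∑ j ∈ S, ENNReal.ofReal (2 ^ ((j : ℝ) * (p - 1))) *
      mixedNorm 1 I (mulOp (symCut n lam (β * (1 - z)) (cut s t)) (b j)) ≤
        ENNReal.ofReal (M₀ * (1 + |z.im|) ^ n))
    (h₁ : ∀ z : ℂ, z.re = 1 → mixedNorm 2 I (mulOp (symCut n lam (β * (1 - z)) (cut s t))
      (fun x => ∑ j ∈ S, steinCoeff p j z * b j x)) ≤ ENNReal.ofReal M₁)
    (hF : F = mulOp (symCut n lam (β * (1 - ((2 - 2 / p : ℝ) : ℂ))) (cut s t))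
      (fun x => ∑ j ∈ S, b j x))
    (hFm : Measurable (Function.uncurry F)) (hAm : Measurable A)
    (hA : ∀ x, ENNReal.ofReal (A x) = eLpNorm (fun u => F u x) 2 (volume.restrict I))
    (hKm : MeasurableSet K) (hK : volume K ≠ ⊤) {D δ Δ : ℝ} (hD : ∀ u x, ‖F u x‖ ≤ D) (hδ : 0 < δ)
    (hKδ : ∀ x ∈ K, δ ≤ A x) (hKΔ : ∀ x ∈ K, A x ≤ Δ) :
    (∫ x in K, A x ^ p) ^ (1 / p) ≤
      n.factorial * Real.exp 2 * (M₀ ^ (2 / p - 1) * M₁ ^ (2 - 2 / p)) := by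
  have hp0 : 0 < p := by linarith
  have hp2' : 2 / p < 2 := by rw [div_lt_iff₀ hp0]; linarith
  have hp1' : 1 < 2 / p := by rw [lt_div_iff₀ hp0]; linarith
  have hK0 : ∀ x ∈ K, 0 < A x := fun x hx => hδ.trans_le (hKδ x hx)
  have hX0 : 0 ≤ ∫ x in K, A x ^ p :=
    setIntegral_nonneg hKm fun x hx => Real.rpow_nonneg (hK0 x hx).le _
  have hXi := integrable_rpow_of_le hp0 hAm hKm hK hK0 hKΔ
  obtain ⟨T, hTd, hTB, hTe, hTs⟩ :=
    exists_dualPairing (p := p) lam hp0 hI hs hst hβ hFm hAm hKm hK hD hδ hKδ hKΔ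
  have hmeas : ∀ (z : ℂ) {f : 𝔼 → ℂ}, Integrable f →
      Measurable (Function.uncurry (mulOp (symCut n lam (β * (1 - z)) (cut s t)) f)) := fun z f hf =>
    measurable_mulOp (isNice_symCut _ hs hst).meas hf
  have hsumi : ∀ c : ℤ → ℂ, Integrable fun x => ∑ j ∈ S, c j * b j x := fun c =>
    integrable_finsetSum S fun j _ => (hb j).const_mul (c j)
  -- At z = 2 - 2/p all coefficients are 1 and the pairing equals ∫_K A^p, so the three lines
  -- theorem bounds this integral by a power of itself.
  have h3 := norm_le_of_three_lines (H := fun z => ∑ j ∈ S, steinCoeff p j z * T (b j) z)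
    (M₀ := M₀) (M₁ := M₁ * (∫ x in K, A x ^ p) ^ (1 / 2 : ℝ)) ?_ ?_ hM₀ n ?_ ?_
    (θ := 2 - 2 / p) (by linarith) (by linarith)
  · have hHθ : ∑ j ∈ S, steinCoeff p j ((2 - 2 / p : ℝ) : ℂ) * T (b j) ((2 - 2 / p : ℝ) : ℂ) =
        ((∫ x in K, A x ^ p : ℝ) : ℂ) := by
      rw [← hTs S (fun j => steinCoeff p j ((2 - 2 / p : ℝ) : ℂ)) b hb, hTe _ (hsumi _)]
      simp only [steinCoeff_eq_one hp0, one_mul]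
      rw [← hF]
      exact integral_dualFun_mul_exp hp0 hFm hA hKm hK0
    beta_reduce at h3
    rw [hHθ, Complex.norm_real, Real.norm_of_nonneg hX0] at h3
    exact rpow_le_of_three_lines hp1 hp2 hM₀ hM₁ hX0 (by positivity) h3
  · exact Differentiable.fun_sum fun j _ => (differentiable_steinCoeff j).mul (hTd _ (hb j))
  · choose B hB using fun j => hTB _ (hb j)
    refine ⟨∑ j ∈ S, 2 ^ (|(j : ℝ)| * (p + p)) * |B j|, fun z hz0 hz1 => ?_⟩
    refine (norm_sum_le _ _).trans (Finset.sum_le_sum fun j _ => ?_)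
    rw [norm_mul, norm_steinCoeff]
    refine mul_le_mul (Real.rpow_le_rpow_of_exponent_le one_le_two ?_)
      ((hB j z hz0 hz1).trans (le_abs_self _)) (norm_nonneg _) (by positivity)
    refine (le_abs_self _).trans ?_
    rw [abs_mul]
    refine mul_le_mul_of_nonneg_left ?_ (abs_nonneg _)
    rw [abs_le]
    constructor <;> nlinarith
  · intro z hz
    have h4 : ∀ j, ‖steinCoeff p j z * T (b j) z‖ₑ ≤ ENNReal.ofReal (2 ^ ((j : ℝ) * (p - 1))) *
        mixedNorm 1 I (mulOp (symCut n lam (β * (1 - z)) (cut s t)) (b j)) := fun j => by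
      rw [enorm_mul]
      gcongr
      · rw [← ofReal_norm, norm_steinCoeff, hz]
        simp
      · rw [hTe _ (hb j)]
        exact enorm_pairing_le_mixedNorm_one (hmeas z (hb j)) hFm hAm hA hKm hK0 hz
    have h5 : ‖∑ j ∈ S, steinCoeff p j z * T (b j) z‖ₑ ≤ ENNReal.ofReal (M₀ * (1 + |z.im|) ^ n) :=
      (enorm_sum_le _ _).trans ((Finset.sum_le_sum fun j _ => h4 j).trans (h₀ z hz))
    rw [← ofReal_norm] at h5
    exact (ENNReal.ofReal_le_ofReal_iff (by positivity)).1 h5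
  · intro z hz
    have h4 : ‖∑ j ∈ S, steinCoeff p j z * T (b j) z‖ₑ ≤
        ENNReal.ofReal (M₁ * (∫ x in K, A x ^ p) ^ (1 / 2 : ℝ)) := by
      rw [← hTs S (fun j => steinCoeff p j z) b hb, hTe _ (hsumi _)]
      refine (enorm_pairing_le_mixedNorm_two (hmeas z (hsumi _)) hFm hAm hA hKm hK0 hXi hz).trans ?_
      rw [ENNReal.ofReal_mul hM₁]
      gcongr
      exact h₁ z hz
    rw [← ofReal_norm] at h4
    exact (ENNReal.ofReal_le_ofReal_iff (by positivity)).1 h4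

end Stein
end SquareFunction

namespace SquareFunction

variable {n : ℕ} {lam : ℝ}

local notation "𝔼" => EuclideanSpace ℝ (Fin n)

/-! ### Interpolation on the whole space, and convergence of the stopped functions -/

section Interpolation

open Filter Topology

variable {s t : ℝ} {I : Set ℝ}

lemma exists_norm_mulOp_symCut_le {ζ : ℂ} (hζ : 0 ≤ ζ.re) (hs : 0 < s) (hst : s ≤ t) {f : 𝔼 → ℂ}
    (hf : Integrable f) :
    ∃ D : ℝ, ∀ u x, ‖mulOp (symCut n lam ζ (cut s t)) f u x‖ ≤ D := by
  have h := (integrable_mul_fourier (contDiff_cut s t).continuous (hasCompactSupport_cut hs hst)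
    hf).2.ne
  refine ⟨(∫⁻ ξ, ‖cut s t ξ * 𝓕 f ξ‖ₑ).toReal, fun u x => ?_⟩
  rw [← toReal_enorm]
  refine ENNReal.toReal_mono h ((enorm_mulOp_le u x f).trans (lintegral_mono fun ξ => ?_))
  rw [enorm_mul]
  gcongr
  rw [symCut, enorm_mul]
  refine mul_le_of_le_one_left' ?_
  rw [← ofReal_norm]
  exact ENNReal.ofReal_le_one.2 (norm_sym_le_one hζ u ξ)

lemma enorm_mulOp_symCut_le_eLpNorm_two {ζ : ℂ} (hζ : 0 ≤ ζ.re) {f : 𝔼 → ℂ}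
    (hf : Integrable f) (hf2 : MemLp f 2) (u : ℝ) (x : 𝔼) :
    ‖mulOp (symCut n lam ζ (cut s t)) f u x‖ₑ ≤ eLpNorm (cut s t : 𝔼 → ℂ) 2 * eLpNorm f 2 := by
  refine (enorm_mulOp_le u x f).trans ?_
  rw [← eLpNorm_fourier hf hf2, ← eLpNorm_enorm (cut s t), ← eLpNorm_enorm (𝓕 f)]
  refine le_trans (lintegral_mono fun ξ => ?_) (lintegral_mul_le_eLpNorm_two
    (contDiff_cut s t).continuous.enorm.aemeasurable (continuous_fourier hf).enorm.aemeasurable)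
  gcongr
  rw [symCut, enorm_mul]
  refine mul_le_of_le_one_left' ?_
  rw [← ofReal_norm]
  exact ENNReal.ofReal_le_one.2 (norm_sym_le_one hζ u ξ)

/-- Stein interpolation for the truncated operators. -/
lemma stein_interpolation {β p : ℝ} (hp1 : 1 < p) (hp2 : p < 2) (hI : volume I ≠ ⊤) (hs : 0 < s)
    (hst : s ≤ t) (hβ : 0 ≤ β) (S : Finset ℤ) {b : ℤ → 𝔼 → ℂ} (hb : ∀ j, Integrable (b j))
    {M₀ M₁ : ℝ} (hM₀ : 0 ≤ M₀) (hM₁ : 0 ≤ M₁)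
    (h₀ : ∀ z : ℂ, z.re = 0 → ∑ j ∈ S, ENNReal.ofReal (2 ^ ((j : ℝ) * (p - 1))) *
      mixedNorm 1 I (mulOp (symCut n lam (β * (1 - z)) (cut s t)) (b j)) ≤
        ENNReal.ofReal (M₀ * (1 + |z.im|) ^ n))
    (h₁ : ∀ z : ℂ, z.re = 1 → mixedNorm 2 I (mulOp (symCut n lam (β * (1 - z)) (cut s t))
      (fun x => ∑ j ∈ S, steinCoeff p j z * b j x)) ≤ ENNReal.ofReal M₁) :
    mixedNorm (ENNReal.ofReal p) I (mulOp (symCut n lam (β * (1 - ((2 - 2 / p : ℝ) : ℂ))) (cut s t))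
      (fun x => ∑ j ∈ S, b j x)) ≤
        ENNReal.ofReal (n.factorial * Real.exp 2 * (M₀ ^ (2 / p - 1) * M₁ ^ (2 - 2 / p))) := by
  have hp0 : 0 < p := by linarith
  have : IsFiniteMeasure (volume.restrict I) := ⟨by simpa using hI.lt_top⟩
  have hre : 0 ≤ ((β : ℂ) * (1 - ((2 - 2 / p : ℝ) : ℂ))).re := by
    have : 1 ≤ 2 / p := by rw [le_div_iff₀ hp0]; linarith
    rw [← Complex.ofReal_one, ← Complex.ofReal_sub, ← Complex.ofReal_mul, Complex.ofReal_re]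
    exact mul_nonneg hβ (by linarith)
  have hint : Integrable fun x => ∑ j ∈ S, b j x := integrable_finsetSum S fun j _ => hb j
  obtain ⟨D, hD⟩ := exists_norm_mulOp_symCut_le (lam := lam) hre hs hst hint
  have hFm : Measurable (Function.uncurry (mulOp (symCut n lam (β * (1 - ((2 - 2 / p : ℝ) : ℂ)))
      (cut s t)) (fun x => ∑ j ∈ S, b j x))) :=
    measurable_mulOp (isNice_symCut _ hs hst).meas hint
  generalize hF : mulOp (symCut n lam (β * (1 - ((2 - 2 / p : ℝ) : ℂ))) (cut s t))
    (fun x => ∑ j ∈ S, b j x) = F at hD hFm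
  have hAb : ∀ x, eLpNorm (fun u => F u x) 2 (volume.restrict I) ≤
      (volume.restrict I) Set.univ ^ (2 : ℝ≥0∞).toReal⁻¹ * ENNReal.ofReal D := fun x =>
    eLpNorm_le_of_ae_bound (Eventually.of_forall fun u => hD u x)
  have hfin : (volume.restrict I) Set.univ ^ (2 : ℝ≥0∞).toReal⁻¹ * ENNReal.ofReal D ≠ ⊤ :=
    ENNReal.mul_ne_top (ENNReal.rpow_ne_top_of_nonneg (by positivity) (measure_ne_top _ _))
      ENNReal.ofReal_ne_top
  set A : 𝔼 → ℝ := fun x => (eLpNorm (fun u => F u x) 2 (volume.restrict I)).toReal with hAdef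
  have hA : ∀ x, ENNReal.ofReal (A x) = eLpNorm (fun u => F u x) 2 (volume.restrict I) := fun x =>
    ENNReal.ofReal_toReal ((hAb x).trans_lt hfin.lt_top).ne
  have hAm : Measurable A := (measurable_slice_norm I hFm).ennreal_toReal
  clear_value A
  have hAΔ : ∀ x, A x ≤
      ((volume.restrict I) Set.univ ^ (2 : ℝ≥0∞).toReal⁻¹ * ENNReal.ofReal D).toReal := fun x => by
    rw [← ENNReal.ofReal_le_iff_le_toReal hfin, hA]
    exact hAb x
  -- These bounded sets keep A away from 0, as the logarithmic weight requires, and exhaust the set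
  -- where A > 0.
  set K : ℕ → Set 𝔼 := fun k => Metric.closedBall 0 k ∩ {x | 1 / (k + 1 : ℝ) ≤ A x} with hK
  have hKm : ∀ k, MeasurableSet (K k) := fun k =>
    Metric.isClosed_closedBall.measurableSet.inter (measurableSet_le measurable_const hAm)
  have hKv : ∀ k, volume (K k) ≠ ⊤ := fun k =>
    ((measure_mono Set.inter_subset_left).trans_lt measure_closedBall_lt_top).ne
  have hbound : ∀ k, eLpNorm ((K k).indicator fun x => ENNReal.ofReal (A x)) (ENNReal.ofReal p) volume
      ≤ ENNReal.ofReal (n.factorial * Real.exp 2 * (M₀ ^ (2 / p - 1) * M₁ ^ (2 - 2 / p))) := by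
    intro k
    have hk0 : (0 : ℝ) < 1 / (k + 1 : ℝ) := by positivity
    have hpos : ∀ x ∈ K k, 0 < A x := fun x hx => hk0.trans_le hx.2
    have h := stein_interpolation_on hp1 hp2 hI hs hst hβ S hb hM₀ hM₁ h₀ h₁ hF.symm hFm hAm hA
      (hKm k) (hKv k) hD hk0 (fun x hx => hx.2) (fun x _ => hAΔ x)
    refine le_trans (le_of_eq ?_) (ENNReal.ofReal_le_ofReal h)
    rw [eLpNorm_indicator_eq_eLpNorm_restrict (hKm k), eLpNorm_eq_lintegral_rpow_enorm_toReal
      (by simpa using hp0) ENNReal.ofReal_ne_top, ENNReal.toReal_ofReal hp0.le,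
      ← ENNReal.ofReal_rpow_of_nonneg (setIntegral_nonneg (hKm k) fun x hx =>
        Real.rpow_nonneg (hpos x hx).le _) (by positivity),
      ofReal_integral_eq_lintegral_ofReal (integrable_rpow_of_le hp0 hAm (hKm k) (hKv k) hpos
        fun x _ => hAΔ x)]
    · congr 1
      refine setLIntegral_congr_fun (hKm k) fun x hx => ?_
      simp only [enorm_eq_self]
      rw [ENNReal.ofReal_rpow_of_nonneg (hpos x hx).le hp0.le]
    · filter_upwards [ae_restrict_mem (hKm k)] with x hx
      exact Real.rpow_nonneg (hpos x hx).le _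
  rw [mixedNorm_eq]
  refine (eLpNorm_le_liminf (by simpa using hp0) ENNReal.ofReal_ne_top
    (H := fun k => (K k).indicator fun x => ENNReal.ofReal (A x))
    (fun k => hAm.ennreal_ofReal.indicator (hKm k)) (Eventually.of_forall fun x => ?_)).trans
    (liminf_le_of_frequently_le' (Frequently.of_forall hbound))
  rw [← hA]
  rcases le_or_gt (A x) 0 with h0 | h0
  · rw [ENNReal.ofReal_of_nonpos h0]
    exact zero_le
  · have hev : ∀ᶠ k : ℕ in atTop, x ∈ K k := by
      obtain ⟨k₀, hk₀⟩ := exists_nat_ge (max ‖x‖ (A x)⁻¹)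
      filter_upwards [eventually_ge_atTop k₀] with k hk
      have hk' : (k₀ : ℝ) ≤ k := by exact_mod_cast hk
      refine ⟨?_, ?_⟩
      · rw [mem_closedBall_zero_iff]
        exact (le_max_left _ _).trans (hk₀.trans hk')
      · have h1 : (A x)⁻¹ ≤ k + 1 := ((le_max_right _ _).trans (hk₀.trans hk')).trans (by linarith)
        change 1 / (k + 1 : ℝ) ≤ A x
        rw [one_div]
        exact inv_le_of_inv_le₀ h0 h1
    refine le_liminf_of_le (by isBoundedDefault) ?_
    filter_upwards [hev] with k hk
    rw [Set.indicator_of_mem hk]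

variable {K : ℤ} {g : EuclideanSpace ℝ (Fin n) → ℂ}

lemma memLp_two_stopAvg (hn : 1 ≤ n) (hg : Integrable g) (hstep : IsStep K g) {α : ℝ} (hα : 0 < α) :
    MemLp (stopAvg K g α) 2 := by
  refine ⟨(integrable_stopAvg hn hg hstep hα).1, ?_⟩
  rw [← lintegral_sq_eq_eLpNorm]
  refine ENNReal.rpow_lt_top_of_nonneg (by norm_num) ((lintegral_stopAvg_sq_le hn hg hstep hα).trans_lt
    (ENNReal.mul_lt_top ENNReal.ofReal_lt_top hg.2)).ne

/-- Once 2^J is at least the supremum of |g|, stopping at 2^J returns g. Stopping at 2^(-J) gives a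
function whose squared L² norm is O(2^(-J)‖g‖₁), and the compactly supported frequency cutoff turns
L² smallness into pointwise smallness. -/
lemma mulOp_stopAvg_sub_tendsto (hn : 1 ≤ n) {ζ : ℂ} (hζ : 0 ≤ ζ.re) (hs : 0 < s) (hst : s ≤ t)
    (hg : Integrable g) (hstep : IsStep K g) {R : ℝ} (hR : ∀ x, ‖g x‖ ≤ R) (u : ℝ) (x : 𝔼) :
    Tendsto (fun J : ℕ => mulOp (symCut n lam ζ (cut s t))
      (fun y => stopAvg K g (2 ^ (J : ℝ)) y - stopAvg K g (2 ^ (-(J : ℝ))) y) u x) atTop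
      (𝓝 (mulOp (symCut n lam ζ (cut s t)) g u x)) := by
  have hpos : ∀ r : ℝ, (0 : ℝ) < 2 ^ r := fun r => by positivity
  have hev : ∀ᶠ J : ℕ in atTop, stopAvg K g (2 ^ (J : ℝ)) = g := by
    obtain ⟨J₀, hJ₀⟩ := pow_unbounded_of_one_lt R (one_lt_two : (1 : ℝ) < 2)
    filter_upwards [eventually_ge_atTop J₀] with J hJ
    ext y
    refine stopAvg_eq_of_notMem hn hg hstep (hpos _) ?_
    rw [bigSet_eq_empty hg fun y => (hR y).trans ?_]
    · simp
    · rw [Real.rpow_natCast]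
      exact hJ₀.le.trans (pow_le_pow_right₀ one_le_two hJ)
  have hsmall : Tendsto (fun J : ℕ => mulOp (symCut n lam ζ (cut s t))
      (stopAvg K g (2 ^ (-(J : ℝ)))) u x) atTop (𝓝 0) := by
    rw [tendsto_zero_iff_enorm_tendsto_zero]
    have h2 : Tendsto (fun J : ℕ => eLpNorm (cut s t : 𝔼 → ℂ) 2 *
        (ENNReal.ofReal ((2 * (2 ^ n) ^ 2 + 1) * (2 : ℝ) ^ (-(J : ℝ))) * ∫⁻ x, ‖g x‖ₑ) ^
          (1 / 2 : ℝ)) atTop (𝓝 0) := by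
      have h3 : Tendsto (fun J : ℕ => (2 * (2 ^ n) ^ 2 + 1) * (2 : ℝ) ^ (-(J : ℝ))) atTop (𝓝 0) := by
        have := tendsto_pow_atTop_nhds_zero_of_lt_one (r := (1 / 2 : ℝ)) (by norm_num) (by norm_num)
        have h4 := this.const_mul (2 * ((2 : ℝ) ^ n) ^ 2 + 1)
        rw [mul_zero] at h4
        refine h4.congr fun J => ?_
        rw [Real.rpow_neg two_pos.le, Real.rpow_natCast, one_div, inv_pow]
      have h4 := ENNReal.tendsto_ofReal h3
      rw [ENNReal.ofReal_zero] at h4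
      have h5 := ENNReal.Tendsto.mul_const (b := ∫⁻ x, ‖g x‖ₑ) h4 (Or.inr hg.2.ne)
      rw [zero_mul] at h5
      have h6 := (ENNReal.continuous_rpow_const (y := (1 / 2 : ℝ))).continuousAt.tendsto.comp h5
      rw [ENNReal.zero_rpow_of_pos (by norm_num)] at h6
      have h7 := ENNReal.Tendsto.const_mul (a := eLpNorm (cut s t : 𝔼 → ℂ) 2) h6 (Or.inr
        (((contDiff_cut s t).continuous.memLp_of_hasCompactSupport
          (hasCompactSupport_cut hs hst)).2.ne))
      rwa [mul_zero] at h7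
    refine tendsto_of_tendsto_of_tendsto_of_le_of_le tendsto_const_nhds h2 (fun _ => zero_le) fun J => ?_
    refine (enorm_mulOp_symCut_le_eLpNorm_two hζ (integrable_stopAvg hn hg hstep (hpos _))
      (memLp_two_stopAvg hn hg hstep (hpos _)) u x).trans ?_
    gcongr
    rw [← lintegral_sq_eq_eLpNorm]
    exact ENNReal.rpow_le_rpow (lintegral_stopAvg_sq_le hn hg hstep (hpos _)) (by norm_num)
  have := (tendsto_const_nhds (x := mulOp (symCut n lam ζ (cut s t)) g u x)).sub hsmall
  rw [sub_zero] at this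
  refine this.congr' ?_
  filter_upwards [hev] with J hJ
  rw [hJ, mulOp_sub (isNice_symCut ζ hs hst) hg (integrable_stopAvg hn hg hstep (hpos _))]

end Interpolation
end SquareFunction

namespace SquareFunction

variable {n : ℕ} {lam : ℝ}

local notation "𝔼" => EuclideanSpace ℝ (Fin n)

/-! ### The layers of a step function and the two endpoint bounds -/

section Layers

open Filter Topology

variable {s t : ℝ} {I : Set ℝ} {K : ℤ} {g : EuclideanSpace ℝ (Fin n) → ℂ}

lemma bigSet_anti {α α' : ℝ} (h : α ≤ α') : bigSet K g α' ⊆ bigSet K g α :=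
  fun _ ⟨k, hk, hx⟩ => ⟨k, hk, h.trans_lt hx⟩

/-- The difference of the truncations of `g` at the heights `2 ^ (j + 1)` and `2 ^ j`. -/
noncomputable def layer (K : ℤ) (g : 𝔼 → ℂ) (j : ℤ) (x : 𝔼) : ℂ :=
  stopAvg K g (2 ^ ((j + 1 : ℤ) : ℝ)) x - stopAvg K g (2 ^ (j : ℝ)) x

lemma two_rpow_succ (j : ℤ) : (2 : ℝ) ^ ((j + 1 : ℤ) : ℝ) = 2 * 2 ^ (j : ℝ) := by
  push_cast
  rw [Real.rpow_add two_pos, Real.rpow_one, mul_comm]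

lemma integrable_layer (hn : 1 ≤ n) (hg : Integrable g) (hstep : IsStep K g) (j : ℤ) :
    Integrable (layer K g j) :=
  (integrable_stopAvg hn hg hstep (by positivity)).sub
    (integrable_stopAvg hn hg hstep (by positivity))

lemma norm_layer_le (hn : 1 ≤ n) (hg : Integrable g) (hstep : IsStep K g) (j : ℤ) (x : 𝔼) :
    ‖layer K g j x‖ ≤ (bigSet K g (2 ^ (j : ℝ))).indicator (fun _ => 3 * 2 ^ n * 2 ^ (j : ℝ)) x := by
  have h0 : (0 : ℝ) < 2 ^ (j : ℝ) := by positivity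
  have h0' : (0 : ℝ) < 2 ^ ((j + 1 : ℤ) : ℝ) := by positivity
  by_cases hx : x ∈ bigSet K g (2 ^ (j : ℝ))
  · rw [Set.indicator_of_mem hx]
    have h1 := norm_stopAvg_le (K := K) hn hg h0 x
    have h2 := norm_stopAvg_le (K := K) hn hg h0' x
    rw [two_rpow_succ] at h2
    refine (norm_sub_le _ _).trans ?_
    rw [two_rpow_succ]
    linarith
  · have hx' : x ∉ bigSet K g (2 ^ ((j + 1 : ℤ) : ℝ)) := fun h =>
      hx (bigSet_anti (by rw [two_rpow_succ]; linarith) h)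
    rw [Set.indicator_of_notMem hx, layer, stopAvg_eq_of_notMem hn hg hstep h0 hx,
      stopAvg_eq_of_notMem hn hg hstep h0' hx', sub_self, norm_zero]

lemma sum_layer (J : ℕ) (x : 𝔼) : ∑ j ∈ Finset.Ico (-(J : ℤ)) J, layer K g j x =
    stopAvg K g (2 ^ (J : ℝ)) x - stopAvg K g (2 ^ (-(J : ℝ))) x := by
  have h : ∀ m : ℕ, ∑ j ∈ Finset.Ico (-(J : ℤ)) (-(J : ℤ) + m), layer K g j x =
      stopAvg K g (2 ^ ((-(J : ℤ) + m : ℤ) : ℝ)) x - stopAvg K g (2 ^ ((-(J : ℤ) : ℤ) : ℝ)) x := by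
    intro m
    induction m with
    | zero => simp
    | succ m ih =>
      have : (-(J : ℤ) + (m + 1 : ℕ)) = (-(J : ℤ) + m) + 1 := by push_cast; ring
      rw [this, ← Finset.insert_Ico_right_eq_Ico_add_one (by omega), Finset.sum_insert (by simp), ih,
        layer]
      ring
  have h2 := h (2 * J)
  have h3 : (-(J : ℤ) + (2 * J : ℕ)) = J := by push_cast; ring
  rw [h3] at h2
  rw [h2]
  push_cast
  rfl

/-- The atomic estimate applied to each atom of the layer; the coefficient sum is of order 2^j times
the measure of the exceptional set. -/
lemma exists_mixedNorm_layer_le (hn : 1 ≤ n) (hlam : 1 < lam) (I : Set ℝ)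
    (hI : Bornology.IsBounded I) (hIm : MeasurableSet I) :
    ∃ C : ℝ, 0 ≤ C ∧ ∀ (γ s t : ℝ) (K : ℤ) (g : 𝔼 → ℂ) (j : ℤ), 0 < s → s ≤ t → Integrable g →
      IsStep K g →
      mixedNorm 1 I (mulOp (symCut n lam (critExp n lam γ) (cut s t)) (layer K g j)) ≤
        ENNReal.ofReal (C * (1 + |γ|) ^ n * 2 ^ (j : ℝ)) * volume (bigSet K g (2 ^ (j : ℝ))) := by
  obtain ⟨C, hC, h⟩ := exists_mixedNorm_atom_le (lam := lam) hn hlam I hI hIm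
  refine ⟨C * (2 ^ n * 3 * √n ^ n), by positivity, fun γ s t K g j hs hst hg hstep => ?_⟩
  have hle : (2 : ℝ) ^ (j : ℝ) ≤ 2 ^ ((j + 1 : ℤ) : ℝ) := by
    rw [two_rpow_succ]
    linarith [Real.rpow_pos_of_pos two_pos (j : ℝ)]
  obtain ⟨S, c, a, ha, hai, hsum, hc⟩ := exists_atomic_decomposition hn hg hstep
    (by positivity : (0 : ℝ) < 2 ^ (j : ℝ)) hle
  have hl : layer K g j = fun x => ∑ i ∈ S, (c i : ℂ) * a i x := funext hsum
  rw [hl]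
  refine (mixedNorm_mulOp_sum_le (isNice_symCut _ hs hst) le_rfl I S _ hai).trans ?_
  calc _ ≤ ∑ i ∈ S, ENNReal.ofReal (c i) * ENNReal.ofReal (C * (1 + |γ|) ^ n) := by
        refine Finset.sum_le_sum fun i hi => ?_
        obtain ⟨hci, r, x₀, hr⟩ := ha i hi
        gcongr
        · rw [← ofReal_norm, Complex.norm_real, Real.norm_of_nonneg hci]
        · exact h γ s t r x₀ (a i) hs hst hr
    _ = (∑ i ∈ S, ENNReal.ofReal (c i)) * ENNReal.ofReal (C * (1 + |γ|) ^ n) := by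
        rw [Finset.sum_mul]
    _ ≤ (ENNReal.ofReal (2 ^ n * (2 ^ (j : ℝ) + 2 ^ ((j + 1 : ℤ) : ℝ)) * √n ^ n) *
          volume (bigSet K g (2 ^ (j : ℝ)))) * ENNReal.ofReal (C * (1 + |γ|) ^ n) := by gcongr
    _ = _ := by
        rw [mul_right_comm, ← ENNReal.ofReal_mul (by positivity), two_rpow_succ]
        congr 2
        ring

/-- The left endpoint. On Re z = 0 the order is critical with γ proportional to Im z, so the growth
is polynomial. The weight 2^(j(p-1)) and the layer cost 2^j |Ω_j| combine to the summable quantity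
2^(jp)|Ω_j|. -/
lemma exists_sum_mixedNorm_layer_le (hn : 1 ≤ n) (hlam : 1 < lam) (I : Set ℝ)
    (hI : Bornology.IsBounded I) (hIm : MeasurableSet I) {p : ℝ} (hp : 1 < p) :
    ∃ C : ℝ, 0 ≤ C ∧ ∀ (s t : ℝ) (K : ℤ) (g : 𝔼 → ℂ) (S : Finset ℤ), 0 < s → s ≤ t → Integrable g →
      IsStep K g → ∀ z : ℂ, z.re = 0 → ∑ j ∈ S, ENNReal.ofReal (2 ^ ((j : ℝ) * (p - 1))) *
      mixedNorm 1 I (mulOp (symCut n lam ((n * lam / 2 : ℝ) * (1 - z)) (cut s t)) (layer K g j)) ≤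
        ENNReal.ofReal (C * (1 + |z.im|) ^ n) * ∫⁻ x, ‖g x‖ₑ ^ p := by
  obtain ⟨C, hC, h⟩ := exists_mixedNorm_layer_le (lam := lam) hn hlam I hI hIm
  have hq1 : (2 : ℝ) ^ (-(p - 1)) < 1 := Real.rpow_lt_one_of_one_lt_of_neg one_lt_two (by linarith)
  have hpos : 0 < (1 - (2 : ℝ) ^ (-(p - 1)))⁻¹ := inv_pos.2 (by linarith)
  set C₁ : ℝ := 2 * (1 - (2 : ℝ) ^ (-(p - 1)))⁻¹ * 2 ^ (p - 1) with hC₁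
  have hC₁0 : 0 ≤ C₁ := by positivity
  have hβ0 : 0 ≤ n * lam / 2 := by positivity
  refine ⟨C * (1 + n * lam / 2) ^ n * C₁, by positivity, fun s t K g S hs hst hg hstep z hz => ?_⟩
  have hζ : (((n * lam / 2 : ℝ) : ℂ) * (1 - z)) = critExp n lam (-(n * lam / 2 * z.im)) := by
    apply Complex.ext
    · rw [Complex.re_ofReal_mul, critExp_re, Complex.sub_re, hz, Complex.one_re, sub_zero, mul_one]
    · rw [Complex.im_ofReal_mul, critExp]
      simp only [Complex.sub_im, Complex.one_im, Complex.add_im, Complex.ofReal_im, Complex.mul_im,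
        Complex.ofReal_re, Complex.I_im, Complex.I_re]
      ring
  rw [hζ]
  calc _ ≤ ∑ j ∈ S, ENNReal.ofReal (C * (1 + n * lam / 2) ^ n * (1 + |z.im|) ^ n) *
        (ENNReal.ofReal ((2 : ℝ) ^ ((j : ℝ) * p)) * volume (bigSet K g (2 ^ (j : ℝ)))) := by
        refine Finset.sum_le_sum fun j _ => ?_
        refine (mul_le_mul_right (h (-(n * lam / 2 * z.im)) s t K g j hs hst hg hstep) _).trans ?_
        rw [← mul_assoc, ← mul_assoc, ← ENNReal.ofReal_mul (by positivity),
          ← ENNReal.ofReal_mul (by positivity)]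
        refine mul_le_mul' (ENNReal.ofReal_le_ofReal ?_) le_rfl
        have h1 : (2 : ℝ) ^ ((j : ℝ) * p) = 2 ^ ((j : ℝ) * (p - 1)) * 2 ^ (j : ℝ) := by
          rw [← Real.rpow_add two_pos]
          congr 1
          ring
        have h2 : 1 + |-(n * lam / 2 * z.im)| ≤ (1 + n * lam / 2) * (1 + |z.im|) := by
          rw [abs_neg, abs_mul, abs_of_nonneg hβ0]
          nlinarith [abs_nonneg z.im]
        calc _ ≤ 2 ^ ((j : ℝ) * (p - 1)) *
              (C * ((1 + n * lam / 2) * (1 + |z.im|)) ^ n * 2 ^ (j : ℝ)) := by gcongr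
          _ = _ := by rw [h1, mul_pow]; ring
    _ ≤ ENNReal.ofReal (C * (1 + n * lam / 2) ^ n * (1 + |z.im|) ^ n) *
        (ENNReal.ofReal C₁ * ∫⁻ x, ‖g x‖ₑ ^ p) := by
        rw [← Finset.mul_sum]
        gcongr
        exact sum_measure_bigSet_le hn hg hp S
    _ = _ := by
        rw [← mul_assoc, ← ENNReal.ofReal_mul (by positivity)]
        congr 2
        ring

/-- The right endpoint. On Re z = 1 the weighted layer is O(2^(jp/2)) on Ω_j and zero elsewhere. The
layers are not orthogonal, but at each point the sum is geometric, so its square is controlled by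
the sum of 2^(jp) over the sets Ω_j containing the point. -/
lemma exists_eLpNorm_sum_layer_le (hn : 1 ≤ n) {p : ℝ} (hp : 1 < p) :
    ∃ C : ℝ, 0 ≤ C ∧ ∀ (K : ℤ) (g : 𝔼 → ℂ) (S : Finset ℤ), Integrable g → IsStep K g →
      ∀ z : ℂ, z.re = 1 → eLpNorm (fun x => ∑ j ∈ S, steinCoeff p j z * layer K g j x) 2 ≤
        ENNReal.ofReal C * (∫⁻ x, ‖g x‖ₑ ^ p) ^ (1 / 2 : ℝ) := by
  have hp0 : 0 < p := by linarith
  have hq1 : (2 : ℝ) ^ (-(p - 1)) < 1 := Real.rpow_lt_one_of_one_lt_of_neg one_lt_two (by linarith)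
  have hpos : 0 < (1 - (2 : ℝ) ^ (-(p - 1)))⁻¹ := inv_pos.2 (by linarith)
  set C₁ : ℝ := 2 * (1 - (2 : ℝ) ^ (-(p - 1)))⁻¹ * 2 ^ (p - 1) with hC₁
  have hC₁0 : 0 ≤ C₁ := by positivity
  set C₂ : ℝ := (3 * 2 ^ n) ^ 2 * ((1 - (2 : ℝ) ^ (-(p / 2)))⁻¹) ^ 2 with hC₂
  have hC₂0 : 0 ≤ C₂ := by positivity
  refine ⟨(C₂ * C₁) ^ (1 / 2 : ℝ), by positivity, fun K g S hg hstep z hz => ?_⟩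
  rw [← ENNReal.ofReal_rpow_of_nonneg (by positivity) (by norm_num), ← ENNReal.mul_rpow_of_nonneg _ _
    (by norm_num), ← lintegral_sq_eq_eLpNorm]
  refine ENNReal.rpow_le_rpow ?_ (by norm_num)
  have hpt : ∀ x, ‖∑ j ∈ S, steinCoeff p j z * layer K g j x‖ₑ ^ 2 ≤ ENNReal.ofReal C₂ *
      ∑ j ∈ S, (bigSet K g (2 ^ (j : ℝ))).indicator (fun _ => ENNReal.ofReal (2 ^ ((j : ℝ) * p))) x := by
    classical
    intro x
    set T := S.filter fun j : ℤ => x ∈ bigSet K g (2 ^ (j : ℝ)) with hT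
    have h1 : ‖∑ j ∈ S, steinCoeff p j z * layer K g j x‖ ≤
        3 * 2 ^ n * ∑ j ∈ T, (2 : ℝ) ^ ((j : ℝ) * (p / 2)) := by
      rw [Finset.mul_sum, hT, Finset.sum_filter]
      refine (norm_sum_le _ _).trans (Finset.sum_le_sum fun j _ => ?_)
      rw [norm_mul, norm_steinCoeff, hz]
      have h2 := norm_layer_le hn hg hstep j x
      by_cases hx : x ∈ bigSet K g (2 ^ (j : ℝ))
      · rw [Set.indicator_of_mem hx] at h2
        rw [if_pos hx]
        have h3 : (2 : ℝ) ^ ((j : ℝ) * (p / 2)) =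
            2 ^ ((j : ℝ) * (p - 1 - p / 2 * 1)) * 2 ^ (j : ℝ) := by
          rw [← Real.rpow_add two_pos]
          congr 1
          ring
        rw [h3]
        calc _ ≤ (2 : ℝ) ^ ((j : ℝ) * (p - 1 - p / 2 * 1)) * (3 * 2 ^ n * 2 ^ (j : ℝ)) := by gcongr
          _ = _ := by ring
      · rw [Set.indicator_of_notMem hx] at h2
        rw [if_neg hx, norm_le_zero_iff.1 h2]
        simp
    have h4 : ‖∑ j ∈ S, steinCoeff p j z * layer K g j x‖ ^ 2 ≤
        C₂ * ∑ j ∈ T, (2 : ℝ) ^ ((j : ℝ) * p) := by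
      have h5 := sq_sum_two_rpow_le (by positivity : 0 < p / 2) T
      rw [mul_div_cancel₀ p two_ne_zero] at h5
      calc _ ≤ (3 * 2 ^ n * ∑ j ∈ T, (2 : ℝ) ^ ((j : ℝ) * (p / 2))) ^ 2 := by gcongr
        _ = (3 * 2 ^ n) ^ 2 * (∑ j ∈ T, (2 : ℝ) ^ ((j : ℝ) * (p / 2))) ^ 2 := by ring
        _ ≤ (3 * 2 ^ n) ^ 2 * (((1 - (2 : ℝ) ^ (-(p / 2)))⁻¹) ^ 2 *
            ∑ j ∈ T, (2 : ℝ) ^ ((j : ℝ) * p)) := by gcongr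
        _ = _ := by rw [hC₂]; ring
    rw [← ofReal_norm, ← ENNReal.ofReal_pow (norm_nonneg _)]
    refine (ENNReal.ofReal_le_ofReal h4).trans (le_of_eq ?_)
    rw [ENNReal.ofReal_mul hC₂0, ENNReal.ofReal_sum_of_nonneg fun j _ => by positivity, hT,
      Finset.sum_filter]
    rfl
  calc _ ≤ ∫⁻ x, ENNReal.ofReal C₂ * ∑ j ∈ S, (bigSet K g (2 ^ (j : ℝ))).indicator
        (fun _ => ENNReal.ofReal (2 ^ ((j : ℝ) * p))) x := lintegral_mono hpt
    _ = ENNReal.ofReal C₂ * ∑ j ∈ S, ENNReal.ofReal (2 ^ ((j : ℝ) * p)) *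
        volume (bigSet K g (2 ^ (j : ℝ))) := by
        have hm : ∀ j : ℤ, Measurable ((bigSet K g (2 ^ (j : ℝ))).indicator
          (fun _ => ENNReal.ofReal (2 ^ ((j : ℝ) * p)))) := fun j =>
          measurable_const.indicator measurableSet_bigSet
        rw [lintegral_const_mul _ (Finset.measurable_sum _ fun j _ => hm j),
          lintegral_finsetSum' _ fun j _ => (hm j).aemeasurable]
        congr 1
        refine Finset.sum_congr rfl fun j _ => ?_
        rw [lintegral_indicator_const measurableSet_bigSet]
    _ ≤ ENNReal.ofReal C₂ * (ENNReal.ofReal C₁ * ∫⁻ x, ‖g x‖ₑ ^ p) := by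
        gcongr
        exact sum_measure_bigSet_le hn hg hp S
    _ = _ := by rw [← mul_assoc, ← ENNReal.ofReal_mul hC₂0]

/-- The square function estimate for truncated operators and step functions, `1 < p < 2`. -/
lemma exists_mixedNorm_step_le (hn : 1 ≤ n) (hlam : 1 < lam) (I : Set ℝ)
    (hI : Bornology.IsBounded I) (hIm : MeasurableSet I) {p : ℝ} (hp : 1 < p) (hp2 : p < 2) :
    ∃ C : ℝ, 0 ≤ C ∧ ∀ (s t : ℝ) (K : ℤ) (g : 𝔼 → ℂ) (R : ℝ), 0 < s → s ≤ t → Integrable g →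
      MemLp g (ENNReal.ofReal p) → IsStep K g → (∀ x, ‖g x‖ ≤ R) →
      mixedNorm (ENNReal.ofReal p) I (mulOp (symCut n lam
        ((n * lam * (1 / p - 1 / 2) : ℝ) : ℂ) (cut s t)) g) ≤
        ENNReal.ofReal C * eLpNorm g (ENNReal.ofReal p) := by
  have hp0 : 0 < p := by linarith
  have hIv : volume I ≠ ⊤ := hI.measure_lt_top.ne
  obtain ⟨C₀, hC₀, h₀⟩ := exists_sum_mixedNorm_layer_le (lam := lam) hn hlam I hI hIm hp
  obtain ⟨C₁, hC₁, h₁⟩ := exists_eLpNorm_sum_layer_le hn hp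
  set V : ℝ := (volume I ^ (1 / 2 : ℝ)).toReal with hV
  have hVv : ENNReal.ofReal V = volume I ^ (1 / 2 : ℝ) :=
    ENNReal.ofReal_toReal (ENNReal.rpow_ne_top_of_nonneg (by norm_num) hIv)
  have hV0 : 0 ≤ V := ENNReal.toReal_nonneg
  refine ⟨n.factorial * Real.exp 2 * (C₀ ^ (2 / p - 1) * (V * C₁) ^ (2 - 2 / p)), by positivity,
    fun s t K g R hs hst hg hgp hstep hR => ?_⟩
  have hp0' : ENNReal.ofReal p ≠ 0 := by simpa using hp0
  have hNfin : ∫⁻ x, ‖g x‖ₑ ^ p ≠ ⊤ := by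
    have := (lintegral_rpow_enorm_lt_top_of_eLpNorm_lt_top hp0' ENNReal.ofReal_ne_top hgp.2).ne
    rwa [ENNReal.toReal_ofReal hp0.le] at this
  set N : ℝ := (∫⁻ x, ‖g x‖ₑ ^ p).toReal with hN
  have hN0 : 0 ≤ N := ENNReal.toReal_nonneg
  have hNv : ENNReal.ofReal N = ∫⁻ x, ‖g x‖ₑ ^ p := ENNReal.ofReal_toReal hNfin
  have hnorm : eLpNorm g (ENNReal.ofReal p) = ENNReal.ofReal (N ^ (1 / p)) := by
    rw [eLpNorm_eq_lintegral_rpow_enorm_toReal hp0' ENNReal.ofReal_ne_top,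
      ENNReal.toReal_ofReal hp0.le, ← hNv, ENNReal.ofReal_rpow_of_nonneg hN0 (by positivity)]
  have hβ : (0 : ℝ) ≤ n * lam / 2 := by positivity
  have hexp : ((n * lam * (1 / p - 1 / 2) : ℝ) : ℂ) =
      ((n * lam / 2 : ℝ) : ℂ) * (1 - ((2 - 2 / p : ℝ) : ℂ)) := by
    rw [← Complex.ofReal_one, ← Complex.ofReal_sub, ← Complex.ofReal_mul]
    congr 1
    ring
  have hre : 0 ≤ (((n * lam * (1 / p - 1 / 2) : ℝ) : ℂ)).re := by
    rw [Complex.ofReal_re]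
    have : 1 / 2 ≤ 1 / p := one_div_le_one_div_of_le hp0 hp2.le
    exact mul_nonneg (by positivity) (by linarith)
  -- Homogeneity: both endpoint bounds are powers of N = ∫|g|^p, and (2/p - 1) + (2 - 2/p)/2 = 1/p.
  have hconst : n.factorial * Real.exp 2 * ((C₀ * N) ^ (2 / p - 1) *
      (V * C₁ * N ^ (1 / 2 : ℝ)) ^ (2 - 2 / p)) =
      n.factorial * Real.exp 2 * (C₀ ^ (2 / p - 1) * (V * C₁) ^ (2 - 2 / p)) * N ^ (1 / p) := by
    rw [Real.mul_rpow hC₀ hN0, Real.mul_rpow (by positivity) (by positivity), ← Real.rpow_mul hN0]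
    have h3 : N ^ (1 / p) = N ^ (2 / p - 1) * N ^ (1 / 2 * (2 - 2 / p)) := by
      have h4 : (2 / p - 1) + 1 / 2 * (2 - 2 / p) = 1 / p := by ring
      rw [← Real.rpow_add' hN0 (by rw [h4]; positivity), h4]
    rw [h3]
    ring
  -- Interpolation is applied to the finitely many layers with -J ≤ j < J, with bounds independent
  -- of J; their sum telescopes and recovers g in the limit.
  refine mixedNorm_le_of_tendsto hp0' ENNReal.ofReal_ne_top I
    (G := fun J : ℕ => mulOp (symCut n lam ((n * lam * (1 / p - 1 / 2) : ℝ) : ℂ) (cut s t))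
      (fun y => stopAvg K g (2 ^ (J : ℝ)) y - stopAvg K g (2 ^ (-(J : ℝ))) y))
    (fun J => measurable_mulOp (isNice_symCut _ hs hst).meas
      ((integrable_stopAvg hn hg hstep (by positivity)).sub
        (integrable_stopAvg hn hg hstep (by positivity))))
    (Eventually.of_forall fun x => Eventually.of_forall fun u =>
      mulOp_stopAvg_sub_tendsto hn hre hs hst hg hstep hR u x)
    (Eventually.of_forall fun J => ?_)
  simp only [← sum_layer]
  rw [hexp]
  refine (stein_interpolation hp hp2 hIv hs hst hβ (Finset.Ico (-(J : ℤ)) J)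
    (integrable_layer hn hg hstep) (M₀ := C₀ * N) (M₁ := V * C₁ * N ^ (1 / 2 : ℝ)) (by positivity)
    (by positivity) (fun z hz => ?_) (fun z hz => ?_)).trans (le_of_eq ?_)
  · refine (h₀ s t K g _ hs hst hg hstep z hz).trans (le_of_eq ?_)
    rw [← hNv, ← ENNReal.ofReal_mul (by positivity)]
    congr 1
    ring
  · have hzre : (((n * lam / 2 : ℝ) : ℂ) * (1 - z)).re = 0 := by
      rw [Complex.re_ofReal_mul, Complex.sub_re, hz, Complex.one_re, sub_self, mul_zero]
    have hfi : Integrable fun x => ∑ j ∈ Finset.Ico (-(J : ℤ)) J, steinCoeff p j z * layer K g j x :=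
      integrable_finsetSum _ fun j _ => (integrable_layer hn hg hstep j).const_mul _
    have hf2 : MemLp (fun x => ∑ j ∈ Finset.Ico (-(J : ℤ)) J, steinCoeff p j z * layer K g j x) 2 :=
      memLp_finsetSum _ fun j _ => ((memLp_two_stopAvg hn hg hstep (by positivity)).sub
        (memLp_two_stopAvg hn hg hstep (by positivity))).const_mul _
    refine (mixedNorm_two_le I (measurable_mulOp (isNice_symCut _ hs hst).meas hfi) fun u =>
      (eLpNorm_mulOp_le (isNice_symCut _ hs hst) (fun u ξ => norm_symCut_le_one hzre.ge s t u ξ)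
        hfi hf2 u).trans (h₁ K g _ hg hstep z hz)).trans (le_of_eq ?_)
    rw [← hVv, ← hNv, ENNReal.ofReal_rpow_of_nonneg hN0 (by norm_num),
      ← ENNReal.ofReal_mul hC₁, ← ENNReal.ofReal_mul hV0, mul_assoc]
  · rw [hconst, hnorm, ENNReal.ofReal_mul (by positivity)]

end Layers
end SquareFunction

namespace SquareFunction

variable {n : ℕ} {lam : ℝ}

local notation "𝔼" => EuclideanSpace ℝ (Fin n)

/-! ### Approximation by bounded step functions -/

section Approximation

open Filter Topology

/-- Bounded integrable functions that are constant on small dyadic cubes. -/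
structure IsTame (f : 𝔼 → ℂ) : Prop where
  step : ∃ K, IsStep K f
  bound : ∃ R : ℝ, ∀ x, ‖f x‖ ≤ R
  memLp : ∀ r : ℝ≥0∞, MemLp f r

lemma IsStep.mono {β : Type*} {K L : ℤ} (hKL : K ≤ L) {f : 𝔼 → β} (hf : IsStep K f) : IsStep L f :=
  fun x y h => hf x y (grid_eq_of_le hKL h)

lemma IsTame.integrable {f : 𝔼 → ℂ} (hf : IsTame f) : Integrable f :=
  memLp_one_iff_integrable.1 (hf.memLp 1)

lemma IsTame.map₂ {f g : 𝔼 → ℂ} (hf : IsTame f) (hg : IsTame g) (σ : ℂ) :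
    IsTame (fun x => f x + σ * g x) := by
  obtain ⟨K, hK⟩ := hf.step
  obtain ⟨L, hL⟩ := hg.step
  obtain ⟨R, hR⟩ := hf.bound
  obtain ⟨T, hT⟩ := hg.bound
  refine ⟨⟨max K L, fun x y h => ?_⟩, ⟨R + ‖σ‖ * T, fun x => ?_⟩, fun r =>
    (hf.memLp r).add ((hg.memLp r).const_mul σ)⟩
  · simp only [hK.mono (le_max_left K L) x y h, hL.mono (le_max_right K L) x y h]
  · refine (norm_add_le _ _).trans (add_le_add (hR x) ?_)
    rw [norm_mul]
    exact mul_le_mul_of_nonneg_left (hT x) (norm_nonneg _)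

lemma IsTame.add {f g : 𝔼 → ℂ} (hf : IsTame f) (hg : IsTame g) : IsTame (fun x => f x + g x) := by
  simpa using hf.map₂ hg 1

lemma IsTame.sub {f g : 𝔼 → ℂ} (hf : IsTame f) (hg : IsTame g) : IsTame (fun x => f x - g x) := by
  simpa [sub_eq_add_neg] using hf.map₂ hg (-1)

/-- A union of unit cubes exhausting the space. -/
def box (n M : ℕ) : Set (EuclideanSpace ℝ (Fin n)) :=
  {x | ∀ i, (grid n 0 x i).natAbs ≤ M}

lemma box_eq_preimage (M : ℕ) :
    box n M = grid n 0 ⁻¹' (Set.univ.pi fun _ => {a : ℤ | a.natAbs ≤ M}) := by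
  ext x
  simp [box]

lemma measurableSet_box (M : ℕ) : MeasurableSet (box n M) := by
  rw [box_eq_preimage]
  exact measurable_grid 0 (Set.to_countable _).measurableSet

lemma volume_box_ne_top (M : ℕ) : volume (box n M) ≠ ⊤ := by
  have hfin : (Set.univ.pi fun _ : Fin n => {a : ℤ | a.natAbs ≤ M}).Finite := by
    refine Set.Finite.pi fun _ => (Set.finite_Icc (-(M : ℤ)) M).subset fun a ha => ?_
    have : a.natAbs ≤ M := ha
    exact ⟨by omega, by omega⟩
  rw [box_eq_preimage, ← Set.biUnion_preimage_singleton]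
  refine (measure_biUnion_lt_top hfin fun k _ => ?_).ne
  by_cases h : ∃ x : 𝔼, grid n 0 x = k
  · obtain ⟨x, rfl⟩ := h
    have : grid n 0 ⁻¹' {grid n 0 x} = cube 0 x := rfl
    rw [this, volume_cube]
    exact ENNReal.ofReal_lt_top
  · have : grid n 0 ⁻¹' {k} = (∅ : Set 𝔼) := by
      ext x
      simp only [Set.mem_preimage, Set.mem_singleton_iff, Set.mem_empty_iff_false, iff_false]
      exact fun hx => h ⟨x, hx⟩
    rw [this]
    simp

lemma tendsto_eLpNorm_box_compl {p : ℝ≥0∞} (hp : 1 ≤ p) (hp' : p ≠ ⊤) {f : 𝔼 → ℂ} (hf : MemLp f p) :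
    Tendsto (fun M => eLpNorm ((box n M)ᶜ.indicator f) p) atTop (𝓝 0) := by
  have hp0 : p ≠ 0 := (zero_lt_one.trans_le hp).ne'
  have hpp : 0 < p.toReal := ENNReal.toReal_pos hp0 hp'
  have hm : ∀ M, MeasurableSet (box n M)ᶜ := fun M => (measurableSet_box M).compl
  have hfin := lintegral_rpow_enorm_lt_top_of_eLpNorm_lt_top hp0 hp' hf.2
  have h := tendsto_measure_iInter_atTop (μ := volume.withDensity fun x => ‖f x‖ₑ ^ p.toReal)
    (s := fun M => (box n M)ᶜ) (fun M => (hm M).nullMeasurableSet)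
    (fun M M' h x hx hx' => hx fun i => (hx' i).trans h)
    ⟨0, by
      rw [withDensity_apply _ (hm 0)]
      exact ((setLIntegral_le_lintegral _ _).trans_lt hfin).ne⟩
  have hempty : ⋂ M, (box n M)ᶜ = ∅ := by
    refine Set.eq_empty_of_forall_notMem fun x hx => ?_
    refine Set.mem_iInter.1 hx (Finset.univ.sup fun i => (grid n 0 x i).natAbs) fun i => ?_
    exact Finset.le_sup (f := fun i => (grid n 0 x i).natAbs) (Finset.mem_univ i)
  rw [hempty, measure_empty] at h
  have h2 := (ENNReal.continuous_rpow_const (y := 1 / p.toReal)).continuousAt.tendsto.comp h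
  rw [ENNReal.zero_rpow_of_pos (by positivity)] at h2
  refine h2.congr fun M => ?_
  rw [eLpNorm_indicator_eq_eLpNorm_restrict (hm M), eLpNorm_eq_lintegral_rpow_enorm_toReal hp0 hp']
  simp only [Function.comp]
  rw [withDensity_apply _ (hm M)]

/-- A continuous function of compact support approximates `f`. By uniform continuity it may be
replaced by its value at one chosen point of each cube, once the diameter √n · 2^(-m) is small. -/
lemma exists_isStep_eLpNorm_sub_le {r : ℝ≥0∞} (hr1 : 1 ≤ r) (hr : r ≠ ⊤) {μ : Measure 𝔼} [IsFiniteMeasure μ]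
    {f : 𝔼 → ℂ} (hf : MemLp f r μ) {ε : ℝ≥0∞} (hε : ε ≠ 0) :
    ∃ (K : ℤ) (s : 𝔼 → ℂ) (R : ℝ), 0 ≤ K ∧ IsStep K s ∧ (∀ x, ‖s x‖ ≤ R) ∧
      MemLp (f - s) r μ ∧ eLpNorm (f - s) r μ ≤ ε * (1 + μ Set.univ ^ r.toReal⁻¹) := by
  obtain ⟨ε', hε'0, hε'⟩ := ENNReal.lt_iff_exists_nnreal_btwn.1 (pos_iff_ne_zero.2 hε)
  have hε'0 : 0 < ε' := by exact_mod_cast hε'0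
  obtain ⟨g, hgs, hg, hgc, hgm⟩ := hf.exists_hasCompactSupport_eLpNorm_sub_le hr hε
  obtain ⟨R, hR⟩ := hgs.exists_bound_of_continuous hgc
  obtain ⟨δ, hδ, hgδ⟩ := Metric.uniformContinuous_iff.1
    (hgs.uniformContinuous_of_continuous hgc) ε' (by exact_mod_cast hε'0)
  obtain ⟨m, hm⟩ := exists_pow_lt_of_lt_one (show 0 < δ / (√n + 1) by positivity)
    (by norm_num : (1 / 2 : ℝ) < 1)
  have hm' : √n * (2 : ℝ) ^ (-(m : ℤ)) < δ := by
    rw [zpow_neg, zpow_natCast, ← one_div, ← one_div_pow]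
    rw [lt_div_iff₀ (by positivity)] at hm
    nlinarith [pow_pos (by norm_num : (0 : ℝ) < 1 / 2) m]
  have hrep : ∀ x : 𝔼, grid n m (Function.invFun (grid n m) (grid n m x)) = grid n m x := fun x =>
    Function.invFun_eq ⟨x, rfl⟩
  set s : 𝔼 → ℂ := fun x => g (Function.invFun (grid n m) (grid n m x)) with hs
  have hstep : IsStep m s := fun x y h => by simp only [hs, h]
  have hsm : Measurable s := hstep.measurable
  have hclose : ∀ x, ‖(g - s) x‖ ≤ ε' := fun x => by
    have h1 : dist x (Function.invFun (grid n m) (grid n m x)) < δ := by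
      rw [dist_eq_norm, norm_sub_rev]
      exact (norm_sub_le_of_mem_cube (hrep x)).trans_lt hm'
    have := (hgδ h1).le
    rwa [dist_eq_norm] at this
  have hgsm : MemLp (g - s) r μ :=
    MemLp.of_bound (hgc.measurable.sub hsm).aestronglyMeasurable ε' (Eventually.of_forall hclose)
  have heq : f - s = (f - g) + (g - s) := by simp
  refine ⟨m, s, R, by positivity, hstep, fun x => hR _, ?_, ?_⟩
  · rw [heq]
    exact (hf.sub hgm).add hgsm
  rw [heq]
  refine (eLpNorm_add_le (hf.sub hgm).1 hgsm.1 hr1).trans ?_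
  rw [mul_add, mul_one]
  refine add_le_add hg ((eLpNorm_le_of_ae_bound (Eventually.of_forall hclose)).trans ?_)
  rw [mul_comm, ENNReal.ofReal_coe_nnreal]
  gcongr

/-- Simultaneous approximation by bounded step functions in two Lebesgue spaces. -/
lemma exists_isTame_eLpNorm_sub_le {p q : ℝ≥0∞} (hp : 1 ≤ p) (hp' : p ≠ ⊤) (hq : 1 ≤ q) (hq' : q ≠ ⊤)
    {f : 𝔼 → ℂ} (hfp : MemLp f p) (hfq : MemLp f q) {ε : ℝ≥0∞} (hε : ε ≠ 0) :
    ∃ s : 𝔼 → ℂ, IsTame s ∧ eLpNorm (fun x => f x - s x) p ≤ ε ∧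
      eLpNorm (fun x => f x - s x) q ≤ ε := by
  have hε2 : ε / 2 ≠ 0 := by simpa using hε
  obtain ⟨M, hMp, hMq⟩ := (((tendsto_eLpNorm_box_compl hp hp' hfp).eventually_le_const
    (pos_iff_ne_zero.2 hε2)).and ((tendsto_eLpNorm_box_compl hq hq' hfq).eventually_le_const
    (pos_iff_ne_zero.2 hε2))).exists
  set Q := box n M with hQ
  have hQm : MeasurableSet Q := measurableSet_box M
  have hQv : volume Q ≠ ⊤ := volume_box_ne_top M
  set μ := (volume : Measure 𝔼).restrict Q with hμ
  have : IsFiniteMeasure μ := ⟨by rw [hμ, Measure.restrict_apply_univ]; exact hQv.lt_top⟩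
  -- On the box, which has finite measure, the L^r norm with the larger exponent controls both
  -- norms; `f` is in L^r there because r is one of the two exponents. The box is a union of unit
  -- cubes, so restricting to it preserves steps of scale K ≥ 0.
  set r := max p q with hr
  have hr1 : 1 ≤ r := hp.trans (le_max_left _ _)
  have hr' : r ≠ ⊤ := by
    rw [hr]
    rcases max_choice p q with h | h <;> rw [h] <;> assumption
  have hfr : MemLp f r μ := by
    rw [hr]
    rcases max_choice p q with h | h <;> rw [h]
    · exact hfp.restrict Q
    · exact hfq.restrict Q
  have hμfin : ∀ y : ℝ, 0 ≤ y → μ Set.univ ^ y ≠ ⊤ := fun y hy =>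
    ENNReal.rpow_ne_top_of_nonneg hy (measure_ne_top _ _)
  have hexp : ∀ q : ℝ≥0∞, 1 ≤ q → q ≤ r → 0 ≤ 1 / q.toReal - 1 / r.toReal := fun q hq hqr => by
    rw [sub_nonneg]
    exact one_div_le_one_div_of_le
      (ENNReal.toReal_pos (zero_lt_one.trans_le hq).ne' (ne_top_of_le_ne_top hr' hqr))
      (ENNReal.toReal_mono hr' hqr)
  set Ξ : ℝ≥0∞ := (1 + μ Set.univ ^ r.toReal⁻¹) *
    (μ Set.univ ^ (1 / p.toReal - 1 / r.toReal) + μ Set.univ ^ (1 / q.toReal - 1 / r.toReal)) with hΞ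
  have hΞfin : Ξ ≠ ⊤ := by
    refine ENNReal.mul_ne_top (ENNReal.add_ne_top.2 ⟨ENNReal.one_ne_top, hμfin _ (by positivity)⟩)
      (ENNReal.add_ne_top.2 ⟨hμfin _ (hexp p hp (le_max_left _ _)),
        hμfin _ (hexp q hq (le_max_right _ _))⟩)
  obtain ⟨η, hη0, hη⟩ := ENNReal.exists_nnreal_pos_mul_lt hΞfin hε2
  obtain ⟨K, s, R, hK, hstep, hR, hsm, hsle⟩ :=
    exists_isStep_eLpNorm_sub_le hr1 hr' hfr (ε := η) (by exact_mod_cast hη0.ne')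
  have hQstep : ∀ x y : 𝔼, grid n K y = grid n K x → (y ∈ Q ↔ x ∈ Q) := fun x y h => by
    simp only [hQ, box, Set.mem_ofPred_eq, grid_eq_of_le hK h]
  have hts : IsStep K (Q.indicator s) := fun x y h => by
    by_cases hx : x ∈ Q
    · rw [Set.indicator_of_mem hx, Set.indicator_of_mem ((hQstep x y h).2 hx), hstep x y h]
    · rw [Set.indicator_of_notMem hx, Set.indicator_of_notMem (mt (hQstep x y h).1 hx)]
  have main : ∀ q : ℝ≥0∞, 1 ≤ q → q ≤ r → MemLp f q → eLpNorm (Qᶜ.indicator f) q ≤ ε / 2 →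
      (1 + μ Set.univ ^ r.toReal⁻¹) * μ Set.univ ^ (1 / q.toReal - 1 / r.toReal) ≤ Ξ →
      eLpNorm (fun x => f x - Q.indicator s x) q ≤ ε := by
    intro q hq hqr hfq hMq hle
    have heq : (fun x => f x - Q.indicator s x) = Qᶜ.indicator f + Q.indicator (f - s) := by
      ext x
      by_cases hx : x ∈ Q
      · simp [hx]
      · simp [hx]
    have hms : AEStronglyMeasurable (Q.indicator (f - s)) volume :=
      (hfq.1.sub hstep.measurable.aestronglyMeasurable).indicator hQm
    rw [heq]
    refine (eLpNorm_add_le (hfq.1.indicator hQm.compl) hms hq).trans ?_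
    rw [← ENNReal.add_halves ε]
    refine add_le_add hMq ?_
    rw [eLpNorm_indicator_eq_eLpNorm_restrict hQm]
    calc _ ≤ eLpNorm (f - s) r μ * μ Set.univ ^ (1 / q.toReal - 1 / r.toReal) :=
          eLpNorm_le_eLpNorm_mul_rpow_measure_univ hqr hsm.1
      _ ≤ η * (1 + μ Set.univ ^ r.toReal⁻¹) * μ Set.univ ^ (1 / q.toReal - 1 / r.toReal) := by
          gcongr
      _ ≤ η * Ξ := by
          rw [mul_assoc]
          gcongr
      _ ≤ _ := hη.le
  refine ⟨Q.indicator s, ⟨⟨K, hts⟩, ⟨R, fun x => ?_⟩, fun r => ?_⟩,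
    main p hp (le_max_left _ _) hfp hMp (by rw [hΞ]; gcongr; exact le_self_add),
    main q hq (le_max_right _ _) hfq hMq (by rw [hΞ]; gcongr; exact le_add_self)⟩
  · exact (norm_indicator_le_norm_self s x).trans (hR x)
  · rw [memLp_indicator_iff_restrict hQm]
    exact MemLp.of_bound hstep.measurable.aestronglyMeasurable R (Eventually.of_forall hR)

end Approximation
end SquareFunction

namespace SquareFunction

variable {n : ℕ} {lam : ℝ}

local notation "𝔼" => EuclideanSpace ℝ (Fin n)

/-! ### From step functions to L¹ + L² -/

section BesselSpace

open Filter Topology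

lemma fourier_add' {f g : 𝔼 → ℂ} (hf : Integrable f) (hg : Integrable g) (x : 𝔼) :
    𝓕 (fun x => f x + g x) x = 𝓕 f x + 𝓕 g x := by
  have := fourier_sum_mul Finset.univ ![1, 1] (f := ![f, g])
    (by simp [Fin.forall_fin_two, hf, hg]) x
  simp only [Fin.sum_univ_two, Matrix.cons_val_zero, Matrix.cons_val_one, one_mul] at this
  exact this

lemma isFunction_fourier_L2 (f : Lp ℂ 2 (volume : Measure 𝔼)) :
    IsFunction (𝓕 (f : 𝓢'(𝔼, ℂ))) (𝓕 f : Lp ℂ 2 (volume : Measure 𝔼)) := by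
  rw [Lp.fourier_toTemperedDistribution_eq]
  exact isFunction_toTemperedDistribution _

lemma integrable_mul_of_memLp_two {f g : 𝔼 → ℂ} (hf : MemLp f 2) (hg : MemLp g 2) :
    Integrable fun x => f x * g x :=
  hf.integrable_mul hg

lemma tendsto_const_mul_zero {a : ℝ≥0∞} (ha : a ≠ ⊤) {f : ℕ → ℝ≥0∞} (hf : Tendsto f atTop (𝓝 0)) :
    Tendsto (fun k => a * f k) atTop (𝓝 0) := by
  have := ENNReal.Tendsto.const_mul hf (Or.inr ha)
  rwa [mul_zero] at this

lemma eLpNorm_fourier_sub_toLp {f g : 𝔼 → ℂ} (hf : MemLp f 2) (hg : Integrable g) (hg2 : MemLp g 2) :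
    eLpNorm (𝓕 g - ⇑(𝓕 (hf.toLp f) : Lp ℂ 2 (volume : Measure 𝔼))) 2 =
      eLpNorm (g - f) 2 := by
  have h2 : (𝓕 g - ⇑(𝓕 (hf.toLp f) : Lp ℂ 2 (volume : Measure 𝔼))) =ᵐ[volume]
      (𝓕 (hg2.toLp g - hf.toLp f) : Lp ℂ 2 (volume : Measure 𝔼)) := by
    have : (𝓕 (hg2.toLp g - hf.toLp f) : Lp ℂ 2 (volume : Measure 𝔼)) =
        𝓕 (hg2.toLp g) - 𝓕 (hf.toLp f) := map_sub (Lp.fourierTransformₗᵢ 𝔼 ℂ) _ _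
    rw [this]
    filter_upwards [Lp.coeFn_sub (𝓕 (hg2.toLp g) : Lp ℂ 2 (volume : Measure 𝔼))
      (𝓕 (hf.toLp f)), fourier_ae_eq_L2 hg hg2] with x hx hx'
    rw [hx, Pi.sub_apply, Pi.sub_apply, hx']
  rw [eLpNorm_congr_ae h2, ← Lp.enorm_def, enorm_eq_iff_norm_eq.2 (Lp.norm_fourier_eq _),
    ← MemLp.toLp_sub, Lp.enorm_toLp]

lemma tendsto_integral_mul_fourier_two {f : 𝔼 → ℂ} {g : ℕ → 𝔼 → ℂ} (hf : MemLp f 2)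
    (hg : ∀ k, Integrable (g k)) (hg2 : ∀ k, MemLp (g k) 2)
    (h : Tendsto (fun k => eLpNorm (g k - f) 2) atTop (𝓝 0)) {ψ : 𝔼 → ℂ} (hψ : MemLp ψ 2) :
    Tendsto (fun k => ∫ x, ψ x * 𝓕 (g k) x) atTop
      (𝓝 (∫ x, ψ x * (𝓕 (hf.toLp f) : Lp ℂ 2 (volume : Measure 𝔼)) x)) := by
  rw [tendsto_iff_enorm_sub_tendsto_zero]
  have h1 := tendsto_const_mul_zero hψ.2.ne h
  refine tendsto_of_tendsto_of_tendsto_of_le_of_le tendsto_const_nhds h1 (fun _ => zero_le) fun k => ?_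
  have hk := memLp_fourier (hg k) (hg2 k)
  have hh := Lp.memLp (𝓕 (hf.toLp f) : Lp ℂ 2 (volume : Measure 𝔼))
  rw [← integral_sub (integrable_mul_of_memLp_two hψ hk) (integrable_mul_of_memLp_two hψ hh)]
  simp only [← mul_sub]
  refine (enorm_integral_mul_le hψ.1 (hk.sub hh).1).trans ?_
  rw [eLpNorm_fourier_sub_toLp hf (hg k) (hg2 k)]

lemma memLp_two_schwartz_mul_sym (φ : 𝓢(𝔼, ℂ)) {ζ : ℂ} (hζ : 0 ≤ ζ.re) (u : ℝ) :
    MemLp (fun x => φ x * sym n lam ζ u x) 2 := by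
  refine (φ.memLp 2).mono (integrable_schwartz_mul_sym φ hζ u).1 (Eventually.of_forall fun x => ?_)
  rw [norm_mul]
  exact mul_le_of_le_one_right (norm_nonneg _) (norm_sym_le_one hζ u x)

lemma isTame_diffSeq {c : ℕ → 𝔼 → ℂ} (hc : ∀ k, IsTame (c k)) (k : ℕ) : IsTame (diffSeq c k) := by
  cases k with
  | zero => exact hc 0
  | succ k => exact (hc (k + 1)).sub (hc k)

lemma sum_fourier_diffSeq {c : ℕ → 𝔼 → ℂ} (hc : ∀ k, IsTame (c k)) (K : ℕ) (ξ : 𝔼) :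
    ∑ k ∈ Finset.range (K + 1), 𝓕 (diffSeq c k) ξ = 𝓕 (c K) ξ := by
  have : ∀ k, 𝓕 (diffSeq c k) ξ = diffSeq (fun k => 𝓕 (c k) ξ) k := fun k => by
    cases k with
    | zero => rfl
    | succ k => exact fourier_sub' (hc (k + 1)).integrable (hc k).integrable ξ
  simp only [this]
  exact sum_diffSeq (fun k => 𝓕 (c k) ξ) K

/-- The first term is close to `g` and later increments are at most the sum of two consecutive
errors. The coefficient 1 in front of the norm of `g` allows the operator constant to survive the
approximation unchanged. -/
lemma tsum_eLpNorm_diffSeq_le {p : ℝ≥0∞} (hp : 1 ≤ p) {c : ℕ → 𝔼 → ℂ} {g : 𝔼 → ℂ}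
    (hc : ∀ k, MemLp (c k) p) (hg : MemLp g p) {δ : ℕ → ℝ≥0∞}
    (h : ∀ k, eLpNorm (fun x => g x - c k x) p ≤ δ k) :
    ∑' k, eLpNorm (diffSeq c k) p ≤ eLpNorm g p + 3 * ∑' k, δ k := by
  have h' : ∀ k, eLpNorm (fun x => c k x - g x) p ≤ δ k := fun k => by
    have : (fun x => c k x - g x) = -(fun x => g x - c k x) := by
      ext x
      simp
    rw [this, eLpNorm_neg]
    exact h k
  have h0 : eLpNorm (diffSeq c 0) p ≤ eLpNorm g p + δ 0 := by
    have : diffSeq c 0 = g + fun x => c 0 x - g x := by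
      ext x
      simp [diffSeq]
    rw [this]
    exact (eLpNorm_add_le hg.1 ((hc 0).sub hg).1 hp).trans (by gcongr; exact h' 0)
  have h1 : ∀ k, eLpNorm (diffSeq c (k + 1)) p ≤ δ (k + 1) + δ k := fun k => by
    have : diffSeq c (k + 1) = (fun x => c (k + 1) x - g x) + fun x => g x - c k x := by
      ext x
      simp [diffSeq]
    rw [this]
    exact (eLpNorm_add_le ((hc _).sub hg).1 (hg.sub (hc k)).1 hp).trans (add_le_add (h' _) (h k))
  rw [tsum_eq_zero_add' ENNReal.summable]
  calc _ ≤ (eLpNorm g p + δ 0) + ∑' k, (δ (k + 1) + δ k) := by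
        gcongr with k
        exact h1 k
    _ = eLpNorm g p + ((δ 0 + ∑' k, δ (k + 1)) + ∑' k, δ k) := by
        rw [ENNReal.tsum_add]
        ring
    _ = eLpNorm g p + (∑' k, δ k + ∑' k, δ k) := by
        rw [← tsum_eq_zero_add' (f := δ) ENNReal.summable]
    _ ≤ _ := by
        gcongr
        rw [← two_mul]
        gcongr
        norm_num

/-- The operator on a sum of an integrable and a square integrable function. -/
lemma exists_version_of_tame_bound (hn : 1 ≤ n) {I : Set ℝ} (hI : volume I ≠ ⊤) {ζ : ℂ}
    (hζ : 0 ≤ ζ.re) {p : ℝ≥0∞} (hp : 1 ≤ p) (hp2 : p ≤ 2) {C : ℝ≥0∞} (hC : C ≠ ⊤)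
    (hB : ∀ (s t : ℝ) (f : 𝔼 → ℂ), 0 < s → s ≤ t → IsTame f →
      mixedNorm p I (mulOp (symCut n lam ζ (cut s t)) f) ≤ C * eLpNorm f p)
    {g₁ g₂ : 𝔼 → ℂ} (h₁ : Integrable g₁) (h₁p : MemLp g₁ p) (h₂ : MemLp g₂ 2) (h₂p : MemLp g₂ p)
    {ε : ℝ≥0∞} (hε : ε ≠ 0) :
    ∃ F : ℝ → 𝔼 → ℂ, Measurable (Function.uncurry F) ∧
      (∀ᵐ u ∂(volume.restrict I), HasFourier (F u) (fun ξ => sym n lam ζ u ξ *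
        (𝓕 g₁ ξ + (𝓕 (h₂.toLp g₂) : Lp ℂ 2 (volume : Measure 𝔼)) ξ))) ∧
      mixedNorm p I F ≤ C * (eLpNorm (fun x => g₁ x + g₂ x) p + 6 * ε) := by
  have hp' : p ≠ ⊤ := (hp2.trans_lt (by simp)).ne
  have hp0 : p ≠ 0 := (zero_lt_one.trans_le hp).ne'
  obtain ⟨δ, hδ0, hδ⟩ := ENNReal.exists_pos_sum_of_countable hε ℕ
  have hδ0' : ∀ k, (δ k : ℝ≥0∞) ≠ 0 := fun k => by exact_mod_cast (hδ0 k).ne'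
  have hδt : ∑' k, (δ k : ℝ≥0∞) ≠ ⊤ := hδ.ne_top
  have hδlim := ENNReal.tendsto_atTop_zero_of_tsum_ne_top hδt
  -- Each part is approximated in two norms at once: L^p for the estimate, and L¹ for g₁ or L² for
  -- g₂ to identify the Fourier transform of the limit.
  choose a hat ha1 hap using fun k => exists_isTame_eLpNorm_sub_le le_rfl ENNReal.one_ne_top hp hp'
    (memLp_one_iff_integrable.2 h₁) h₁p (hδ0' k)
  choose b hbt hb2 hbp using fun k => exists_isTame_eLpNorm_sub_le one_le_two ENNReal.ofNat_ne_top hp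
    hp' h₂ h₂p (hδ0' k)
  set c : ℕ → 𝔼 → ℂ := fun k x => a k x + b k x with hc
  have hct : ∀ k, IsTame (c k) := fun k => (hat k).add (hbt k)
  have hcp : ∀ k, eLpNorm (fun x => (g₁ x + g₂ x) - c k x) p ≤ 2 * δ k := fun k => by
    have : (fun x => (g₁ x + g₂ x) - c k x) =
        (fun x => g₁ x - a k x) + fun x => g₂ x - b k x := by
      ext x
      simp only [hc, Pi.add_apply]
      ring
    rw [this, two_mul]
    exact (eLpNorm_add_le (h₁p.sub ((hat k).memLp p)).1 (h₂p.sub ((hbt k).memLp p)).1 hp).trans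
      (add_le_add (hap k) (hbp k))
  have hd := isTame_diffSeq hct
  have hsum : ∑' k, eLpNorm (diffSeq c k) p ≤ eLpNorm (fun x => g₁ x + g₂ x) p + 6 * ε := by
    refine (tsum_eLpNorm_diffSeq_le hp (fun k => (hct k).memLp p) (h₁p.add h₂p) hcp).trans ?_
    rw [ENNReal.tsum_mul_left, ← mul_assoc]
    norm_num
    exact add_le_add le_rfl (by gcongr)
  have hsum' : ∑' k, eLpNorm (diffSeq c k) p ≠ ⊤ := by
    refine ne_top_of_le_ne_top ?_ (tsum_eLpNorm_diffSeq_le hp (fun k => (hct k).memLp p)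
      (h₁p.add h₂p) hcp)
    rw [ENNReal.tsum_mul_left]
    exact ENNReal.add_ne_top.2 ⟨(h₁p.add h₂p).2.ne, ENNReal.mul_ne_top (by simp)
      (ENNReal.mul_ne_top (by simp) hδt)⟩
  choose G hGm hGF hGB using fun k => exists_version_of_memLp_two (lam := lam) hn hζ hI
    (hd k).integrable ((hd k).memLp 2)
  have hGB' : ∀ k, mixedNorm p I (G k) ≤ C * eLpNorm (diffSeq c k) p := fun k =>
    hGB k p hp0 hp' _ fun s t hs hst => hB s t _ hs hst (hd k)
  have hGs : ∑' k, mixedNorm p I (G k) ≤ C * ∑' k, eLpNorm (diffSeq c k) p := by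
    rw [← ENNReal.tsum_mul_left]
    exact ENNReal.tsum_le_tsum hGB'
  obtain ⟨F, hFm, hFs, hF⟩ := exists_hasSum_of_mixedNorm hp hp2 hI hGm
    (ne_top_of_le_ne_top (ENNReal.mul_ne_top hC hsum') hGs)
  refine ⟨F, hFm, ?_, ?_⟩
  · filter_upwards [hF, ae_all_iff.2 hGF] with u hu hGu
    refine hasFourier_of_series hp hu.1 hu.2 (H := fun k ξ => sym n lam ζ u ξ * 𝓕 (diffSeq c k) ξ)
      (fun k φ => ((hGu k).integral_eq φ).2) fun φ => ?_
    have hψ := integrable_schwartz_mul_sym (lam := lam) φ hζ u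
    have hψ2 := memLp_two_schwartz_mul_sym (lam := lam) φ hζ u
    have hmul : ∀ {g : 𝔼 → ℂ}, Integrable g →
        Integrable fun x => (φ x * sym n lam ζ u x) * 𝓕 g x := fun {g} hg =>
      hψ.mul_bdd (continuous_fourier hg).aestronglyMeasurable
        (Eventually.of_forall (norm_fourier_le g))
    have hmul2 := integrable_mul_of_memLp_two hψ2
      (Lp.memLp (𝓕 (h₂.toLp g₂) : Lp ℂ 2 (volume : Measure 𝔼)))
    have hsplit : ∀ ξ, φ ξ * (sym n lam ζ u ξ *
        (𝓕 g₁ ξ + (𝓕 (h₂.toLp g₂) : Lp ℂ 2 (volume : Measure 𝔼)) ξ)) =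
        (φ ξ * sym n lam ζ u ξ) * 𝓕 g₁ ξ + (φ ξ * sym n lam ζ u ξ) *
          (𝓕 (h₂.toLp g₂) : Lp ℂ 2 (volume : Measure 𝔼)) ξ := fun ξ => by ring
    simp only [hsplit]
    refine ⟨(hmul h₁).add hmul2, ?_⟩
    rw [integral_add (hmul h₁) hmul2, ← tendsto_add_atTop_iff_nat 1]
    have t1 := tendsto_integral_mul_fourier h₁ (g := a) (fun k => (hat k).integrable) (by
      refine tendsto_of_tendsto_of_tendsto_of_le_of_le tendsto_const_nhds hδlim (fun _ => zero_le)
        fun k => ?_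
      rw [← eLpNorm_neg, neg_sub]
      exact ha1 k) hψ
    have t2 := tendsto_integral_mul_fourier_two h₂ (g := b) (fun k => (hbt k).integrable)
      (fun k => (hbt k).memLp 2) (by
      refine tendsto_of_tendsto_of_tendsto_of_le_of_le tendsto_const_nhds hδlim (fun _ => zero_le)
        fun k => ?_
      rw [← eLpNorm_neg, neg_sub]
      exact hb2 k) hψ2
    refine (t1.add t2).congr fun K => ?_
    rw [← integral_add (hmul (hat K).integrable) (hmul (hbt K).integrable), ← integral_finsetSum]
    · refine integral_congr_ae (Eventually.of_forall fun ξ => ?_)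
      simp only
      rw [← Finset.mul_sum, ← Finset.mul_sum, sum_fourier_diffSeq hct, hc,
        fourier_add' (hat K).integrable (hbt K).integrable]
      ring
    · intro k _
      simpa only [mul_assoc] using hmul (hd k).integrable
  · refine mixedNorm_le_of_tendsto hp0 hp' I
      (G := fun K u x => ∑ k ∈ Finset.range K, G k u x) (fun K => measurable_sum_uncurry _ hGm) ?_
      (Eventually.of_forall fun K => ?_)
    · filter_upwards [hFs] with x hx
      filter_upwards [hx] with u hu
      exact hu.tendsto_sum_nat
    · refine (mixedNorm_sum_le hp I _ hGm).trans ((ENNReal.sum_le_tsum _).trans (hGs.trans ?_))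
      gcongr

/-- The square function estimate for truncated operators on bounded step functions. -/
lemma exists_mixedNorm_tame_le (hn : 1 ≤ n) (hlam : 1 < lam) (I : Set ℝ)
    (hI : Bornology.IsBounded I) (hIm : MeasurableSet I) {p : ℝ} (hp : 1 < p) (hp2 : p ≤ 2) :
    ∃ C : ℝ, 0 ≤ C ∧ ∀ (s t : ℝ) (f : 𝔼 → ℂ), 0 < s → s ≤ t → IsTame f →
      mixedNorm (ENNReal.ofReal p) I (mulOp (symCut n lam
        ((n * lam * (1 / p - 1 / 2) : ℝ) : ℂ) (cut s t)) f) ≤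
        ENNReal.ofReal C * eLpNorm f (ENNReal.ofReal p) := by
  rcases hp2.lt_or_eq with hp2 | rfl
  · obtain ⟨C, hC, h⟩ := exists_mixedNorm_step_le (n := n) hn hlam I hI hIm hp hp2
    refine ⟨C, hC, fun s t f hs hst hf => ?_⟩
    obtain ⟨K, hK⟩ := hf.step
    obtain ⟨R, hR⟩ := hf.bound
    exact h s t K f R hs hst hf.integrable (hf.memLp _) hK hR
  -- At p = 2 the order is zero and the symbol is unimodular, so Plancherel for each `u` suffices.
  · refine ⟨(volume I ^ (1 / 2 : ℝ)).toReal, ENNReal.toReal_nonneg, fun s t f hs hst hf => ?_⟩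
    rw [ENNReal.ofReal_toReal (ENNReal.rpow_ne_top_of_nonneg (by norm_num) hI.measure_lt_top.ne),
      ENNReal.ofReal_ofNat]
    refine mixedNorm_two_le I (measurable_mulOp (isNice_symCut _ hs hst).meas hf.integrable) fun u =>
      eLpNorm_mulOp_le (isNice_symCut _ hs hst) (fun u ξ => norm_symCut_le_one ?_ s t u ξ)
        hf.integrable (hf.memLp 2) u
    simp

end BesselSpace
end SquareFunction

namespace SquareFunction

variable {n : ℕ} {lam : ℝ}

local notation "𝔼" => EuclideanSpace ℝ (Fin n)

/-! ### The estimate for Bessel potential spaces -/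

section BesselBound

open Filter Topology

/-- Where |g| > 1 there is |g| ≤ |g|^p. The complementary part is square integrable, as |g|² ≤ |g|^p
there for p ≤ 2; together they place g in L¹ + L². -/
lemma integrable_indicator_one_lt {p : ℝ≥0∞} (hp : 1 ≤ p) (hp' : p ≠ ⊤) {g : 𝔼 → ℂ} (hgm : Measurable g)
    (hg : MemLp g p) : Integrable ({x | 1 < ‖g x‖}.indicator g) := by
  have hp0 : p ≠ 0 := (zero_lt_one.trans_le hp).ne'
  have hpr : 1 ≤ p.toReal := by
    rw [← ENNReal.toReal_one]
    exact ENNReal.toReal_mono hp' hp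
  have hS : MeasurableSet {x | 1 < ‖g x‖} := measurableSet_lt measurable_const hgm.norm
  refine (hg.integrable_norm_rpow hp0 hp').mono' (hgm.indicator hS).aestronglyMeasurable
    (Eventually.of_forall fun x => ?_)
  by_cases hx : x ∈ {x | 1 < ‖g x‖}
  · rw [Set.indicator_of_mem hx]
    have hx : 1 < ‖g x‖ := hx
    calc ‖g x‖ = ‖g x‖ ^ (1 : ℝ) := (Real.rpow_one _).symm
      _ ≤ _ := Real.rpow_le_rpow_of_exponent_le hx.le hpr
  · rw [Set.indicator_of_notMem hx, norm_zero]
    positivity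

lemma memLp_two_indicator_compl_one_lt {p : ℝ≥0∞} (hp : 1 ≤ p) (hp2 : p ≤ 2) {g : 𝔼 → ℂ}
    (hgm : Measurable g) (hg : MemLp g p) : MemLp ({x | 1 < ‖g x‖}ᶜ.indicator g) 2 := by
  have hp' : p ≠ ⊤ := (hp2.trans_lt (by simp)).ne
  have hp0 : p ≠ 0 := (zero_lt_one.trans_le hp).ne'
  have hpr : p.toReal ≤ 2 := by
    rw [← ENNReal.toReal_ofNat]
    exact ENNReal.toReal_mono (by simp) hp2
  have hpp : 0 < p.toReal := ENNReal.toReal_pos hp0 hp'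
  have hS : MeasurableSet {x | 1 < ‖g x‖} := measurableSet_lt measurable_const hgm.norm
  have hm := (hgm.indicator hS.compl).aestronglyMeasurable (μ := volume)
  rw [memLp_two_iff_integrable_sq_norm hm]
  refine (hg.integrable_norm_rpow hp0 hp').mono' (hm.norm.pow 2) (Eventually.of_forall fun x => ?_)
  rw [Real.norm_of_nonneg (sq_nonneg _)]
  by_cases hx : x ∈ {x | 1 < ‖g x‖}ᶜ
  · rw [Set.indicator_of_mem hx]
    have hx : ‖g x‖ ≤ 1 := not_lt.1 hx
    rcases (norm_nonneg (g x)).eq_or_lt with h0 | h0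
    · rw [← h0, Real.zero_rpow hpp.ne']
      norm_num
    · calc ‖g x‖ ^ 2 = ‖g x‖ ^ (2 : ℝ) := (Real.rpow_two _).symm
        _ ≤ _ := Real.rpow_le_rpow_of_exponent_ge h0 hx hpr
  · rw [Set.indicator_of_notMem hx, norm_zero, zero_pow two_ne_zero]
    positivity

/-- Hausdorff-Young by splitting: the Fourier transform of `g₁ + g₂` for `g₁` integrable and `g₂`
square integrable is a function. -/
lemma isFunction_fourier_add {v : 𝓢'(𝔼, ℂ)} {g₁ g₂ : 𝔼 → ℂ} (h₁ : Integrable g₁) (h₂ : MemLp g₂ 2)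
    (hv : IsFunction v (fun x => g₁ x + g₂ x)) :
    IsFunction (𝓕 v) (fun ξ => 𝓕 g₁ ξ + (𝓕 (h₂.toLp g₂) : Lp ℂ 2 (volume : Measure 𝔼)) ξ) := by
  have h₁' := memLp_one_iff_integrable.2 h₁
  have e1 := (isFunction_toTemperedDistribution (h₁'.toLp g₁)).congr_ae h₁'.coeFn_toLp
  have e2 := (isFunction_toTemperedDistribution (h₂.toLp g₂)).congr_ae h₂.coeFn_toLp
  have f1 := isFunction_fourier_L1 (h₁'.toLp g₁)
  rw [fourier_congr_ae h₁'.coeFn_toLp] at f1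
  have f := f1.add (isFunction_fourier_L2 (h₂.toLp g₂))
  have hv' : 𝓕 v = 𝓕 (h₁'.toLp g₁ : 𝓢'(𝔼, ℂ)) + 𝓕 (h₂.toLp g₂ : 𝓢'(𝔼, ℂ)) := by
    ext φ
    have h3 : (𝓕 (h₁'.toLp g₁ : 𝓢'(𝔼, ℂ)) + 𝓕 (h₂.toLp g₂ : 𝓢'(𝔼, ℂ))) φ =
        𝓕 (h₁'.toLp g₁ : 𝓢'(𝔼, ℂ)) φ + 𝓕 (h₂.toLp g₂ : 𝓢'(𝔼, ℂ)) φ := rfl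
    rw [h3, TemperedDistribution.fourier_apply, TemperedDistribution.fourier_apply,
      TemperedDistribution.fourier_apply, (hv (𝓕 φ)).2, (e1 (𝓕 φ)).2, (e2 (𝓕 φ)).2,
      ← integral_add (e1 (𝓕 φ)).1 (e2 (𝓕 φ)).1]
    simp only [mul_add]
  rw [hv']
  exact f

lemma hasTemperateGrowth_bessel (s : ℝ) : (fun ξ : 𝔼 =>
    (((1 + ‖(2 * Real.pi) • ξ‖ ^ 2) ^ (s / 2) : ℝ) : ℂ)).HasTemperateGrowth := by
  have h1 : (fun ξ : 𝔼 => (2 * Real.pi) • ξ).HasTemperateGrowth := by fun_prop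
  have h2 := (Function.hasTemperateGrowth_one_add_norm_sq_rpow 𝔼 (s / 2)).comp h1
  have h3 : (fun ξ : 𝔼 => (1 + ‖(2 * Real.pi) • ξ‖ ^ 2) ^ (s / 2)).HasTemperateGrowth := h2
  fun_prop

/-- The Bessel multiplier has temperate growth, so it can be moved onto the Schwartz test function.
-/
lemma isFunction_fourier_besselOp (s : ℝ) {v : 𝓢'(𝔼, ℂ)} {h : 𝔼 → ℂ} (hv : IsFunction (𝓕 v) h) :
    IsFunction (𝓕 (besselOp n s v))
      (fun ξ => (((1 + ‖(2 * Real.pi) • ξ‖ ^ 2) ^ (s / 2) : ℝ) : ℂ) * h ξ) := by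
  have hg := hasTemperateGrowth_bessel (n := n) s
  intro φ
  have h1 := hv (SchwartzMap.smulLeftCLM ℂ
    (fun ξ : 𝔼 => (((1 + ‖(2 * Real.pi) • ξ‖ ^ 2) ^ (s / 2) : ℝ) : ℂ)) φ)
  have h2 : ∀ ξ, SchwartzMap.smulLeftCLM ℂ
      (fun ξ : 𝔼 => (((1 + ‖(2 * Real.pi) • ξ‖ ^ 2) ^ (s / 2) : ℝ) : ℂ)) φ ξ * h ξ =
      φ ξ * ((((1 + ‖(2 * Real.pi) • ξ‖ ^ 2) ^ (s / 2) : ℝ) : ℂ) * h ξ) := fun ξ => by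
    rw [SchwartzMap.smulLeftCLM_apply_apply hg, smul_eq_mul]
    ring
  simp only [h2] at h1
  refine ⟨h1.1, ?_⟩
  rw [← h1.2, besselOp, fourierMultiplierCLM_apply, FourierTransform.fourier_fourierInv_eq]
  rfl

/-- The propagator after the Bessel potential of order β has the symbol already studied, with real
order β. -/
lemma phase_mul_bessel (β u : ℝ) (ξ : 𝔼) : phase n lam u ((2 * Real.pi) • ξ) *
    (((1 + ‖(2 * Real.pi) • ξ‖ ^ 2) ^ (-β / 2) : ℝ) : ℂ) = sym n lam β u ξ := by
  rw [sym, Complex.ofReal_cpow (by positivity)]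
  push_cast
  rfl

/-- Every version of the propagator applied to `(I - Δ)^{-β/2} g` is controlled by `g`. -/
lemma exists_version_of_bessel (hn : 1 ≤ n) {I : Set ℝ} (hI : volume I ≠ ⊤) {β : ℝ}
    (hβ : 0 ≤ β) {p : ℝ≥0∞} [hp : Fact (1 ≤ p)] (hp2 : p ≤ 2) {C : ℝ≥0∞} (hC : C ≠ ⊤)
    (hB : ∀ (s t : ℝ) (f : 𝔼 → ℂ), 0 < s → s ≤ t → IsTame f →
      mixedNorm p I (mulOp (symCut n lam β (cut s t)) f) ≤ C * eLpNorm f p)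
    (g : Lp ℂ p (volume : Measure 𝔼)) :
    (∃ F, IsVersion I (phase n lam) (besselOp n (-β) (g : 𝓢'(𝔼, ℂ))) F) ∧
      ∀ F, IsVersion I (phase n lam) (besselOp n (-β) (g : 𝓢'(𝔼, ℂ))) F →
        mixedNorm p I F ≤ C * ‖g‖ₑ := by
  have hp' : p ≠ ⊤ := (hp2.trans_lt (by simp)).ne
  have hgm : Measurable g := (Lp.stronglyMeasurable g).measurable
  have hg := Lp.memLp g
  have hS : MeasurableSet {x | 1 < ‖g x‖} := measurableSet_lt measurable_const hgm.norm
  have h₁ := integrable_indicator_one_lt hp.out hp' hgm hg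
  have h₂ := memLp_two_indicator_compl_one_lt hp.out hp2 hgm hg
  have hsplit : (fun x => {x | 1 < ‖g x‖}.indicator g x + {x | 1 < ‖g x‖}ᶜ.indicator g x) = g :=
    Set.indicator_self_add_compl _ _
  have hv := isFunction_toTemperedDistribution g
  rw [← hsplit] at hv
  have hh := isFunction_fourier_besselOp (-β) (isFunction_fourier_add h₁ h₂ hv)
  have key := fun {ε : ℝ≥0∞} (hε : ε ≠ 0) => exists_version_of_tame_bound (lam := lam) hn hI
    (ζ := (β : ℂ)) (by simpa using hβ) hp.out hp2 hC hB h₁ (hg.indicator hS) h₂ (hg.indicator hS.compl) hε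
  simp only [← phase_mul_bessel, mul_assoc] at key
  constructor
  · obtain ⟨F, hFm, hF, -⟩ := key one_ne_zero
    refine ⟨F, hFm.aestronglyMeasurable, ?_⟩
    filter_upwards [hF] with u hu
    exact HasFourier.isMultiplierImage hu hh
  · intro F hF
    -- The approximation loses an arbitrary ε. Since all versions have the same mixed norm, the
    -- versions built for different ε bound the same number, and ε can tend to 0.
    refine ENNReal.le_of_forall_pos_le_add fun η hη _ => ?_
    obtain ⟨ε, hε, hεη⟩ := ENNReal.exists_nnreal_pos_mul_lt (a := C * 6) (b := η)
      (ENNReal.mul_ne_top hC (by simp)) (by exact_mod_cast hη.ne')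
    obtain ⟨F', hFm, hF', hle⟩ := key (ε := ε) (by exact_mod_cast hε.ne')
    rw [hF.mixedNorm_eq hh hFm hF']
    refine hle.trans ?_
    rw [hsplit, mul_add, Lp.enorm_def]
    refine add_le_add le_rfl (le_trans (le_of_eq ?_) hεη.le)
    ring

variable (n) in
theorem bessel_bound (hn : 1 ≤ n) (hlam : 1 < lam) (p : ℝ≥0∞) [Fact (1 ≤ p)] (hp : 1 < p)
    (hp2 : p ≤ 2) (β : ℝ) (hβ : β / lam = n * (1 / p.toReal - 1 / 2)) (a b : ℝ) :
    ∃ C : ℝ, ∀ f : 𝓢'(EuclideanSpace ℝ (Fin n), ℂ), MemBessel β p f →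
      (∃ F, IsVersion (Set.Icc a b) (phase n lam) f F) ∧
      ∀ F, IsVersion (Set.Icc a b) (phase n lam) f F →
        mixedNorm p (Set.Icc a b) F ≤ ENNReal.ofReal C * besselNorm β p f := by
  have hp' : p ≠ ⊤ := (hp2.trans_lt (by simp)).ne
  have hpr : 1 < p.toReal := by
    rw [← ENNReal.toReal_one]
    exact (ENNReal.toReal_lt_toReal ENNReal.one_ne_top hp').2 hp
  have hpr2 : p.toReal ≤ 2 := by
    rw [← ENNReal.toReal_ofNat]
    exact ENNReal.toReal_mono (by simp) hp2
  have hlam0 : 0 < lam := by linarith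
  obtain ⟨C, hC, h⟩ := exists_mixedNorm_tame_le (n := n) hn hlam (Set.Icc a b)
    (Metric.isBounded_Icc a b) measurableSet_Icc hpr hpr2
  have hβ' : n * lam * (1 / p.toReal - 1 / 2) = β := by
    rw [div_eq_iff hlam0.ne'] at hβ
    rw [hβ]
    ring
  rw [ENNReal.ofReal_toReal hp', hβ'] at h
  have hβ0 : 0 ≤ β := by
    rw [← hβ']
    have : 1 / 2 ≤ 1 / p.toReal := one_div_le_one_div_of_le (by linarith) hpr2
    exact mul_nonneg (by positivity) (by linarith)
  have hI : volume (Set.Icc a b) ≠ ⊤ := by simp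
  have hCpos : ENNReal.ofReal (C + 1) ≠ 0 := by
    rw [ENNReal.ofReal_ne_zero_iff]
    linarith
  have key := exists_version_of_bessel (lam := lam) hn hI hβ0 hp2 (ENNReal.ofReal_ne_top (r := C + 1))
    fun s t f hs hst hf => (h s t f hs hst hf).trans (by gcongr; linarith)
  -- As in the Hardy space case, a nonzero constant lets multiplication pass through the infimum
  -- that defines the norm.
  refine ⟨C + 1, fun f ⟨g, hg⟩ => ⟨?_, fun F hF => ?_⟩⟩
  · rw [hg]
    exact (key g).1
  · rw [besselNorm]
    simp only [ENNReal.mul_iInf_of_ne hCpos ENNReal.ofReal_ne_top]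
    refine le_iInf fun g => le_iInf fun hg => ?_
    rw [hg] at hF
    exact (key g).2 F hF

end BesselBound
end SquareFunction

theorem theorem5p2 (n : ℕ) (hn : 1 ≤ n) (lam : ℝ) (hlam : 1 < lam) :
    (∀ a b : ℝ, a ≤ b → (0 : ℝ) ∉ Set.Icc a b →
      ∃ (C : ℝ) (N : ℕ), ∀ (γ : ℝ)
        (f : Lp ℂ 1 (volume : Measure (EuclideanSpace ℝ (Fin n)))),
        SquareFunction.MemHardy f →
        (∃ F, SquareFunction.IsVersion (Set.Icc a b)
            (SquareFunction.symbol n lam (n * lam / 2) γ)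
            (f : 𝓢'(EuclideanSpace ℝ (Fin n), ℂ)) F) ∧
        ∀ F, SquareFunction.IsVersion (Set.Icc a b)
            (SquareFunction.symbol n lam (n * lam / 2) γ)
            (f : 𝓢'(EuclideanSpace ℝ (Fin n), ℂ)) F →
          SquareFunction.mixedNorm 1 (Set.Icc a b) F ≤
            ENNReal.ofReal (C * (1 + |γ|) ^ N) * SquareFunction.hardyNorm f) ∧
    (2 ≤ n → ∀ (p : ℝ≥0∞) [Fact (1 ≤ p)], 1 < p → p ≤ 2 →
      ∀ β : ℝ, β / lam = n * (1 / p.toReal - 1 / 2) →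
      ∀ a b : ℝ, a ≤ b →
      ∃ C : ℝ, ∀ f : 𝓢'(EuclideanSpace ℝ (Fin n), ℂ),
        SquareFunction.MemBessel β p f →
        (∃ F, SquareFunction.IsVersion (Set.Icc a b) (SquareFunction.phase n lam) f F) ∧
        ∀ F, SquareFunction.IsVersion (Set.Icc a b) (SquareFunction.phase n lam) f F →
          SquareFunction.mixedNorm p (Set.Icc a b) F ≤
            ENNReal.ofReal C * SquareFunction.besselNorm β p f) := by
  refine ⟨fun a b _ _ => SquareFunction.hardy_bound n hn hlam a b, fun _ p _ hp hp2 β hβ a b _ =>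
    SquareFunction.bessel_bound n hn hlam p hp hp2 β hβ a b⟩
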